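/- **Setting.** Let $G$ be an $n$-dimensional (real, smooth, Hausdorff, second countable) Lie group with Lie algebra $\mathfrak g$ and left Haar measure $\mathrm dm$. Assume that $G$ is weakly exponential: there is an open neighbourhood $\mathcal O$ of $0$ in $\mathfrak g$ with $t\mathcal O\subset\mathcal O$ for $-1\le t\le 1$, such that $\exp$ restricts to a diffeomorphism of $\mathcal O$ onto an open set $\mathcal U=\exp(\mathcal O)$, and $G\setminus\mathcal U$ has measure zero; assume moreover that for every $S\subset\mathcal U$ with compact closure in $G$ the set $(\exp|_{\mathcal O})^{-1}(S)$ has compact closure in $\mathfrak g$. Let $\hbar\in\mathbb R\setminus\{0\}$. Let $\mathrm dX$ be the Lebesgue measure on $\mathfrak g=T_eG$ given by the value at $e$ of the left invariant density of $\mathrm dm$, let $\mathrm dp$ be the dual measure on $\mathfrak g^*$ (so that $g(X)=(2\pi)^{-n}\int_{\mathfrak g^*}\int_{\mathfrak g} g(Y)e^{-i\langle p,Y\rangle}\,\mathrm dY\,e^{i\langle p,X\rangle}\,\mathrm dp$ for Schwartz functions $g$), and put $M=G\times\mathfrak g^*$, $\mathrm dl=|2\pi\hbar|^{-n}\,\mathrm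 dm\,\mathrm dp$. Let $$F(X)=\sqrt{\bigl|\det\phi(\mathrm{ad}_X)\,\det\mathrm{Ad}_{\exp(X/2)}\bigr|},\qquad \phi(x)=\frac{1-e^{-x}}{x}.$$ Let $L^2(G\times\mathcal O)$ be the space of functions in $L^2(G\times\mathfrak g,\mathrm dm\,\mathrm dX)$ supported in $G\times\overline{\mathcal O}$, and let $\mathcal L(M)\subset L^2(M,\mathrm dl)$ be its image under the inverse momentum Fourier transform, i.e. the $L^2$-continuous extension of $\tilde f\mapsto f(q,p)=\int_{\mathfrak g}\tilde f(q,X)e^{-\frac i\hbar\langle p,X\rangle}\,\mathrm dX$. All scalar products are conjugate linear in the first argument. To a kernel $\mathsf f$ on $G\times G$ we assign the phase space function $f$ with $$\tilde f(q,X)=\mathsf f\bigl(q\exp(-\tfrac12X),q\exp(\tfrac12X)\bigr)F(X)\ \text{ for }X\in\mathcal O,\qquad \tilde f(q,X)=0\ \text{ for }X\notin\mathcal O .$$ $\mathcal F(M)\subset\mathcal L(M)$ is the space of the functions $f$ that arise from kernels $\mathsf f\in C_c^\infty(G\times G)$; for $f\in\mathcal F(M)$, $\hat f$ denotes the integral operator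 on $\mathcal H=L^2(G,\mathrm dm)$ with kernel $\mathsf f$. The star-product of $f,g\in\mathcal F(M)$ is $$(f\star g)(q,p)=\int_{\mathfrak g\times\mathfrak g}\tilde f\bigl(q\exp(-\tfrac12(X\diamond Y))\exp(\tfrac12X),X\bigr)\,\tilde g\bigl(q\exp(\tfrac12(X\diamond Y))\exp(-\tfrac12Y),Y\bigr)\,e^{-\frac i\hbar\langle p,X\diamond Y\rangle}L(X,Y)\,\mathrm dX\,\mathrm dY,$$ where $X\diamond Y=(\exp|_{\mathcal O})^{-1}(\exp X\exp Y)$ and $L(X,Y)=F(X)F(Y)/F(X\diamond Y)$ if $X,Y\in\mathcal O$ and $\exp X\exp Y\in\mathcal U$, and $L(X,Y)=0$ otherwise. For $\varphi,\psi\in\mathcal H$ the generalized Wigner function $\mathcal W(\varphi,\psi)\in\mathcal L(M)$ is the phase space function assigned to the kernel $\mathsf f(a,b)=\psi(a)\overline{\varphi(b)}$, i.e. $$\mathcal W(\varphi,\psi)(q,p)=\int_{\mathcal O}\overline{\varphi\bigl(q\exp(\tfrac12X)\bigr)}\,\psi\bigl(q\exp(-\tfrac12X)\bigr)e^{-\frac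 i\hbar\langle p,X\rangle}F(X)\,\mathrm dX$$ (as an $L^2$ Fourier integral). Integrals of functions on $\mathfrak g^*$ and on $M$ that need not be absolutely convergent are improper integrals in the following sense: for every Euclidean norm $|\cdot|$ on $\mathfrak g^*$, $$\int_{\mathfrak g^*}f\,\mathrm dp=\lim_{\varepsilon\to0^+}\int_{\mathfrak g^*}f(p)e^{-\varepsilon|p|^2}\,\mathrm dp,\qquad \int_M f\,\mathrm dl=\lim_{\varepsilon\to0^+}\frac1{|2\pi\hbar|^n}\int_G\Bigl(\int_{\mathfrak g^*}f(q,p)e^{-\varepsilon|p|^2}\,\mathrm dp\Bigr)\mathrm dm(q),$$ where the integrals on the right have to converge absolutely (over $\mathfrak g^*$, in the second case for almost every $q$, and then over $G$) and the limit has to exist and to be the same for all Euclidean norms. **Theorem.** All these objects are well defined: the inverse momentum Fourier transform has a unique continuous extension to $L^2$; the functions $\tilde f$ assigned to the kernels in $C_c^\infty(G\times G)$ and to the kernels $\psi(a)\overline{\varphi(b)}$ are square integrable; every kernel in $C_c^\infty(G\times G)$ defines a unique bounded operator on $\mathcal H$; and the star-product of $\mathcal F(M)$ extends to a unique continuous bilinear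 map $\star\colon\mathcal L(M)\times\mathcal L(M)\to\mathcal L(M)$. For all $\varphi,\psi,\eta,\chi\in\mathcal H$ and $f\in\mathcal F(M)$: 1. $\overline{\mathcal W(\varphi,\psi)}=\mathcal W(\psi,\varphi)$; 2. $\int_M\mathcal W(\varphi,\psi)\,\mathrm dl=(\varphi,\psi)$ (improper integral); 3. $\bigl(\mathcal W(\varphi,\psi),\mathcal W(\eta,\chi)\bigr)=\overline{(\varphi,\eta)}\,(\psi,\chi)$; 4. $\mathcal W(\varphi,\psi)\star\mathcal W(\eta,\chi)=(\varphi,\chi)\,\mathcal W(\eta,\psi)$; 5. $f\star\mathcal W(\varphi,\psi)=\mathcal W(\varphi,\hat f\psi)$ and $\mathcal W(\varphi,\psi)\star f=\mathcal W(\hat f^\dagger\varphi,\psi)$; 6. $\frac1{|2\pi\hbar|^n}\int_{\mathfrak g^*}\mathcal W(\varphi,\varphi)(q,p)\,\mathrm dp=|\varphi(q)|^2$ for almost every $q\in G$ (improper integral). -/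

import Mathlib

open MeasureTheory Filter Topology Manifold ContDiff ENNReal

noncomputable section

/-- The model `ℝⁿ` of the Lie algebra `𝔤 = T_e G` of an `n`-dimensional Lie group. By definition
`GroupLieAlgebra (𝓡 n) G`, the tangent space at the identity, is this type; the present name only
gives access to its norm and its Borel sets. -/
abbrev LieAlg (n : ℕ) : Type := EuclideanSpace ℝ (Fin n)

/-- The dual space `𝔤*`. -/
abbrev LieDual (n : ℕ) : Type := LieAlg n →L[ℝ] ℝ

namespace LieWigner

variable {n : ℕ} {G : Type*} [TopologicalSpace G] [ChartedSpace (EuclideanSpace ℝ (Fin n)) G]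
  [Group G]

/-! ### The exponential map and the function `F` -/

/-- `exp X = γ 1`, where `γ` is the integral curve through the identity of the left invariant
vector field generated by `X`. -/
def lieExp (X : LieAlg n) : G :=
  Classical.epsilon (fun g : G => ∃ γ : ℝ → G, γ 0 = 1 ∧
    IsMIntegralCurve (I := 𝓡 n) γ
      (mulInvariantVectorField (I := 𝓡 n) (G := G) (X : GroupLieAlgebra (𝓡 n) G)) ∧ γ 1 = g)

variable (G) in
/-- `ad_X = [X, ·]` on the Lie algebra of `G`. -/
def adL [LieGroup (𝓡 n) ∞ G] (X : LieAlg n) : LieAlg n →L[ℝ] LieAlg n :=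
  haveI : LieGroup (𝓡 n) (minSmoothness ℝ 3) G := LieGroup.of_le (n := ∞) (by
    rw [minSmoothness_of_isRCLikeNormedField]; exact ENat.LEInfty.out)
  LinearMap.toContinuousLinearMap (𝕜 := ℝ) (E := LieAlg n) (F' := LieAlg n)
    (LieAlgebra.ad ℝ (GroupLieAlgebra (𝓡 n) G) (X : GroupLieAlgebra (𝓡 n) G))

/-- `φ(A) = ∑ₖ (-1)ᵏ Aᵏ / (k+1)!`, that is, `φ(x) = (1 - e⁻ˣ) / x`. -/
def phiSeries (A : LieAlg n →L[ℝ] LieAlg n) : LieAlg n →L[ℝ] LieAlg n :=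
  ∑' k : ℕ, ((-1 : ℝ) ^ k / ((k + 1).factorial : ℝ)) • A ^ k

/-- `Ad_g`, the derivative at the identity of `h ↦ g h g⁻¹`. -/
def AdL (g : G) : LieAlg n →L[ℝ] LieAlg n :=
  mfderiv (𝓡 n) (𝓡 n) (fun h : G => g * h * g⁻¹) 1

variable (G) in
/-- `F(X) = √|det φ(ad_X) · det Ad_{exp(X/2)}|`. -/
def weightF [LieGroup (𝓡 n) ∞ G] (X : LieAlg n) : ℝ :=
  Real.sqrt |(phiSeries (adL G X)).det * (AdL (n := n) (lieExp ((1 / 2 : ℝ) • X) : G)).det|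

/-! ### Measures -/

/-- The density at the identity of the Haar measure `m`, that is, the value at `e` of the
corresponding left invariant density, relative to the Lebesgue measure of `T_e G = ℝⁿ`. -/
def densityAtOne [MeasurableSpace G] (m : Measure G) : ℝ≥0∞ :=
  limUnder (𝓝[>] (0 : ℝ)) (fun r : ℝ =>
    m ((lieExp : LieAlg n → G) '' Metric.ball 0 r) / volume (Metric.ball (0 : LieAlg n) r))

/-- The measure `dX` on `𝔤` determined by the Haar measure `m`. -/
def measX [MeasurableSpace G] (m : Measure G) : Measure (LieAlg n) :=
  densityAtOne (n := n) m • volume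

/-- The measure `dp` on `𝔤*` dual to `dX`: with `f̃(p) = ∫ f(X) e^{-i⟨p,X⟩} dX` one has
`f(X) = (2π)⁻ⁿ ∫ f̃(p) e^{i⟨p,X⟩} dp`. -/
def measP [MeasurableSpace G] (m : Measure G) : Measure (LieDual n) :=
  (densityAtOne (n := n) m)⁻¹ •
    (volume : Measure (LieAlg n)).map (fun Y : LieAlg n => (innerSL ℝ Y : LieDual n))

/-- The measure `dn = dm × dX` on `G × 𝔤`. -/
def measN [MeasurableSpace G] (m : Measure G) : Measure (G × LieAlg n) :=
  m.prod (measX m)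

/-- The normalized Liouville measure `dl = dm × dp / |2πℏ|ⁿ` on `M = G × 𝔤*`. -/
def measL [MeasurableSpace G] (m : Measure G) (ℏ : ℝ) : Measure (G × LieDual n) :=
  ENNReal.ofReal (|2 * Real.pi * ℏ| ^ n)⁻¹ • m.prod (measP m)

/-! ### The groups under consideration -/

/-- `G` is weakly exponential, with `O ⊆ 𝔤` a corresponding domain of the exponential map: `O` is
an open, symmetric and star-shaped neighbourhood of `0`, `exp` restricts to a diffeomorphism of `O`
onto the open set `exp(O)`, and the complement of `exp(O)` is a null set. The last field is the
standing condition that the inverse of `exp` on `O` maps precompact sets to precompact sets. -/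
structure IsWeaklyExponential [MeasurableSpace G] (m : Measure G) (O : Set (LieAlg n)) :
    Prop where
  isOpen : IsOpen O
  zero_mem : (0 : LieAlg n) ∈ O
  starShaped : ∀ X ∈ O, ∀ t : ℝ, -1 ≤ t → t ≤ 1 → t • X ∈ O
  injOn : Set.InjOn (lieExp : LieAlg n → G) O
  isOpen_image : IsOpen ((lieExp : LieAlg n → G) '' O)
  smooth_exp : ContMDiffOn 𝓘(ℝ, LieAlg n) (𝓡 n) ∞ (lieExp : LieAlg n → G) O
  smooth_inv : ContMDiffOn (𝓡 n) 𝓘(ℝ, LieAlg n) ∞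
    (Function.invFunOn (lieExp : LieAlg n → G) O) ((lieExp : LieAlg n → G) '' O)
  null_compl : m ((lieExp : LieAlg n → G) '' O)ᶜ = 0
  precompact : ∀ S : Set G, S ⊆ (lieExp : LieAlg n → G) '' O → IsCompact (closure S) →
    IsCompact (closure (O ∩ (lieExp : LieAlg n → G) ⁻¹' S))

/-! ### The momentum Fourier transform and the Hilbert space `L(M)` -/

/-- `e^{-(i/ℏ)⟨p,X⟩}`. -/
def phase (ℏ : ℝ) (p : LieDual n) (X : LieAlg n) : ℂ :=
  Complex.exp (-(Complex.I / (ℏ : ℂ)) * ((p X : ℝ) : ℂ))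

/-- `T` is the inverse momentum Fourier transform `L²(G × 𝔤, dn) → L²(M, dl)`: the continuous
extension of `h ↦ ∫ h(q,X) e^{-(i/ℏ)⟨p,X⟩} dX` from `L¹ ∩ L²` to `L²`. -/
def IsInvMomentumFourier [MeasurableSpace G] (m : Measure G) (ℏ : ℝ)
    (T : Lp ℂ 2 (measN (n := n) m) →L[ℂ] Lp ℂ 2 (measL (n := n) m ℏ)) : Prop :=
  ∀ h : Lp ℂ 2 (measN (n := n) m), Integrable (h : G × LieAlg n → ℂ) (measN m) →
    (T h : G × LieDual n → ℂ) =ᵐ[measL m ℏ]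
      fun x => ∫ X, (h : G × LieAlg n → ℂ) (x.1, X) * phase ℏ x.2 X ∂(measX m)

/-- The inverse momentum Fourier transform on `L²` (it is unique). -/
def invMomentumFourier [MeasurableSpace G] (m : Measure G) (ℏ : ℝ) :
    Lp ℂ 2 (measN (n := n) m) →L[ℂ] Lp ℂ 2 (measL (n := n) m ℏ) :=
  Classical.epsilon (IsInvMomentumFourier m ℏ)

/-- `L²(G × O, dn)`: the square integrable functions on `G × 𝔤` supported in the closure of
`G × O`. -/
def L2O [MeasurableSpace G] (m : Measure G) (O : Set (LieAlg n)) :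
    Submodule ℂ (Lp ℂ 2 (measN (n := n) m)) where
  carrier := {h | ∀ᵐ y ∂(measN (n := n) m), y.2 ∉ closure O → (h : G × LieAlg n → ℂ) y = 0}
  zero_mem' := by
    filter_upwards [Lp.coeFn_zero ℂ 2 (measN (n := n) m)] with y hy _
    simpa using hy
  add_mem' := by
    intro a b ha hb
    filter_upwards [ha, hb, Lp.coeFn_add a b] with y h1 h2 h3 hy
    rw [h3, Pi.add_apply, h1 hy, h2 hy, add_zero]
  smul_mem' := by
    intro c a ha
    filter_upwards [ha, Lp.coeFn_smul c a] with y h1 h3 hy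
    rw [h3, Pi.smul_apply, h1 hy, smul_zero]

/-- The Hilbert space `L(M) ⊆ L²(M, dl)`: the image of `L²(G × O, dn)` under the inverse momentum
Fourier transform. -/
def LM [MeasurableSpace G] (m : Measure G) (ℏ : ℝ) (O : Set (LieAlg n)) :
    Submodule ℂ (Lp ℂ 2 (measL (n := n) m ℏ)) :=
  (L2O m O).map (invMomentumFourier (n := n) m ℏ).toLinearMap

open Classical in
/-- The class in `L²(G × O, dn)` of a function on `G × 𝔤` (zero if it is not in this space). -/
def toL2O [MeasurableSpace G] (m : Measure G) (O : Set (LieAlg n)) (u : G × LieAlg n → ℂ) :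
    L2O (n := n) m O :=
  if h : ∃ hu : MemLp u 2 (measN m), hu.toLp u ∈ L2O (n := n) m O then
    ⟨h.choose.toLp u, h.choose_spec⟩ else 0

/-- The element of `L(M)` with momentum Fourier transform `u`. -/
def toLM [MeasurableSpace G] (m : Measure G) (ℏ : ℝ) (O : Set (LieAlg n))
    (u : G × LieAlg n → ℂ) : LM (n := n) m ℏ O :=
  ⟨invMomentumFourier m ℏ (toL2O m O u : Lp ℂ 2 (measN (n := n) m)),
    Submodule.mem_map_of_mem (toL2O m O u).2⟩

/-! ### Phase space functions and integral kernels -/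

open Classical in
/-- The momentum Fourier transform of the phase space function with integral kernel `k`:
`(q, X) ↦ k(q exp(-X/2), q exp(X/2)) F(X)` for `X ∈ O`, and `0` otherwise. -/
def symbolTilde [LieGroup (𝓡 n) ∞ G] (O : Set (LieAlg n)) (k : G × G → ℂ) :
    G × LieAlg n → ℂ := fun y =>
  if y.2 ∈ O then
    k (y.1 * lieExp ((-(1 / 2) : ℝ) • y.2), y.1 * lieExp ((1 / 2 : ℝ) • y.2)) * (weightF G y.2 : ℂ)
  else 0

/-- `k ∈ C_c^∞(G × G)`. -/
def IsTestKernel (k : G × G → ℂ) : Prop :=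
  ContMDiff ((𝓡 n).prod (𝓡 n)) 𝓘(ℝ, ℂ) ∞ k ∧ HasCompactSupport k

/-- The phase space function with integral kernel `k`, as an element of `L(M)`. For
`k ∈ C_c^∞(G × G)` these are the elements of the space `F(M)`. -/
def symbol [LieGroup (𝓡 n) ∞ G] [MeasurableSpace G] (m : Measure G) (ℏ : ℝ)
    (O : Set (LieAlg n)) (k : G × G → ℂ) : LM (n := n) m ℏ O :=
  toLM m ℏ O (symbolTilde O k)

/-- The integral kernel `(a, b) ↦ ψ(a) conj φ(b)` of the operator `ψ (φ, ·)`. -/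
def rankOneKernel [MeasurableSpace G] {m : Measure G} (φ ψ : Lp ℂ 2 m) : G × G → ℂ := fun ab =>
  (ψ : G → ℂ) ab.1 * (starRingEnd ℂ) ((φ : G → ℂ) ab.2)

/-- The generalized Wigner function `W(φ, ψ) ∈ L(M)`. -/
def wigner [LieGroup (𝓡 n) ∞ G] [MeasurableSpace G] {m : Measure G} (ℏ : ℝ)
    (O : Set (LieAlg n)) (φ ψ : Lp ℂ 2 m) : LM (n := n) m ℏ O :=
  symbol m ℏ O (rankOneKernel φ ψ)

/-- `A` is the integral operator on `L²(G, dm)` with kernel `k`. -/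
def IsIntegralOperator [MeasurableSpace G] {m : Measure G} (k : G × G → ℂ)
    (A : Lp ℂ 2 m →L[ℂ] Lp ℂ 2 m) : Prop :=
  ∀ ψ : Lp ℂ 2 m, (A ψ : G → ℂ) =ᵐ[m] fun a => ∫ b, k (a, b) * (ψ : G → ℂ) b ∂m

/-- The integral operator on `L²(G, dm)` with kernel `k`. -/
def integralOperator [MeasurableSpace G] (m : Measure G) (k : G × G → ℂ) :
    Lp ℂ 2 m →L[ℂ] Lp ℂ 2 m :=
  Classical.epsilon (IsIntegralOperator k)

/-! ### The star product -/

variable (G) in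
/-- The Baker-Campbell-Hausdorff product `X ⋄ Y = exp⁻¹(exp X exp Y)`. -/
def bch (O : Set (LieAlg n)) (X Y : LieAlg n) : LieAlg n :=
  Function.invFunOn (lieExp : LieAlg n → G) O (lieExp X * lieExp Y)

open Classical in
variable (G) in
/-- `L(X,Y) = F(X) F(Y) / F(X ⋄ Y)` if `X, Y ∈ O` and `exp X exp Y ∈ exp(O)`, and `0` otherwise. -/
def weightL [LieGroup (𝓡 n) ∞ G] (O : Set (LieAlg n)) (X Y : LieAlg n) : ℝ :=
  if X ∈ O ∧ Y ∈ O ∧ (lieExp X * lieExp Y : G) ∈ (lieExp : LieAlg n → G) '' O then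
    weightF G X * weightF G Y / weightF G (bch G O X Y) else 0

/-- The integral formula for the star product of two phase space functions with momentum Fourier
transforms `u` and `v`. -/
def starFormula [LieGroup (𝓡 n) ∞ G] [MeasurableSpace G] (m : Measure G) (ℏ : ℝ)
    (O : Set (LieAlg n)) (u v : G × LieAlg n → ℂ) (x : G × LieDual n) : ℂ :=
  ∫ Z : LieAlg n × LieAlg n,
    u (x.1 * lieExp ((-(1 / 2) : ℝ) • bch G O Z.1 Z.2) * lieExp ((1 / 2 : ℝ) • Z.1), Z.1) *
    v (x.1 * lieExp ((1 / 2 : ℝ) • bch G O Z.1 Z.2) * lieExp ((-(1 / 2) : ℝ) • Z.2), Z.2) *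
    phase ℏ x.2 (bch G O Z.1 Z.2) * (weightL G O Z.1 Z.2 : ℂ) ∂((measX m).prod (measX m))

/-- `B` is a continuous bilinear map on `L(M)` given on `F(M)` by the integral formula for the
star product. -/
def IsStarProduct [LieGroup (𝓡 n) ∞ G] [MeasurableSpace G] (m : Measure G) (ℏ : ℝ)
    (O : Set (LieAlg n))
    (B : LM (n := n) m ℏ O →L[ℂ] LM (n := n) m ℏ O →L[ℂ] LM (n := n) m ℏ O) : Prop :=
  ∀ k l : G × G → ℂ, IsTestKernel (n := n) k → IsTestKernel (n := n) l →
    (((B (symbol m ℏ O k) (symbol m ℏ O l) : LM (n := n) m ℏ O) :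
        Lp ℂ 2 (measL (n := n) m ℏ)) : G × LieDual n → ℂ) =ᵐ[measL m ℏ]
      starFormula m ℏ O (symbolTilde O k) (symbolTilde O l)

/-- The star product on `L(M)`: the unique continuous bilinear extension of the star product of
`F(M)`. -/
def starProd [LieGroup (𝓡 n) ∞ G] [MeasurableSpace G] (m : Measure G) (ℏ : ℝ)
    (O : Set (LieAlg n)) :
    LM (n := n) m ℏ O →L[ℂ] LM (n := n) m ℏ O →L[ℂ] LM (n := n) m ℏ O :=
  Classical.epsilon (IsStarProduct m ℏ O)

/-! ### Improper integrals -/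

/-- The improper integral `∫_{𝔤*} f dp` exists and equals `I`: for every Euclidean norm `‖A p‖` on
`𝔤*` the integrals of `f(p) e^{-ε‖A p‖²}` converge absolutely, and tend to `I` as `ε → 0+`. -/
def HasMomentumIntegral [MeasurableSpace G] (m : Measure G) (f : LieDual n → ℂ) (I : ℂ) : Prop :=
  ∀ A : LieDual n ≃L[ℝ] EuclideanSpace ℝ (Fin n),
    (∀ ε : ℝ, 0 < ε →
      Integrable (fun p => f p * (Real.exp (-ε * ‖A p‖ ^ 2) : ℂ)) (measP m)) ∧
    Tendsto (fun ε : ℝ => ∫ p, f p * (Real.exp (-ε * ‖A p‖ ^ 2) : ℂ) ∂(measP m))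
      (𝓝[>] 0) (𝓝 I)

/-- The improper integral `∫_M f dl` exists and equals `I`: for every Euclidean norm `‖A p‖` on
`𝔤*` the iterated integrals of `f(q,p) e^{-ε‖A p‖²}`, first over `𝔤*` and then over `G`, converge
absolutely, and tend to `I` as `ε → 0+`. -/
def HasPhaseSpaceIntegral [MeasurableSpace G] (m : Measure G) (ℏ : ℝ)
    (f : G × LieDual n → ℂ) (I : ℂ) : Prop :=
  ∀ A : LieDual n ≃L[ℝ] EuclideanSpace ℝ (Fin n),
    (∀ ε : ℝ, 0 < ε →
      (∀ᵐ q ∂m, Integrable (fun p => f (q, p) * (Real.exp (-ε * ‖A p‖ ^ 2) : ℂ)) (measP m)) ∧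
      Integrable (fun q => ∫ p, f (q, p) * (Real.exp (-ε * ‖A p‖ ^ 2) : ℂ) ∂(measP m)) m) ∧
    Tendsto (fun ε : ℝ => ((|2 * Real.pi * ℏ| ^ n : ℝ) : ℂ)⁻¹ *
        ∫ q, ∫ p, f (q, p) * (Real.exp (-ε * ‖A p‖ ^ 2) : ℂ) ∂(measP m) ∂m)
      (𝓝[>] 0) (𝓝 I)

end LieWigner

end

/-! Everything rests on one unitary map. The coordinates `(q, X) ↦ (q exp(-X/2), q exp(X/2))`
identify `G × O` with almost all of `G × G`, and the Jacobian with respect to Haar measure is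
exactly `F(X)²`: the substitution `b = a exp X` contributes `|det φ(ad X)|`, the right translation
`a = q exp(-X/2)` contributes `|det Ad_{exp(X/2)}|`. Hence `k ↦ symbolTilde O k` is isometric from
`L²(G × G)` to `L²(G × O)` (`lintegral_prod_haar`, `symbolIso`). It is onto although `L2O` refers to
the closure of `O`, because the boundary of `O` is a null set (`measX_boundary`). Plancherel in the
fibres makes the momentum Fourier transform isometric as well, and the composite `kernelIso`
identifies Hilbert-Schmidt kernels with `L(M)`.

The substitution `x = exp X`, `exp Z = exp X exp Y` turns the star formula of two test kernels into
the momentum transform of the symbol of the composed kernel (`starFormula_eq_momentumIntegral`).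
Test kernels are dense, so the star product exists, is unique and is the composition of kernels.
Wigner functions are the images of rank one kernels. Scalar products and star products of Wigner
functions are therefore computed with rank one operators, and complex conjugation is the passage to
the adjoint kernel, since `F` is even.

The two improper integrals are statements about approximate identities. A Gaussian cut-off in `p`
is, after Fourier transform, a kernel `δ⁻ⁿ k(X/δ)` of mass one that concentrates at `X = 0`. For the
integral over `M` the integration over `q` comes first and produces the overlap of the translates of
`φ` and `ψ`, which is bounded and continuous at `0` (`tendsto_overlap`). For the marginal, `q` is
fixed and `φ` need not be continuous; convergence holds at common Lebesgue points of `φ` and `|φ|²`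
(`ae_isLebesguePoint`).

The analytic input about `exp` is derived from the definitions: its left trivialized derivative is
`φ(ad X)` (`expDeriv_eq_phiSeries`), Haar measure in exponential coordinates has the density `|det
φ(ad X)|` up to the constant `densityAtOne` (`densityAtOne_spec`), and right translation by `g`
multiplies it by `|det Ad_g|` (`map_mul_right_eq`). -/

noncomputable section
namespace LieWigner

/-! ### The exponential map -/

section Exponential

variable {n : ℕ} {G : Type*} [TopologicalSpace G] [ChartedSpace (EuclideanSpace ℝ (Fin n)) G]
  [Group G] [LieGroup (𝓡 n) ∞ G]

variable (n G) in
theorem lieGroup_minSmoothness : LieGroup (𝓡 n) (minSmoothness ℝ 3) G :=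
  LieGroup.of_le (n := ∞) (by
    rw [minSmoothness_of_isRCLikeNormedField]; exact ENat.LEInfty.out)

variable (n G) in
theorem isManifold_infty : IsManifold (𝓡 n) ∞ G := inferInstance

variable (n G) in
theorem isManifold_one : IsManifold (𝓡 n) 1 G :=
  have := isManifold_infty n G
  IsManifold.of_le (n := ∞) ENat.LEInfty.out

variable (n) in
theorem mdifferentiableAt_mul_left (g h : G) :
    MDifferentiableAt (𝓡 n) (𝓡 n) (fun x : G => g * x) h :=
  (contMDiff_mul_left (n := ∞)).contMDiffAt.mdifferentiableAt (by simp)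

theorem mulInvariantVectorField_mul (X : GroupLieAlgebra (𝓡 n) G) (g h : G) :
    mulInvariantVectorField (I := 𝓡 n) X (g * h) =
      mfderiv (𝓡 n) (𝓡 n) (fun x : G => g * x) h (mulInvariantVectorField (I := 𝓡 n) X h) := by
  have D : (fun x : G => g * h * x) = (fun x => g * x) ∘ (fun x => h * x) := by
    ext x; simp [mul_assoc]
  have h1 : (h * 1 : G) = h := mul_one h
  -- The tangent spaces at `h * 1` and at `h` are different types; the base point is changed while
  -- both derivatives are regarded as maps of the model space.
  have key : ∀ a b : G, a = b → ∀ v : LieAlg n,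
      (mfderiv (𝓡 n) (𝓡 n) (fun x : G => g * x) a : LieAlg n →L[ℝ] LieAlg n) v =
      (mfderiv (𝓡 n) (𝓡 n) (fun x : G => g * x) b : LieAlg n →L[ℝ] LieAlg n) v := by
    rintro a _ rfl v; rfl
  unfold mulInvariantVectorField
  rw [D, mfderiv_comp (I' := 𝓡 n) _ (mdifferentiableAt_mul_left n _ _)
    (mdifferentiableAt_mul_left n _ _)]
  exact key _ _ h1 _

theorem isMIntegralCurveOn_mul_left {X : GroupLieAlgebra (𝓡 n) G} {γ : ℝ → G} {s : Set ℝ}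
    (hγ : IsMIntegralCurveOn (I := 𝓡 n) γ (mulInvariantVectorField (I := 𝓡 n) X) s) (g : G) :
    IsMIntegralCurveOn (I := 𝓡 n) (fun t => g * γ t)
      (mulInvariantVectorField (I := 𝓡 n) X) s := by
  intro t ht
  have h := ((mdifferentiableAt_mul_left n g (γ t)).hasMFDerivAt).comp_hasMFDerivWithinAt t (hγ t ht)
  refine h.congr_mfderiv ?_
  rw [mulInvariantVectorField_mul]
  exact ContinuousLinearMap.ext fun r => ContinuousLinearMap.map_smul _ _ _

theorem isMIntegralCurve_mul_left {X : GroupLieAlgebra (𝓡 n) G} {γ : ℝ → G}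
    (hγ : IsMIntegralCurve (I := 𝓡 n) γ (mulInvariantVectorField (I := 𝓡 n) X)) (g : G) :
    IsMIntegralCurve (I := 𝓡 n) (fun t => g * γ t)
      (mulInvariantVectorField (I := 𝓡 n) X) := by
  rw [isMIntegralCurve_iff_isMIntegralCurveOn] at *
  exact isMIntegralCurveOn_mul_left hγ g

theorem contMDiff_one_mulInvariantVectorField (X : GroupLieAlgebra (𝓡 n) G) :
    haveI := isManifold_one n G
    ContMDiff (𝓡 n) (𝓡 n).tangent 1
      (fun g : G => (⟨g, mulInvariantVectorField (I := 𝓡 n) X g⟩ : TangentBundle (𝓡 n) G)) := by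
  have := lieGroup_minSmoothness n G
  have := isManifold_one n G
  refine (contMDiff_mulInvariantVectorField (I := 𝓡 n) (G := G) X).of_le ?_
  rw [minSmoothness_of_isRCLikeNormedField]
  norm_num

variable [T2Space G]

theorem integralCurve_unique {X : GroupLieAlgebra (𝓡 n) G} {γ γ' : ℝ → G}
    (hγ : IsMIntegralCurve (I := 𝓡 n) γ (mulInvariantVectorField (I := 𝓡 n) X))
    (hγ' : IsMIntegralCurve (I := 𝓡 n) γ' (mulInvariantVectorField (I := 𝓡 n) X))
    {t : ℝ} (h : γ t = γ' t) : γ = γ' :=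
  have := isManifold_one n G
  isMIntegralCurve_Ioo_eq_of_contMDiff_boundaryless (t₀ := t)
    (contMDiff_one_mulInvariantVectorField X) hγ hγ' h

/-- Left invariant fields are complete: a solution through `1` on a time interval of length `2ε` is
carried by left translations to every starting point, with the same `ε`, so solutions can be
continued indefinitely. -/
theorem exists_integralCurve (X : GroupLieAlgebra (𝓡 n) G) :
    ∃ γ : ℝ → G, γ 0 = 1 ∧
      IsMIntegralCurve (I := 𝓡 n) γ (mulInvariantVectorField (I := 𝓡 n) X) := by
  have := isManifold_one n G
  obtain ⟨γ, h0, hγ⟩ := exists_isMIntegralCurveAt_of_contMDiffAt_boundaryless (t₀ := 0)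
    (contMDiff_one_mulInvariantVectorField X).contMDiffAt (x₀ := (1 : G))
  obtain ⟨ε, hε, hγ⟩ := isMIntegralCurveAt_iff'.1 hγ
  refine exists_isMIntegralCurve_of_isMIntegralCurveOn
    (contMDiff_one_mulInvariantVectorField X) hε (fun g => ⟨fun t => g * γ t, by simp [h0], ?_⟩) 1
  refine (isMIntegralCurveOn_mul_left hγ g).mono ?_
  rw [Real.ball_eq_Ioo]; simp

/-- The choice in `lieExp` is harmless because integral curves are unique; rescaling time by `t`
turns the curve of `X` into that of `t • X`. -/
theorem lieExp_spec (X : LieAlg n) : ∃ γ : ℝ → G, γ 0 = 1 ∧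
    IsMIntegralCurve (I := 𝓡 n) γ
      (mulInvariantVectorField (I := 𝓡 n) (G := G) (X : GroupLieAlgebra (𝓡 n) G)) ∧
      ∀ t : ℝ, γ t = lieExp (t • X) := by
  obtain ⟨γ, h0, hγ⟩ := exists_integralCurve (G := G) (X : GroupLieAlgebra (𝓡 n) G)
  refine ⟨γ, h0, hγ, fun t => ?_⟩
  obtain ⟨γ', h0', hγ', h1⟩ : ∃ γ' : ℝ → G, γ' 0 = 1 ∧ IsMIntegralCurve (I := 𝓡 n) γ'
      (mulInvariantVectorField (I := 𝓡 n) (G := G) ((t • X : LieAlg n) : GroupLieAlgebra (𝓡 n) G))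
      ∧ γ' 1 = lieExp (t • X) := by
    obtain ⟨γ', h0', hγ'⟩ := exists_integralCurve (G := G)
      ((t • X : LieAlg n) : GroupLieAlgebra (𝓡 n) G)
    exact Classical.epsilon_spec (p := fun g : G => ∃ γ : ℝ → G, γ 0 = 1 ∧
      IsMIntegralCurve (I := 𝓡 n) γ
      (mulInvariantVectorField (I := 𝓡 n) (G := G) ((t • X : LieAlg n) : GroupLieAlgebra (𝓡 n) G))
      ∧ γ 1 = g) ⟨_, γ', h0', hγ', rfl⟩
  have h2 := hγ.comp_mul t
  have h3 := mulInvariantVectorField_smul (I := 𝓡 n) (G := G) t (X : GroupLieAlgebra (𝓡 n) G)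
  rw [← h3] at h2
  have h4 := integralCurve_unique (t := 0) h2 hγ' (by simp [h0, h0'])
  rw [← h1, ← h4]
  simp

theorem lieExp_zero : (lieExp (0 : LieAlg n) : G) = 1 := by
  obtain ⟨γ, h0, -, h⟩ := lieExp_spec (G := G) (0 : LieAlg n)
  rw [← h0, h, smul_zero]

/-- As functions of `t` both sides are integral curves of the same left invariant field, and they
agree at `t = 0`. -/
theorem lieExp_add_smul (X : LieAlg n) (s t : ℝ) :
    (lieExp ((s + t) • X) : G) = lieExp (s • X) * lieExp (t • X) := by
  obtain ⟨γ, h0, hγ, h⟩ := lieExp_spec (G := G) X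
  have h1 := hγ.comp_add s
  have h2 := isMIntegralCurve_mul_left hγ (γ s)
  have h3 := congrFun (integralCurve_unique (t := 0) h1 h2 (by simp [h0])) t
  simp only [Function.comp] at h3
  rw [← h, ← h, ← h, ← h3, add_comm]

theorem lieExp_neg (X : LieAlg n) : (lieExp (-X) : G) = (lieExp X)⁻¹ := by
  have h := lieExp_add_smul (G := G) X (-1) 1
  rw [neg_add_cancel, zero_smul, lieExp_zero, neg_one_smul, one_smul] at h
  exact eq_inv_of_mul_eq_one_left h.symm

theorem lieExp_half_mul_half (X : LieAlg n) :
    (lieExp ((1 / 2 : ℝ) • X) : G) * lieExp ((1 / 2 : ℝ) • X) = lieExp X := by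
  rw [← lieExp_add_smul]; norm_num

theorem lieExp_neg_half (X : LieAlg n) :
    (lieExp ((-(1 / 2) : ℝ) • X) : G) = (lieExp ((1 / 2 : ℝ) • X))⁻¹ := by
  rw [neg_smul, lieExp_neg]

theorem lieExp_pow (X : LieAlg n) (k : ℕ) : (lieExp X : G) ^ k = lieExp ((k : ℝ) • X) := by
  induction k with
  | zero => simp [lieExp_zero]
  | succ k ih => rw [pow_succ, ih, Nat.cast_succ, lieExp_add_smul, one_smul]

theorem hasMFDerivAt_lieExp_smul (X : LieAlg n) :
    HasMFDerivAt 𝓘(ℝ, ℝ) (𝓡 n) (fun t : ℝ => (lieExp (t • X) : G)) 0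
      ((ContinuousLinearMap.smulRight (1 : ℝ →L[ℝ] ℝ) X : ℝ →L[ℝ] LieAlg n)) := by
  obtain ⟨γ, h0, hγ, h⟩ := lieExp_spec (G := G) X
  have h1 : γ = fun t : ℝ => (lieExp (t • X) : G) := funext h
  have h2 := hγ 0
  rw [h1] at h2
  refine h2.congr_mfderiv ?_
  have h3 : ∀ g : G, g = 1 → mulInvariantVectorField (I := 𝓡 n) (X : GroupLieAlgebra (𝓡 n) G) g
      = (X : LieAlg n) := by
    rintro g rfl
    have h4 : (fun x : G => (1 : G) * x) = id := by ext x; simp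
    unfold mulInvariantVectorField
    rw [h4, mfderiv_id]
    rfl
  exact congrArg (fun Y : LieAlg n => (ContinuousLinearMap.smulRight (1 : ℝ →L[ℝ] ℝ) Y))
    (h3 _ (by simp [lieExp_zero]))

end Exponential

end LieWigner
end

noncomputable section
namespace LieWigner

/-! ### Logarithm and left trivialized derivatives -/

section Logarithm

variable {n : ℕ} {G : Type*} [TopologicalSpace G] [ChartedSpace (EuclideanSpace ℝ (Fin n)) G]
  [Group G]

variable (G) in
/-- The set `exp(O)`. -/
def expImage (O : Set (LieAlg n)) : Set G := (lieExp : LieAlg n → G) '' O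

/-- The inverse of the exponential map on `exp(O)`. -/
def lieLog (O : Set (LieAlg n)) : G → LieAlg n := Function.invFunOn (lieExp : LieAlg n → G) O

variable {O : Set (LieAlg n)}

theorem lieLog_mem {g : G} (hg : g ∈ expImage G O) : lieLog O g ∈ O :=
  Function.invFunOn_mem hg

theorem lieExp_lieLog {g : G} (hg : g ∈ expImage G O) : lieExp (lieLog O g) = g :=
  Function.invFunOn_eq hg

theorem lieExp_mem_expImage {X : LieAlg n} (hX : X ∈ O) : (lieExp X : G) ∈ expImage G O :=
  Set.mem_image_of_mem _ hX

variable [MeasurableSpace G] {m : Measure G} (hO : IsWeaklyExponential m O)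
include hO

theorem lieLog_lieExp {X : LieAlg n} (hX : X ∈ O) : lieLog O (lieExp X : G) = X :=
  hO.injOn.leftInvOn_invFunOn hX

theorem mem_nhds_zero : O ∈ 𝓝 (0 : LieAlg n) := hO.isOpen.mem_nhds hO.zero_mem

theorem smul_mem_O {X : LieAlg n} (hX : X ∈ O) {t : ℝ} (h1 : -1 ≤ t) (h2 : t ≤ 1) :
    t • X ∈ O := hO.starShaped X hX t h1 h2

theorem neg_mem_O {X : LieAlg n} (hX : X ∈ O) : -X ∈ O := by
  simpa using smul_mem_O hO hX (t := -1) le_rfl (by norm_num)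

theorem neg_mem_O_iff {X : LieAlg n} : -X ∈ O ↔ X ∈ O :=
  ⟨fun h => by simpa using neg_mem_O hO h, neg_mem_O hO⟩

variable [LieGroup (𝓡 n) ∞ G] [T2Space G]

theorem one_mem_expImage : (1 : G) ∈ expImage G O :=
  ⟨0, hO.zero_mem, lieExp_zero⟩

theorem expImage_mem_nhds_one : expImage G O ∈ 𝓝 (1 : G) :=
  hO.isOpen_image.mem_nhds (one_mem_expImage hO)

theorem lieLog_one : lieLog O (1 : G) = 0 := by
  rw [← lieExp_zero (n := n), lieLog_lieExp hO hO.zero_mem]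

/-- Smoothness on `O` spreads to all of `𝔤` through `exp X = (exp (X/(k+1)))^(k+1)`, with `k` so
large that `X/(k+1)` lies in `O`. -/
theorem contMDiff_lieExp : ContMDiff 𝓘(ℝ, LieAlg n) (𝓡 n) ∞ (lieExp : LieAlg n → G) := by
  intro X
  have h1 : Tendsto (fun k : ℕ => ((k + 1 : ℕ) : ℝ)⁻¹ • X) atTop (𝓝 0) := by
    have h0 : Tendsto (fun k : ℕ => ((k + 1 : ℕ) : ℝ)⁻¹) atTop (𝓝 0) :=
      tendsto_inv_atTop_zero.comp (tendsto_natCast_atTop_atTop.comp (tendsto_add_atTop_nat 1))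
    simpa using h0.smul_const X
  obtain ⟨k, hk⟩ := (h1.eventually (mem_nhds_zero hO)).exists
  set c : ℝ := ((k + 1 : ℕ) : ℝ)⁻¹ with hc
  have hc1 : ((k + 1 : ℕ) : ℝ) * c = 1 := mul_inv_cancel₀ (by positivity)
  have h2 : (lieExp : LieAlg n → G) = (fun g : G => g ^ (k + 1)) ∘ fun Y => lieExp (c • Y) := by
    ext Y
    simp only [Function.comp]
    rw [lieExp_pow, smul_smul, hc1, one_smul]
  rw [h2]
  refine (contMDiff_pow (I := 𝓡 n) (n := ∞) (G := G) (k + 1)).contMDiffAt.comp X ?_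
  have h3 : ContMDiffAt 𝓘(ℝ, LieAlg n) (𝓡 n) ∞ (lieExp : LieAlg n → G) (c • X) :=
    hO.smooth_exp.contMDiffAt (hO.isOpen.mem_nhds hk)
  exact h3.comp (f := fun Y : LieAlg n => c • Y) X
    (contDiff_const_smul c).contMDiff.contMDiffAt

theorem continuous_lieExp : Continuous (lieExp : LieAlg n → G) := (contMDiff_lieExp hO).continuous

theorem contMDiffAt_lieLog {g : G} (hg : g ∈ expImage G O) :
    ContMDiffAt (𝓡 n) 𝓘(ℝ, LieAlg n) ∞ (lieLog O : G → LieAlg n) g :=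
  hO.smooth_inv.contMDiffAt (hO.isOpen_image.mem_nhds hg)

theorem contMDiffAt_lieLog_one :
    ContMDiffAt (𝓡 n) 𝓘(ℝ, LieAlg n) ∞ (lieLog O : G → LieAlg n) 1 :=
  contMDiffAt_lieLog hO (one_mem_expImage hO)

theorem continuousOn_lieLog : ContinuousOn (lieLog O : G → LieAlg n) (expImage G O) :=
  hO.smooth_inv.continuousOn

theorem eventually_lieLog_lieExp :
    ∀ᶠ X : LieAlg n in 𝓝 0, lieLog O (lieExp X : G) = X := by
  filter_upwards [mem_nhds_zero hO] with X hX using lieLog_lieExp hO hX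

theorem eventually_lieExp_lieLog : ∀ᶠ g : G in 𝓝 1, lieExp (lieLog O g) = g := by
  filter_upwards [expImage_mem_nhds_one hO] with g hg using lieExp_lieLog hg

/-- The derivative exists by smoothness and is determined along each line `t ↦ t • X`, where it is
known from the integral curve. -/
theorem hasMFDerivAt_lieExp_zero : HasMFDerivAt 𝓘(ℝ, LieAlg n) (𝓡 n) (lieExp : LieAlg n → G) 0
    (ContinuousLinearMap.id ℝ (LieAlg n)) := by
  have h0 := ((contMDiff_lieExp hO).contMDiffAt (x := 0)).mdifferentiableAt (by simp)
  refine h0.hasMFDerivAt.congr_mfderiv ?_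
  refine ContinuousLinearMap.ext fun (X : LieAlg n) => ?_
  have h1 : HasMFDerivAt 𝓘(ℝ, ℝ) 𝓘(ℝ, LieAlg n) (fun t : ℝ => t • X) 0
      (ContinuousLinearMap.smulRight (1 : ℝ →L[ℝ] ℝ) X) := by
    have : HasFDerivAt (fun t : ℝ => t • X) (ContinuousLinearMap.smulRight (1 : ℝ →L[ℝ] ℝ) X) 0 :=
      (ContinuousLinearMap.smulRight (1 : ℝ →L[ℝ] ℝ) X).hasFDerivAt
    exact this.hasMFDerivAt
  have h2 : MDifferentiableAt 𝓘(ℝ, LieAlg n) (𝓡 n) (lieExp : LieAlg n → G) ((0 : ℝ) • X) :=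
    ((contMDiff_lieExp hO).contMDiffAt).mdifferentiableAt (by simp)
  have h3 := (h2.hasMFDerivAt.comp (0 : ℝ) h1)
  have h4 := hasMFDerivAt_unique h3 (hasMFDerivAt_lieExp_smul X)
  have h5 : (mfderiv 𝓘(ℝ, LieAlg n) (𝓡 n) (lieExp : LieAlg n → G) ((0 : ℝ) • X) :
      LieAlg n →L[ℝ] LieAlg n) ((1 : ℝ) • X) = (1 : ℝ) • X :=
    congrArg (fun A : ℝ →L[ℝ] LieAlg n => A 1) h4
  have key : ∀ a : LieAlg n, a = 0 →
      (mfderiv 𝓘(ℝ, LieAlg n) (𝓡 n) (lieExp : LieAlg n → G) a : LieAlg n →L[ℝ] LieAlg n) =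
      (mfderiv 𝓘(ℝ, LieAlg n) (𝓡 n) (lieExp : LieAlg n → G) 0) := by rintro _ rfl; rfl
  rw [one_smul, key _ (zero_smul _ _)] at h5
  exact h5

theorem hasMFDerivAt_lieLog_one : HasMFDerivAt (𝓡 n) 𝓘(ℝ, LieAlg n) (lieLog O : G → LieAlg n) 1
    (ContinuousLinearMap.id ℝ (LieAlg n)) := by
  have h0 := (contMDiffAt_lieLog_one hO).mdifferentiableAt (by simp)
  refine h0.hasMFDerivAt.congr_mfderiv ?_
  have h1 : MDifferentiableAt (𝓡 n) 𝓘(ℝ, LieAlg n) (lieLog O : G → LieAlg n) (lieExp (0 : LieAlg n)) := by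
    rw [lieExp_zero]; exact h0
  have h2 := h1.hasMFDerivAt.comp (0 : LieAlg n) (hasMFDerivAt_lieExp_zero hO)
  have h3 : HasMFDerivAt 𝓘(ℝ, LieAlg n) 𝓘(ℝ, LieAlg n) ((lieLog O : G → LieAlg n) ∘ lieExp) 0
      (ContinuousLinearMap.id ℝ (LieAlg n)) :=
    (hasMFDerivAt_id (I := 𝓘(ℝ, LieAlg n)) (0 : LieAlg n)).congr_of_eventuallyEq (by
      filter_upwards [eventually_lieLog_lieExp (G := G) hO] with X hX
      simpa using hX)
  have h4 := hasMFDerivAt_unique h2 h3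
  have key : ∀ g : G, g = 1 →
      (mfderiv (𝓡 n) 𝓘(ℝ, LieAlg n) (lieLog O : G → LieAlg n) g : LieAlg n →L[ℝ] LieAlg n) =
      mfderiv (𝓡 n) 𝓘(ℝ, LieAlg n) (lieLog O : G → LieAlg n) 1 := by rintro _ rfl; rfl
  exact (key _ (lieExp_zero (n := n))).symm.trans h4

end Logarithm
end LieWigner
end

/-! ### Calculus of left trivialized derivatives: chain rule and product rule. -/

noncomputable section
namespace LieWigner

section LeftDerivative

variable {n : ℕ} {G : Type*} [TopologicalSpace G] [ChartedSpace (EuclideanSpace ℝ (Fin n)) G]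
  [Group G] {V W : Type*} [NormedAddCommGroup V] [NormedSpace ℝ V]
  [NormedAddCommGroup W] [NormedSpace ℝ W]

/-- The left trivialized derivative of a map from a vector space to `G`. -/
def lderiv (O : Set (LieAlg n)) (f : V → G) (x : V) : V →L[ℝ] LieAlg n :=
  fderiv ℝ (fun w => lieLog O ((f x)⁻¹ * f w)) x

variable {O : Set (LieAlg n)}

theorem lderiv_mul_left (g : G) (f : V → G) (x : V) :
    lderiv O (fun w => g * f w) x = lderiv O f x := by
  unfold lderiv
  congr 1
  ext1 w
  group

theorem lderiv_const (g : G) (x : V) : lderiv O (fun _ => g) x = 0 := by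
  unfold lderiv; simp

theorem lderiv_congr {f g : V → G} {x : V} (h : f =ᶠ[𝓝 x] g) : lderiv O f x = lderiv O g x := by
  unfold lderiv
  refine Filter.EventuallyEq.fderiv_eq ?_
  filter_upwards [h] with w hw
  rw [hw, h.eq_of_nhds]

variable [MeasurableSpace G] {m : Measure G} (hO : IsWeaklyExponential m O)
  [LieGroup (𝓡 n) ∞ G] [T2Space G]
include hO

variable (n) in
omit hO [MeasurableSpace G] [T2Space G] in
theorem contMDiff_const_mul_mul_const (g h : G) :
    ContMDiff (𝓡 n) (𝓡 n) ∞ (fun x : G => g * x * h) :=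
  (contMDiff_mul_right (I := 𝓡 n) (n := ∞) (a := h)).comp (contMDiff_mul_left (a := g))

/-- A smooth map to `G` becomes smooth as a map of vector spaces after composition with `log`. -/
theorem contDiffAt_lieLog {f : V → G} {x : V} (hf : ContMDiffAt 𝓘(ℝ, V) (𝓡 n) ∞ f x)
    (hx : f x ∈ expImage G O) : ContDiffAt ℝ ∞ (fun w => lieLog O (f w)) x :=
  ((contMDiffAt_lieLog hO hx).comp x hf).contDiffAt

theorem contMDiffAt_lieExp {f : V → LieAlg n} {x : V} (hf : ContDiffAt ℝ ∞ f x) :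
    ContMDiffAt 𝓘(ℝ, V) (𝓡 n) ∞ (fun w => (lieExp (f w) : G)) x :=
  (contMDiff_lieExp hO).contMDiffAt.comp x hf.contMDiffAt

theorem differentiableAt_lderiv {f : V → G} {x : V} (hf : ContMDiffAt 𝓘(ℝ, V) (𝓡 n) ∞ f x) :
    DifferentiableAt ℝ (fun w => lieLog O ((f x)⁻¹ * f w)) x := by
  refine (contDiffAt_lieLog hO (f := fun w => (f x)⁻¹ * f w) ?_ ?_).differentiableAt (by simp)
  · exact (contMDiff_mul_left (I := 𝓡 n) (n := ∞) (a := (f x)⁻¹)).contMDiffAt.comp x hf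
  · simpa using one_mem_expImage hO

theorem eventually_lieExp_lieLog_of_continuousAt {X : Type*} [TopologicalSpace X] {f : X → G}
    {x : X} (hf : ContinuousAt f x) :
    ∀ᶠ w in 𝓝 x, lieExp (lieLog O ((f x)⁻¹ * f w)) = (f x)⁻¹ * f w := by
  have := topologicalGroup_of_lieGroup (𝓡 n) ∞ (G := G)
  have h1 : Tendsto (fun w => (f x)⁻¹ * f w) (𝓝 x) (𝓝 1) := by
    have h0 : Tendsto (fun w => (f x)⁻¹ * f w) (𝓝 x) (𝓝 ((f x)⁻¹ * f x)) :=
      tendsto_const_nhds.mul hf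
    rwa [inv_mul_cancel] at h0
  exact h1.eventually (eventually_lieExp_lieLog hO)

theorem lderiv_comp {f : V → G} {u : W → V} {x : W} (hf : ContMDiffAt 𝓘(ℝ, V) (𝓡 n) ∞ f (u x))
    (hu : DifferentiableAt ℝ u x) :
    lderiv O (fun w => f (u w)) x = (lderiv O f (u x)).comp (fderiv ℝ u x) := by
  unfold lderiv
  exact fderiv_comp x (differentiableAt_lderiv hO hf) hu

theorem hasFDerivAt_conj (g : G) :
    HasFDerivAt (fun a : LieAlg n => lieLog O (g * lieExp a * g⁻¹)) (AdL g) 0 := by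
  have h1 : MDifferentiableAt (𝓡 n) (𝓡 n) (fun x : G => g * x * g⁻¹) (1 : G) :=
    (contMDiff_const_mul_mul_const n g g⁻¹).contMDiffAt.mdifferentiableAt (by simp)
  have e1 : (lieExp (0 : LieAlg n) : G) = 1 := lieExp_zero
  have e2 : g * lieExp (0 : LieAlg n) * g⁻¹ = 1 := by rw [e1]; simp
  have h2 : HasMFDerivAt (𝓡 n) (𝓡 n) (fun x : G => g * x * g⁻¹) (lieExp (0 : LieAlg n))
      (AdL g : LieAlg n →L[ℝ] LieAlg n) := by
    unfold AdL; rw [e1]; exact h1.hasMFDerivAt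
  have h3 : HasMFDerivAt (𝓡 n) 𝓘(ℝ, LieAlg n) (lieLog O : G → LieAlg n)
      (g * lieExp (0 : LieAlg n) * g⁻¹) (ContinuousLinearMap.id ℝ (LieAlg n)) := by
    rw [e2]; exact hasMFDerivAt_lieLog_one hO
  have h4 := h2.comp (0 : LieAlg n) (hasMFDerivAt_lieExp_zero hO)
  have h5 := h3.comp (0 : LieAlg n) h4
  exact h5.hasFDerivAt

/-- Setting either factor to `1` leaves `log ∘ exp`, so both partial derivatives at the origin are
the identity. -/
theorem hasFDerivAt_lieLog_mul :
    HasFDerivAt (fun p : LieAlg n × LieAlg n => lieLog O (lieExp p.1 * lieExp p.2 : G))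
      (ContinuousLinearMap.fst ℝ (LieAlg n) (LieAlg n) +
        ContinuousLinearMap.snd ℝ (LieAlg n) (LieAlg n)) 0 := by
  have e1 : (lieExp (0 : LieAlg n) : G) = 1 := lieExp_zero
  have h1 : ContMDiffAt 𝓘(ℝ, LieAlg n × LieAlg n) (𝓡 n) ∞
      (fun p : LieAlg n × LieAlg n => (lieExp p.1 * lieExp p.2 : G)) 0 :=
    (contMDiffAt_lieExp hO contDiff_fst.contDiffAt).mul
      (contMDiffAt_lieExp hO contDiff_snd.contDiffAt)
  have h2 := (contDiffAt_lieLog hO h1 (by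
    simpa [e1] using one_mem_expImage hO)).differentiableAt (by simp)
  have h3 := h2.hasFDerivAt
  set D := fderiv ℝ (fun p : LieAlg n × LieAlg n => lieLog O (lieExp p.1 * lieExp p.2 : G)) 0
  have h4 : D.comp (ContinuousLinearMap.inl ℝ (LieAlg n) (LieAlg n)) =
      ContinuousLinearMap.id ℝ (LieAlg n) := by
    have := HasFDerivAt.comp (0 : LieAlg n) (f := fun a : LieAlg n => (a, (0 : LieAlg n))) h3
      (hasFDerivAt_prodMk_left 0 0)
    refine this.unique ((hasFDerivAt_id _).congr_of_eventuallyEq ?_)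
    filter_upwards [eventually_lieLog_lieExp (G := G) hO] with a ha
    simp [e1, ha]
  have h5 : D.comp (ContinuousLinearMap.inr ℝ (LieAlg n) (LieAlg n)) =
      ContinuousLinearMap.id ℝ (LieAlg n) := by
    have := HasFDerivAt.comp (0 : LieAlg n) (f := fun a : LieAlg n => ((0 : LieAlg n), a)) h3
      (hasFDerivAt_prodMk_right 0 0)
    refine this.unique ((hasFDerivAt_id _).congr_of_eventuallyEq ?_)
    filter_upwards [eventually_lieLog_lieExp (G := G) hO] with a ha
    simp [e1, ha]
  refine h3.congr_fderiv (ContinuousLinearMap.ext fun (p : LieAlg n × LieAlg n) => ?_)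
  have e2 : p = ContinuousLinearMap.inl ℝ (LieAlg n) (LieAlg n) p.1 +
    ContinuousLinearMap.inr ℝ (LieAlg n) (LieAlg n) p.2 := by ext <;> simp
  conv_lhs => rw [e2, map_add]
  have h6 := congrArg (fun A : LieAlg n →L[ℝ] LieAlg n => A p.1) h4
  have h7 := congrArg (fun A : LieAlg n →L[ℝ] LieAlg n => A p.2) h5
  simp only [ContinuousLinearMap.comp_apply, ContinuousLinearMap.id_apply] at h6 h7
  rw [h6, h7]
  simp

/-- The increment factors as `(f g)(x)⁻¹ (f g)(w) = [g(x)⁻¹ (f(x)⁻¹ f(w)) g(x)] · [g(x)⁻¹ g(w)]`.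
The first bracket is conjugated by `g(x)⁻¹`, whence `Ad`, and to first order the product of two
elements near `1` is the sum of their logarithms. -/
theorem lderiv_mul {f g : V → G} {x : V} (hf : ContMDiffAt 𝓘(ℝ, V) (𝓡 n) ∞ f x)
    (hg : ContMDiffAt 𝓘(ℝ, V) (𝓡 n) ∞ g x) :
    lderiv O (fun w => f w * g w) x =
      (AdL (g x)⁻¹ : LieAlg n →L[ℝ] LieAlg n).comp (lderiv O f x) + lderiv O g x := by
  have := topologicalGroup_of_lieGroup (𝓡 n) ∞ (G := G)
  have e1 : (lieExp (0 : LieAlg n) : G) = 1 := lieExp_zero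
  have e2 : lieLog O (1 : G) = 0 := lieLog_one hO
  set u : V → LieAlg n := fun w => lieLog O ((f x)⁻¹ * f w)
  set v : V → LieAlg n := fun w => lieLog O ((g x)⁻¹ * g w)
  set C : LieAlg n → LieAlg n := fun a => lieLog O ((g x)⁻¹ * lieExp a * ((g x)⁻¹)⁻¹)
  have hu : HasFDerivAt u (lderiv O f x) x := (differentiableAt_lderiv hO hf).hasFDerivAt
  have hv : HasFDerivAt v (lderiv O g x) x := (differentiableAt_lderiv hO hg).hasFDerivAt
  have hu0 : u x = 0 := by simp [u, e2]
  have hv0 : v x = 0 := by simp [v, e2]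
  have hC : HasFDerivAt C (AdL (g x)⁻¹) (u x) := by rw [hu0]; exact hasFDerivAt_conj hO (g x)⁻¹
  have hCu := hC.comp x hu
  have hC0 : C (u x) = 0 := by simp [C, hu0, e1, e2]
  have hP := hasFDerivAt_lieLog_mul hO
  have hP' : HasFDerivAt (fun p : LieAlg n × LieAlg n => lieLog O (lieExp p.1 * lieExp p.2 : G))
      (ContinuousLinearMap.fst ℝ (LieAlg n) (LieAlg n) +
        ContinuousLinearMap.snd ℝ (LieAlg n) (LieAlg n)) ((fun w => (C (u w), v w)) x) := by
    simp only [hC0, hv0]; exact hP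
  have hfin := hP'.comp x (hCu.prodMk hv)
  unfold lderiv
  refine HasFDerivAt.fderiv ?_
  have hfin' := hfin.congr_fderiv (f' := _)
    (g' := (AdL (g x)⁻¹ : LieAlg n →L[ℝ] LieAlg n).comp (lderiv O f x) + lderiv O g x)
    (by ext; simp)
  refine hfin'.congr_of_eventuallyEq ?_
  have hcu : ContinuousAt (fun w => (g x)⁻¹ * lieExp (u w) * ((g x)⁻¹)⁻¹) x :=
    (continuousAt_const.mul ((continuous_lieExp hO).continuousAt.comp hu.continuousAt)).mul
      continuousAt_const
  filter_upwards [eventually_lieExp_lieLog_of_continuousAt hO hf.continuousAt,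
    eventually_lieExp_lieLog_of_continuousAt hO hg.continuousAt,
    eventually_lieExp_lieLog_of_continuousAt hO hcu] with w h1 h2 h3
  have h3' : lieExp (C (u w)) = (g x)⁻¹ * lieExp (u w) * ((g x)⁻¹)⁻¹ := by
    simpa [hu0, e1, C] using h3
  simp only [Function.comp]
  rw [h3', h1, h2]
  congr 1
  group

theorem lderiv_lieExp_smul (X : LieAlg n) (t : ℝ) :
    lderiv O (fun s : ℝ => (lieExp (s • X) : G)) t = ContinuousLinearMap.smulRight (1 : ℝ →L[ℝ] ℝ) X := by
  unfold lderiv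
  refine HasFDerivAt.fderiv ?_
  have h1 : HasFDerivAt (fun s : ℝ => (s - t) • X)
      (ContinuousLinearMap.smulRight (1 : ℝ →L[ℝ] ℝ) X) t := by
    exact ((hasFDerivAt_id t).sub_const t).smul_const X
  refine h1.congr_of_eventuallyEq ?_
  have h2 : Tendsto (fun s : ℝ => (s - t) • X) (𝓝 t) (𝓝 0) := by
    have := h1.continuousAt.tendsto
    simpa using this
  filter_upwards [h2.eventually (eventually_lieLog_lieExp (G := G) hO)] with s hs
  rw [← lieExp_neg, ← neg_smul, ← lieExp_add_smul, neg_add_eq_sub, hs]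

end LeftDerivative
end LieWigner
end

/-! ### The left trivialized derivative of `exp` and its relation to `Ad`. -/

noncomputable section
namespace LieWigner

section ExpDerivative

variable {n : ℕ} {G : Type*} [TopologicalSpace G] [ChartedSpace (EuclideanSpace ℝ (Fin n)) G]
  [Group G] {O : Set (LieAlg n)}

variable (G) in
/-- The left trivialized derivative of the exponential map. -/
def expDeriv (O : Set (LieAlg n)) (Z : LieAlg n) : LieAlg n →L[ℝ] LieAlg n :=
  lderiv O (lieExp : LieAlg n → G) Z

variable [MeasurableSpace G] {m : Measure G} (hO : IsWeaklyExponential m O)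
  [LieGroup (𝓡 n) ∞ G] [T2Space G]
include hO

theorem contDiff_expDeriv : ContDiff ℝ ∞ (expDeriv G O) := by
  refine contDiff_iff_contDiffAt.2 fun Z => ?_
  have h1 : ContDiffAt ℝ ∞ (Function.uncurry fun Z W : LieAlg n =>
      lieLog O ((lieExp Z)⁻¹ * lieExp W : G)) (Z, Z) := by
    refine contDiffAt_lieLog hO (f := fun p : LieAlg n × LieAlg n =>
      ((lieExp p.1)⁻¹ * lieExp p.2 : G)) ?_ ?_
    · exact (contMDiffAt_lieExp hO contDiff_fst.contDiffAt).inv.mul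
        (contMDiffAt_lieExp hO contDiff_snd.contDiffAt)
    · simpa using one_mem_expImage hO
  exact h1.fderiv (m := ∞) contDiffAt_id (by simp)

theorem expDeriv_zero : expDeriv G O (0 : LieAlg n) = ContinuousLinearMap.id ℝ (LieAlg n) := by
  refine HasFDerivAt.fderiv ((hasFDerivAt_id _).congr_of_eventuallyEq ?_)
  filter_upwards [eventually_lieLog_lieExp (G := G) hO] with W hW
  simp [lieExp_zero, hW]

theorem lderiv_lieExp_comp {V : Type*} [NormedAddCommGroup V] [NormedSpace ℝ V]
    {u : V → LieAlg n} {x : V} (hu : DifferentiableAt ℝ u x) :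
    lderiv O (fun w => (lieExp (u w) : G)) x = (expDeriv G O (u x)).comp (fderiv ℝ u x) :=
  lderiv_comp hO ((contMDiff_lieExp hO).contMDiffAt) hu

theorem expDeriv_smul_self (X : LieAlg n) (t : ℝ) : expDeriv G O (t • X) X = X := by
  have hd : HasFDerivAt (fun s : ℝ => s • X) (ContinuousLinearMap.smulRight (1 : ℝ →L[ℝ] ℝ) X) t :=
    (ContinuousLinearMap.smulRight (1 : ℝ →L[ℝ] ℝ) X).hasFDerivAt
  have h1 := lderiv_lieExp_comp (G := G) hO hd.differentiableAt
  rw [lderiv_lieExp_smul hO, hd.fderiv] at h1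
  have h2 := congrArg (fun A : ℝ →L[ℝ] LieAlg n => A 1) h1
  simpa using h2.symm

theorem lderiv_lieExp_const_smul (X : LieAlg n) (t : ℝ) :
    lderiv O (fun W : LieAlg n => (lieExp (t • W) : G)) X = t • expDeriv G O (t • X) := by
  have hd : HasFDerivAt (fun W : LieAlg n => t • W) (t • ContinuousLinearMap.id ℝ (LieAlg n)) X :=
    (hasFDerivAt_id X).const_smul t
  rw [lderiv_lieExp_comp hO hd.differentiableAt, hd.fderiv]
  simp

/-- This is the product rule applied to `exp((t+h)W) = exp(tW) exp(hW)` as functions of `W`. The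
resulting cocycle identity is the source of the differential equation for `t ↦ t • expDeriv G O (t •
X)` and of the relation between `expDeriv` at `X` and `-X`. -/
theorem smul_expDeriv_add (X : LieAlg n) (t h : ℝ) :
    (t + h) • expDeriv G O ((t + h) • X) =
      (AdL (lieExp (-(h • X)) : G) : LieAlg n →L[ℝ] LieAlg n).comp (t • expDeriv G O (t • X)) +
        h • expDeriv G O (h • X) := by
  rw [← lderiv_lieExp_const_smul hO, ← lderiv_lieExp_const_smul hO, ← lderiv_lieExp_const_smul hO,
    lieExp_neg]
  rw [← lderiv_mul hO (contMDiffAt_lieExp hO (contDiff_const_smul t).contDiffAt)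
    (contMDiffAt_lieExp hO (contDiff_const_smul h).contDiffAt)]
  congr 1
  ext1 W
  rw [lieExp_add_smul]

theorem AdL_one : (AdL (1 : G) : LieAlg n →L[ℝ] LieAlg n) = ContinuousLinearMap.id ℝ _ := by
  refine (hasFDerivAt_conj hO (1 : G)).unique ((hasFDerivAt_id _).congr_of_eventuallyEq ?_)
  filter_upwards [eventually_lieLog_lieExp (G := G) hO] with W hW
  simp [hW]

/-- The cocycle identity with `t = 1` and `h = -1`, where the left side vanishes. -/
theorem AdL_comp_expDeriv (X : LieAlg n) :
    (AdL (lieExp X : G) : LieAlg n →L[ℝ] LieAlg n).comp (expDeriv G O X) =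
      expDeriv G O (-X) := by
  have h := smul_expDeriv_add (G := G) hO X 1 (-1)
  simp only [add_neg_cancel, zero_smul, neg_smul, one_smul, neg_neg] at h
  rw [neg_one_smul ℝ (expDeriv G O (-X)), zero_smul ℝ (expDeriv G O 0), ← sub_eq_add_neg] at h
  exact sub_eq_zero.1 h.symm

theorem AdL_mul (g h : G) : (AdL (g * h) : LieAlg n →L[ℝ] LieAlg n) = (AdL g).comp (AdL h) := by
  have := topologicalGroup_of_lieGroup (𝓡 n) ∞ (G := G)
  have e1 : (lieExp (0 : LieAlg n) : G) = 1 := lieExp_zero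
  have e0 : lieLog O (h * lieExp (0 : LieAlg n) * h⁻¹) = 0 := by
    rw [e1]; simp [lieLog_one hO]
  have h1 : HasFDerivAt (fun a : LieAlg n => lieLog O (g * lieExp a * g⁻¹)) (AdL g)
      (lieLog O (h * lieExp (0 : LieAlg n) * h⁻¹)) := by
    rw [e0]; exact hasFDerivAt_conj hO g
  have h2 := h1.comp (0 : LieAlg n) (hasFDerivAt_conj hO h)
  refine (hasFDerivAt_conj hO (g * h)).unique (h2.congr_of_eventuallyEq ?_)
  have hc : ContinuousAt (fun a : LieAlg n => h * lieExp a * h⁻¹) 0 :=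
    (continuousAt_const.mul (continuous_lieExp hO).continuousAt).mul continuousAt_const
  filter_upwards [eventually_lieExp_lieLog_of_continuousAt hO hc] with a ha
  have ha' : lieExp (lieLog O (h * lieExp a * h⁻¹)) = h * lieExp a * h⁻¹ := by
    simpa [e1] using ha
  simp only [Function.comp]
  rw [ha']
  congr 1
  group

theorem contDiff_AdL_lieExp :
    ContDiff ℝ ∞ (fun X : LieAlg n => (AdL (lieExp X : G) : LieAlg n →L[ℝ] LieAlg n)) := by
  refine contDiff_iff_contDiffAt.2 fun Z => ?_
  have h1 : ContDiffAt ℝ ∞ (Function.uncurry fun Z W : LieAlg n =>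
      lieLog O (lieExp Z * lieExp W * (lieExp Z)⁻¹ : G)) (Z, 0) := by
    refine contDiffAt_lieLog hO (f := fun p : LieAlg n × LieAlg n =>
      (lieExp p.1 * lieExp p.2 * (lieExp p.1)⁻¹ : G)) ?_ ?_
    · have h2 := contMDiffAt_lieExp (G := G) hO
        (f := fun p : LieAlg n × LieAlg n => p.1) (x := (Z, 0)) contDiff_fst.contDiffAt
      have h3 := contMDiffAt_lieExp (G := G) hO
        (f := fun p : LieAlg n × LieAlg n => p.2) (x := (Z, 0)) contDiff_snd.contDiffAt
      exact (h2.mul h3).mul h2.inv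
    · simpa [lieExp_zero] using one_mem_expImage hO
  have h2 := h1.fderiv (m := ∞) (g := fun _ => (0 : LieAlg n)) contDiffAt_const (by simp)
  refine h2.congr_of_eventuallyEq (Eventually.of_forall fun X => ?_)
  exact (hasFDerivAt_conj hO (lieExp X : G)).fderiv.symm

theorem hasFDerivAt_expDeriv_zero :
    HasFDerivAt (expDeriv G O) (fderiv ℝ (expDeriv G O) 0) 0 :=
  ((contDiff_expDeriv hO).contDiffAt.differentiableAt (by simp)).hasFDerivAt

/-- Along the line through `X` the vector `expDeriv G O (s • X) X` is constantly `X`. Polarization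
then makes the second order term of `exp` antisymmetric. -/
theorem fderiv_expDeriv_zero_self (X : LieAlg n) : fderiv ℝ (expDeriv G O) 0 X X = 0 := by
  have hd : HasDerivAt (fun s : ℝ => s • X) X 0 := by
    simpa using (hasDerivAt_id (0 : ℝ)).smul_const X
  have h0 : HasFDerivAt (expDeriv G O) (fderiv ℝ (expDeriv G O) 0) ((0 : ℝ) • X) := by
    rw [zero_smul]; exact hasFDerivAt_expDeriv_zero hO
  have h1 := h0.comp_hasDerivAt (0 : ℝ) hd
  have h2 := ((ContinuousLinearMap.apply ℝ (LieAlg n) X).hasFDerivAt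
    (x := (expDeriv G O ∘ fun s : ℝ => s • X) 0)).comp_hasDerivAt (0 : ℝ) h1
  exact h2.unique ((hasDerivAt_const (0 : ℝ) X).congr_of_eventuallyEq
    (Eventually.of_forall fun s => expDeriv_smul_self hO X s))

theorem fderiv_expDeriv_zero_antisymm (X Y : LieAlg n) :
    fderiv ℝ (expDeriv G O) 0 X Y = -fderiv ℝ (expDeriv G O) 0 Y X := by
  have h := fderiv_expDeriv_zero_self (G := G) hO (X + Y)
  simp only [map_add, _root_.add_apply, fderiv_expDeriv_zero_self hO, zero_add,
    add_zero] at h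
  exact eq_neg_of_add_eq_zero_right h

/-- Write `J` for `expDeriv` and differentiate `Ad_{exp(sX)} J(sX) = J(-sX)` at `s = 0`: the unknown
derivative `a` satisfies `a + J'(X) = -J'(X)`. -/
theorem hasDerivAt_AdL_lieExp_smul (X : LieAlg n) :
    HasDerivAt (fun s : ℝ => (AdL (lieExp (s • X) : G) : LieAlg n →L[ℝ] LieAlg n))
      (-(2 : ℝ) • fderiv ℝ (expDeriv G O) 0 X) 0 := by
  have hd : HasDerivAt (fun s : ℝ => s • X) X 0 := by
    simpa using (hasDerivAt_id (0 : ℝ)).smul_const X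
  have hdn : HasDerivAt (fun s : ℝ => -(s • X)) (-X) 0 := hd.neg
  have hA : DifferentiableAt ℝ
      (fun X : LieAlg n => (AdL (lieExp X : G) : LieAlg n →L[ℝ] LieAlg n)) ((0 : ℝ) • X) :=
    (contDiff_AdL_lieExp hO).contDiffAt.differentiableAt (by simp)
  have h1 := hA.hasFDerivAt.comp_hasDerivAt (0 : ℝ) hd
  set a := fderiv ℝ (fun X : LieAlg n => (AdL (lieExp X : G) : LieAlg n →L[ℝ] LieAlg n))
    ((0 : ℝ) • X) X
  have h0 : HasFDerivAt (expDeriv G O) (fderiv ℝ (expDeriv G O) 0) ((0 : ℝ) • X) := by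
    rw [zero_smul]; exact hasFDerivAt_expDeriv_zero hO
  have h0' : HasFDerivAt (expDeriv G O) (fderiv ℝ (expDeriv G O) 0) (-((0 : ℝ) • X)) := by
    rw [zero_smul, neg_zero]; exact hasFDerivAt_expDeriv_zero hO
  have h2 := h1.clm_comp (h0.comp_hasDerivAt (0 : ℝ) hd)
  have h3 := h0'.comp_hasDerivAt (0 : ℝ) hdn
  have h4 := h2.unique (h3.congr_of_eventuallyEq (Eventually.of_forall fun s =>
    AdL_comp_expDeriv hO (s • X)))
  simp only [Function.comp, zero_smul, expDeriv_zero hO, lieExp_zero, AdL_one hO, map_neg] at h4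
  have h5 : a = -(2 : ℝ) • fderiv ℝ (expDeriv G O) 0 X := by
    have : a + fderiv ℝ (expDeriv G O) 0 X = -fderiv ℝ (expDeriv G O) 0 X := by
      simpa using h4
    rw [eq_sub_of_add_eq this, neg_smul (2 : ℝ) (fderiv ℝ (expDeriv G O) 0 X),
      two_smul ℝ (fderiv ℝ (expDeriv G O) 0 X), neg_add, sub_eq_add_neg]
  rw [← h5]
  exact h1

theorem mfderiv_lieExp (Z : LieAlg n) :
    (mfderiv 𝓘(ℝ, LieAlg n) (𝓡 n) (lieExp : LieAlg n → G) Z : LieAlg n →L[ℝ] LieAlg n) =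
      ContinuousLinearMap.comp
        (mfderiv (𝓡 n) (𝓡 n) (fun x : G => lieExp Z * x) 1 : LieAlg n →L[ℝ] LieAlg n)
        (expDeriv G O Z) := by
  have hc : ContinuousAt (lieExp : LieAlg n → G) Z := (continuous_lieExp hO).continuousAt
  set u : LieAlg n → LieAlg n := fun W => lieLog O ((lieExp Z)⁻¹ * lieExp W : G)
  have hu0 : u Z = 0 := by simp [u, lieLog_one hO]
  have hu : HasMFDerivAt 𝓘(ℝ, LieAlg n) 𝓘(ℝ, LieAlg n) u Z (expDeriv G O Z) :=
    (differentiableAt_lderiv hO (contMDiff_lieExp hO).contMDiffAt).hasFDerivAt.hasMFDerivAt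
  have e1 : (lieExp (u Z) : G) = 1 := by rw [hu0, lieExp_zero]
  have h1 : HasMFDerivAt 𝓘(ℝ, LieAlg n) (𝓡 n) (lieExp : LieAlg n → G) (u Z)
      (ContinuousLinearMap.id ℝ (LieAlg n)) := by
    rw [hu0]; exact hasMFDerivAt_lieExp_zero hO
  have h2 : HasMFDerivAt (𝓡 n) (𝓡 n) (fun x : G => lieExp Z * x) (lieExp (u Z))
      (mfderiv (𝓡 n) (𝓡 n) (fun x : G => lieExp Z * x) 1 : LieAlg n →L[ℝ] LieAlg n) := by
    rw [e1]; exact (mdifferentiableAt_mul_left n _ _).hasMFDerivAt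
  have h3 := h2.comp Z (h1.comp Z hu)
  have h4 : HasMFDerivAt 𝓘(ℝ, LieAlg n) (𝓡 n) (lieExp : LieAlg n → G) Z
      (ContinuousLinearMap.comp
        (mfderiv (𝓡 n) (𝓡 n) (fun x : G => lieExp Z * x) 1 : LieAlg n →L[ℝ] LieAlg n)
        (expDeriv G O Z)) := by
    refine HasMFDerivAt.congr_of_eventuallyEq
      (f := (fun x : G => lieExp Z * x) ∘ lieExp ∘ u) h3 ?_
    filter_upwards [eventually_lieExp_lieLog_of_continuousAt hO hc] with W hW
    simp only [Function.comp, u]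
    rw [hW, mul_inv_cancel_left]
  exact h4.mfderiv

end ExpDerivative
end LieWigner
end

/-! ### The Lie bracket, computed in exponential coordinates. -/

noncomputable section
namespace LieWigner

section Bracket

variable {n : ℕ} {G : Type*} [TopologicalSpace G] [ChartedSpace (EuclideanSpace ℝ (Fin n)) G]
  [Group G] {O : Set (LieAlg n)} [MeasurableSpace G] {m : Measure G}
  (hO : IsWeaklyExponential m O) [LieGroup (𝓡 n) ∞ G] [T2Space G]
include hO

omit hO [MeasurableSpace G] [T2Space G] in
theorem mfderiv_mul_left_one_comp (g : G) :
    ContinuousLinearMap.comp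
      (mfderiv (𝓡 n) (𝓡 n) (fun x : G => g * x) 1 : LieAlg n →L[ℝ] LieAlg n)
      (mfderiv (𝓡 n) (𝓡 n) (fun x : G => g⁻¹ * x) g : LieAlg n →L[ℝ] LieAlg n) =
      ContinuousLinearMap.id ℝ (LieAlg n) := by
  have e1 : g⁻¹ * g = 1 := inv_mul_cancel g
  have h1 := (mdifferentiableAt_mul_left n g⁻¹ g).hasMFDerivAt
  have h2 : HasMFDerivAt (𝓡 n) (𝓡 n) (fun x : G => g * x) (g⁻¹ * g)
      (mfderiv (𝓡 n) (𝓡 n) (fun x : G => g * x) 1 : LieAlg n →L[ℝ] LieAlg n) := by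
    rw [e1]; exact (mdifferentiableAt_mul_left n _ _).hasMFDerivAt
  have h3 := h2.comp g h1
  have h4 : HasMFDerivAt (𝓡 n) (𝓡 n) ((fun x : G => g * x) ∘ fun x => g⁻¹ * x) g
      (ContinuousLinearMap.id ℝ (LieAlg n)) :=
    (hasMFDerivAt_id g).congr_of_eventuallyEq (Eventually.of_forall fun x => by simp)
  exact hasMFDerivAt_unique h3 h4

omit hO [MeasurableSpace G] [T2Space G] in
theorem mfderiv_mul_left_comp_one (g : G) :
    ContinuousLinearMap.comp
      (mfderiv (𝓡 n) (𝓡 n) (fun x : G => g⁻¹ * x) g : LieAlg n →L[ℝ] LieAlg n)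
      (mfderiv (𝓡 n) (𝓡 n) (fun x : G => g * x) 1 : LieAlg n →L[ℝ] LieAlg n) =
      ContinuousLinearMap.id ℝ (LieAlg n) := by
  have e1 : g * 1 = g := mul_one g
  have h1 := (mdifferentiableAt_mul_left n g 1).hasMFDerivAt
  have h2 : HasMFDerivAt (𝓡 n) (𝓡 n) (fun x : G => g⁻¹ * x) (g * 1)
      (mfderiv (𝓡 n) (𝓡 n) (fun x : G => g⁻¹ * x) g : LieAlg n →L[ℝ] LieAlg n) := by
    rw [e1]; exact (mdifferentiableAt_mul_left n _ _).hasMFDerivAt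
  have h3 := h2.comp (1 : G) h1
  have h4 : HasMFDerivAt (𝓡 n) (𝓡 n) ((fun x : G => g⁻¹ * x) ∘ fun x => g * x) 1
      (ContinuousLinearMap.id ℝ (LieAlg n)) :=
    (hasMFDerivAt_id (1 : G)).congr_of_eventuallyEq (Eventually.of_forall fun x => by simp)
  exact hasMFDerivAt_unique h3 h4

theorem eventually_expDeriv_isInvertible :
    ∀ᶠ Z : LieAlg n in 𝓝 0, (expDeriv G O Z).IsInvertible := by
  have h1 : (expDeriv G O 0).IsInvertible := by
    rw [expDeriv_zero hO]; exact ⟨ContinuousLinearEquiv.refl ℝ _, rfl⟩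
  have h2 : {A : LieAlg n →L[ℝ] LieAlg n | A.IsInvertible} ∈ 𝓝 (expDeriv G O 0) := by
    obtain ⟨e, he⟩ := h1
    rw [← he]
    exact ContinuousLinearEquiv.nhds e
  exact (contDiff_expDeriv hO).continuous.continuousAt.eventually h2

/-- Left translation cancels between the invariant field and the derivative of `exp`, leaving the
inverse of `expDeriv`. The formula is local because it needs this derivative to be invertible. -/
theorem mpullback_lieExp (X : LieAlg n) :
    ∀ᶠ Z : LieAlg n in 𝓝 0, (VectorField.mpullback 𝓘(ℝ, LieAlg n) (𝓡 n) (lieExp : LieAlg n → G)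
      (mulInvariantVectorField (I := 𝓡 n) (X : GroupLieAlgebra (𝓡 n) G)) Z : LieAlg n) =
      (expDeriv G O Z).inverse X := by
  filter_upwards [eventually_expDeriv_isInvertible hO] with Z hZ
  set A : LieAlg n →L[ℝ] LieAlg n := mfderiv (𝓡 n) (𝓡 n) (fun x : G => lieExp Z * x) 1 with hA
  set A' : LieAlg n →L[ℝ] LieAlg n :=
    mfderiv (𝓡 n) (𝓡 n) (fun x : G => (lieExp Z)⁻¹ * x) (lieExp Z) with hA'
  have h1 : A.comp A' = ContinuousLinearMap.id ℝ _ := mfderiv_mul_left_one_comp _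
  have h2 : A'.comp A = ContinuousLinearMap.id ℝ _ := mfderiv_mul_left_comp_one _
  obtain ⟨e, he⟩ := hZ
  have h3 : (A.comp (expDeriv G O Z)).inverse = (expDeriv G O Z).inverse.comp A' := by
    rw [← he, ContinuousLinearMap.inverse_equiv]
    refine ContinuousLinearMap.inverse_eq ?_ ?_
    · refine ContinuousLinearMap.ext fun Y => ?_
      simpa using congrArg (fun B : LieAlg n →L[ℝ] LieAlg n => B Y) h1
    · refine ContinuousLinearMap.ext fun Y => ?_
      have := congrArg (fun B : LieAlg n →L[ℝ] LieAlg n => B (e Y)) h2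
      simp only [ContinuousLinearMap.comp_apply, ContinuousLinearMap.id_apply] at this
      simp [this]
  have h4 : (VectorField.mpullback 𝓘(ℝ, LieAlg n) (𝓡 n) (lieExp : LieAlg n → G)
      (mulInvariantVectorField (I := 𝓡 n) (X : GroupLieAlgebra (𝓡 n) G)) Z : LieAlg n) =
      (mfderiv 𝓘(ℝ, LieAlg n) (𝓡 n) (lieExp : LieAlg n → G) Z :
        LieAlg n →L[ℝ] LieAlg n).inverse (A X) := rfl
  have h5 := congrArg (fun B : LieAlg n →L[ℝ] LieAlg n => B.inverse (A X)) (mfderiv_lieExp hO Z)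
  have h6 := congrArg (fun B : LieAlg n →L[ℝ] LieAlg n => B (A X)) h3
  have h7 := congrArg (fun B : LieAlg n →L[ℝ] LieAlg n => B X) h2
  exact (h4.trans h5).trans (h6.trans (congrArg (expDeriv G O Z).inverse h7))

theorem hasFDerivAt_expDeriv_inverse (X : LieAlg n) :
    HasFDerivAt (fun Z : LieAlg n => (expDeriv G O Z).inverse X)
      (-((ContinuousLinearMap.apply ℝ (LieAlg n) X).comp (fderiv ℝ (expDeriv G O) 0))) 0 := by
  have hi : HasFDerivAt (ContinuousLinearMap.inverse :
      (LieAlg n →L[ℝ] LieAlg n) → (LieAlg n →L[ℝ] LieAlg n))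
      (-ContinuousLinearMap.id ℝ (LieAlg n →L[ℝ] LieAlg n)) (expDeriv G O 0) := by
    rw [expDeriv_zero hO, ← ContinuousLinearMap.ringInverse_eq_inverse]
    have := hasFDerivAt_ringInverse (𝕜 := ℝ) (1 : (LieAlg n →L[ℝ] LieAlg n)ˣ)
    refine this.congr_fderiv ?_
    ext A
    simp
  have h1 := hi.comp (0 : LieAlg n) (hasFDerivAt_expDeriv_zero hO)
  have h2 := ((ContinuousLinearMap.apply ℝ (LieAlg n) X).hasFDerivAt
    (x := (expDeriv G O 0).inverse)).comp (0 : LieAlg n) h1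
  refine h2.congr_fderiv ?_
  ext
  simp

/-- Brackets commute with pullback along `exp`, whose derivative at `0` is the identity. In these
coordinates the invariant fields are `Z ↦ J(Z)⁻¹ X` and `Z ↦ J(Z)⁻¹ Y` with `J = expDeriv`, so their
bracket at `0` is `J'(Y) X - J'(X) Y`, which is `-2 J'(X) Y` by antisymmetry. Comparison with
`hasDerivAt_AdL_lieExp_smul` shows that `ad` is the derivative of `Ad`. -/
theorem adL_eq (X : LieAlg n) :
    adL G X = -(2 : ℝ) • fderiv ℝ (expDeriv G O) 0 X := by
  have i1 := lieGroup_minSmoothness n G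
  have i2 : LieGroup (𝓡 n) (minSmoothness ℝ 2) G :=
    LieGroup.of_le (n := ∞) (by
      rw [minSmoothness_of_isRCLikeNormedField]; exact ENat.LEInfty.out)
  refine ContinuousLinearMap.ext fun (Y : LieAlg n) => ?_
  have hX := (mdifferentiableAt_mulInvariantVectorField (I := 𝓡 n) (G := G) (X : GroupLieAlgebra (𝓡 n) G)
    (g := lieExp (0 : LieAlg n)))
  have hY := (mdifferentiableAt_mulInvariantVectorField (I := 𝓡 n) (G := G) (Y : GroupLieAlgebra (𝓡 n) G)
    (g := lieExp (0 : LieAlg n)))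
  have h1 := VectorField.mpullback_mlieBracket (n := ∞) hX hY
    ((contMDiff_lieExp (G := G) hO).contMDiffAt)
    (by rw [minSmoothness_of_isRCLikeNormedField]; exact ENat.LEInfty.out)
  have h2 : (VectorField.mpullback 𝓘(ℝ, LieAlg n) (𝓡 n) (lieExp : LieAlg n → G)
      (VectorField.mlieBracket (𝓡 n)
        (mulInvariantVectorField (I := 𝓡 n) (X : GroupLieAlgebra (𝓡 n) G))
        (mulInvariantVectorField (I := 𝓡 n) (Y : GroupLieAlgebra (𝓡 n) G))) 0 : LieAlg n) =
      adL G X Y := by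
    have e1 : (mfderiv 𝓘(ℝ, LieAlg n) (𝓡 n) (lieExp : LieAlg n → G) 0 :
        LieAlg n →L[ℝ] LieAlg n) = ContinuousLinearMap.id ℝ (LieAlg n) :=
      (hasMFDerivAt_lieExp_zero hO).mfderiv
    have e2 : ∀ g : G, g = 1 → (VectorField.mlieBracket (𝓡 n)
        (mulInvariantVectorField (I := 𝓡 n) (X : GroupLieAlgebra (𝓡 n) G))
        (mulInvariantVectorField (I := 𝓡 n) (Y : GroupLieAlgebra (𝓡 n) G)) g : LieAlg n) =
        adL G X Y := by
      rintro _ rfl; rfl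
    have e3 : (mfderiv 𝓘(ℝ, LieAlg n) (𝓡 n) (lieExp : LieAlg n → G) 0 :
        LieAlg n →L[ℝ] LieAlg n).inverse (VectorField.mlieBracket (𝓡 n)
        (mulInvariantVectorField (I := 𝓡 n) (X : GroupLieAlgebra (𝓡 n) G))
        (mulInvariantVectorField (I := 𝓡 n) (Y : GroupLieAlgebra (𝓡 n) G))
        (lieExp (0 : LieAlg n)) : LieAlg n) = adL G X Y := by
      refine (congrArg (fun B : LieAlg n →L[ℝ] LieAlg n => B.inverse _) e1).trans ?_
      refine (congrArg (fun B : LieAlg n →L[ℝ] LieAlg n => B _)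
        ContinuousLinearMap.inverse_id).trans ?_
      exact e2 _ lieExp_zero
    exact e3
  rw [← h2]
  refine h1.trans ?_
  have hW := (hasFDerivAt_expDeriv_inverse hO Y).congr_of_eventuallyEq (mpullback_lieExp (G := G) hO Y)
  have hV := (hasFDerivAt_expDeriv_inverse hO X).congr_of_eventuallyEq (mpullback_lieExp (G := G) hO X)
  have hW0 := (mpullback_lieExp (G := G) hO Y).self_of_nhds
  have hV0 := (mpullback_lieExp (G := G) hO X).self_of_nhds
  rw [expDeriv_zero hO, ContinuousLinearMap.inverse_id] at hW0 hV0
  have h3 : ∀ (V W : LieAlg n → LieAlg n) (V' W' : LieAlg n →L[ℝ] LieAlg n),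
      HasFDerivAt V V' 0 → HasFDerivAt W W' 0 →
      (VectorField.mlieBracket 𝓘(ℝ, LieAlg n) V W 0 : LieAlg n) = W' (V 0) - V' (W 0) := by
    intro V W V' W' h h'
    have e : (VectorField.mlieBracket 𝓘(ℝ, LieAlg n) V W 0 : LieAlg n) =
        VectorField.lieBracket ℝ V W 0 := by
      refine Eq.trans (b := (VectorField.mlieBracketWithin 𝓘(ℝ, LieAlg n) V W Set.univ 0 :
        LieAlg n)) (congrFun VectorField.mlieBracketWithin_univ.symm _) ?_
      refine (congrFun VectorField.mlieBracketWithin_eq_lieBracketWithin _).trans ?_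
      rw [VectorField.lieBracketWithin_univ]
    rw [e, VectorField.lieBracket, h.fderiv, h'.fderiv]
  refine (h3 _ _ _ _ hV hW).trans ?_
  have h4 : ∀ (v w : LieAlg n), v = X → w = Y →
    (-((ContinuousLinearMap.apply ℝ (LieAlg n) Y).comp (fderiv ℝ (expDeriv G O) 0))) v -
    (-((ContinuousLinearMap.apply ℝ (LieAlg n) X).comp (fderiv ℝ (expDeriv G O) 0))) w =
    (-(2 : ℝ) • fderiv ℝ (expDeriv G O) 0 X) Y := by
    intro v w hv hw
    rw [hv, hw]
    have := fderiv_expDeriv_zero_antisymm (G := G) hO Y X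
    simp [this, two_smul, sub_eq_add_neg]
  exact h4 _ _ hV0 hW0

end Bracket
end LieWigner
end

/-! ### The derivative of `exp` as the series `φ(ad X)`. -/

noncomputable section
namespace LieWigner

section PhiSeries

variable {𝔸 : Type*} [NormedRing 𝔸] [NormedAlgebra ℝ 𝔸] [CompleteSpace 𝔸]

theorem integral_exp_neg_smul (A : 𝔸) :
    ∫ t in (0 : ℝ)..1, NormedSpace.exp ((-t) • A) =
      ∑' k : ℕ, ((-1 : ℝ) ^ k / ((k + 1).factorial : ℝ)) • A ^ k := by
  have key : HasSum (fun k : ℕ => ∫ t in (0 : ℝ)..1, ((k.factorial : ℝ)⁻¹ • ((-t) • A) ^ k))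
      (∫ t in (0 : ℝ)..1, NormedSpace.exp ((-t) • A)) := by
    -- The factor `1 + ‖1‖` serves the term `k = 0`, since the unit of `𝔸` is not assumed to have
    -- norm at most one.
    refine intervalIntegral.hasSum_integral_of_dominated_convergence
      (fun k _ => (k.factorial : ℝ)⁻¹ * ((1 + ‖(1 : 𝔸)‖) * ‖A‖ ^ k)) (fun k => ?_) (fun k => ?_)
      ?_ ?_ ?_
    · exact (Continuous.aestronglyMeasurable (by fun_prop))
    · refine Eventually.of_forall fun t ht => ?_
      rw [Set.uIoc_of_le zero_le_one] at ht
      rw [norm_smul, norm_inv, Real.norm_natCast]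
      refine mul_le_mul_of_nonneg_left ?_ (by positivity)
      rcases k with _ | k
      · simp
      · refine (norm_pow_le' _ k.succ_pos).trans ?_
        refine (pow_le_pow_left₀ (norm_nonneg _) ?_ _).trans
          (le_mul_of_one_le_left (by positivity) (le_add_of_nonneg_right (norm_nonneg _)))
        rw [norm_smul, norm_neg, Real.norm_of_nonneg ht.1.le]
        exact mul_le_of_le_one_left (norm_nonneg _) ht.2
    · refine Eventually.of_forall fun t _ => ?_
      refine ((Real.summable_pow_div_factorial ‖A‖).mul_left (1 + ‖(1 : 𝔸)‖)).congr fun k => ?_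
      ring
    · exact intervalIntegrable_const
    · exact Eventually.of_forall fun t _ => NormedSpace.exp_series_hasSum_exp' (𝕂 := ℝ) ((-t) • A)
  rw [← key.tsum_eq]
  congr 1
  ext1 k
  have h1 : ∀ t : ℝ, ((k.factorial : ℝ)⁻¹ • ((-t) • A) ^ k) =
      ((k.factorial : ℝ)⁻¹ * (-1) ^ k * t ^ k) • A ^ k := by
    intro t
    rw [smul_pow, smul_smul, neg_pow, mul_assoc]
  simp_rw [h1]
  rw [intervalIntegral.integral_smul_const, intervalIntegral.integral_const_mul, integral_pow]
  congr 1
  rw [Nat.factorial_succ]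
  push_cast
  field_simp
  simp

/-- The product `exp(-sA) E(s)` has derivative zero, hence is constantly `1`. -/
theorem eq_exp_smul_of_hasDerivAt {A : 𝔸} {E : ℝ → 𝔸} (hE : ∀ t, HasDerivAt E (A * E t) t)
    (h0 : E 0 = 1) (t : ℝ) : E t = NormedSpace.exp (t • A) := by
  letI : NormedAlgebra ℚ 𝔸 := NormedAlgebra.restrictScalars ℚ ℝ 𝔸
  have h1 : ∀ s : ℝ, HasDerivAt (fun s : ℝ => NormedSpace.exp ((-s) • A) * E s) 0 s := by
    intro s
    have e1 : HasDerivAt (fun s : ℝ => NormedSpace.exp (s • A))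
        (NormedSpace.exp ((-s) • A) * A) (-s) :=
      hasDerivAt_exp_smul_const (𝕂 := ℝ) A (-s)
    have e2 := (e1.scomp s (hasDerivAt_neg s)).mul (hE s)
    refine HasDerivAt.congr_deriv (f := fun s : ℝ => NormedSpace.exp ((-s) • A) * E s) e2 ?_
    simp only [Function.comp]
    rw [neg_one_smul ℝ, neg_mul, mul_assoc, neg_add_cancel]
  have h2 := is_const_of_deriv_eq_zero (fun s => (h1 s).differentiableAt)
    (fun s => (h1 s).deriv) t 0
  simp only [neg_zero, zero_smul, NormedSpace.exp_zero, h0, one_mul] at h2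
  have h3 : NormedSpace.exp (t • A) * NormedSpace.exp ((-t) • A) = 1 := by
    rw [← NormedSpace.exp_add_of_commute ((Commute.refl A).smul_left t |>.smul_right (-t))]
    simp
  calc E t = NormedSpace.exp (t • A) * (NormedSpace.exp ((-t) • A) * E t) := by
        rw [← mul_assoc, h3, one_mul]
    _ = _ := by rw [h2, mul_one]

theorem eq_tsum_of_hasDerivAt {A : 𝔸} {E M : ℝ → 𝔸} (hE : ∀ t, HasDerivAt E (A * E t) t)
    (h0 : E 0 = 1) (hM : ∀ t, HasDerivAt M (E (-t)) t) (hM0 : M 0 = 0) :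
    M 1 = ∑' k : ℕ, ((-1 : ℝ) ^ k / ((k + 1).factorial : ℝ)) • A ^ k := by
  have hc : Continuous E := continuous_iff_continuousAt.2 fun t => (hE t).continuousAt
  rw [← integral_exp_neg_smul, ← sub_zero (M 1), ← hM0, ← intervalIntegral.integral_eq_sub_of_hasDerivAt
    (fun t _ => hM t) ((hc.comp continuous_neg).intervalIntegrable _ _)]
  simp_rw [eq_exp_smul_of_hasDerivAt hE h0]

variable {n : ℕ} {G : Type*} [TopologicalSpace G] [ChartedSpace (EuclideanSpace ℝ (Fin n)) G]
  [Group G] {O : Set (LieAlg n)} [MeasurableSpace G] {m : Measure G}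
  (hO : IsWeaklyExponential m O) [LieGroup (𝓡 n) ∞ G] [T2Space G]
include hO

theorem hasDerivAt_AdL_smul_zero (X : LieAlg n) :
    HasDerivAt (fun s : ℝ => (AdL (lieExp (s • X) : G) : LieAlg n →L[ℝ] LieAlg n))
      (adL G X) 0 := by
  rw [adL_eq hO]; exact hasDerivAt_AdL_lieExp_smul hO X

theorem hasDerivAt_AdL_smul (X : LieAlg n) (t : ℝ) :
    HasDerivAt (fun s : ℝ => (AdL (lieExp (s • X) : G) : LieAlg n →L[ℝ] LieAlg n))
      ((adL G X).comp (AdL (lieExp (t • X) : G))) t := by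
  have h1 : HasDerivAt (fun s : ℝ => (AdL (lieExp ((s - t) • X) : G) : LieAlg n →L[ℝ] LieAlg n))
      (adL G X) t := by
    have h0 := hasDerivAt_AdL_smul_zero (G := G) hO X
    rw [← sub_self t] at h0
    simpa using! h0.scomp t (h := fun s => s - t) ((hasDerivAt_id t).sub_const t)
  have h2 := h1.clm_comp (hasDerivAt_const t (AdL (lieExp (t • X) : G) : LieAlg n →L[ℝ] LieAlg n))
  have h3 := h2.congr_of_eventuallyEq (f₁ := fun s : ℝ =>
    (AdL (lieExp (s • X) : G) : LieAlg n →L[ℝ] LieAlg n)) (Eventually.of_forall fun s => by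
      simp only
      rw [← AdL_mul hO, ← lieExp_add_smul, sub_add_cancel])
  simpa using h3

/-- The cocycle identity, with `s - t` and `t` as the two times, reduces the derivative at `t` to
the derivative at `0`, which is the identity. -/
theorem hasDerivAt_smul_expDeriv (X : LieAlg n) (t : ℝ) :
    HasDerivAt (fun s : ℝ => s • expDeriv G O (s • X)) (AdL (lieExp ((-t) • X) : G)) t := by
  have h0 : HasDerivAt (fun s : ℝ => s • expDeriv G O (s • X))
      (ContinuousLinearMap.id ℝ (LieAlg n)) 0 := by
    have hd : DifferentiableAt ℝ (fun s : ℝ => expDeriv G O (s • X)) 0 :=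
      ((contDiff_expDeriv hO).comp (contDiff_id.smul contDiff_const)).contDiffAt.differentiableAt
        (by simp)
    refine ((hasDerivAt_id (0 : ℝ)).smul hd.hasDerivAt).congr_deriv ?_
    rw [id, zero_smul ℝ (deriv (fun s : ℝ => expDeriv G O (s • X)) 0), zero_add, one_smul,
      zero_smul, expDeriv_zero hO]
  have h1 : HasDerivAt (fun s : ℝ => (s - t) • expDeriv G O ((s - t) • X))
      (ContinuousLinearMap.id ℝ (LieAlg n)) t := by
    rw [← sub_self t] at h0
    simpa using! h0.scomp t (h := fun s => s - t) ((hasDerivAt_id t).sub_const t)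
  have h2 := ((hasDerivAt_const t
    (AdL (lieExp (-(t • X)) : G) : LieAlg n →L[ℝ] LieAlg n)).clm_comp h1).add_const
      (t • expDeriv G O (t • X))
  have h3 := h2.congr_of_eventuallyEq (f₁ := fun s : ℝ => s • expDeriv G O (s • X))
    (Eventually.of_forall fun s => by
      have := smul_expDeriv_add (G := G) hO X (s - t) t
      rw [sub_add_cancel] at this
      exact this)
  rw [neg_smul]
  simpa using! h3

/-- The function `M(s) = s • expDeriv G O (s • X)` satisfies `M' (s) = Ad_{exp(-sX)} = exp(-s ad X)`
and `M(0) = 0`; hence `M(1)` is the integral of `exp(-s ad X)` over `[0, 1]`, which integrates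
termwise to the series. -/
theorem expDeriv_eq_phiSeries (X : LieAlg n) : expDeriv G O X = phiSeries (adL G X) := by
  have h := eq_tsum_of_hasDerivAt (𝔸 := LieAlg n →L[ℝ] LieAlg n) (A := adL G X)
    (E := fun s : ℝ => (AdL (lieExp (s • X) : G) : LieAlg n →L[ℝ] LieAlg n))
    (M := fun s : ℝ => s • expDeriv G O (s • X))
    (fun t => hasDerivAt_AdL_smul hO X t)
    (by simp only [zero_smul, lieExp_zero]; exact AdL_one hO)
    (fun t => hasDerivAt_smul_expDeriv hO X t)
    (zero_smul ℝ (expDeriv G O ((0 : ℝ) • X)))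
  refine Eq.trans ?_ h
  rw [one_smul ℝ X]
  exact (one_smul ℝ (expDeriv G O X)).symm

end PhiSeries
end LieWigner
end

/-! ### Translations of `G` in exponential coordinates. -/

noncomputable section
namespace LieWigner

section HaarCoordinates

variable {n : ℕ} {G : Type*} [TopologicalSpace G] [ChartedSpace (EuclideanSpace ℝ (Fin n)) G]
  [Group G] {O : Set (LieAlg n)} [MeasurableSpace G] {m : Measure G}
  (hO : IsWeaklyExponential m O) [LieGroup (𝓡 n) ∞ G] [T2Space G]
include hO

/-- `|det Ad_g|`. -/
def absDetAd (n : ℕ) {G : Type*} [TopologicalSpace G] [ChartedSpace (EuclideanSpace ℝ (Fin n)) G]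
    [Group G] (g : G) : ℝ := |(AdL (n := n) g).det|

/-- The Jacobian of the exponential map. -/
def expJac (G : Type*) [TopologicalSpace G] [ChartedSpace (EuclideanSpace ℝ (Fin n)) G]
    [Group G] (O : Set (LieAlg n)) (X : LieAlg n) : ℝ := |(expDeriv G O X).det|

omit [LieGroup (𝓡 n) ∞ G] [T2Space G] hO [MeasurableSpace G] in
theorem absDetAd_nonneg (g : G) : 0 ≤ absDetAd n g := abs_nonneg _

omit [LieGroup (𝓡 n) ∞ G] [T2Space G] hO [MeasurableSpace G] in
theorem expJac_nonneg (X : LieAlg n) : 0 ≤ expJac G O X := abs_nonneg _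

theorem absDetAd_one : absDetAd n (1 : G) = 1 := by
  rw [absDetAd, AdL_one hO, ContinuousLinearMap.det]; simp

theorem absDetAd_mul (g h : G) : absDetAd n (g * h) = absDetAd n g * absDetAd n h := by
  simp only [absDetAd, AdL_mul hO, ContinuousLinearMap.det, ContinuousLinearMap.toLinearMap_comp,
    LinearMap.det_comp, abs_mul]

theorem absDetAd_inv_mul (g : G) : absDetAd n g⁻¹ * absDetAd n g = 1 := by
  rw [← absDetAd_mul hO, inv_mul_cancel, absDetAd_one hO]

theorem absDetAd_pos (g : G) : 0 < absDetAd n g :=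
  (absDetAd_nonneg g).lt_of_ne fun h => by
    have := absDetAd_inv_mul hO g
    rw [← h, mul_zero] at this
    exact zero_ne_one this

theorem absDetAd_inv (g : G) : absDetAd n g⁻¹ = (absDetAd n g)⁻¹ :=
  eq_inv_of_mul_eq_one_left (absDetAd_inv_mul hO g)

theorem continuous_absDetAd_lieExp : Continuous fun X : LieAlg n => absDetAd n (lieExp X : G) :=
  (ContinuousLinearMap.continuous_det.comp (contDiff_AdL_lieExp hO).continuous).abs

theorem continuous_expJac : Continuous (expJac G O) :=
  (ContinuousLinearMap.continuous_det.comp (contDiff_expDeriv hO).continuous).abs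

theorem expJac_zero : expJac G O 0 = 1 := by
  rw [expJac, expDeriv_zero hO, ContinuousLinearMap.det]; simp

theorem absDetAd_mul_expJac (X : LieAlg n) :
    absDetAd n (lieExp X : G) * expJac G O X = expJac G O (-X) := by
  simp only [absDetAd, expJac, ← AdL_comp_expDeriv hO X, ContinuousLinearMap.det,
    ContinuousLinearMap.toLinearMap_comp, LinearMap.det_comp, abs_mul]

theorem absDetAd_half_sq (X : LieAlg n) :
    absDetAd n (lieExp ((1 / 2 : ℝ) • X) : G) * absDetAd n (lieExp ((1 / 2 : ℝ) • X) : G) =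
      absDetAd n (lieExp X : G) := by
  rw [← absDetAd_mul hO, lieExp_half_mul_half]

theorem contMDiffAt_translate (g h : G) (Z : LieAlg n) :
    ContMDiffAt 𝓘(ℝ, LieAlg n) (𝓡 n) ∞ (fun Z : LieAlg n => g * lieExp Z * h) Z :=
  (contMDiff_const_mul_mul_const n g h).contMDiffAt.comp Z (contMDiff_lieExp hO).contMDiffAt

/-- The group translation `x ↦ g x h` in exponential coordinates. -/
theorem expDeriv_comp_fderiv_translate (g h : G) {Z : LieAlg n}
    (hZ : g * lieExp Z * h ∈ expImage G O) :
    DifferentiableAt ℝ (fun Z : LieAlg n => lieLog O (g * lieExp Z * h)) Z ∧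
    (expDeriv G O (lieLog O (g * lieExp Z * h))).comp
      (fderiv ℝ (fun Z : LieAlg n => lieLog O (g * lieExp Z * h)) Z) =
      (AdL h⁻¹ : LieAlg n →L[ℝ] LieAlg n).comp (expDeriv G O Z) := by
  have := topologicalGroup_of_lieGroup (𝓡 n) ∞ (G := G)
  have h1 : DifferentiableAt ℝ (fun Z : LieAlg n => lieLog O (g * lieExp Z * h)) Z :=
    (contDiffAt_lieLog hO (contMDiffAt_translate hO g h Z) hZ).differentiableAt (by simp)
  refine ⟨h1, ?_⟩
  rw [← lderiv_lieExp_comp hO h1]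
  -- Both sides of `exp(log(g exp(W) h)) = g exp(W) h` are differentiated: the chain rule acts on
  -- the left, and in the product rule on the right the constant `g` drops out while `h` leaves
  -- `Ad_{h⁻¹}`.
  have h2 : (fun W : LieAlg n => lieExp (lieLog O (g * lieExp W * h))) =ᶠ[𝓝 Z]
      fun W => g * lieExp W * h := by
    have hc : ContinuousAt (fun W : LieAlg n => g * lieExp W * h) Z :=
      (contMDiffAt_translate hO g h Z).continuousAt
    filter_upwards [hc.eventually (hO.isOpen_image.mem_nhds hZ)] with W hW
    exact lieExp_lieLog hW
  rw [lderiv_congr h2, lderiv_mul hO (f := fun W : LieAlg n => g * lieExp W) (g := fun _ => h)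
    ?_ contMDiffAt_const, lderiv_mul_left, lderiv_const, add_zero]
  · rfl
  · exact (contMDiff_mul_left (I := 𝓡 n) (n := ∞) (a := g)).contMDiffAt.comp Z
      (contMDiff_lieExp hO).contMDiffAt

theorem expJac_mul_abs_det_translate (g h : G) {Z : LieAlg n}
    (hZ : g * lieExp Z * h ∈ expImage G O) :
    |(fderiv ℝ (fun Z : LieAlg n => lieLog O (g * lieExp Z * h)) Z).det| *
      expJac G O (lieLog O (g * lieExp Z * h)) = absDetAd n h⁻¹ * expJac G O Z := by
  have h1 := congrArg (fun A : LieAlg n →L[ℝ] LieAlg n => |A.det|)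
    (expDeriv_comp_fderiv_translate hO g h hZ).2
  simp only [ContinuousLinearMap.det, ContinuousLinearMap.toLinearMap_comp, LinearMap.det_comp,
    abs_mul] at h1
  rw [mul_comm]
  exact h1

variable [BorelSpace G]

/-- Lebesgue measure on `O`, weighted with the Jacobian of the exponential map. -/
def expVolume (G : Type*) [TopologicalSpace G] [ChartedSpace (EuclideanSpace ℝ (Fin n)) G]
    [Group G] (O : Set (LieAlg n)) : Measure (LieAlg n) :=
  (volume.restrict O).withDensity fun X => ENNReal.ofReal (expJac G O X)

instance {G : Type*} [TopologicalSpace G] [ChartedSpace (EuclideanSpace ℝ (Fin n)) G]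
    [Group G] {O : Set (LieAlg n)} : SFinite (expVolume G O) := by
  unfold expVolume; infer_instance

omit [BorelSpace G] in
theorem lintegral_expVolume (f : LieAlg n → ℝ≥0∞) (hf : Measurable f) :
    ∫⁻ X, f X ∂(expVolume G O) = ∫⁻ X in O, ENNReal.ofReal (expJac G O X) * f X := by
  unfold expVolume
  rw [lintegral_withDensity_eq_lintegral_mul _ (continuous_expJac hO).measurable.ennreal_ofReal hf]
  rfl

theorem measurable_lieExp : Measurable (lieExp : LieAlg n → G) :=
  (continuous_lieExp hO).measurable

theorem measurableSet_expImage : MeasurableSet (expImage G O) := hO.isOpen_image.measurableSet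

/-- Change of variables along `Z ↦ log(g exp(Z) h)`, whose Jacobian is given by
`expJac_mul_abs_det_translate`. A translation can leave `exp(O)`; the two indicators confine the
identity to the points that start and end there. -/
theorem lintegral_expVolume_translate (g h : G) (f : G → ℝ≥0∞) (hf : Measurable f) :
    ENNReal.ofReal (absDetAd n h⁻¹) *
      ∫⁻ X, (expImage G O).indicator f (g * lieExp X * h) ∂(expVolume G O) =
    ∫⁻ X, (expImage G O).indicator (fun _ => f (lieExp X)) (g⁻¹ * lieExp X * h⁻¹)
      ∂(expVolume G O) := by
  classical
  have := topologicalGroup_of_lieGroup (𝓡 n) ∞ (G := G)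
  have hU := measurableSet_expImage (G := G) hO
  have htr : ∀ g h : G, Measurable fun X : LieAlg n => g * lieExp X * h := fun g h =>
    ((continuous_const.mul (continuous_lieExp hO)).mul continuous_const).measurable
  have hm1 : MeasurableSet {X : LieAlg n | g⁻¹ * lieExp X * h⁻¹ ∈ expImage G O} := htr g⁻¹ h⁻¹ hU
  have hm2 : MeasurableSet {X : LieAlg n | g * lieExp X * h ∈ expImage G O} := htr g h hU
  set τ : LieAlg n → LieAlg n := fun Z => lieLog O (g * lieExp Z * h) with hτ
  set S : Set (LieAlg n) := O ∩ {Z | g * lieExp Z * h ∈ expImage G O}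
  have hS : MeasurableSet S := hO.isOpen.measurableSet.inter (htr g h hU)
  have hτS : ∀ Z ∈ S, HasFDerivWithinAt τ (fderiv ℝ τ Z) S Z := fun Z hZ =>
    (expDeriv_comp_fderiv_translate hO g h hZ.2).1.hasFDerivAt.hasFDerivWithinAt
  have hinj : Set.InjOn τ S := by
    intro Z hZ Z' hZ' he
    have h1 := congrArg (lieExp : LieAlg n → G) he
    simp only [hτ] at h1
    rw [lieExp_lieLog hZ.2, lieExp_lieLog hZ'.2] at h1
    exact hO.injOn hZ.1 hZ'.1 (mul_left_cancel (mul_right_cancel h1))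
  have himg : τ '' S = O ∩ {X | g⁻¹ * lieExp X * h⁻¹ ∈ expImage G O} := by
    ext X
    constructor
    · rintro ⟨Z, hZ, rfl⟩
      refine ⟨lieLog_mem hZ.2, ?_⟩
      simp only [Set.mem_setOf_eq, hτ]
      rw [lieExp_lieLog hZ.2]
      have : g⁻¹ * (g * lieExp Z * h) * h⁻¹ = lieExp Z := by group
      rw [this]
      exact lieExp_mem_expImage hZ.1
    · rintro ⟨hX, hX'⟩
      simp only [Set.mem_setOf_eq] at hX'
      have e : g * lieExp (lieLog O (g⁻¹ * lieExp X * h⁻¹)) * h = lieExp X := by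
        rw [lieExp_lieLog hX']; group
      refine ⟨lieLog O (g⁻¹ * lieExp X * h⁻¹), ⟨lieLog_mem hX', ?_⟩, ?_⟩
      · simp only [Set.mem_setOf_eq, e]; exact lieExp_mem_expImage hX
      · simp only [hτ, e]; exact lieLog_lieExp hO hX
  have key := lintegral_image_eq_lintegral_abs_det_fderiv_mul volume hS hτS hinj
    (fun X => ENNReal.ofReal (expJac G O X) * f (lieExp X))
  rw [himg] at key
  rw [lintegral_expVolume hO (fun X => (expImage G O).indicator f (g * lieExp X * h))
    ((hf.indicator hU).comp (htr g h)), lintegral_expVolume hO]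
  · have e1 : ∫⁻ X in O, ENNReal.ofReal (expJac G O X) *
        (expImage G O).indicator (fun _ => f (lieExp X)) (g⁻¹ * lieExp X * h⁻¹) =
        ∫⁻ X in O ∩ {X | g⁻¹ * lieExp X * h⁻¹ ∈ expImage G O},
          ENNReal.ofReal (expJac G O X) * f (lieExp X) := by
      rw [Set.inter_comm, ← Measure.restrict_restrict hm1, ← lintegral_indicator hm1]
      refine lintegral_congr fun X => ?_
      by_cases hX : g⁻¹ * lieExp X * h⁻¹ ∈ expImage G O <;> simp [Set.indicator, hX]
    have e2 : ∫⁻ X in O, ENNReal.ofReal (expJac G O X) *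
        (expImage G O).indicator f (g * lieExp X * h) =
        ∫⁻ X in S, ENNReal.ofReal (expJac G O X) * f (g * lieExp X * h) := by
      simp only [S]
      rw [Set.inter_comm, ← Measure.restrict_restrict hm2, ← lintegral_indicator hm2]
      refine lintegral_congr fun X => ?_
      by_cases hX : g * lieExp X * h ∈ expImage G O <;> simp [Set.indicator, hX]
    rw [e1, e2, key, ← lintegral_const_mul' _ _ ENNReal.ofReal_ne_top]
    refine setLIntegral_congr_fun hS fun Z hZ => ?_
    simp only [hτ]
    rw [lieExp_lieLog hZ.2, ← mul_assoc, ← mul_assoc, ← ENNReal.ofReal_mul (absDetAd_nonneg _),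
      ← ENNReal.ofReal_mul (abs_nonneg _), expJac_mul_abs_det_translate hO g h hZ.2]
  · exact Measurable.ite (htr g⁻¹ h⁻¹ hU) (hf.comp (measurable_lieExp hO)) measurable_const

end HaarCoordinates
end LieWigner
end

/-! ### Haar measure agrees with the exponential volume up to a constant. -/

noncomputable section
namespace LieWigner

section HaarDensity

variable {n : ℕ} {G : Type*} [TopologicalSpace G] [ChartedSpace (EuclideanSpace ℝ (Fin n)) G]
  [Group G] {O : Set (LieAlg n)} [MeasurableSpace G] {m : Measure G}
  [LieGroup (𝓡 n) ∞ G] [T2Space G] [BorelSpace G] [SecondCountableTopology G]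
  [m.IsHaarMeasure]

theorem locallyCompactSpace_of_charted (n : ℕ) (G : Type*) [TopologicalSpace G]
    [ChartedSpace (EuclideanSpace ℝ (Fin n)) G] : LocallyCompactSpace G :=
  Manifold.locallyCompact_of_finiteDimensional (𝓡 n)

variable (n) (m) in
include n in
omit [T2Space G] in
theorem sigmaFinite_haar : SigmaFinite m := by
  have := topologicalGroup_of_lieGroup (𝓡 n) ∞ (G := G)
  have := locallyCompactSpace_of_charted n G
  infer_instance

variable (n) (m) in
include n in
omit [T2Space G] in
theorem exists_map_mul_right (z : G) :
    ∃ c : ℝ≥0∞, Measure.map (fun x => x * z) m = c • m := by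
  have := topologicalGroup_of_lieGroup (𝓡 n) ∞ (G := G)
  have := locallyCompactSpace_of_charted n G
  refine ⟨(Measure.modularCharacterFun z : ℝ≥0∞), ?_⟩
  rw [Measure.map_right_mul_eq_modularCharacterFun_smul]
  rfl

variable (hO : IsWeaklyExponential m O)
include hO

omit [SecondCountableTopology G] [m.IsHaarMeasure] [BorelSpace G] in
/-- A small ball on which the Jacobian of `exp` is close to `1`. -/
theorem exists_ball_expJac : ∃ r > 0, Metric.closedBall 0 r ⊆ O ∧
    ∀ X ∈ Metric.closedBall (0 : LieAlg n) r, 1 / 2 ≤ expJac G O X ∧ expJac G O X ≤ 2 := by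
  have h1 : ∀ᶠ X in 𝓝 (0 : LieAlg n), X ∈ O ∧ expJac G O X ∈ Set.Icc (1 / 2 : ℝ) 2 := by
    refine Eventually.and (mem_nhds_zero hO) ?_
    refine (continuous_expJac (G := G) hO).continuousAt.eventually (Icc_mem_nhds ?_ ?_) <;>
    · rw [expJac_zero hO]; norm_num
  obtain ⟨r, hr, h⟩ := Metric.nhds_basis_closedBall.eventually_iff.1 h1
  exact ⟨r, hr, fun X hX => (h hX).1, fun X hX => (h hX).2⟩

omit [SecondCountableTopology G] [m.IsHaarMeasure] [BorelSpace G] in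
theorem isOpen_lieExp_image {S : Set (LieAlg n)} (hS : IsOpen S) (hSO : S ⊆ O) :
    IsOpen ((lieExp : LieAlg n → G) '' S) := by
  have h1 := (continuousOn_lieLog (G := G) hO).isOpen_inter_preimage hO.isOpen_image hS
  convert h1 using 1
  ext g
  constructor
  · rintro ⟨X, hX, rfl⟩
    refine ⟨lieExp_mem_expImage (hSO hX), ?_⟩
    simp only [Set.mem_preimage]
    rwa [lieLog_lieExp hO (hSO hX)]
  · rintro ⟨h, h'⟩
    exact ⟨_, h', lieExp_lieLog h⟩

omit hO [m.IsHaarMeasure] [SecondCountableTopology G] [MeasurableSpace G] [LieGroup (𝓡 n) ∞ G]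
  [T2Space G] [BorelSpace G] in
theorem expVolume_apply {S : Set (LieAlg n)} (hS : MeasurableSet S) :
    expVolume G O S = ∫⁻ X in S ∩ O, ENNReal.ofReal (expJac G O X) := by
  rw [expVolume, withDensity_apply _ hS, Measure.restrict_restrict hS]

/-- A uniqueness argument: `m` and the image of `expVolume` agree on `exp(O)` up to a constant. -/
theorem exists_haar_constant : ∃ c : ℝ≥0∞, c ≠ 0 ∧ c ≠ ⊤ ∧
    ∀ f : G → ℝ≥0∞, Measurable f → (∀ x ∉ expImage G O, f x = 0) →
      ∫⁻ x, f x ∂m = c * ∫⁻ X, f (lieExp X) ∂(expVolume G O) := by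
  have := topologicalGroup_of_lieGroup (𝓡 n) ∞ (G := G)
  have := sigmaFinite_haar n m
  obtain ⟨r, hr, hrO, hrJ⟩ := exists_ball_expJac hO
  have hbO : Metric.ball (0 : LieAlg n) r ⊆ O := Metric.ball_subset_closedBall.trans hrO
  set W : Set G := (lieExp : LieAlg n → G) '' Metric.ball 0 r with hW
  have hWo : IsOpen W := isOpen_lieExp_image hO Metric.isOpen_ball hbO
  have hWm : MeasurableSet W := hWo.measurableSet
  have hWU : W ⊆ expImage G O := Set.image_mono hbO
  have hWne : W.Nonempty := ⟨_, Set.mem_image_of_mem _ (Metric.mem_ball_self hr)⟩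
  have hW0 : m W ≠ 0 := (hWo.measure_pos m hWne).ne'
  have hWtop : m W ≠ ⊤ := by
    have h1 : W ⊆ (lieExp : LieAlg n → G) '' Metric.closedBall 0 r :=
      Set.image_mono Metric.ball_subset_closedBall
    have h2 : IsCompact ((lieExp : LieAlg n → G) '' Metric.closedBall 0 r) :=
      (isCompact_closedBall _ _).image (continuous_lieExp hO)
    exact ((measure_mono h1).trans_lt h2.measure_lt_top).ne
  have hpre : (lieExp : LieAlg n → G) ⁻¹' W ∩ O = Metric.ball 0 r := by
    ext X
    constructor
    · rintro ⟨⟨Y, hY, hYX⟩, hX⟩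
      rwa [← hO.injOn (hbO hY) hX hYX]
    · exact fun hX => ⟨Set.mem_image_of_mem _ hX, hbO hX⟩
  have hνW : expVolume G O (lieExp ⁻¹' W) =
      ∫⁻ X in Metric.ball 0 r, ENNReal.ofReal (expJac G O X) := by
    rw [expVolume_apply (measurable_lieExp hO hWm), hpre]
  have hvol0 : volume (Metric.ball (0 : LieAlg n) r) ≠ 0 := (Metric.measure_ball_pos _ _ hr).ne'
  have hν0 : expVolume G O (lieExp ⁻¹' W) ≠ 0 := by
    rw [hνW]
    refine (lt_of_lt_of_le ?_ (setLIntegral_mono' Metric.isOpen_ball.measurableSet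
      (fun X hX => ENNReal.ofReal_le_ofReal (hrJ X (Metric.ball_subset_closedBall hX)).1))).ne'
    rw [setLIntegral_const]
    exact ENNReal.mul_pos (by simp) hvol0
  have hνtop : expVolume G O (lieExp ⁻¹' W) ≠ ⊤ := by
    rw [hνW]
    refine ((setLIntegral_mono' Metric.isOpen_ball.measurableSet
      (fun X hX => ENNReal.ofReal_le_ofReal
        (hrJ X (Metric.ball_subset_closedBall hX)).2)).trans_lt ?_).ne
    rw [setLIntegral_const]
    exact ENNReal.mul_lt_top (by simp) measure_ball_lt_top
  have hWinv : W⁻¹ = W := by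
    ext g
    rw [Set.mem_inv]
    constructor
    · rintro ⟨X, hX, h⟩
      refine ⟨-X, by simpa using hX, ?_⟩
      rw [lieExp_neg, h, inv_inv]
    · rintro ⟨X, hX, rfl⟩
      exact ⟨-X, by simpa using hX, lieExp_neg X⟩
  set w : G → ℝ≥0∞ := W.indicator 1 with hw
  have hwm : Measurable w := measurable_one.indicator hWm
  have hwint : ∫⁻ y, w y ∂m = m W := lintegral_indicator_one hWm
  -- the modular function
  set c : G → ℝ≥0∞ := fun z => (∫⁻ y, w (y * z) ∂m) / m W with hc
  -- Writing the multiplier of a right translation as a quotient of integrals of `w` makes its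
  -- measurability a case of Tonelli.
  have hcm : Measurable c := by
    refine Measurable.div_const ?_ _
    exact Measurable.lintegral_prod_left' (f := fun p : G × G => w (p.1 * p.2))
      (hwm.comp measurable_mul)
  have hright : ∀ z : G, ∀ f : G → ℝ≥0∞, Measurable f →
      ∫⁻ y, f (y * z) ∂m = c z * ∫⁻ y, f y ∂m := by
    intro z f hf
    obtain ⟨a, ha⟩ := exists_map_mul_right n m z
    have h1 : ∀ f : G → ℝ≥0∞, Measurable f → ∫⁻ y, f (y * z) ∂m = a * ∫⁻ y, f y ∂m := by
      intro f hf
      rw [← lintegral_map hf (measurable_mul_const z), ha, lintegral_smul_measure]; rfl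
    have h2 : c z = a := by
      simp only [hc]
      rw [h1 w hwm, hwint, ENNReal.mul_div_cancel_right hW0 hWtop]
    rw [h1 f hf, h2]
  set C : ℝ≥0∞ := ∫⁻ X, w (lieExp X) * c (lieExp X) ∂(expVolume G O) with hC
  -- Weil's uniqueness argument: `f(exp X) w(y⁻¹ exp X)` is integrated over `X` and `y` in both
  -- orders. Integration over `y` first yields `m W`, because `W` is symmetric. Integration over `X`
  -- first, after translation by `y`, leaves `f(y exp X) w(exp X)`, whose integral over `y` is a
  -- multiple of that of `f`.
  have key : ∀ f : G → ℝ≥0∞, Measurable f → (∀ x ∉ expImage G O, f x = 0) →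
      (∫⁻ X, f (lieExp X) ∂(expVolume G O)) * m W = (∫⁻ x, f x ∂m) * C := by
    intro f hf hfU
    have hexp := measurable_lieExp (G := G) hO
    have hswap1 : ∫⁻ X, ∫⁻ y, f (lieExp X) * w (y⁻¹ * lieExp X) ∂m ∂(expVolume G O) =
        ∫⁻ y, ∫⁻ X, f (lieExp X) * w (y⁻¹ * lieExp X) ∂(expVolume G O) ∂m := by
      refine lintegral_lintegral_swap (Measurable.aemeasurable ?_)
      exact ((hf.comp hexp).comp measurable_fst).mul
        (hwm.comp (measurable_snd.inv.mul (hexp.comp measurable_fst)))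
    have hL : ∀ X : LieAlg n, ∫⁻ y, f (lieExp X) * w (y⁻¹ * lieExp X) ∂m =
        f (lieExp X) * m W := by
      intro X
      have h4 : Measurable fun y : G => w (y⁻¹ * lieExp X) :=
        hwm.comp (measurable_inv.mul_const _)
      rw [lintegral_const_mul _ h4,
        ← lintegral_mul_left_eq_self _ (lieExp X : G)]
      congr 1
      have : ∀ y : G, (lieExp X * y)⁻¹ * lieExp X = y⁻¹ := fun y => by group
      simp_rw [this]
      have h3 : (fun y : G => w y⁻¹) = W.indicator 1 := by
        conv_rhs => rw [← hWinv]
        rfl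
      rw [h3, lintegral_indicator_one hWm]
    have hR : ∀ y : G, ∫⁻ X, f (lieExp X) * w (y⁻¹ * lieExp X) ∂(expVolume G O) =
        ∫⁻ X, f (y * lieExp X) * w (lieExp X) ∂(expVolume G O) := by
      intro y
      have h1 := lintegral_expVolume_translate hO y 1 (fun x => f x * w (y⁻¹ * x))
        (hf.mul (hwm.comp (measurable_const_mul _)))
      simp only [inv_one, absDetAd_one hO, ENNReal.ofReal_one, one_mul, mul_one] at h1
      have h2 : ∀ X : LieAlg n, (expImage G O).indicator (fun x => f x * w (y⁻¹ * x))
          (y * lieExp X) = f (y * lieExp X) * w (lieExp X) := by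
        intro X
        by_cases h : y * lieExp X ∈ expImage G O
        · simp [h]
        · simp [h, hfU _ h]
      have h3 : ∀ X : LieAlg n, (expImage G O).indicator (fun _ => f (lieExp X) *
          w (y⁻¹ * lieExp X)) (y⁻¹ * lieExp X) = f (lieExp X) * w (y⁻¹ * lieExp X) := by
        intro X
        by_cases h : y⁻¹ * lieExp X ∈ expImage G O
        · simp [h]
        · have : y⁻¹ * lieExp X ∉ W := fun h' => h (hWU h')
          simp [h, hw, this]
      simp_rw [h2, h3] at h1
      exact h1.symm
    have hswap2 : ∫⁻ y, ∫⁻ X, f (y * lieExp X) * w (lieExp X) ∂(expVolume G O) ∂m =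
        ∫⁻ X, ∫⁻ y, f (y * lieExp X) * w (lieExp X) ∂m ∂(expVolume G O) := by
      refine lintegral_lintegral_swap (Measurable.aemeasurable ?_)
      exact (hf.comp (measurable_fst.mul (hexp.comp measurable_snd))).mul
        ((hwm.comp hexp).comp measurable_snd)
    have hR2 : ∀ X : LieAlg n, ∫⁻ y, f (y * lieExp X) * w (lieExp X) ∂m =
        (∫⁻ x, f x ∂m) * (w (lieExp X) * c (lieExp X)) := by
      intro X
      have h4 : Measurable fun y : G => f (y * lieExp X) := hf.comp (measurable_mul_const _)
      rw [lintegral_mul_const _ h4, hright _ f hf]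
      ring
    simp_rw [hL, hR] at hswap1
    rw [hswap2] at hswap1
    simp_rw [hR2] at hswap1
    have h5 : Measurable fun X => f (lieExp X) := hf.comp hexp
    have h6 : Measurable fun X => w (lieExp X) * c (lieExp X) :=
      (hwm.comp hexp).mul (hcm.comp hexp)
    rw [lintegral_mul_const _ h5, lintegral_const_mul _ h6] at hswap1
    exact hswap1
  have hνw : ∫⁻ X, w (lieExp X) ∂(expVolume G O) = expVolume G O (lieExp ⁻¹' W) := by
    rw [← lintegral_indicator_one (measurable_lieExp hO hWm)]
    rfl
  -- The constant is identified by taking `f = w` in `key`.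
  have hCν : C = expVolume G O (lieExp ⁻¹' W) := by
    have h1 := key w hwm (fun x hx => by
      have : x ∉ W := fun h => hx (hWU h)
      simp [hw, this])
    rw [hνw, hwint, mul_comm] at h1
    exact ((ENNReal.mul_right_inj hW0 hWtop).1 h1).symm
  refine ⟨m W / expVolume G O (lieExp ⁻¹' W), ENNReal.div_ne_zero.2 ⟨hW0, hνtop⟩,
    ENNReal.div_ne_top hWtop hν0, fun f hf hfU => ?_⟩
  have h1 := key f hf hfU
  rw [hCν] at h1
  rw [ENNReal.mul_comm_div, ← mul_div_assoc, ENNReal.eq_div_iff hν0 hνtop, mul_comm, ← h1,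
    mul_comm]

end HaarDensity
end LieWigner
end

/-! ### The density at the identity and the modular function. -/

noncomputable section
namespace LieWigner

section Density

variable {n : ℕ} {G : Type*} [TopologicalSpace G] [ChartedSpace (EuclideanSpace ℝ (Fin n)) G]
  [Group G] {O : Set (LieAlg n)} [MeasurableSpace G] {m : Measure G}
  [LieGroup (𝓡 n) ∞ G] [T2Space G] [BorelSpace G]
  (hO : IsWeaklyExponential m O)
include hO

theorem tendsto_lintegral_expJac_div :
    Tendsto (fun r : ℝ => (∫⁻ X in Metric.ball 0 r, ENNReal.ofReal (expJac G O X)) /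
      volume (Metric.ball (0 : LieAlg n) r)) (𝓝[>] 0) (𝓝 1) := by
  have hcont : Continuous fun X => ENNReal.ofReal (expJac G O X) :=
    ENNReal.continuous_ofReal.comp (continuous_expJac hO)
  have h0 : ENNReal.ofReal (expJac G O 0) = 1 := by rw [expJac_zero hO, ENNReal.ofReal_one]
  have hball : ∀ s ∈ 𝓝 (0 : LieAlg n), ∀ᶠ r in 𝓝[>] (0 : ℝ), 0 < r ∧ Metric.ball 0 r ⊆ s := by
    intro s hs
    obtain ⟨ε, hε, h⟩ := Metric.mem_nhds_iff.1 hs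
    filter_upwards [Ioo_mem_nhdsGT hε] with r hr
    exact ⟨hr.1, (Metric.ball_subset_ball hr.2.le).trans h⟩
  refine tendsto_order.2 ⟨fun a ha => ?_, fun a ha => ?_⟩
  · obtain ⟨b, hab, hb⟩ := exists_between ha
    have h1 : {X : LieAlg n | b < ENNReal.ofReal (expJac G O X)} ∈ 𝓝 0 :=
      hcont.continuousAt.eventually (lt_mem_nhds (by simpa only [h0] using hb))
    filter_upwards [hball _ h1] with r hr
    refine hab.trans_le ?_
    rw [ENNReal.le_div_iff_mul_le (Or.inl (Metric.measure_ball_pos _ _ hr.1).ne')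
      (Or.inl measure_ball_lt_top.ne), ← setLIntegral_const]
    exact setLIntegral_mono' Metric.isOpen_ball.measurableSet fun X hX => (hr.2 hX).le
  · obtain ⟨b, hb, hab⟩ := exists_between ha
    have h1 : {X : LieAlg n | ENNReal.ofReal (expJac G O X) < b} ∈ 𝓝 0 :=
      hcont.continuousAt.eventually (gt_mem_nhds (by simpa only [h0] using hb))
    filter_upwards [hball _ h1] with r hr
    refine lt_of_le_of_lt ?_ hab
    rw [ENNReal.div_le_iff (Metric.measure_ball_pos _ _ hr.1).ne' measure_ball_lt_top.ne,
      ← setLIntegral_const]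
    exact setLIntegral_mono' Metric.isOpen_ball.measurableSet fun X hX => (hr.2 hX).le

variable [SecondCountableTopology G] [m.IsHaarMeasure]

/-- The limit defining `densityAtOne` exists and is the constant of `exists_haar_constant`: the Haar
measure of `exp` of a small ball is that constant times the integral of `expJac`, which is
continuous with value `1` at `0`. -/
theorem densityAtOne_spec : densityAtOne (n := n) m ≠ 0 ∧ densityAtOne (n := n) m ≠ ⊤ ∧
    ∀ f : G → ℝ≥0∞, Measurable f → (∀ x ∉ expImage G O, f x = 0) →
      ∫⁻ x, f x ∂m = densityAtOne (n := n) m * ∫⁻ X, f (lieExp X) ∂(expVolume G O) := by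
  obtain ⟨c, hc0, hct, hc⟩ := exists_haar_constant hO
  have h : densityAtOne (n := n) m = c := by
    refine Tendsto.limUnder_eq ?_
    have h1 := ENNReal.Tendsto.const_mul (tendsto_lintegral_expJac_div hO) (Or.inr hct)
    rw [mul_one] at h1
    refine h1.congr' ?_
    obtain ⟨ε, hε, hεO⟩ := Metric.mem_nhds_iff.1 (mem_nhds_zero hO)
    filter_upwards [Ioo_mem_nhdsGT hε] with r hr
    have hrO : Metric.ball (0 : LieAlg n) r ⊆ O := (Metric.ball_subset_ball hr.2.le).trans hεO
    have hW := isOpen_lieExp_image (G := G) hO Metric.isOpen_ball hrO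
    have hpre : (lieExp : LieAlg n → G) ⁻¹' (lieExp '' Metric.ball (0 : LieAlg n) r) ∩ O =
        Metric.ball 0 r := by
      ext X
      constructor
      · rintro ⟨⟨Y, hY, hYX⟩, hX⟩
        rwa [← hO.injOn (hrO hY) hX hYX]
      · exact fun hX => ⟨Set.mem_image_of_mem _ hX, hrO hX⟩
    rw [← mul_div_assoc]
    congr 1
    rw [← lintegral_indicator_one hW.measurableSet, hc _ (measurable_one.indicator hW.measurableSet)]
    · congr 1
      have h2 := lintegral_indicator_one (μ := expVolume G O)
        (measurable_lieExp (G := G) hO hW.measurableSet)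
      rw [expVolume_apply (measurable_lieExp (G := G) hO hW.measurableSet), hpre] at h2
      exact h2.symm
    · intro x hx
      have : x ∉ (lieExp : LieAlg n → G) '' Metric.ball (0 : LieAlg n) r :=
        fun h => hx (Set.image_mono hrO h)
      simp [this]
  rw [h]
  exact ⟨hc0, hct, hc⟩

theorem densityAtOne_ne_zero : densityAtOne (n := n) m ≠ 0 := (densityAtOne_spec hO).1

theorem densityAtOne_ne_top : densityAtOne (n := n) m ≠ ⊤ := (densityAtOne_spec hO).2.1

theorem sigmaFinite_measX : SigmaFinite (measX (n := n) m) := by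
  have : IsFiniteMeasureOnCompacts (measX (n := n) m) := by
    unfold measX
    exact IsFiniteMeasureOnCompacts.smul _ (densityAtOne_ne_top hO)
  infer_instance

omit [BorelSpace G] [SecondCountableTopology G] [m.IsHaarMeasure] in
theorem ae_mem_expImage : ∀ᵐ x ∂m, x ∈ expImage G O := by
  rw [ae_iff]; exact hO.null_compl

/-- Haar measure in exponential coordinates. -/
theorem lintegral_haar {f : G → ℝ≥0∞} (hf : Measurable f) :
    ∫⁻ x, f x ∂m =
      ∫⁻ X in O, ENNReal.ofReal (expJac G O X) * f (lieExp X) ∂(measX m) := by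
  have hU := measurableSet_expImage (G := G) hO
  have h1 : ∫⁻ x, f x ∂m = ∫⁻ x, (expImage G O).indicator f x ∂m := by
    refine lintegral_congr_ae ?_
    filter_upwards [ae_mem_expImage hO] with x hx
    simp [hx]
  rw [h1, (densityAtOne_spec hO).2.2 _ (hf.indicator hU) (fun x hx => by simp [hx]),
    lintegral_expVolume hO (fun X => (expImage G O).indicator f (lieExp X))
      ((hf.indicator hU).comp (measurable_lieExp hO)),
    measX, Measure.restrict_smul, lintegral_smul_measure]
  congr 1
  refine setLIntegral_congr_fun hO.isOpen.measurableSet fun X hX => ?_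
  simp [lieExp_mem_expImage hX]

/-- Right translation multiplies `m` by some constant, so one test set suffices. By left invariance
the right translate by `g` can be replaced with the conjugate by `g`, and conjugation is evaluated
in exponential coordinates near the identity. -/
theorem map_mul_right_eq (g : G) :
    Measure.map (fun x => x * g) m = ENNReal.ofReal (absDetAd n g) • m := by
  have := topologicalGroup_of_lieGroup (𝓡 n) ∞ (G := G)
  have hU := measurableSet_expImage (G := G) hO
  obtain ⟨c, hc⟩ := exists_map_mul_right n m g
  have hright : ∀ f : G → ℝ≥0∞, Measurable f → ∫⁻ y, f (y * g) ∂m = c * ∫⁻ y, f y ∂m := by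
    intro f hf
    rw [← lintegral_map hf (measurable_mul_const g), hc, lintegral_smul_measure]; rfl
  -- a small open neighbourhood of the identity
  have hconj : Continuous fun x : G => g * x * g⁻¹ := by fun_prop
  obtain ⟨K, hKc, hK⟩ : ∃ K : Set G, IsCompact K ∧ K ∈ 𝓝 (1 : G) := by
    have := locallyCompactSpace_of_charted n G
    exact exists_compact_mem_nhds 1
  -- Both `E` and `g E g⁻¹` lie in `exp(O)`, so no indicator survives in the translation formula;
  -- the compact `K` keeps the measure of `E` finite.
  set E : Set G := interior K ∩ (expImage G O ∩ (fun x => g * x * g⁻¹) ⁻¹' expImage G O) with hE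
  have hEo : IsOpen E := isOpen_interior.inter
    (hO.isOpen_image.inter (hO.isOpen_image.preimage hconj))
  have hEne : (1 : G) ∈ E := by
    refine ⟨mem_interior_iff_mem_nhds.2 hK, one_mem_expImage hO, ?_⟩
    simpa using one_mem_expImage hO
  have hEm := hEo.measurableSet
  have hE0 : m E ≠ 0 := (hEo.measure_pos m ⟨_, hEne⟩).ne'
  have hEtop : m E ≠ ⊤ :=
    ((measure_mono (Set.inter_subset_left.trans interior_subset)).trans_lt hKc.measure_lt_top).ne
  set e : G → ℝ≥0∞ := E.indicator 1
  have hem : Measurable e := measurable_one.indicator hEm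
  have hesupp : ∀ x, x ∉ expImage G O → e x = 0 := by
    intro x hx
    have : x ∉ E := fun h => hx h.2.1
    simp [e, this]
  have hesupp' : ∀ x, g * x * g⁻¹ ∉ expImage G O → e x = 0 := by
    intro x hx
    have : x ∉ E := fun h => hx h.2.2
    simp [e, this]
  have hcm : Measurable fun x : G => g⁻¹ * x * g := by fun_prop
  have h1 := lintegral_expVolume_translate hO g⁻¹ g e hem
  have h2 : ∀ X : LieAlg n, (expImage G O).indicator e (g⁻¹ * lieExp X * g) =
      e (g⁻¹ * lieExp X * g) := by
    intro X
    by_cases h : g⁻¹ * lieExp X * g ∈ expImage G O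
    · simp [h]
    · simp [h, hesupp _ h]
  have h3 : ∀ X : LieAlg n, (expImage G O).indicator (fun _ => e (lieExp X))
      (g⁻¹⁻¹ * lieExp X * g⁻¹) = e (lieExp X) := by
    intro X
    rw [inv_inv]
    by_cases h : g * lieExp X * g⁻¹ ∈ expImage G O
    · simp [h]
    · simp [h, hesupp' _ h]
  simp_rw [h2, h3] at h1
  have spec := (densityAtOne_spec hO).2.2
  have h4 : ∫⁻ x, e (g⁻¹ * x * g) ∂m =
      densityAtOne (n := n) m * ∫⁻ X, e (g⁻¹ * lieExp X * g) ∂(expVolume G O) := by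
    refine spec (fun x => e (g⁻¹ * x * g)) (hem.comp hcm) fun x hx => hesupp' _ ?_
    have : g * (g⁻¹ * x * g) * g⁻¹ = x := by group
    rwa [this]
  have h5 := spec e hem hesupp
  have h6 : ENNReal.ofReal (absDetAd n g⁻¹) * (c * m E) = m E := by
    have h7 : ∫⁻ x, e (g⁻¹ * x * g) ∂m = c * m E := by
      rw [← lintegral_indicator_one hEm, ← hright e hem,
        ← lintegral_mul_left_eq_self (fun x => e (x * g)) g⁻¹]
    rw [← h7, h4, ← lintegral_indicator_one hEm, h5, ← h1]
    ring
  have h8 : ENNReal.ofReal (absDetAd n g⁻¹) * c = 1 := by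
    rw [← mul_assoc] at h6
    exact (ENNReal.mul_left_inj hE0 hEtop).1 (by rw [h6, one_mul])
  have h9 : ENNReal.ofReal (absDetAd n g) * ENNReal.ofReal (absDetAd n g⁻¹) = 1 := by
    rw [← ENNReal.ofReal_mul (absDetAd_nonneg _), mul_comm, absDetAd_inv_mul hO, ENNReal.ofReal_one]
  rw [hc]
  congr 1
  calc c = ENNReal.ofReal (absDetAd n g) * ENNReal.ofReal (absDetAd n g⁻¹) * c := by
        rw [h9, one_mul]
    _ = _ := by rw [mul_assoc, h8, mul_one]

theorem lintegral_mul_right {f : G → ℝ≥0∞} (hf : Measurable f) (g : G) :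
    ∫⁻ x, f (x * g) ∂m = ENNReal.ofReal (absDetAd n g) * ∫⁻ x, f x ∂m := by
  have := topologicalGroup_of_lieGroup (𝓡 n) ∞ (G := G)
  rw [← lintegral_map hf (measurable_mul_const g), map_mul_right_eq hO, lintegral_smul_measure]
  rfl

end Density

/-! ### Positivity, continuity and evenness of the weight `F`. -/

section Weight

variable {n : ℕ} {G : Type*} [TopologicalSpace G] [ChartedSpace (EuclideanSpace ℝ (Fin n)) G]
  [Group G] {O : Set (LieAlg n)} [MeasurableSpace G] {m : Measure G}
  [LieGroup (𝓡 n) ∞ G] [T2Space G] (hO : IsWeaklyExponential m O)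
include hO

/-- The translation formula from `0` to `X` reads `|det| · expJac G O X = 1`, so the second factor
cannot vanish. -/
theorem expJac_pos {X : LieAlg n} (hX : X ∈ O) : 0 < expJac G O X := by
  refine (expJac_nonneg X).lt_of_ne fun h => ?_
  have e1 : (lieExp X * lieExp (0 : LieAlg n) * 1 : G) = lieExp X := by
    rw [lieExp_zero, mul_one, mul_one]
  have h1 := expJac_mul_abs_det_translate hO (lieExp X : G) 1 (Z := 0) (by
    rw [e1]; exact lieExp_mem_expImage hX)
  rw [e1, lieLog_lieExp hO hX, ← h, mul_zero, inv_one, absDetAd_one hO, expJac_zero hO] at h1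
  norm_num at h1

theorem weightF_eq (X : LieAlg n) :
    weightF G X = Real.sqrt (expJac G O X * absDetAd n (lieExp ((1 / 2 : ℝ) • X) : G)) := by
  rw [weightF, ← expDeriv_eq_phiSeries hO, abs_mul]; rfl

theorem weightF_sq (X : LieAlg n) :
    weightF G X * weightF G X = expJac G O X * absDetAd n (lieExp ((1 / 2 : ℝ) • X) : G) := by
  rw [weightF_eq hO]
  exact Real.mul_self_sqrt (mul_nonneg (expJac_nonneg X) (absDetAd_nonneg _))

omit [T2Space G] [MeasurableSpace G] hO in
theorem weightF_nonneg (X : LieAlg n) : 0 ≤ weightF G X := Real.sqrt_nonneg _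

theorem weightF_pos {X : LieAlg n} (hX : X ∈ O) : 0 < weightF G X := by
  rw [weightF_eq hO]
  exact Real.sqrt_pos.2 (mul_pos (expJac_pos hO hX) (absDetAd_pos hO _))

theorem continuous_weightF : Continuous (weightF G : LieAlg n → ℝ) := by
  have : (weightF G : LieAlg n → ℝ) = fun X =>
    Real.sqrt (expJac G O X * absDetAd n (lieExp ((1 / 2 : ℝ) • X) : G)) :=
    funext (weightF_eq hO)
  rw [this]
  exact ((continuous_expJac hO).mul ((continuous_absDetAd_lieExp hO).comp
    (continuous_const_smul _))).sqrt

theorem weightF_zero : weightF G (0 : LieAlg n) = 1 := by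
  rw [weightF_eq hO, smul_zero, lieExp_zero, absDetAd_one hO, expJac_zero hO]; simp

/-- The Jacobian at `-X` exceeds that at `X` by the factor `|det Ad_{exp X}| = |det
Ad_{exp(X/2)}|²`, and passing to `-X` inverts `|det Ad_{exp(X/2)}|`. The symmetric placing of `X/2`
in `F` is made for this. -/
theorem weightF_neg (X : LieAlg n) : weightF G (-X) = weightF G X := by
  rw [weightF_eq hO, weightF_eq hO, smul_neg, lieExp_neg, absDetAd_inv hO,
    ← absDetAd_mul_expJac hO, ← absDetAd_half_sq hO]
  congr 1
  have := (absDetAd_pos hO (lieExp ((1 / 2 : ℝ) • X) : G)).ne'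
  field_simp

end Weight

end LieWigner
end

/-! ### The critical set of `exp` is null, and `F` grows at most exponentially. -/

noncomputable section
namespace LieWigner

section Analytic

variable {n : ℕ}

theorem analyticAt_phiSeries (A : LieAlg n →L[ℝ] LieAlg n) : AnalyticAt ℝ phiSeries A := by
  set c : ℕ → ℝ := fun k => (-1 : ℝ) ^ k / ((k + 1).factorial : ℝ) with hc
  have hr : (FormalMultilinearSeries.ofScalars (LieAlg n →L[ℝ] LieAlg n) c).radius = ⊤ := by
    refine FormalMultilinearSeries.ofScalars_radius_eq_top_of_tendsto _ _ ?_ ?_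
    · refine Eventually.of_forall fun k => ?_
      simp only [hc]; positivity
    · have h1 : ∀ k : ℕ, ‖c k.succ‖ / ‖c k‖ = (((k + 1 : ℕ) : ℝ) + 1)⁻¹ := by
        intro k
        simp only [hc, norm_div, norm_pow, norm_neg, norm_one, one_pow, Real.norm_natCast]
        rw [Nat.factorial_succ (k.succ)]
        have : ((k + 1).factorial : ℝ) ≠ 0 := by positivity
        push_cast
        field_simp
      simp_rw [h1]
      have h2 := (tendsto_one_div_add_atTop_nhds_zero_nat (𝕜 := ℝ)).comp (tendsto_add_atTop_nat 1)
      simpa [Function.comp_def] using h2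
  have h2 : phiSeries = (FormalMultilinearSeries.ofScalars (LieAlg n →L[ℝ] LieAlg n) c).sum := by
    ext1 B
    exact (FormalMultilinearSeries.ofScalars_sum_eq c B).symm
  rw [h2]
  have h3 := (FormalMultilinearSeries.ofScalars (LieAlg n →L[ℝ] LieAlg n) c).hasFPowerSeriesOnBall
    (by rw [hr]; exact ENNReal.zero_lt_top)
  refine h3.analyticAt_of_mem ?_
  rw [hr]; simp

theorem analyticAt_det {B : ℝ → (LieAlg n →L[ℝ] LieAlg n)} {t : ℝ} (hB : AnalyticAt ℝ B t) :
    AnalyticAt ℝ (fun t => (B t).det) t := by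
  set b := (EuclideanSpace.basisFun (Fin n) ℝ).toBasis
  have h1 : (fun t => (B t).det) = fun t => ∑ σ : Equiv.Perm (Fin n),
      ((Equiv.Perm.sign σ : ℤ) : ℝ) * ∏ i, (B t (b i)) (σ i) := by
    ext1 t
    rw [ContinuousLinearMap.det, ← LinearMap.det_toMatrix b, Matrix.det_apply']
    refine Finset.sum_congr rfl fun σ _ => ?_
    congr 1
    refine Finset.prod_congr rfl fun i _ => ?_
    rw [LinearMap.toMatrix_apply]
    simp [b]
  rw [h1]
  refine Finset.analyticAt_fun_sum _ fun σ _ => analyticAt_const.mul ?_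
  refine Finset.analyticAt_fun_prod _ fun i _ => ?_
  exact (((EuclideanSpace.proj (σ i) : EuclideanSpace ℝ (Fin n) →L[ℝ] ℝ).comp
    (ContinuousLinearMap.apply ℝ (LieAlg n) (b i))).analyticAt _).comp hB

/-- The determinant is analytic in `t` and equals `1` at `t = 0`, so its zeros are isolated. -/
theorem volume_zeros_det_phiSeries (A : LieAlg n →L[ℝ] LieAlg n) :
    volume {t : ℝ | (phiSeries (t • A)).det = 0} = 0 := by
  have h1 : AnalyticOnNhd ℝ (fun t : ℝ => (phiSeries (t • A)).det) Set.univ := by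
    intro t _
    refine analyticAt_det ?_
    have h2 : AnalyticAt ℝ (fun t : ℝ => t • A) t := analyticAt_id.smul analyticAt_const
    exact AnalyticAt.comp' (f := fun t : ℝ => t • A) (g := phiSeries) (analyticAt_phiSeries (t • A)) h2
  have h0 : (phiSeries ((0 : ℝ) • A)).det = 1 := by
    have : phiSeries ((0 : ℝ) • A) = ContinuousLinearMap.id ℝ (LieAlg n) := by
      rw [phiSeries, tsum_eq_single 0]
      · rw [pow_zero]
        norm_num
        rfl
      · intro k hk
        rw [zero_smul ℝ A, zero_pow hk]
        exact smul_zero (M := ℝ) (A := LieAlg n →L[ℝ] LieAlg n) _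
    rw [this, ContinuousLinearMap.det]; simp
  refine measure_null_of_locally_null _ fun t _ => ?_
  rcases (h1 t (Set.mem_univ t)).eventually_eq_zero_or_eventually_ne_zero with h | h
  · exfalso
    have := h1.eqOn_zero_of_preconnected_of_eventuallyEq_zero isPreconnected_univ
      (Set.mem_univ t) h (Set.mem_univ 0)
    simp only [Pi.zero_apply] at this
    rw [h0] at this
    exact one_ne_zero this
  · rw [eventually_nhdsWithin_iff] at h
    refine ⟨{s | s = t ∨ (phiSeries (s • A)).det ≠ 0} ∩ {s | (phiSeries (s • A)).det = 0},
      ?_, ?_⟩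
    · refine inter_mem (mem_nhdsWithin_of_mem_nhds ?_) self_mem_nhdsWithin
      filter_upwards [h] with s hs
      by_cases hst : s = t
      · exact Or.inl hst
      · exact Or.inr (hs hst)
    · refine measure_mono_null (t := {t}) ?_ (measure_singleton t)
      rintro s ⟨hs | hs, hs'⟩
      · exact hs
      · exact absurd hs' hs

/-- A closed set that meets every ray in a null set is a null set. -/
theorem volume_eq_zero_of_rays {Z : Set (LieAlg n)} (hZ : MeasurableSet Z)
    (h : ∀ X : LieAlg n, volume {t : ℝ | t • X ∈ Z} = 0) : volume Z = 0 := by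
  have hm : MeasurableSet {p : ℝ × LieAlg n | p.1 • p.2 ∈ Z} :=
    measurable_smul hZ
  -- Tonelli for `{(t, X) | t • X ∈ Z}`: null sections in `t` force null sections in `X` for almost
  -- every `t`, and a single `t ≠ 0` suffices because dilations scale the volume.
  have h1 : (volume : Measure ℝ).prod (volume : Measure (LieAlg n))
      {p : ℝ × LieAlg n | p.1 • p.2 ∈ Z} = 0 := by
    rw [Measure.prod_apply_symm hm]
    simp_rw [Set.preimage_setOf_eq, h]
    simp
  rw [Measure.prod_apply hm, lintegral_eq_zero_iff (measurable_measure_prodMk_left hm)] at h1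
  have h2 : ∀ᵐ t : ℝ, t ≠ 0 := Measure.ae_ne volume 0
  obtain ⟨t, ht, ht0⟩ := (h1.and h2).exists
  have h3 : volume ((t • ·) ⁻¹' Z) = 0 := ht
  rw [Measure.addHaar_preimage_smul _ ht0] at h3
  refine (mul_eq_zero.1 h3).resolve_left ?_
  simp only [ne_eq, ENNReal.ofReal_eq_zero, not_le]
  positivity

/-- The image of the unit ball lies in the ball of radius `‖A‖`; the volumes are compared. -/
theorem abs_det_le (A : LieAlg n →L[ℝ] LieAlg n) : |A.det| ≤ ‖A‖ ^ n := by
  have h1 := Measure.addHaar_image_continuousLinearMap volume A (Metric.closedBall (0 : LieAlg n) 1)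
  have h2 : A '' Metric.closedBall (0 : LieAlg n) 1 ⊆ Metric.closedBall 0 ‖A‖ := by
    rintro _ ⟨X, hX, rfl⟩
    rw [mem_closedBall_zero_iff] at hX ⊢
    exact (A.le_opNorm X).trans (mul_le_of_le_one_right (norm_nonneg _) hX)
  have h3 := measure_mono (μ := volume) h2
  rw [h1, Measure.addHaar_closedBall' _ _ (norm_nonneg _), finrank_euclideanSpace_fin] at h3
  have h4 := (ENNReal.mul_le_mul_iff_left (Metric.measure_closedBall_pos volume 0 one_pos).ne'
    measure_closedBall_lt_top.ne).1 h3
  exact (ENNReal.ofReal_le_ofReal_iff (by positivity)).1 h4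

theorem norm_phiSeries_le (A : LieAlg n →L[ℝ] LieAlg n) : ‖phiSeries A‖ ≤ Real.exp ‖A‖ := by
  rw [phiSeries, Real.exp_eq_exp_ℝ, NormedSpace.exp_eq_tsum_div]
  refine tsum_of_norm_bounded (Real.summable_pow_div_factorial ‖A‖).hasSum fun k => ?_
  rw [norm_smul, norm_div, norm_pow, norm_neg, norm_one, one_pow, Real.norm_natCast, div_mul_eq_mul_div,
    one_mul]
  have h1 : ‖A ^ k‖ ≤ ‖A‖ ^ k := by
    rcases k with _ | k
    · rw [pow_zero, pow_zero]; exact ContinuousLinearMap.norm_id_le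
    · exact norm_pow_le' _ k.succ_pos
  gcongr
  omega

theorem norm_exp_le_exp_norm (A : LieAlg n →L[ℝ] LieAlg n) :
    ‖NormedSpace.exp A‖ ≤ Real.exp ‖A‖ := by
  rw [NormedSpace.exp_eq_tsum ℝ, Real.exp_eq_exp_ℝ, NormedSpace.exp_eq_tsum_div]
  refine tsum_of_norm_bounded (Real.summable_pow_div_factorial ‖A‖).hasSum fun k => ?_
  rw [norm_smul, norm_inv, Real.norm_natCast, inv_mul_eq_div]
  have h1 : ‖A ^ k‖ ≤ ‖A‖ ^ k := by
    rcases k with _ | k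
    · rw [pow_zero, pow_zero]; exact ContinuousLinearMap.norm_id_le
    · exact norm_pow_le' _ k.succ_pos
  gcongr

variable {G : Type*} [TopologicalSpace G] [ChartedSpace (EuclideanSpace ℝ (Fin n)) G]
  [Group G] {O : Set (LieAlg n)} [MeasurableSpace G] {m : Measure G}
  (hO : IsWeaklyExponential m O) [LieGroup (𝓡 n) ∞ G] [T2Space G]
include hO

theorem adL_smul (t : ℝ) (X : LieAlg n) : adL G (t • X) = t • adL G X := by
  rw [adL_eq hO, adL_eq hO, map_smul, smul_comm]

theorem exists_norm_adL_le : ∃ C : ℝ, 0 ≤ C ∧ ∀ X : LieAlg n, ‖adL G X‖ ≤ C * ‖X‖ := by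
  refine ⟨2 * ‖fderiv ℝ (expDeriv G O) 0‖, by positivity, fun X => ?_⟩
  rw [adL_eq hO, norm_smul, norm_neg, Real.norm_ofNat, mul_assoc]
  exact mul_le_mul_of_nonneg_left (ContinuousLinearMap.le_opNorm _ _) two_pos.le

theorem AdL_lieExp_eq_exp (X : LieAlg n) :
    (AdL (lieExp X : G) : LieAlg n →L[ℝ] LieAlg n) = NormedSpace.exp (adL G X) := by
  have h := eq_exp_smul_of_hasDerivAt (𝔸 := LieAlg n →L[ℝ] LieAlg n) (A := adL G X)
    (E := fun s : ℝ => (AdL (lieExp (s • X) : G) : LieAlg n →L[ℝ] LieAlg n))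
    (fun t => hasDerivAt_AdL_smul hO X t)
    (by simp only [zero_smul, lieExp_zero]; exact AdL_one hO) 1
  rw [one_smul ℝ X] at h
  exact h.trans (congrArg NormedSpace.exp (one_smul ℝ (adL G X)))

/-- Both `φ(ad X)` and `Ad_{exp X} = exp(ad X)` have norm at most `exp ‖ad X‖`. Exponential growth
is what a Gaussian can absorb when `O` is unbounded. -/
theorem exists_exp_bound : ∃ C : ℝ, 0 ≤ C ∧ ∀ X : LieAlg n,
    weightF G X ≤ Real.exp (C * ‖X‖) := by
  obtain ⟨C, hC, h⟩ := exists_norm_adL_le (G := G) hO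
  have h1 : ∀ X : LieAlg n, expJac G O X ≤ Real.exp (n * (C * ‖X‖)) := by
    intro X
    rw [expJac, expDeriv_eq_phiSeries hO]
    refine (abs_det_le _).trans ?_
    rw [Real.exp_nat_mul]
    exact pow_le_pow_left₀ (norm_nonneg _)
      ((norm_phiSeries_le _).trans (Real.exp_le_exp.2 (h X))) _
  have h2 : ∀ X : LieAlg n, absDetAd n (lieExp X : G) ≤ Real.exp (n * (C * ‖X‖)) := by
    intro X
    rw [absDetAd, AdL_lieExp_eq_exp hO]
    refine (abs_det_le _).trans ?_
    rw [Real.exp_nat_mul]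
    exact pow_le_pow_left₀ (norm_nonneg _)
      ((norm_exp_le_exp_norm _).trans (Real.exp_le_exp.2 (h X))) _
  refine ⟨n * C, by positivity, fun X => ?_⟩
  refine abs_le_of_sq_le_sq' ?_ (Real.exp_pos _).le |>.2
  rw [sq, weightF_sq hO, sq]
  refine mul_le_mul ((h1 X).trans_eq (by ring_nf)) ((h2 _).trans ?_) (absDetAd_nonneg _)
    (Real.exp_pos _).le
  refine Real.exp_le_exp.2 ?_
  rw [norm_smul, mul_assoc]
  have : ‖(1 / 2 : ℝ)‖ ≤ 1 := by norm_num
  gcongr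
  exact mul_le_of_le_one_left (norm_nonneg _) this

theorem volume_expJac_eq_zero : volume {X : LieAlg n | expJac G O X = 0} = 0 := by
  refine volume_eq_zero_of_rays
    ((continuous_expJac hO).measurable (measurableSet_singleton 0)) fun X => ?_
  have h1 := volume_zeros_det_phiSeries (adL G X)
  refine measure_mono_null (fun t ht => ?_) h1
  simp only [Set.mem_setOf_eq, expJac, abs_eq_zero] at ht
  rw [expDeriv_eq_phiSeries hO, adL_smul hO] at ht
  exact ht

end Analytic
end LieWigner
end

/-! ### The boundary of `O` is a null set. -/

noncomputable section
namespace LieWigner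

section Boundary

variable {n : ℕ} {G : Type*} [TopologicalSpace G] [ChartedSpace (EuclideanSpace ℝ (Fin n)) G]
  [Group G] {O : Set (LieAlg n)} [MeasurableSpace G] {m : Measure G}
  (hO : IsWeaklyExponential m O) [LieGroup (𝓡 n) ∞ G] [T2Space G]
include hO

/-- Otherwise `log` would be continuous at `exp X`. Points `Y` of `O` tending to `X` satisfy
`log(exp Y) = Y`, so the limit `X` would equal `log(exp X)`, an element of `O`. -/
theorem lieExp_notMem_expImage_of_mem_closure {X : LieAlg n} (hX : X ∈ closure O) (hXO : X ∉ O) :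
    (lieExp X : G) ∉ expImage G O := by
  intro hU
  have hne : (𝓝[O] X).NeBot := mem_closure_iff_nhdsWithin_neBot.1 hX
  have h1 : Tendsto (fun Y : LieAlg n => lieLog O (lieExp Y : G)) (𝓝[O] X)
      (𝓝 (lieLog O (lieExp X : G))) := by
    have h2 : ContinuousAt (lieLog O) (lieExp X : G) :=
      (continuousOn_lieLog hO).continuousAt (hO.isOpen_image.mem_nhds hU)
    exact (h2.tendsto.comp ((continuous_lieExp hO).tendsto X)).mono_left nhdsWithin_le_nhds
  have h2 : Tendsto (fun Y : LieAlg n => Y) (𝓝[O] X) (𝓝 (lieLog O (lieExp X : G))) := by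
    refine h1.congr' ?_
    filter_upwards [self_mem_nhdsWithin] with Y hY
    exact lieLog_lieExp hO hY
  have h3 : X = lieLog O (lieExp X : G) :=
    tendsto_nhds_unique (tendsto_id.mono_left nhdsWithin_le_nhds) h2
  exact hXO (h3 ▸ lieLog_mem hU)

variable [BorelSpace G] [SecondCountableTopology G] [m.IsHaarMeasure]

theorem volume_lieExp_mul_notMem (g : G) :
    volume {Y : LieAlg n | Y ∈ O ∧ g * lieExp Y ∉ expImage G O} = 0 := by
  haveI := topologicalGroup_of_lieGroup (𝓡 n) ∞ (G := G)
  have hU := measurableSet_expImage (G := G) hO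
  have h1 : ∫⁻ x, (expImage G O)ᶜ.indicator 1 (g * x) ∂m = 0 := by
    rw [lintegral_mul_left_eq_self, lintegral_indicator_one hU.compl]
    exact hO.null_compl
  have hm : Measurable fun x : G => (expImage G O)ᶜ.indicator (1 : G → ℝ≥0∞) (g * x) :=
    (measurable_const.indicator hU.compl).comp (measurable_const_mul g)
  rw [lintegral_haar hO hm] at h1
  have hm2 : Measurable fun X : LieAlg n => ENNReal.ofReal (expJac G O X) *
      (expImage G O)ᶜ.indicator (1 : G → ℝ≥0∞) (g * lieExp X) :=
    ((continuous_expJac hO).measurable.ennreal_ofReal).mul (hm.comp (measurable_lieExp hO))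
  rw [setLIntegral_eq_zero_iff hO.isOpen.measurableSet hm2, measX,
    Measure.ae_ennreal_smul_measure_iff (densityAtOne_ne_zero hO)] at h1
  rw [← compl_mem_ae_iff]
  filter_upwards [h1] with X hX hX'
  have := hX hX'.1
  rw [Set.indicator_of_mem (by exact hX'.2), mul_eq_zero, ENNReal.ofReal_eq_zero] at this
  rcases this with h | h
  · exact absurd (expJac_pos hO hX'.1) (not_lt.2 h)
  · simp at h

/-- Near a noncritical point `X₀` the map `X ↦ log(exp(X₀)⁻¹ exp X)` is a local diffeomorphism. It
carries the set in question into the logarithms of `exp(X₀)⁻¹ · exp(O)ᶜ`, a null set by left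
invariance, and its differentiable inverse maps null sets to null sets. -/
theorem volume_lieExp_notMem : volume {X : LieAlg n | expJac G O X ≠ 0 ∧
    (lieExp X : G) ∉ expImage G O} = 0 := by
  refine measure_null_of_locally_null _ fun X₀ hX₀ => ?_
  set ψ : LieAlg n → LieAlg n := fun Z => lieLog O ((lieExp X₀ : G)⁻¹ * lieExp Z * 1) with hψ
  have hmem : (lieExp X₀ : G)⁻¹ * lieExp X₀ * 1 ∈ expImage G O := by
    rw [mul_one, inv_mul_cancel]; exact one_mem_expImage hO
  have hψ0 : ψ X₀ = 0 := by
    simp only [hψ, mul_one, inv_mul_cancel]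
    exact lieLog_one hO
  obtain ⟨hd, hc⟩ := expDeriv_comp_fderiv_translate hO (lieExp X₀ : G)⁻¹ 1 hmem
  have hsm : ContDiffAt ℝ ∞ ψ X₀ :=
    contDiffAt_lieLog hO (contMDiffAt_translate hO (lieExp X₀ : G)⁻¹ 1 X₀) hmem
  have hdet : (fderiv ℝ ψ X₀).det ≠ 0 := by
    intro h0
    apply hX₀.1
    have h1 : expDeriv G O X₀ = fderiv ℝ ψ X₀ := by
      have e1 : expDeriv G O (ψ X₀) = ContinuousLinearMap.id ℝ (LieAlg n) := by
        rw [hψ0]; exact expDeriv_zero hO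
      have e2 : (AdL (1 : G)⁻¹ : LieAlg n →L[ℝ] LieAlg n) = ContinuousLinearMap.id ℝ (LieAlg n) := by
        rw [inv_one]; exact AdL_one hO
      have e3 : expDeriv G O (ψ X₀) ∘SL fderiv ℝ ψ X₀ = AdL (1 : G)⁻¹ ∘SL expDeriv G O X₀ := hc
      rw [e1, e2] at e3
      exact e3.symm
    rw [expJac, h1, h0, abs_zero]
  set D := ContinuousLinearMap.toContinuousLinearEquivOfDetNeZero (fderiv ℝ ψ X₀) hdet with hD
  have hder : HasFDerivAt ψ (D : LieAlg n →L[ℝ] LieAlg n) X₀ := by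
    have : (D : LieAlg n →L[ℝ] LieAlg n) = fderiv ℝ ψ X₀ := by ext1 x; rfl
    rw [this]; exact hd.hasFDerivAt
  have hstr : HasStrictFDerivAt ψ (D : LieAlg n →L[ℝ] LieAlg n) X₀ :=
    hsm.hasStrictFDerivAt' hder (by simp)
  have hinv : ContDiffAt ℝ ∞ (hsm.localInverse hder (by simp)) (ψ X₀) :=
    hsm.to_localInverse hder (by simp)
  have hleft : ∀ᶠ X in 𝓝 X₀, hsm.localInverse hder (by simp) (ψ X) = X :=
    hstr.eventually_left_inverse
  set κ := hsm.localInverse hder (by simp) with hκ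
  have hdiff : ∀ᶠ Y in 𝓝 (ψ X₀), DifferentiableAt ℝ κ Y :=
    (hinv.of_le (m := 1) (by exact_mod_cast le_top)).eventually (by simp) |>.mono
      fun Y hY => hY.differentiableAt (by simp)
  have hdiff' := hsm.continuousAt.eventually hdiff
  have hexp : ∀ᶠ X in 𝓝 X₀, lieExp (lieLog O ((lieExp X₀ : G)⁻¹ * lieExp X)) =
      (lieExp X₀ : G)⁻¹ * lieExp X :=
    eventually_lieExp_lieLog_of_continuousAt hO (continuous_lieExp hO).continuousAt
  have hOev : ∀ᶠ X in 𝓝 X₀, ψ X ∈ O := by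
    refine hsm.continuousAt.eventually ?_
    rw [hψ0]; exact mem_nhds_zero hO
  refine ⟨{X | κ (ψ X) = X ∧ DifferentiableAt ℝ κ (ψ X) ∧ ψ X ∈ O ∧
    lieExp (ψ X) = (lieExp X₀ : G)⁻¹ * lieExp X} ∩ {X | (lieExp X : G) ∉ expImage G O}, ?_, ?_⟩
  · refine inter_mem (mem_nhdsWithin_of_mem_nhds ?_)
      (mem_of_superset self_mem_nhdsWithin fun X hX => hX.2)
    filter_upwards [hleft, hdiff', hexp, hOev] with X h1 h2 h3 h4
    refine ⟨h1, h2, h4, ?_⟩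
    simp only [hψ, mul_one]
    exact h3
  · refine measure_mono_null (t := κ '' ({Y | Y ∈ O ∧ (lieExp X₀ : G) * lieExp Y ∉ expImage G O} ∩
      {Y | DifferentiableAt ℝ κ Y})) ?_ ?_
    · rintro X ⟨⟨h1, h2, h3, h4⟩, h5⟩
      refine ⟨ψ X, ⟨⟨h3, ?_⟩, h2⟩, h1⟩
      rw [h4, mul_inv_cancel_left]
      exact h5
    · exact addHaar_image_eq_zero_of_differentiableOn_of_addHaar_eq_zero volume
        (fun Y hY => hY.2.differentiableWithinAt)
        (measure_mono_null Set.inter_subset_left (volume_lieExp_mul_notMem hO _))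

/-- A boundary point is either critical for `exp` or sent outside `exp(O)`, and both sets are null.
This is what makes every element of `L2O`, which is allowed to live on the closure of `O`, come from
a kernel. -/
theorem measX_boundary : measX m (closure O \ O) = 0 := by
  have h : volume (closure O \ O) = 0 := by
    refine measure_mono_null (t := {X : LieAlg n | expJac G O X = 0} ∪
      {X : LieAlg n | expJac G O X ≠ 0 ∧ (lieExp X : G) ∉ expImage G O}) ?_ ?_
    · rintro X ⟨h1, h2⟩
      by_cases h3 : expJac G O X = 0
      · exact Or.inl h3
      · exact Or.inr ⟨h3, lieExp_notMem_expImage_of_mem_closure hO h1 h2⟩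
    · exact measure_union_null (volume_expJac_eq_zero hO) (volume_lieExp_notMem hO)
  rw [measX, Measure.smul_apply, h, smul_zero]

end Boundary
end LieWigner
end

/-! ### Midpoint coordinates: kernels on `G × G` and functions on `G × O`. -/

noncomputable section
namespace LieWigner

section Midpoint

variable {n : ℕ} {G : Type*} [TopologicalSpace G] [ChartedSpace (EuclideanSpace ℝ (Fin n)) G]
  [Group G]

/-- `(q, X) ↦ (q exp(-X/2), q exp(X/2))`. -/
def endpoints (y : G × LieAlg n) : G × G :=
  (y.1 * lieExp ((-(1 / 2) : ℝ) • y.2), y.1 * lieExp ((1 / 2 : ℝ) • y.2))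

/-- The inverse of `endpoints` on `G × O`. -/
def midpoint (O : Set (LieAlg n)) (x : G × G) : G × LieAlg n :=
  (x.1 * lieExp ((1 / 2 : ℝ) • (expImage G O).indicator (lieLog O) (x.1⁻¹ * x.2)),
    (expImage G O).indicator (lieLog O) (x.1⁻¹ * x.2))

variable {O : Set (LieAlg n)} [MeasurableSpace G] {m : Measure G}
  (hO : IsWeaklyExponential m O) [LieGroup (𝓡 n) ∞ G] [T2Space G]

theorem endpoints_inv_mul (q : G) (X : LieAlg n) :
    (endpoints (q, X)).1⁻¹ * (endpoints (q, X)).2 = lieExp X := by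
  simp only [endpoints, lieExp_neg_half, mul_inv_rev, inv_inv]
  rw [mul_assoc, inv_mul_cancel_left, lieExp_half_mul_half]

theorem symbolTilde_eq_indicator (k : G × G → ℂ) :
    symbolTilde O k = (Set.univ ×ˢ O).indicator
      (fun y : G × LieAlg n => k (endpoints y) * (weightF G y.2 : ℂ)) := by
  classical
  ext1 y
  by_cases h : y.2 ∈ O <;> simp [symbolTilde, endpoints, h, Set.indicator]

include hO

theorem midpoint_endpoints {y : G × LieAlg n} (hy : y.2 ∈ O) : midpoint O (endpoints y) = y := by
  obtain ⟨q, X⟩ := y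
  rw [midpoint, endpoints_inv_mul, Set.indicator_of_mem (lieExp_mem_expImage hy),
    lieLog_lieExp hO hy]
  simp only [endpoints, lieExp_neg_half, inv_mul_cancel_right]

theorem continuous_endpoints : Continuous (endpoints : G × LieAlg n → G × G) := by
  have := topologicalGroup_of_lieGroup (𝓡 n) ∞ (G := G)
  have := continuous_lieExp (G := G) hO
  unfold endpoints
  fun_prop

variable [BorelSpace G]

theorem measurable_indicator_lieLog :
    Measurable ((expImage G O).indicator (lieLog O : G → LieAlg n)) := by
  have hU := measurableSet_expImage (G := G) hO
  refine measurable_of_restrict_of_restrict_compl hU ?_ ?_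
  · have : (expImage G O).domRestrict ((expImage G O).indicator (lieLog O : G → LieAlg n)) =
        (expImage G O).domRestrict (lieLog O) := by
      ext1 x
      exact Set.indicator_of_mem x.2 _
    rw [this]
    exact (continuousOn_iff_continuous_domRestrict.1 (continuousOn_lieLog hO)).measurable
  · have : (expImage G O)ᶜ.domRestrict ((expImage G O).indicator (lieLog O : G → LieAlg n)) =
        fun _ => 0 := by
      ext1 x
      exact Set.indicator_of_notMem x.2 _
    rw [this]; exact measurable_const

variable [SecondCountableTopology G]

theorem measurable_midpoint : Measurable (midpoint O : G × G → G × LieAlg n) := by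
  have := topologicalGroup_of_lieGroup (𝓡 n) ∞ (G := G)
  have h1 : Measurable fun x : G × G => x.1⁻¹ * x.2 := by fun_prop
  have h2 := (measurable_indicator_lieLog (G := G) hO).comp h1
  have h3 := (measurable_lieExp (G := G) hO).comp (h2.const_smul (1 / 2 : ℝ))
  exact (measurable_fst.mul h3).prodMk h2

variable [m.IsHaarMeasure]

omit hO [LieGroup (𝓡 n) ∞ G] [T2Space G] [BorelSpace G] [SecondCountableTopology G]
  [m.IsHaarMeasure] in
theorem measN_restrict [SigmaFinite m] [SigmaFinite (measX (n := n) m)] :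
    (measN (n := n) m).restrict (Set.univ ×ˢ O) = m.prod ((measX m).restrict O) := by
  rw [measN, ← Measure.prod_restrict, Measure.restrict_univ]

/-- For fixed `a` the substitution `b = a exp X` brings in `expJac`; for fixed `X` the right
translation `a = q exp(-X/2)` brings in `|det Ad_{exp(X/2)}|`. Their product is `F(X)²`. -/
theorem lintegral_prod_haar {f : G × G → ℝ≥0∞} (hf : Measurable f) :
    ∫⁻ x, f x ∂(m.prod m) = ∫⁻ y in Set.univ ×ˢ O,
      f (endpoints y) * ENNReal.ofReal (weightF G y.2 * weightF G y.2) ∂(measN m) := by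
  have := topologicalGroup_of_lieGroup (𝓡 n) ∞ (G := G)
  have := sigmaFinite_haar n m
  have := sigmaFinite_measX (G := G) hO
  have hJ : Measurable fun X : LieAlg n => ENNReal.ofReal (expJac G O X) :=
    (continuous_expJac hO).measurable.ennreal_ofReal
  have hexp := measurable_lieExp (G := G) hO
  have hF : Measurable (weightF G : LieAlg n → ℝ) := (continuous_weightF (G := G) hO).measurable
  have h1 : ∀ a : G, ∫⁻ b, f (a, b) ∂m =
      ∫⁻ X in O, ENNReal.ofReal (expJac G O X) * f (a, a * lieExp X) ∂(measX m) := by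
    intro a
    have hm : Measurable fun b => f (a, a * b) := by fun_prop
    rw [← lintegral_mul_left_eq_self _ a, lintegral_haar hO hm]
  have h2 : ∀ X : LieAlg n, ENNReal.ofReal (expJac G O X) * ∫⁻ a, f (a, a * lieExp X) ∂m =
      ∫⁻ q, f (endpoints (q, X)) * ENNReal.ofReal (weightF G X * weightF G X) ∂m := by
    intro X
    have hm : Measurable fun a => f (a, a * lieExp X) := by fun_prop
    have hm' : Measurable fun q : G => f (endpoints (q, X)) := by
      have := (continuous_endpoints (G := G) hO).measurable
      fun_prop
    have h3 := lintegral_mul_right (n := n) hO hm (lieExp ((-(1 / 2) : ℝ) • X) : G)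
    rw [lintegral_mul_const _ hm', weightF_sq hO, ENNReal.ofReal_mul (expJac_nonneg X)]
    have h4 : ∀ q : G, f (q * lieExp ((-(1 / 2) : ℝ) • X),
        q * lieExp ((-(1 / 2) : ℝ) • X) * lieExp X) = f (endpoints (q, X)) := by
      intro q
      congr 1
      rw [endpoints, Prod.mk.injEq]
      refine ⟨rfl, ?_⟩
      rw [← lieExp_half_mul_half X, lieExp_neg_half]
      simp only [mul_assoc, inv_mul_cancel_left]
    simp_rw [h4] at h3
    rw [h3, lieExp_neg_half, absDetAd_inv hO, ENNReal.ofReal_inv_of_pos (absDetAd_pos hO _)]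
    have h5 : ENNReal.ofReal (absDetAd n (lieExp ((1 / 2 : ℝ) • X) : G)) ≠ 0 := by
      simpa using absDetAd_pos hO (lieExp ((1 / 2 : ℝ) • X) : G)
    rw [mul_comm (ENNReal.ofReal (expJac G O X)) (ENNReal.ofReal (absDetAd n _)),
      mul_mul_mul_comm, ENNReal.inv_mul_cancel h5 ENNReal.ofReal_ne_top, one_mul, mul_comm]
  have hmm : Measurable fun y : G × LieAlg n =>
      f (endpoints y) * ENNReal.ofReal (weightF G y.2 * weightF G y.2) := by
    have := (continuous_endpoints (G := G) hO).measurable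
    fun_prop
  have hmm2 : Measurable fun z : G × LieAlg n =>
      ENNReal.ofReal (expJac G O z.2) * f (z.1, z.1 * lieExp z.2) :=
    (hJ.comp measurable_snd).mul (by fun_prop)
  rw [lintegral_prod _ hf.aemeasurable]
  simp_rw [h1]
  rw [lintegral_lintegral_swap hmm2.aemeasurable]
  have h5 : ∀ X : LieAlg n, ∫⁻ a, ENNReal.ofReal (expJac G O X) * f (a, a * lieExp X) ∂m =
      ∫⁻ q, f (endpoints (q, X)) * ENNReal.ofReal (weightF G X * weightF G X) ∂m := by
    intro X
    rw [← h2, lintegral_const_mul]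
    fun_prop
  simp_rw [h5]
  rw [measN_restrict (O := O), lintegral_prod_symm _ hmm.aemeasurable]

/-- Since `F² > 0` on `O`, the change of variables pulls null sets back to null sets; this lets
kernels be treated as classes. -/
theorem ae_restrict_of_ae_endpoints {p : G × G → Prop} (hp : ∀ᵐ x ∂(m.prod m), p x) :
    ∀ᵐ y ∂((measN (n := n) m).restrict (Set.univ ×ˢ O)), p (endpoints y) := by
  obtain ⟨N, hN, hNm, hN0⟩ := exists_measurable_superset_of_null (ae_iff.1 hp)
  have h1 := lintegral_prod_haar hO (m := m) (f := N.indicator 1) (measurable_const.indicator hNm)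
  have hmm : Measurable fun y : G × LieAlg n => N.indicator (1 : G × G → ℝ≥0∞) (endpoints y) *
      ENNReal.ofReal (weightF G y.2 * weightF G y.2) := by
    have h2 : Measurable (fun y : G × LieAlg n => N.indicator (1 : G × G → ℝ≥0∞) (endpoints y)) :=
      (measurable_const.indicator hNm).comp (continuous_endpoints (G := G) hO).measurable
    have h3 : Measurable (weightF G : LieAlg n → ℝ) := (continuous_weightF (G := G) hO).measurable
    fun_prop
  rw [lintegral_indicator_one hNm, hN0, eq_comm,
    setLIntegral_eq_zero_iff (MeasurableSet.univ.prod hO.isOpen.measurableSet) hmm] at h1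
  rw [ae_restrict_iff' (MeasurableSet.univ.prod hO.isOpen.measurableSet)]
  filter_upwards [h1] with y hy hyO
  have h2 := hy hyO
  by_contra hpy
  rw [Set.indicator_of_mem (hN hpy), Pi.one_apply, one_mul, ENNReal.ofReal_eq_zero] at h2
  exact absurd (mul_pos (weightF_pos hO hyO.2) (weightF_pos hO hyO.2)) (not_lt.2 h2)

theorem quasiMeasurePreserving_endpoints :
    Measure.QuasiMeasurePreserving (endpoints : G × LieAlg n → G × G)
      ((measN (n := n) m).restrict (Set.univ ×ˢ O)) (m.prod m) :=
  ⟨(continuous_endpoints hO).measurable, Measure.AbsolutelyContinuous.mk fun N hN h0 => by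
    rw [Measure.map_apply (continuous_endpoints hO).measurable hN]
    have := ae_restrict_of_ae_endpoints hO (m := m) (compl_mem_ae_iff.2 h0 : ∀ᵐ x ∂_, x ∉ N)
    exact (ae_iff.1 this).symm ▸ by simp [Set.preimage]⟩

theorem symbolTilde_ae_eq {k l : G × G → ℂ} (h : k =ᵐ[m.prod m] l) :
    symbolTilde O k =ᵐ[measN (n := n) m] symbolTilde O l := by
  have h1 := ae_restrict_of_ae_endpoints hO (m := m) h
  rw [ae_restrict_iff' (MeasurableSet.univ.prod hO.isOpen.measurableSet)] at h1
  filter_upwards [h1] with y hy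
  rw [symbolTilde_eq_indicator, symbolTilde_eq_indicator]
  by_cases hyO : y ∈ Set.univ ×ˢ O
  · rw [Set.indicator_of_mem hyO, Set.indicator_of_mem hyO, hy hyO]
  · rw [Set.indicator_of_notMem hyO, Set.indicator_of_notMem hyO]

theorem aestronglyMeasurable_symbolTilde {k : G × G → ℂ}
    (hk : AEStronglyMeasurable k (m.prod m)) :
    AEStronglyMeasurable (symbolTilde O k) (measN (n := n) m) := by
  rw [symbolTilde_eq_indicator,
    aestronglyMeasurable_indicator_iff (MeasurableSet.univ.prod hO.isOpen.measurableSet)]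
  refine (hk.comp_quasiMeasurePreserving (quasiMeasurePreserving_endpoints hO)).mul ?_
  have h3 : Continuous (weightF G : LieAlg n → ℝ) := continuous_weightF (G := G) hO
  exact (Complex.continuous_ofReal.comp (h3.comp continuous_snd)).aestronglyMeasurable

theorem eLpNorm_symbolTilde {k : G × G → ℂ} (hk : AEStronglyMeasurable k (m.prod m)) :
    eLpNorm (symbolTilde O k) 2 (measN (n := n) m) = eLpNorm k 2 (m.prod m) := by
  wlog hk' : StronglyMeasurable k generalizing k
  · rw [eLpNorm_congr_ae hk.ae_eq_mk, ← this hk.stronglyMeasurable_mk.aestronglyMeasurable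
      hk.stronglyMeasurable_mk]
    exact eLpNorm_congr_ae (symbolTilde_ae_eq hO hk.ae_eq_mk)
  rw [eLpNorm_eq_lintegral_rpow_enorm_toReal two_ne_zero ENNReal.ofNat_ne_top,
    eLpNorm_eq_lintegral_rpow_enorm_toReal two_ne_zero ENNReal.ofNat_ne_top]
  congr 1
  have hm : Measurable fun x => ‖k x‖ₑ ^ (2 : ℝ≥0∞).toReal :=
    hk'.measurable.enorm.pow_const _
  rw [lintegral_prod_haar hO hm, ← lintegral_indicator (MeasurableSet.univ.prod
    hO.isOpen.measurableSet)]
  refine lintegral_congr fun y => ?_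
  rw [symbolTilde_eq_indicator]
  by_cases hyO : y ∈ Set.univ ×ˢ O
  · rw [Set.indicator_of_mem hyO, Set.indicator_of_mem hyO, enorm_mul,
      ENNReal.mul_rpow_of_nonneg _ _ (by simp)]
    congr 1
    rw [ENNReal.toReal_ofNat, ENNReal.rpow_ofNat, ← ofReal_norm (weightF G y.2 : ℂ),
      Complex.norm_of_nonneg (weightF_nonneg _), sq, ← ENNReal.ofReal_mul (weightF_nonneg _)]
  · rw [Set.indicator_of_notMem hyO, Set.indicator_of_notMem hyO]
    simp

theorem memLp_symbolTilde {k : G × G → ℂ} (hk : MemLp k 2 (m.prod m)) :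
    MemLp (symbolTilde O k) 2 (measN (n := n) m) :=
  ⟨aestronglyMeasurable_symbolTilde hO hk.1, by rw [eLpNorm_symbolTilde hO hk.1]; exact hk.2⟩

theorem symbolTilde_mem_L2O {k : G × G → ℂ} (hk : MemLp k 2 (m.prod m)) :
    (memLp_symbolTilde hO hk).toLp _ ∈ L2O (n := n) m O := by
  change ∀ᵐ y ∂(measN (n := n) m), _
  filter_upwards [(memLp_symbolTilde hO hk).coeFn_toLp] with y hy hyO
  rw [hy, symbolTilde, if_neg fun h => hyO (subset_closure h)]

theorem toL2O_symbolTilde {k : G × G → ℂ} (hk : MemLp k 2 (m.prod m)) :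
    (toL2O m O (symbolTilde O k) : Lp ℂ 2 (measN (n := n) m)) =
      (memLp_symbolTilde hO hk).toLp _ := by
  rw [toL2O, dif_pos ⟨memLp_symbolTilde hO hk, symbolTilde_mem_L2O hO hk⟩]

/-- The kernel is `h / F` at the midpoint. It reproduces `h` on `G × O`, and the remaining part of
the closure has measure zero. -/
theorem exists_symbolTilde_eq (h : Lp ℂ 2 (measN (n := n) m)) (hh : h ∈ L2O m O) :
    ∃ k : G × G → ℂ, MemLp k 2 (m.prod m) ∧ symbolTilde O k =ᵐ[measN (n := n) m] h := by
  have := sigmaFinite_measX (m := m) hO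
  have h1 : Measurable fun x : G × G => h (midpoint O x) :=
    (Lp.stronglyMeasurable h).measurable.comp (measurable_midpoint hO)
  have h2 : Measurable fun x : G × G => ((weightF G (midpoint O x).2 : ℝ) : ℂ) :=
    Complex.measurable_ofReal.comp ((continuous_weightF (G := G) hO).measurable.comp
      (measurable_snd.comp (measurable_midpoint hO)))
  set k : G × G → ℂ := fun x => h (midpoint O x) / ((weightF G (midpoint O x).2 : ℝ) : ℂ) with hk
  have hkm : AEStronglyMeasurable k (m.prod m) :=
    (h1.div h2).stronglyMeasurable.aestronglyMeasurable
  have h3 : symbolTilde O k =ᵐ[measN (n := n) m] h := by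
    have h4 : ∀ᵐ X ∂(measX m), X ∉ closure O \ O := compl_mem_ae_iff.2 (measX_boundary hO)
    have h5 : ∀ᵐ y ∂(measN (n := n) m), y.2 ∉ closure O \ O :=
      (Measure.quasiMeasurePreserving_snd (μ := m) (ν := measX m)).ae h4
    have h6 : ∀ᵐ y ∂(measN (n := n) m), y.2 ∉ closure O → h y = 0 := hh
    filter_upwards [h5, h6] with y hy hy'
    by_cases hyO : y.2 ∈ O
    · rw [symbolTilde_eq_indicator, Set.indicator_of_mem (by exact ⟨trivial, hyO⟩)]
      simp only [hk]
      rw [midpoint_endpoints hO hyO, div_mul_cancel₀]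
      exact_mod_cast (weightF_pos hO hyO).ne'
    · rw [symbolTilde_eq_indicator, Set.indicator_of_notMem (by exact fun h => hyO h.2),
        hy' fun hc => hy ⟨hc, hyO⟩]
  refine ⟨k, ⟨hkm, ?_⟩, h3⟩
  rw [← eLpNorm_symbolTilde hO hkm, eLpNorm_congr_ae h3]
  exact (Lp.memLp h).2

variable (m) in
/-- The isometry from the Hilbert-Schmidt kernels onto `L²(G × O)`. -/
def symbolIso : Lp ℂ 2 (m.prod m) ≃ₗᵢ[ℂ] L2O (n := n) m O :=
  LinearIsometryEquiv.ofSurjective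
    { toFun := fun k => ⟨(memLp_symbolTilde hO (Lp.memLp k)).toLp _,
        symbolTilde_mem_L2O hO (Lp.memLp k)⟩
      map_add' := fun k l => by
        ext1
        refine Lp.ext ?_
        simp only [Submodule.coe_add]
        filter_upwards [(memLp_symbolTilde hO (Lp.memLp (k + l))).coeFn_toLp,
          (memLp_symbolTilde hO (Lp.memLp k)).coeFn_toLp,
          (memLp_symbolTilde hO (Lp.memLp l)).coeFn_toLp,
          Lp.coeFn_add ((memLp_symbolTilde hO (Lp.memLp k)).toLp _)
            ((memLp_symbolTilde hO (Lp.memLp l)).toLp _),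
          symbolTilde_ae_eq hO (Lp.coeFn_add k l)] with y h1 h2 h3 h4 h5
        rw [h1, h4, Pi.add_apply, h2, h3, h5]
        simp only [symbolTilde, Pi.add_apply]
        split_ifs
        · ring
        · ring
      map_smul' := fun c k => by
        ext1
        refine Lp.ext ?_
        simp only [Submodule.coe_smul, RingHom.id_apply]
        filter_upwards [(memLp_symbolTilde hO (Lp.memLp (c • k))).coeFn_toLp,
          (memLp_symbolTilde hO (Lp.memLp k)).coeFn_toLp,
          Lp.coeFn_smul c ((memLp_symbolTilde hO (Lp.memLp k)).toLp _),
          symbolTilde_ae_eq hO (Lp.coeFn_smul c k)] with y h1 h2 h3 h4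
        rw [h1, h3, Pi.smul_apply, h2, h4]
        simp only [symbolTilde, Pi.smul_apply, smul_eq_mul]
        split_ifs
        · ring
        · ring
      norm_map' := fun k => by
        change ‖(memLp_symbolTilde hO (Lp.memLp k)).toLp _‖ = ‖k‖
        rw [Lp.norm_toLp, eLpNorm_symbolTilde hO (Lp.memLp k).1, Lp.norm_def] } (by
    rintro ⟨h, hh⟩
    obtain ⟨k, hk, hkh⟩ := exists_symbolTilde_eq hO h hh
    refine ⟨hk.toLp k, Subtype.ext (Lp.ext ?_)⟩
    exact ((memLp_symbolTilde hO (Lp.memLp (hk.toLp k))).coeFn_toLp.trans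
      (symbolTilde_ae_eq hO hk.coeFn_toLp)).trans hkh)

theorem coe_symbolIso_toLp {k : G × G → ℂ} (hk : MemLp k 2 (m.prod m)) :
    (symbolIso m hO (hk.toLp k) : Lp ℂ 2 (measN (n := n) m)) =
      (memLp_symbolTilde hO hk).toLp _ :=
  Lp.ext (((memLp_symbolTilde hO (Lp.memLp (hk.toLp k))).coeFn_toLp.trans
      (symbolTilde_ae_eq hO hk.coeFn_toLp)).trans (memLp_symbolTilde hO hk).coeFn_toLp.symm)

theorem toL2O_symbolTilde_eq_symbolIso {k : G × G → ℂ} (hk : MemLp k 2 (m.prod m)) :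
    toL2O m O (symbolTilde O k) = symbolIso m hO (hk.toLp k) :=
  Subtype.ext ((toL2O_symbolTilde hO hk).trans (coe_symbolIso_toLp hO hk).symm)

end Midpoint
end LieWigner
end

/-! ### Composition of Hilbert-Schmidt kernels. -/

noncomputable section
namespace LieWigner

section Kernel

variable {α : Type*} [MeasurableSpace α] {μ : Measure α}

theorem lintegral_mul_sq_le {f g : α → ℝ≥0∞} (hf : AEMeasurable f μ) (hg : AEMeasurable g μ) :
    (∫⁻ x, f x * g x ∂μ) ^ 2 ≤ (∫⁻ x, f x ^ 2 ∂μ) * ∫⁻ x, g x ^ 2 ∂μ := by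
  have h := ENNReal.lintegral_mul_le_Lp_mul_Lq μ (Real.HolderConjugate.two_two) hf hg
  simp only [Pi.mul_apply, ENNReal.rpow_ofNat] at h
  refine (pow_le_pow_left₀ (zero_le) h 2).trans_eq ?_
  rw [mul_pow, ← ENNReal.rpow_mul_natCast, ← ENNReal.rpow_mul_natCast]
  norm_num

theorem enorm_integral_mul_sq_le {f g : α → ℂ} (hf : AEStronglyMeasurable f μ)
    (hg : AEStronglyMeasurable g μ) :
    ‖∫ x, f x * g x ∂μ‖ₑ ^ 2 ≤ (∫⁻ x, ‖f x‖ₑ ^ 2 ∂μ) * ∫⁻ x, ‖g x‖ₑ ^ 2 ∂μ := by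
  refine le_trans (pow_le_pow_left₀ (zero_le) (enorm_integral_le_lintegral_enorm _) 2) ?_
  simp_rw [enorm_mul]
  exact lintegral_mul_sq_le hf.enorm hg.enorm

theorem eLpNorm_two_sq (f : α → ℂ) : eLpNorm f 2 μ ^ 2 = ∫⁻ x, ‖f x‖ₑ ^ 2 ∂μ := by
  rw [eLpNorm_eq_lintegral_rpow_enorm_toReal two_ne_zero ENNReal.ofNat_ne_top,
    ← ENNReal.rpow_mul_natCast]
  norm_num

theorem memLp_two_iff {f : α → ℂ} (hf : AEStronglyMeasurable f μ) :
    MemLp f 2 μ ↔ ∫⁻ x, ‖f x‖ₑ ^ 2 ∂μ < ⊤ := by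
  rw [← eLpNorm_two_sq, ENNReal.pow_lt_top_iff]
  simp [MemLp, hf]

/-- The composition of integral kernels. -/
def kernelComp (μ : Measure α) (k l : α × α → ℂ) : α × α → ℂ :=
  fun x => ∫ c, k (x.1, c) * l (c, x.2) ∂μ

variable [SFinite μ]

theorem ae_ae_fst {p : α × α → Prop} (h : ∀ᵐ x ∂(μ.prod μ), p x) :
    ∀ᵐ x ∂(μ.prod μ), ∀ᵐ c ∂μ, p (x.1, c) :=
  Measure.quasiMeasurePreserving_fst.ae (Measure.ae_ae_of_ae_prod h)

theorem ae_ae_snd {p : α × α → Prop} (h : ∀ᵐ x ∂(μ.prod μ), p x) :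
    ∀ᵐ x ∂(μ.prod μ), ∀ᵐ c ∂μ, p (c, x.2) :=
  Measure.quasiMeasurePreserving_snd.ae (Measure.ae_ae_of_ae_prod
    (Measure.measurePreserving_swap.quasiMeasurePreserving.ae h))

theorem kernelComp_ae_eq {k k' l l' : α × α → ℂ} (hk : k =ᵐ[μ.prod μ] k')
    (hl : l =ᵐ[μ.prod μ] l') : kernelComp μ k l =ᵐ[μ.prod μ] kernelComp μ k' l' := by
  filter_upwards [ae_ae_fst hk, ae_ae_snd hl] with x h1 h2
  refine integral_congr_ae ?_
  filter_upwards [h1, h2] with c h3 h4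
  rw [h3, h4]

theorem stronglyMeasurable_kernelComp {k l : α × α → ℂ} (hk : StronglyMeasurable k)
    (hl : StronglyMeasurable l) : StronglyMeasurable (kernelComp μ k l) := by
  refine StronglyMeasurable.integral_prod_right'
    (f := fun z : (α × α) × α => k (z.1.1, z.2) * l (z.2, z.1.2)) ?_
  exact (hk.comp_measurable (by fun_prop)).mul (hl.comp_measurable (by fun_prop))

theorem aestronglyMeasurable_kernelComp {k l : α × α → ℂ}
    (hk : AEStronglyMeasurable k (μ.prod μ)) (hl : AEStronglyMeasurable l (μ.prod μ)) :
    AEStronglyMeasurable (kernelComp μ k l) (μ.prod μ) :=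
  ⟨_, stronglyMeasurable_kernelComp hk.stronglyMeasurable_mk hl.stronglyMeasurable_mk,
    kernelComp_ae_eq hk.ae_eq_mk hl.ae_eq_mk⟩

/-- Cauchy-Schwarz in the inner variable bounds the square by a function of the first variable times
a function of the second, whose double integral factors. -/
theorem lintegral_kernelComp_sq_le {k l : α × α → ℂ} (hk : StronglyMeasurable k)
    (hl : StronglyMeasurable l) : ∫⁻ x, ‖kernelComp μ k l x‖ₑ ^ 2 ∂(μ.prod μ) ≤
      (∫⁻ x, ‖k x‖ₑ ^ 2 ∂(μ.prod μ)) * ∫⁻ x, ‖l x‖ₑ ^ 2 ∂(μ.prod μ) := by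
  have hk2 : Measurable fun x => ‖k x‖ₑ ^ 2 := hk.measurable.enorm.pow_const 2
  have hl2 : Measurable fun x => ‖l x‖ₑ ^ 2 := hl.measurable.enorm.pow_const 2
  have h1 : ∀ x, ‖kernelComp μ k l x‖ₑ ^ 2 ≤
      (∫⁻ c, ‖k (x.1, c)‖ₑ ^ 2 ∂μ) * ∫⁻ c, ‖l (c, x.2)‖ₑ ^ 2 ∂μ := fun x =>
    enorm_integral_mul_sq_le
      (hk.comp_measurable measurable_prodMk_left).aestronglyMeasurable
      (hl.comp_measurable measurable_prodMk_right).aestronglyMeasurable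
  refine (lintegral_mono h1).trans_eq ?_
  rw [lintegral_prod_mul (f := fun a => ∫⁻ c, ‖k (a, c)‖ₑ ^ 2 ∂μ)
    (g := fun b => ∫⁻ c, ‖l (c, b)‖ₑ ^ 2 ∂μ) hk2.lintegral_prod_right'.aemeasurable
    hl2.lintegral_prod_left'.aemeasurable, lintegral_prod _ hk2.aemeasurable,
    lintegral_prod_symm _ hl2.aemeasurable]

theorem eLpNorm_kernelComp_le {k l : α × α → ℂ}
    (hk : AEStronglyMeasurable k (μ.prod μ)) (hl : AEStronglyMeasurable l (μ.prod μ)) :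
    eLpNorm (kernelComp μ k l) 2 (μ.prod μ) ≤
      eLpNorm k 2 (μ.prod μ) * eLpNorm l 2 (μ.prod μ) := by
  rw [eLpNorm_congr_ae (kernelComp_ae_eq hk.ae_eq_mk hl.ae_eq_mk), eLpNorm_congr_ae hk.ae_eq_mk,
    eLpNorm_congr_ae hl.ae_eq_mk]
  refine (ENNReal.pow_le_pow_left_iff two_ne_zero).1 ?_
  rw [mul_pow, eLpNorm_two_sq, eLpNorm_two_sq, eLpNorm_two_sq]
  exact lintegral_kernelComp_sq_le hk.stronglyMeasurable_mk hl.stronglyMeasurable_mk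

theorem memLp_kernelComp {k l : α × α → ℂ} (hk : MemLp k 2 (μ.prod μ)) (hl : MemLp l 2 (μ.prod μ)) :
    MemLp (kernelComp μ k l) 2 (μ.prod μ) :=
  ⟨aestronglyMeasurable_kernelComp hk.1 hl.1,
    (eLpNorm_kernelComp_le hk.1 hl.1).trans_lt (ENNReal.mul_lt_top hk.2 hl.2)⟩

theorem ae_memLp_fst {k : α × α → ℂ} (hk : MemLp k 2 (μ.prod μ)) :
    ∀ᵐ a ∂μ, MemLp (fun c => k (a, c)) 2 μ := by
  have h1 := (memLp_two_iff hk.1).1 hk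
  have h2 := hk.1.enorm.pow_const 2
  rw [lintegral_prod _ h2] at h1
  filter_upwards [ae_lt_top' h2.lintegral_prod_right' h1.ne, hk.1.prodMk_left] with a h3 h4
  exact (memLp_two_iff h4).2 h3

theorem ae_memLp_snd {k : α × α → ℂ} (hk : MemLp k 2 (μ.prod μ)) :
    ∀ᵐ b ∂μ, MemLp (fun c => k (c, b)) 2 μ :=
  ae_memLp_fst (hk.comp_measurePreserving Measure.measurePreserving_swap)

theorem ae_integrable_kernelComp {k l : α × α → ℂ} (hk : MemLp k 2 (μ.prod μ))
    (hl : MemLp l 2 (μ.prod μ)) :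
    ∀ᵐ x ∂(μ.prod μ), Integrable (fun c => k (x.1, c) * l (c, x.2)) μ := by
  filter_upwards [Measure.quasiMeasurePreserving_fst.ae (ae_memLp_fst hk),
    Measure.quasiMeasurePreserving_snd.ae (ae_memLp_snd hl)] with x h1 h2
  exact h1.integrable_mul h2

variable (μ) in
/-- The composition of Hilbert-Schmidt kernels as a continuous bilinear map. -/
def kernelCompL : Lp ℂ 2 (μ.prod μ) →L[ℂ] Lp ℂ 2 (μ.prod μ) →L[ℂ] Lp ℂ 2 (μ.prod μ) :=
  LinearMap.mkContinuous₂
    (LinearMap.mk₂ ℂ (fun k l => (memLp_kernelComp (Lp.memLp k) (Lp.memLp l)).toLp _)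
      (fun k k' l => by
        refine Lp.ext ?_
        filter_upwards [(memLp_kernelComp (Lp.memLp (k + k')) (Lp.memLp l)).coeFn_toLp,
          (memLp_kernelComp (Lp.memLp k) (Lp.memLp l)).coeFn_toLp,
          (memLp_kernelComp (Lp.memLp k') (Lp.memLp l)).coeFn_toLp,
          Lp.coeFn_add ((memLp_kernelComp (Lp.memLp k) (Lp.memLp l)).toLp _)
            ((memLp_kernelComp (Lp.memLp k') (Lp.memLp l)).toLp _),
          kernelComp_ae_eq (Lp.coeFn_add k k') (ae_eq_refl l),
          ae_integrable_kernelComp (Lp.memLp k) (Lp.memLp l),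
          ae_integrable_kernelComp (Lp.memLp k') (Lp.memLp l)] with x h1 h2 h3 h4 h5 h6 h7
        rw [h1, h4, Pi.add_apply, h2, h3, h5]
        simp only [kernelComp, Pi.add_apply, add_mul]
        exact integral_add h6 h7)
      (fun c k l => by
        refine Lp.ext ?_
        filter_upwards [(memLp_kernelComp (Lp.memLp (c • k)) (Lp.memLp l)).coeFn_toLp,
          (memLp_kernelComp (Lp.memLp k) (Lp.memLp l)).coeFn_toLp,
          Lp.coeFn_smul c ((memLp_kernelComp (Lp.memLp k) (Lp.memLp l)).toLp _),
          kernelComp_ae_eq (Lp.coeFn_smul c k) (ae_eq_refl l)] with x h1 h2 h4 h5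
        rw [h1, h4, Pi.smul_apply, h2, h5]
        simp only [kernelComp, Pi.smul_apply, smul_eq_mul, mul_assoc]
        exact integral_const_mul _ _)
      (fun k l l' => by
        refine Lp.ext ?_
        filter_upwards [(memLp_kernelComp (Lp.memLp k) (Lp.memLp (l + l'))).coeFn_toLp,
          (memLp_kernelComp (Lp.memLp k) (Lp.memLp l)).coeFn_toLp,
          (memLp_kernelComp (Lp.memLp k) (Lp.memLp l')).coeFn_toLp,
          Lp.coeFn_add ((memLp_kernelComp (Lp.memLp k) (Lp.memLp l)).toLp _)
            ((memLp_kernelComp (Lp.memLp k) (Lp.memLp l')).toLp _),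
          kernelComp_ae_eq (ae_eq_refl k) (Lp.coeFn_add l l'),
          ae_integrable_kernelComp (Lp.memLp k) (Lp.memLp l),
          ae_integrable_kernelComp (Lp.memLp k) (Lp.memLp l')] with x h1 h2 h3 h4 h5 h6 h7
        rw [h1, h4, Pi.add_apply, h2, h3, h5]
        simp only [kernelComp, Pi.add_apply, mul_add]
        exact integral_add h6 h7)
      (fun c k l => by
        refine Lp.ext ?_
        filter_upwards [(memLp_kernelComp (Lp.memLp k) (Lp.memLp (c • l))).coeFn_toLp,
          (memLp_kernelComp (Lp.memLp k) (Lp.memLp l)).coeFn_toLp,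
          Lp.coeFn_smul c ((memLp_kernelComp (Lp.memLp k) (Lp.memLp l)).toLp _),
          kernelComp_ae_eq (ae_eq_refl k) (Lp.coeFn_smul c l)] with x h1 h2 h4 h5
        rw [h1, h4, Pi.smul_apply, h2, h5]
        simp only [kernelComp, Pi.smul_apply, smul_eq_mul, mul_left_comm _ c]
        exact integral_const_mul _ _)) 1 (fun k l => by
      rw [LinearMap.mk₂_apply, one_mul, Lp.norm_toLp, Lp.norm_def, Lp.norm_def,
        ← ENNReal.toReal_mul]
      exact ENNReal.toReal_mono (ENNReal.mul_ne_top (Lp.memLp k).2.ne (Lp.memLp l).2.ne)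
        (eLpNorm_kernelComp_le (Lp.memLp k).1 (Lp.memLp l).1))

theorem kernelCompL_toLp {k l : α × α → ℂ} (hk : MemLp k 2 (μ.prod μ))
    (hl : MemLp l 2 (μ.prod μ)) :
    kernelCompL μ (hk.toLp k) (hl.toLp l) = (memLp_kernelComp hk hl).toLp _ := by
  refine Lp.ext ?_
  refine (MemLp.coeFn_toLp (memLp_kernelComp (Lp.memLp (hk.toLp k)) (Lp.memLp (hl.toLp l)))).trans ?_
  exact (kernelComp_ae_eq hk.coeFn_toLp hl.coeFn_toLp).trans
    (memLp_kernelComp hk hl).coeFn_toLp.symm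

end Kernel
end LieWigner
end

/-! ### Integral operators and rank one kernels. -/

noncomputable section
namespace LieWigner

section Operator

variable {α : Type*} [MeasurableSpace α] {μ : Measure α} [SFinite μ]

theorem integral_kernel_ae_eq {k k' : α × α → ℂ} (hk : k =ᵐ[μ.prod μ] k') (ψ : α → ℂ) :
    (fun a => ∫ b, k (a, b) * ψ b ∂μ) =ᵐ[μ] fun a => ∫ b, k' (a, b) * ψ b ∂μ := by
  filter_upwards [Measure.ae_ae_of_ae_prod hk] with a ha
  refine integral_congr_ae ?_
  filter_upwards [ha] with b hb
  rw [hb]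

theorem aestronglyMeasurable_integral_kernel {k : α × α → ℂ}
    (hk : AEStronglyMeasurable k (μ.prod μ)) {ψ : α → ℂ} (hψ : StronglyMeasurable ψ) :
    AEStronglyMeasurable (fun a => ∫ b, k (a, b) * ψ b ∂μ) μ := by
  refine ⟨fun a => ∫ b, hk.mk k (a, b) * ψ b ∂μ, ?_, integral_kernel_ae_eq hk.ae_eq_mk ψ⟩
  exact StronglyMeasurable.integral_prod_right'
    (f := fun z : α × α => hk.mk k z * ψ z.2)
    (hk.stronglyMeasurable_mk.mul (hψ.comp_measurable measurable_snd))

theorem eLpNorm_integral_kernel_le {k : α × α → ℂ}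
    (hk : AEStronglyMeasurable k (μ.prod μ)) {ψ : α → ℂ} (hψ : StronglyMeasurable ψ) :
    eLpNorm (fun a => ∫ b, k (a, b) * ψ b ∂μ) 2 μ ≤ eLpNorm k 2 (μ.prod μ) * eLpNorm ψ 2 μ := by
  refine (ENNReal.pow_le_pow_left_iff two_ne_zero).1 ?_
  have h2 : AEMeasurable (fun z => ‖k z‖ₑ ^ 2) (μ.prod μ) := hk.enorm.pow_const 2
  rw [mul_pow, eLpNorm_two_sq, eLpNorm_two_sq, eLpNorm_two_sq, lintegral_prod _ h2,
    ← lintegral_mul_const'' _ h2.lintegral_prod_right']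
  refine lintegral_mono_ae ?_
  filter_upwards [hk.prodMk_left] with a ha
  exact enorm_integral_mul_sq_le ha hψ.aestronglyMeasurable

theorem memLp_integral_kernel {k : α × α → ℂ} (hk : MemLp k 2 (μ.prod μ)) (ψ : Lp ℂ 2 μ) :
    MemLp (fun a => ∫ b, k (a, b) * ψ b ∂μ) 2 μ :=
  ⟨aestronglyMeasurable_integral_kernel hk.1 (Lp.stronglyMeasurable ψ),
    (eLpNorm_integral_kernel_le hk.1 (Lp.stronglyMeasurable ψ)).trans_lt
      (ENNReal.mul_lt_top hk.2 (Lp.memLp ψ).2)⟩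

theorem existsUnique_isIntegralOperator {k : α × α → ℂ} (hk : MemLp k 2 (μ.prod μ)) :
    ∃! A, IsIntegralOperator (m := μ) k A := by
  refine ⟨LinearMap.mkContinuous
    { toFun := fun ψ => (memLp_integral_kernel hk ψ).toLp _
      map_add' := fun ψ χ => ?_
      map_smul' := fun c ψ => ?_ } (eLpNorm k 2 (μ.prod μ)).toReal fun ψ => ?_, fun ψ => ?_, ?_⟩
  · refine Lp.ext ?_
    filter_upwards [(memLp_integral_kernel hk (ψ + χ)).coeFn_toLp,
      (memLp_integral_kernel hk ψ).coeFn_toLp, (memLp_integral_kernel hk χ).coeFn_toLp,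
      Lp.coeFn_add ((memLp_integral_kernel hk ψ).toLp _) ((memLp_integral_kernel hk χ).toLp _),
      ae_memLp_fst hk] with a h1 h2 h3 h4 h5
    have h6 : ∀ ξ : Lp ℂ 2 μ, Integrable (fun b => k (a, b) * ξ b) μ :=
      fun ξ => h5.integrable_mul (Lp.memLp ξ)
    rw [h1, h4, Pi.add_apply, h2, h3, ← integral_add (h6 ψ) (h6 χ)]
    refine integral_congr_ae ?_
    filter_upwards [Lp.coeFn_add ψ χ] with b hb
    rw [hb, Pi.add_apply, mul_add]
  · refine Lp.ext ?_
    filter_upwards [(memLp_integral_kernel hk (c • ψ)).coeFn_toLp,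
      (memLp_integral_kernel hk ψ).coeFn_toLp,
      Lp.coeFn_smul c ((memLp_integral_kernel hk ψ).toLp _)] with a h1 h2 h4
    rw [h1, RingHom.id_apply, h4, Pi.smul_apply, h2, smul_eq_mul, ← integral_const_mul]
    refine integral_congr_ae ?_
    filter_upwards [Lp.coeFn_smul c ψ] with b hb
    rw [hb, Pi.smul_apply, smul_eq_mul, mul_left_comm]
  · change ‖(memLp_integral_kernel hk ψ).toLp _‖ ≤ _
    rw [Lp.norm_toLp, Lp.norm_def, ← ENNReal.toReal_mul]
    exact ENNReal.toReal_mono (ENNReal.mul_ne_top hk.2.ne (Lp.memLp ψ).2.ne)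
      (eLpNorm_integral_kernel_le hk.1 (Lp.stronglyMeasurable ψ))
  · exact (memLp_integral_kernel hk ψ).coeFn_toLp
  · intro B hB
    ext1 ψ
    exact Lp.ext ((hB ψ).trans (memLp_integral_kernel hk ψ).coeFn_toLp.symm)

theorem integralOperator_spec {k : α × α → ℂ} (hk : MemLp k 2 (μ.prod μ)) :
    IsIntegralOperator k (integralOperator μ k) :=
  Classical.epsilon_spec (existsUnique_isIntegralOperator hk).exists

theorem memLp_mul_prod {f g : α → ℂ} (hf : MemLp f 2 μ) (hg : MemLp g 2 μ) :
    MemLp (fun x : α × α => f x.1 * g x.2) 2 (μ.prod μ) := by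
  have hm : AEStronglyMeasurable (fun x : α × α => f x.1 * g x.2) (μ.prod μ) :=
    (hf.1.comp_fst).mul (hg.1.comp_snd)
  rw [memLp_two_iff hm]
  simp_rw [enorm_mul, mul_pow]
  rw [lintegral_prod_mul (hf.1.enorm.pow_const 2) (hg.1.enorm.pow_const 2)]
  exact ENNReal.mul_lt_top ((memLp_two_iff hf.1).1 hf) ((memLp_two_iff hg.1).1 hg)

omit [SFinite μ] in
theorem memLp_star {f : α → ℂ} (hf : MemLp f 2 μ) : MemLp (fun x => (starRingEnd ℂ) (f x)) 2 μ :=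
  hf.star

theorem memLp_rankOneKernel (φ ψ : Lp ℂ 2 μ) : MemLp (rankOneKernel φ ψ) 2 (μ.prod μ) :=
  memLp_mul_prod (Lp.memLp ψ) (memLp_star (Lp.memLp φ))

theorem inner_Lp_eq (φ ψ : Lp ℂ 2 μ) :
    inner ℂ φ ψ = ∫ x, (starRingEnd ℂ) (φ x) * ψ x ∂μ := by
  rw [L2.inner_def]
  simp_rw [RCLike.inner_apply, mul_comm]

theorem inner_rankOneKernel (φ ψ η χ : Lp ℂ 2 μ) :
    inner ℂ ((memLp_rankOneKernel φ ψ).toLp _) ((memLp_rankOneKernel η χ).toLp _) =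
      (starRingEnd ℂ) (inner ℂ φ η) * inner ℂ ψ χ := by
  rw [inner_Lp_eq, inner_Lp_eq, inner_Lp_eq, ← integral_conj, mul_comm, ← integral_prod_mul]
  refine integral_congr_ae ?_
  filter_upwards [(memLp_rankOneKernel φ ψ).coeFn_toLp,
    (memLp_rankOneKernel η χ).coeFn_toLp] with x h1 h2
  rw [h1, h2]
  simp only [rankOneKernel, map_mul, Complex.conj_conj]
  ring

theorem kernelComp_rankOneKernel (φ ψ η χ : Lp ℂ 2 μ) :
    kernelComp μ (rankOneKernel φ ψ) (rankOneKernel η χ) =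
      (inner ℂ φ χ : ℂ) • rankOneKernel η ψ := by
  ext1 x
  simp only [kernelComp, rankOneKernel, Pi.smul_apply, smul_eq_mul]
  rw [inner_Lp_eq, ← integral_mul_const]
  congr 1
  ext1 c
  ring

/-- The factor `conj φ` leaves the integral. Equality is only almost everywhere because `A ψ` is
given by its integral only almost everywhere. -/
theorem kernelComp_rankOneKernel_right {k : α × α → ℂ} {A : Lp ℂ 2 μ →L[ℂ] Lp ℂ 2 μ}
    (hA : IsIntegralOperator k A) (φ ψ : Lp ℂ 2 μ) :
    kernelComp μ k (rankOneKernel φ ψ) =ᵐ[μ.prod μ] rankOneKernel φ (A ψ) := by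
  filter_upwards [Measure.quasiMeasurePreserving_fst.ae (hA ψ)] with x hx
  rw [rankOneKernel, hx, ← integral_mul_const]
  simp only [kernelComp, rankOneKernel, mul_assoc]

/-- The conjugate transposed kernel is square integrable, so it defines an operator `B`; Fubini
applied to the two scalar products shows that `B` is the adjoint. -/
theorem isIntegralOperator_adjoint {k : α × α → ℂ} (hk : MemLp k 2 (μ.prod μ))
    {A : Lp ℂ 2 μ →L[ℂ] Lp ℂ 2 μ} (hA : IsIntegralOperator k A) :
    IsIntegralOperator (fun x => (starRingEnd ℂ) (k x.swap)) (ContinuousLinearMap.adjoint A) := by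
  have hk' : MemLp (fun x : α × α => (starRingEnd ℂ) (k x.swap)) 2 (μ.prod μ) :=
    memLp_star (hk.comp_measurePreserving Measure.measurePreserving_swap)
  obtain ⟨B, hB, -⟩ := existsUnique_isIntegralOperator hk'
  have : B = ContinuousLinearMap.adjoint A := by
    rw [ContinuousLinearMap.eq_adjoint_iff]
    intro φ ψ
    have hint : Integrable (fun x : α × α => k x.swap *
        ((starRingEnd ℂ) (φ x.2) * ψ x.1)) (μ.prod μ) := by
      refine MemLp.integrable_mul (p := 2) (q := 2)
        (hk.comp_measurePreserving Measure.measurePreserving_swap) ?_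
      simp_rw [mul_comm]
      exact memLp_mul_prod (Lp.memLp ψ) (memLp_star (Lp.memLp φ))
    have h1 : inner ℂ (B φ) ψ = ∫ b, ∫ c, k (c, b) * ((starRingEnd ℂ) (φ c) * ψ b) ∂μ ∂μ := by
      rw [inner_Lp_eq]
      refine integral_congr_ae ?_
      filter_upwards [hB φ] with b hb
      rw [hb, ← integral_conj, ← integral_mul_const]
      congr 1
      ext1 c
      simp only [map_mul, Complex.conj_conj, Prod.swap_prod_mk, mul_assoc]
    have h2 : inner ℂ φ (A ψ) = ∫ c, ∫ b, k (c, b) * ((starRingEnd ℂ) (φ c) * ψ b) ∂μ ∂μ := by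
      rw [inner_Lp_eq]
      refine integral_congr_ae ?_
      filter_upwards [hA ψ] with c hc
      rw [hc, ← integral_const_mul]
      congr 1
      ext1 b
      ring
    rw [h1, h2]
    exact integral_integral_swap hint
  rw [← this]; exact hB

theorem kernelComp_rankOneKernel_left {k : α × α → ℂ} (hk : MemLp k 2 (μ.prod μ))
    {A : Lp ℂ 2 μ →L[ℂ] Lp ℂ 2 μ} (hA : IsIntegralOperator k A) (φ ψ : Lp ℂ 2 μ) :
    kernelComp μ (rankOneKernel φ ψ) k =ᵐ[μ.prod μ]
      rankOneKernel (ContinuousLinearMap.adjoint A φ) ψ := by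
  filter_upwards [Measure.quasiMeasurePreserving_snd.ae (isIntegralOperator_adjoint hk hA φ)]
    with x hx
  rw [rankOneKernel, hx, ← integral_conj, ← integral_const_mul]
  simp only [kernelComp, rankOneKernel]
  congr 1
  ext1 c
  simp only [map_mul, Complex.conj_conj, Prod.swap_prod_mk]
  ring

end Operator
end LieWigner
end

/-! ### Plancherel for the Fourier integral on `L¹ ∩ L²`. -/

noncomputable section
namespace LieWigner

section Plancherel
open FourierTransform SchwartzMap

variable {V : Type*} [NormedAddCommGroup V] [InnerProductSpace ℝ V] [FiniteDimensional ℝ V]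
  [MeasurableSpace V] [BorelSpace V]

/-- The `L²` Fourier transform agrees with the transform of tempered distributions, which is defined
by this duality. -/
theorem integral_schwartz_smul_fourier (φ : 𝓢(V, ℂ)) (f : Lp ℂ 2 (volume : Measure V)) :
    ∫ x, φ x • (𝓕 f : Lp ℂ 2 (volume : Measure V)) x = ∫ x, (𝓕 φ : 𝓢(V, ℂ)) x • f x := by
  have h := congrArg (fun u : 𝓢'(V, ℂ) => u φ) (Lp.fourier_toTemperedDistribution_eq f)
  simp only [TemperedDistribution.fourier_apply, Lp.toTemperedDistribution_apply] at h
  exact h.symm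

theorem continuous_fourier_of_integrable {f : V → ℂ} (h1 : Integrable f) : Continuous (𝓕 f) :=
  VectorFourier.fourierIntegral_continuous Real.continuous_fourierChar
    (by exact continuous_inner) h1

theorem integral_schwartz_smul_fourier_of_integrable (φ : 𝓢(V, ℂ)) {f : V → ℂ}
    (h1 : Integrable f) : ∫ x, φ x • (𝓕 f) x = ∫ x, (𝓕 φ : 𝓢(V, ℂ)) x • f x := by
  have h := VectorFourier.integral_fourierIntegral_smul_eq_flip (L := innerₗ V)
    Real.continuous_fourierChar (by exact continuous_inner) (φ.integrable (μ := volume)) h1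
  rw [flip_innerₗ] at h
  exact h.symm

/-- On `L¹ ∩ L²` the `L²` Fourier transform is given by the Fourier integral. -/
theorem fourier_toLp_ae_eq {f : V → ℂ} (h1 : Integrable f) (h2 : MemLp f 2) :
    ((𝓕 (h2.toLp f) : Lp ℂ 2 (volume : Measure V)) : V → ℂ) =ᵐ[volume] 𝓕 f := by
  set u : Lp ℂ 2 (volume : Measure V) := 𝓕 (h2.toLp f) with hu
  set v : V → ℂ := 𝓕 f with hv
  have hl1 : LocallyIntegrable (u : V → ℂ) := (Lp.memLp u).locallyIntegrable (by norm_num)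
  have hl2 : LocallyIntegrable v := (continuous_fourier_of_integrable h1).locallyIntegrable
  -- Both transforms satisfy the same duality with Schwartz functions, so their difference is
  -- orthogonal to every test function.
  have key : ∀ g : V → ℝ, ContDiff ℝ ∞ g → HasCompactSupport g →
      ∫ x, g x • ((u : V → ℂ) - v) x = 0 := by
    intro g hg hgc
    have hgC : ContDiff ℝ ∞ (fun x => (g x : ℂ)) := Complex.ofRealCLM.contDiff.comp hg
    have hgcC : HasCompactSupport (fun x => (g x : ℂ)) := 
      hgc.comp_left (g := fun r : ℝ => (r : ℂ)) Complex.ofReal_zero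
    have e1 := integral_schwartz_smul_fourier (hgcC.toSchwartzMap hgC) (h2.toLp f)
    have e2 := integral_schwartz_smul_fourier_of_integrable (hgcC.toSchwartzMap hgC) h1
    have e3 : ∫ x, (𝓕 (hgcC.toSchwartzMap hgC) : 𝓢(V, ℂ)) x • (h2.toLp f) x =
        ∫ x, (𝓕 (hgcC.toSchwartzMap hgC) : 𝓢(V, ℂ)) x • f x := by
      refine integral_congr_ae ?_
      filter_upwards [h2.coeFn_toLp] with x hx
      rw [hx]
    have i1 : Integrable fun x => g x • (u : V → ℂ) x :=
      hl1.integrable_smul_left_of_hasCompactSupport hg.continuous hgc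
    have i2 : Integrable fun x => g x • v x :=
      hl2.integrable_smul_left_of_hasCompactSupport hg.continuous hgc
    simp only [Pi.sub_apply, smul_sub]
    rw [integral_sub i1 i2, sub_eq_zero]
    exact e1.trans (e3.trans e2.symm)
  filter_upwards [ae_eq_zero_of_integral_contDiff_smul_eq_zero (hl1.sub hl2) key] with x hx
  exact sub_eq_zero.1 hx

theorem lintegral_fourier_sq {f : V → ℂ} (h1 : Integrable f) (h2 : MemLp f 2) :
    ∫⁻ w, ‖𝓕 f w‖ₑ ^ 2 = ∫⁻ v, ‖f v‖ₑ ^ 2 := by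
  rw [← eLpNorm_two_sq, ← eLpNorm_two_sq, ← eLpNorm_congr_ae (fourier_toLp_ae_eq h1 h2)]
  congr 1
  have := Lp.norm_fourier_eq (h2.toLp f)
  rw [Lp.norm_def, Lp.norm_toLp, ENNReal.toReal_eq_toReal_iff' (Lp.memLp _).2.ne h2.2.ne] at this
  exact this

end Plancherel

/-! ### The momentum Fourier integral in a single fibre. -/

section Momentum

variable {n : ℕ}

/-- The identification of `ℝⁿ` with its dual. -/
def dualEquiv (n : ℕ) : LieAlg n ≃ₜ LieDual n :=
  (InnerProductSpace.toDual ℝ (LieAlg n)).toHomeomorph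

theorem dualEquiv_apply (Y X : LieAlg n) : dualEquiv n Y X = inner ℝ Y X := rfl

variable {G : Type*} [TopologicalSpace G] [ChartedSpace (EuclideanSpace ℝ (Fin n)) G]
  [Group G] {O : Set (LieAlg n)} [MeasurableSpace G] {m : Measure G}

theorem measP_eq : measP m = (densityAtOne (n := n) m)⁻¹ •
    (volume : Measure (LieAlg n)).map (dualEquiv n) := rfl

theorem lintegral_measP (f : LieDual n → ℝ≥0∞) :
    ∫⁻ p, f p ∂(measP m) = (densityAtOne (n := n) m)⁻¹ * ∫⁻ Y, f (dualEquiv n Y) := by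
  rw [measP_eq, lintegral_smul_measure, (dualEquiv n).measurableEmbedding.lintegral_map,
    smul_eq_mul]

theorem phase_dualEquiv (ℏ : ℝ) (Y X : LieAlg n) :
    phase ℏ (dualEquiv n Y) X =
      Complex.exp (((-2 * Real.pi * inner ℝ X ((2 * Real.pi * ℏ)⁻¹ • Y) : ℝ) : ℂ) * Complex.I) := by
  rw [phase, dualEquiv_apply, inner_smul_right, real_inner_comm]
  congr 1
  by_cases h : ℏ = 0
  · simp [h]
  have : (ℏ : ℂ) ≠ 0 := by exact_mod_cast h
  have hpi : (Real.pi : ℂ) ≠ 0 := by exact_mod_cast Real.pi_ne_zero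
  push_cast
  field_simp

theorem norm_phase (ℏ : ℝ) (p : LieDual n) (X : LieAlg n) : ‖phase ℏ p X‖ = 1 := by
  obtain ⟨Y, rfl⟩ := (dualEquiv n).surjective p
  rw [phase_dualEquiv, Complex.norm_exp_ofReal_mul_I]

theorem continuous_phase (ℏ : ℝ) :
    Continuous fun z : LieDual n × LieAlg n => phase ℏ z.1 z.2 := by
  unfold phase
  have : Continuous fun z : LieDual n × LieAlg n => z.1 z.2 := by fun_prop
  fun_prop

/-- The momentum Fourier integral `∫ h(q,X) e^{-(i/ℏ)⟨p,X⟩} dX`. -/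
def momentumIntegral (m : Measure G) (ℏ : ℝ) (h : G × LieAlg n → ℂ) : G × LieDual n → ℂ :=
  fun x => ∫ X, h (x.1, X) * phase ℏ x.2 X ∂(measX m)

open FourierTransform in
theorem momentumIntegral_dualEquiv (ℏ : ℝ) (h : G × LieAlg n → ℂ) (q : G) (Y : LieAlg n) :
    momentumIntegral m ℏ h (q, dualEquiv n Y) =
      ((densityAtOne (n := n) m).toReal : ℂ) *
        𝓕 (fun X => h (q, X)) ((2 * Real.pi * ℏ)⁻¹ • Y) := by
  simp only [momentumIntegral]
  rw [measX, integral_smul_measure, Real.fourier_eq', Complex.real_smul]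
  congr 2
  ext1 X
  rw [phase_dualEquiv, smul_eq_mul, mul_comm]

variable [LieGroup (𝓡 n) ∞ G] [T2Space G] [BorelSpace G] 
  (hO : IsWeaklyExponential m O) [SecondCountableTopology G] [m.IsHaarMeasure]
include hO

theorem sigmaFinite_measP : SigmaFinite (measP (n := n) m) := by
  have h2 : (densityAtOne (n := n) m)⁻¹ ≠ ⊤ := by simpa using densityAtOne_ne_zero hO
  rw [measP_eq]
  have : IsFiniteMeasureOnCompacts ((volume : Measure (LieAlg n)).map (dualEquiv n)) :=
    ⟨fun K hK => by
      rw [(dualEquiv n).measurableEmbedding.map_apply]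
      exact ((dualEquiv n).isCompact_preimage.2 hK).measure_lt_top⟩
  have := IsFiniteMeasureOnCompacts.smul ((volume : Measure (LieAlg n)).map (dualEquiv n)) h2
  infer_instance

theorem integrable_measX {f : LieAlg n → ℂ} (hf : Integrable f (measX m)) : Integrable f :=
  (integrable_smul_measure (densityAtOne_ne_zero hO) (densityAtOne_ne_top hO)).1 hf

/-- Plancherel together with the constants. With `c = densityAtOne m`, the squared prefactor gives
`c²` and `measP` gives `c⁻¹`, leaving the single `c` contained in `measX`. Rescaling the frequency
by `(2πℏ)⁻¹` gives `|2πℏ|ⁿ`, cancelled by the normalization of the Liouville measure. -/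
theorem lintegral_momentumIntegral {ℏ : ℝ} (hℏ : ℏ ≠ 0) {h : G × LieAlg n → ℂ} {q : G}
    (h1 : Integrable (fun X => h (q, X)) (measX m))
    (h2 : ∫⁻ X, ‖h (q, X)‖ₑ ^ 2 ∂(measX m) < ⊤) :
    ENNReal.ofReal (|2 * Real.pi * ℏ| ^ n)⁻¹ *
      ∫⁻ p, ‖momentumIntegral m ℏ h (q, p)‖ₑ ^ 2 ∂(measP m) =
      ∫⁻ X, ‖h (q, X)‖ₑ ^ 2 ∂(measX m) := by
  have hc0 : densityAtOne (n := n) m ≠ 0 := densityAtOne_ne_zero hO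
  have hct : densityAtOne (n := n) m ≠ ⊤ := densityAtOne_ne_top hO
  have h1' := integrable_measX hO h1
  rw [measX, lintegral_smul_measure, smul_eq_mul] at h2 ⊢
  have h2' : MemLp (fun X => h (q, X)) 2 :=
    (memLp_two_iff h1'.1).2 (lt_of_le_of_ne le_top fun h => by
      rw [h, ENNReal.mul_top hc0] at h2; exact lt_irrefl _ h2)
  rw [lintegral_measP]
  simp_rw [momentumIntegral_dualEquiv, enorm_mul, mul_pow]
  have hr : (2 * Real.pi * ℏ)⁻¹ ≠ 0 := by
    have := Real.pi_ne_zero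
    positivity
  have hm : Measurable fun w => ‖FourierTransform.fourier (fun X => h (q, X)) w‖ₑ ^ 2 := by
    have : Continuous (FourierTransform.fourier (fun X => h (q, X)) : LieAlg n → ℂ) :=
      VectorFourier.fourierIntegral_continuous Real.continuous_fourierChar
        (by exact continuous_inner) h1'
    exact this.measurable.enorm.pow_const 2
  have hs : ∫⁻ Y : LieAlg n,
      ‖FourierTransform.fourier (fun X => h (q, X)) ((2 * Real.pi * ℏ)⁻¹ • Y)‖ₑ ^ 2 =
      ENNReal.ofReal (|2 * Real.pi * ℏ| ^ n) * ∫⁻ X : LieAlg n, ‖h (q, X)‖ₑ ^ 2 := by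
    rw [← lintegral_map hm (measurable_const_smul _), Measure.map_addHaar_smul _ hr,
      lintegral_smul_measure, lintegral_fourier_sq h1' h2', smul_eq_mul,
      finrank_euclideanSpace_fin]
    congr 2
    rw [inv_pow, inv_inv, abs_pow]
  have hfin : ENNReal.ofReal (|2 * Real.pi * ℏ| ^ n) ≠ 0 := by
    have : 0 < |2 * Real.pi * ℏ| := by
      have := Real.pi_ne_zero
      positivity
    simp only [ne_eq, ENNReal.ofReal_eq_zero, not_le]
    positivity
  have hcc : ‖((densityAtOne (n := n) m).toReal : ℂ)‖ₑ = densityAtOne (n := n) m := by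
    rw [← ofReal_norm, Complex.norm_of_nonneg ENNReal.toReal_nonneg, ENNReal.ofReal_toReal hct]
  rw [lintegral_const_mul' _ _ (by simp), hs, hcc, ENNReal.ofReal_inv_of_pos (by
    have := Real.pi_ne_zero
    positivity)]
  rw [sq, mul_assoc (densityAtOne m), ENNReal.inv_mul_cancel_left hc0 hct]
  rw [mul_left_comm, ENNReal.inv_mul_cancel_left hfin ENNReal.ofReal_ne_top]

end Momentum
end LieWigner
end

/-! ### The inverse momentum Fourier transform on `L²`. -/

noncomputable section
namespace LieWigner

section Dense

variable {α : Type*} [MeasurableSpace α] (μ : Measure α)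

/-- `L¹ ∩ L²` as a subspace of `L²`. -/
def integrableLp : Submodule ℂ (Lp ℂ 2 μ) where
  carrier := {h | Integrable h μ}
  zero_mem' := (integrable_zero α ℂ μ).congr (Lp.coeFn_zero ℂ 2 μ).symm
  add_mem' := fun {a b} ha hb =>
    (Integrable.add (f := (a : α → ℂ)) (g := b) ha hb).congr (Lp.coeFn_add a b).symm
  smul_mem' := fun c a ha =>
    (Integrable.smul c (f := (a : α → ℂ)) ha).congr (Lp.coeFn_smul c a).symm

theorem denseRange_integrableLp : DenseRange (integrableLp μ).subtype := by
  have h := Lp.simpleFunc.denseRange (E := ℂ) (p := 2) (μ := μ) ENNReal.ofNat_ne_top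
  refine h.mono ?_
  rintro _ ⟨f, rfl⟩
  refine ⟨⟨f, ?_⟩, rfl⟩
  exact ((SimpleFunc.memLp_iff_integrable two_ne_zero ENNReal.ofNat_ne_top).1
    (Lp.simpleFunc.memLp f)).congr (Lp.simpleFunc.toSimpleFunc_eq_toFun f)

end Dense

section Momentum

variable {n : ℕ} {G : Type*} [TopologicalSpace G] [ChartedSpace (EuclideanSpace ℝ (Fin n)) G]
  [Group G] {O : Set (LieAlg n)} [MeasurableSpace G] {m : Measure G}
  [LieGroup (𝓡 n) ∞ G] [T2Space G] [BorelSpace G] 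
  (hO : IsWeaklyExponential m O) [SecondCountableTopology G] [m.IsHaarMeasure] {ℏ : ℝ}
include hO

omit [T2Space G] [BorelSpace G] [LieGroup (𝓡 n) ∞ G] [SecondCountableTopology G]
  [m.IsHaarMeasure] hO in
theorem measL_absolutelyContinuous : measL (n := n) m ℏ ≪ m.prod (measP m) :=
  Measure.smul_absolutelyContinuous

theorem ae_measL_of_ae {p : G → Prop} (h : ∀ᵐ q ∂m, p q) :
    ∀ᵐ x ∂(measL (n := n) m ℏ), p x.1 := by
  have := sigmaFinite_measP (G := G) hO
  exact measL_absolutelyContinuous.ae_le (Measure.quasiMeasurePreserving_fst.ae h)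

theorem ae_integrable_fiber {h : G × LieAlg n → ℂ} (h1 : Integrable h (measN m)) :
    ∀ᵐ q ∂m, Integrable (fun X => h (q, X)) (measX m) := by
  have := sigmaFinite_measX (G := G) hO
  have := sigmaFinite_haar n m
  exact h1.prod_right_ae

theorem ae_fiber_sq_lt_top {h : G × LieAlg n → ℂ} (h2 : MemLp h 2 (measN m)) :
    ∀ᵐ q ∂m, ∫⁻ X, ‖h (q, X)‖ₑ ^ 2 ∂(measX m) < ⊤ := by
  have := sigmaFinite_measX (G := G) hO
  have h3 := (memLp_two_iff h2.1).1 h2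
  have h4 : AEMeasurable (fun x => ‖h x‖ₑ ^ 2) (m.prod (measX m)) := h2.1.enorm.pow_const 2
  rw [measN, lintegral_prod _ h4] at h3
  exact ae_lt_top' h4.lintegral_prod_right' h3.ne

theorem momentumIntegral_congr {h h' : G × LieAlg n → ℂ} (hh : h =ᵐ[measN m] h') :
    momentumIntegral m ℏ h =ᵐ[measL m ℏ] momentumIntegral m ℏ h' := by
  have := sigmaFinite_measX (G := G) hO
  filter_upwards [ae_measL_of_ae hO (Measure.ae_ae_of_ae_prod hh)] with x hx
  refine integral_congr_ae ?_
  filter_upwards [hx] with X hX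
  rw [hX]

theorem stronglyMeasurable_momentumIntegral {h : G × LieAlg n → ℂ} (hh : StronglyMeasurable h) :
    StronglyMeasurable (momentumIntegral m ℏ h) := by
  have := sigmaFinite_measX (G := G) hO
  refine StronglyMeasurable.integral_prod_right'
    (f := fun z : (G × LieDual n) × LieAlg n => h (z.1.1, z.2) * phase ℏ z.1.2 z.2) ?_
  have h2 : Measurable fun z : (G × LieDual n) × LieAlg n => (z.1.2, z.2) := by fun_prop
  exact (hh.comp_measurable (by fun_prop)).mul
    ((continuous_phase ℏ).measurable.comp h2).stronglyMeasurable

theorem lintegral_measL {f : G × LieDual n → ℝ≥0∞} (hf : AEMeasurable f (m.prod (measP m))) :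
    ∫⁻ x, f x ∂(measL m ℏ) =
      ∫⁻ q, ENNReal.ofReal (|2 * Real.pi * ℏ| ^ n)⁻¹ * ∫⁻ p, f (q, p) ∂(measP m) ∂m := by
  have := sigmaFinite_measP (G := G) hO
  rw [measL, lintegral_smul_measure, lintegral_prod _ hf, smul_eq_mul,
    lintegral_const_mul' _ _ ENNReal.ofReal_ne_top]

theorem eLpNorm_momentumIntegral (hℏ : ℏ ≠ 0) {h : G × LieAlg n → ℂ}
    (hh : StronglyMeasurable h) (h1 : Integrable h (measN m)) (h2 : MemLp h 2 (measN m)) :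
    eLpNorm (momentumIntegral m ℏ h) 2 (measL m ℏ) = eLpNorm h 2 (measN m) := by
  have := sigmaFinite_measX (G := G) hO
  refine (ENNReal.pow_right_strictMono two_ne_zero).injective ?_
  have h3 : AEMeasurable (fun x => ‖h x‖ₑ ^ 2) (m.prod (measX m)) := h2.1.enorm.pow_const 2
  rw [eLpNorm_two_sq, eLpNorm_two_sq, lintegral_measL hO
    ((stronglyMeasurable_momentumIntegral hO hh).measurable.enorm.pow_const 2).aemeasurable,
    measN, lintegral_prod _ h3]
  refine lintegral_congr_ae ?_
  filter_upwards [ae_integrable_fiber hO h1, ae_fiber_sq_lt_top hO h2] with q h4 h5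
  exact lintegral_momentumIntegral hO hℏ h4 h5

theorem memLp_momentumIntegral (hℏ : ℏ ≠ 0) (h : integrableLp (measN (n := n) m)) :
    MemLp (momentumIntegral m ℏ (h : Lp ℂ 2 (measN (n := n) m))) 2 (measL m ℏ) :=
  ⟨(stronglyMeasurable_momentumIntegral hO (Lp.stronglyMeasurable _)).aestronglyMeasurable, by
    rw [eLpNorm_momentumIntegral hO hℏ (Lp.stronglyMeasurable _) h.2 (Lp.memLp _)]
    exact (Lp.memLp _).2⟩

omit [LieGroup (𝓡 n) ∞ G] [T2Space G] [BorelSpace G] hO [SecondCountableTopology G]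
  [m.IsHaarMeasure] in
theorem integrable_mul_phase {f : LieAlg n → ℂ} (hf : Integrable f (measX m)) (p : LieDual n) :
    Integrable (fun X => f X * phase ℏ p X) (measX m) := by
  refine hf.mul_bdd (c := 1) ?_ (Eventually.of_forall fun X => (norm_phase ℏ p X).le)
  exact ((continuous_phase ℏ).comp (Continuous.prodMk_right p)).aestronglyMeasurable

/-- The momentum Fourier integral on `L¹ ∩ L²`. -/
def momentumFourierAux (hℏ : ℏ ≠ 0) :
    integrableLp (measN (n := n) m) →ₗ[ℂ] Lp ℂ 2 (measL (n := n) m ℏ) where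
  toFun h := (memLp_momentumIntegral hO hℏ h).toLp _
  map_add' h k := by
    have := sigmaFinite_measX (G := G) hO
    refine Lp.ext ?_
    filter_upwards [(memLp_momentumIntegral hO hℏ (h + k)).coeFn_toLp,
      (memLp_momentumIntegral hO hℏ h).coeFn_toLp, (memLp_momentumIntegral hO hℏ k).coeFn_toLp,
      Lp.coeFn_add ((memLp_momentumIntegral hO hℏ h).toLp _)
        ((memLp_momentumIntegral hO hℏ k).toLp _),
      momentumIntegral_congr hO (ℏ := ℏ) (Lp.coeFn_add (h : Lp ℂ 2 (measN (n := n) m)) k),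
      ae_measL_of_ae hO (ae_integrable_fiber hO h.2),
      ae_measL_of_ae hO (ae_integrable_fiber hO k.2)] with x h1 h2 h3 h4 h5 h6 h7
    rw [h1, h4, Pi.add_apply, h2, h3]
    refine h5.trans ?_
    simp only [momentumIntegral, Pi.add_apply, add_mul]
    exact integral_add (integrable_mul_phase h6 x.2) (integrable_mul_phase h7 x.2)
  map_smul' c h := by
    refine Lp.ext ?_
    filter_upwards [(memLp_momentumIntegral hO hℏ (c • h)).coeFn_toLp,
      (memLp_momentumIntegral hO hℏ h).coeFn_toLp,
      Lp.coeFn_smul c ((memLp_momentumIntegral hO hℏ h).toLp _),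
      momentumIntegral_congr hO (ℏ := ℏ) (Lp.coeFn_smul c (h : Lp ℂ 2 (measN (n := n) m)))]
      with x h1 h2 h4 h5
    rw [h1, RingHom.id_apply, h4, Pi.smul_apply, h2]
    refine h5.trans ?_
    simp only [momentumIntegral, Pi.smul_apply, smul_eq_mul, mul_assoc]
    exact integral_const_mul _ _

theorem norm_momentumFourierAux (hℏ : ℏ ≠ 0) (h : integrableLp (measN (n := n) m)) :
    ‖momentumFourierAux hO hℏ h‖ = ‖(integrableLp (measN (n := n) m)).subtype h‖ := by
  change ‖(memLp_momentumIntegral hO hℏ h).toLp _‖ = _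
  rw [Lp.norm_toLp, eLpNorm_momentumIntegral hO hℏ (Lp.stronglyMeasurable _) h.2 (Lp.memLp _)]
  rfl

/-- The Fourier integral is isometric on the dense subspace `L¹ ∩ L²`, hence extends uniquely. -/
theorem existsUnique_isInvMomentumFourier (hℏ : ℏ ≠ 0) :
    ∃! T, IsInvMomentumFourier (n := n) m ℏ T := by
  have hd := denseRange_integrableLp (measN (n := n) m)
  have he : ∀ h, LinearMap.extendOfNorm (momentumFourierAux hO hℏ) (integrableLp _).subtype
      ((integrableLp (measN (n := n) m)).subtype h) = momentumFourierAux hO hℏ h :=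
    LinearMap.extendOfNorm_eq hd ⟨1, fun h => by rw [norm_momentumFourierAux, one_mul]⟩
  refine ⟨LinearMap.extendOfNorm (momentumFourierAux hO hℏ) (integrableLp _).subtype, ?_, ?_⟩
  · intro h hh
    have := he ⟨h, hh⟩
    simp only [Submodule.subtype_apply] at this
    rw [this]
    exact (memLp_momentumIntegral hO hℏ ⟨h, hh⟩).coeFn_toLp
  · intro T hT
    refine ContinuousLinearMap.coeFn_injective ?_
    refine hd.equalizer T.continuous (ContinuousLinearMap.continuous _) ?_
    ext1 h
    simp only [Function.comp_apply]
    rw [he h]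
    exact Lp.ext ((hT h h.2).trans (memLp_momentumIntegral hO hℏ h).coeFn_toLp.symm)

theorem invMomentumFourier_spec (hℏ : ℏ ≠ 0) :
    IsInvMomentumFourier (n := n) m ℏ (invMomentumFourier m ℏ) :=
  Classical.epsilon_spec (existsUnique_isInvMomentumFourier hO hℏ).exists

theorem norm_invMomentumFourier (hℏ : ℏ ≠ 0) (h : Lp ℂ 2 (measN (n := n) m)) :
    ‖invMomentumFourier m ℏ h‖ = ‖h‖ := by
  refine (denseRange_integrableLp (measN (n := n) m)).induction_on
    (p := fun h => ‖invMomentumFourier m ℏ h‖ = ‖h‖) h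
    (isClosed_eq (by fun_prop) continuous_norm) fun k => ?_
  rw [← norm_momentumFourierAux hO hℏ k]
  congr 1
  exact Lp.ext ((invMomentumFourier_spec hO hℏ k k.2).trans
    (memLp_momentumIntegral hO hℏ k).coeFn_toLp.symm)

theorem invMomentumFourier_toLp (hℏ : ℏ ≠ 0) {h : G × LieAlg n → ℂ}
    (h1 : Integrable h (measN m)) (h2 : MemLp h 2 (measN m)) :
    (invMomentumFourier m ℏ (h2.toLp h) : G × LieDual n → ℂ) =ᵐ[measL m ℏ]
      momentumIntegral m ℏ h :=
  (invMomentumFourier_spec hO hℏ _ (h1.congr h2.coeFn_toLp.symm)).trans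
    (momentumIntegral_congr hO h2.coeFn_toLp)

/-- The identification of `L²(G × O)` and `L(M)` by the inverse momentum Fourier transform. -/
def momentumIso (O' : Set (LieAlg n)) (hℏ : ℏ ≠ 0) : L2O (n := n) m O' ≃ₗᵢ[ℂ] LM (n := n) m ℏ O' :=
  LinearIsometryEquiv.ofSurjective
    { toLinearMap := (invMomentumFourier (n := n) m ℏ).toLinearMap.submoduleMap (L2O m O')
      norm_map' := fun h => norm_invMomentumFourier hO hℏ (h : Lp ℂ 2 (measN (n := n) m)) }
    (LinearMap.submoduleMap_surjective _ _)

/-- The isometry that assigns phase space functions to Hilbert-Schmidt kernels. -/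
def kernelIso (hℏ : ℏ ≠ 0) : Lp ℂ 2 (m.prod m) ≃ₗᵢ[ℂ] LM (n := n) m ℏ O :=
  (symbolIso m hO).trans (momentumIso hO O hℏ)

theorem kernelIso_toLp (hℏ : ℏ ≠ 0) {k : G × G → ℂ} (hk : MemLp k 2 (m.prod m)) :
    kernelIso hO hℏ (hk.toLp k) = symbol m ℏ O k := by
  rw [symbol, toLM]
  refine Subtype.ext ?_
  change invMomentumFourier m ℏ (symbolIso m hO (hk.toLp k) : Lp ℂ 2 (measN (n := n) m)) = _
  exact congrArg (fun h : L2O m O => invMomentumFourier m ℏ (h : Lp ℂ 2 (measN (n := n) m)))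
    (toL2O_symbolTilde_eq_symbolIso hO hk).symm

theorem coe_kernelIso_toLp (hℏ : ℏ ≠ 0) {k : G × G → ℂ} (hk : MemLp k 2 (m.prod m)) :
    (kernelIso hO hℏ (hk.toLp k) : Lp ℂ 2 (measL (n := n) m ℏ)) =
      invMomentumFourier m ℏ ((memLp_symbolTilde hO hk).toLp _) := by
  rw [← coe_symbolIso_toLp hO hk]
  rfl

end Momentum
end LieWigner
end

/-! ### Density of test kernels and integrability of their symbols. -/

noncomputable section
namespace LieWigner

section TestKernel

variable {n : ℕ} {G : Type*} [TopologicalSpace G] [ChartedSpace (EuclideanSpace ℝ (Fin n)) G]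
  [Group G] {O : Set (LieAlg n)} [MeasurableSpace G] {m : Measure G}
  [LieGroup (𝓡 n) ∞ G] [T2Space G] [BorelSpace G]
  (hO : IsWeaklyExponential m O) [SecondCountableTopology G] [m.IsHaarMeasure] {ℏ : ℝ}

omit [T2Space G] in
theorem memLp_of_continuous_of_hasCompactSupport (n : ℕ)
    [ChartedSpace (EuclideanSpace ℝ (Fin n)) G] [LieGroup (𝓡 n) ∞ G] {k : G × G → ℂ}
    (hk : Continuous k) (hk' : HasCompactSupport k) : MemLp k 2 (m.prod m) := by
  have := sigmaFinite_haar n m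
  exact hk.memLp_of_hasCompactSupport hk'

omit [T2Space G] in
theorem IsTestKernel.memLp {k : G × G → ℂ} (hk : IsTestKernel (n := n) k) :
    MemLp k 2 (m.prod m) :=
  memLp_of_continuous_of_hasCompactSupport n hk.1.continuous hk.2

variable (n m) in
/-- The subspace of `L²(G × G)` of the classes of test kernels. -/
def testKernels : Submodule ℂ (Lp ℂ 2 (m.prod m)) where
  carrier := {h | ∃ k : G × G → ℂ, IsTestKernel (n := n) k ∧ h =ᵐ[m.prod m] k}
  zero_mem' := ⟨0, ⟨contMDiff_const, HasCompactSupport.zero⟩, Lp.coeFn_zero ℂ 2 _⟩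
  add_mem' := by
    rintro a b ⟨k, hk, hak⟩ ⟨l, hl, hbl⟩
    exact ⟨k + l, ⟨hk.1.add hl.1, hk.2.add hl.2⟩, (Lp.coeFn_add a b).trans (hak.add hbl)⟩
  smul_mem' := by
    rintro c a ⟨k, hk, hak⟩
    refine ⟨c • k, ⟨?_, hk.2.smul_left (f := fun _ => c)⟩,
      (Lp.coeFn_smul c a).trans (hak.const_smul c)⟩
    exact (contDiff_const_smul (𝕜 := ℝ) (n := ∞) (F := ℂ) c).contMDiff.comp hk.1

/-- A square integrable function orthogonal to all real smooth compactly supported functions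
vanishes almost everywhere, so the orthogonal complement is trivial. -/
theorem testKernels_topologicalClosure : (testKernels n m).topologicalClosure = ⊤ := by
  have := sigmaFinite_haar n m
  have := isManifold_infty n G
  have := locallyCompactSpace_of_charted n G
  rw [Submodule.topologicalClosure_eq_top_iff, Submodule.eq_bot_iff]
  intro h hh
  have hloc : LocallyIntegrable (h : G × G → ℂ) (m.prod m) :=
    (Lp.memLp h).locallyIntegrable (by norm_num)
  have h0 := ae_eq_zero_of_integral_contMDiff_smul_eq_zero ((𝓡 n).prod (𝓡 n)) hloc ?_
  · exact (Lp.eq_zero_iff_ae_eq_zero).2 h0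
  · intro g hg hgc
    have hgC : IsTestKernel (n := n) (fun x : G × G => (g x : ℂ)) :=
      ⟨Complex.ofRealCLM.contDiff.contMDiff.comp hg,
        hgc.comp_left (g := fun r : ℝ => (r : ℂ)) Complex.ofReal_zero⟩
    have hmem := hgC.memLp (m := m)
    have h1 := (Submodule.mem_orthogonal _ _).1 hh (hmem.toLp _)
      ⟨_, hgC, hmem.coeFn_toLp⟩
    rw [L2.inner_def] at h1
    rw [← h1]
    refine integral_congr_ae ?_
    filter_upwards [hmem.coeFn_toLp] with x hx
    rw [hx, RCLike.inner_apply, Complex.real_smul, Complex.conj_ofReal, mul_comm]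

theorem eq_of_eq_on_testKernels {E : Type*} [TopologicalSpace E] [T2Space E]
    {f g : Lp ℂ 2 (m.prod m) → E} (hf : Continuous f) (hg : Continuous g)
    (h : ∀ k : G × G → ℂ, ∀ hk : IsTestKernel (n := n) k,
      f (hk.memLp.toLp k) = g (hk.memLp.toLp k)) : f = g := by
  refine Continuous.ext_on (s := (testKernels n m : Set (Lp ℂ 2 (m.prod m)))) ?_ hf hg ?_
  · rw [dense_iff_closure_eq, ← Submodule.topologicalClosure_coe, testKernels_topologicalClosure]
    rfl
  · rintro x ⟨k, hk, hxk⟩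
    have : x = hk.memLp.toLp k := Lp.ext (hxk.trans hk.memLp.coeFn_toLp.symm)
    rw [this]
    exact h k hk

include hO

/-- This is where the precompactness condition on `exp⁻¹` enters. A kernel supported in `K₁ × K₂`
has a symbol whose `X` satisfies `exp X ∈ K₁⁻¹ K₂`, so `X` stays in a compact set even where `O` is
unbounded. -/
theorem isCompact_closure_preimage_inv_mul {K₁ K₂ : Set G} (h1 : IsCompact K₁)
    (h2 : IsCompact K₂) : IsCompact (closure (O ∩ (lieExp : LieAlg n → G) ⁻¹'
      (expImage G O ∩ (fun x : G × G => x.1⁻¹ * x.2) '' (K₁ ×ˢ K₂)))) := by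
  have := topologicalGroup_of_lieGroup (𝓡 n) ∞ (G := G)
  refine hO.precompact _ Set.inter_subset_left ?_
  exact ((h1.prod h2).image (by fun_prop)).closure_of_subset Set.inter_subset_right

theorem integrable_of_bounded_of_compact {f : G × LieAlg n → ℂ} {K : Set G} {C : Set (LieAlg n)}
    (hf : AEStronglyMeasurable f (measN m)) (hK : IsCompact K) (hC : IsCompact C) {M : ℝ}
    (hM : ∀ y, ‖f y‖ ≤ M) (h0 : ∀ y, f y ≠ 0 → y.1 ∈ K ∧ y.2 ∈ C) : Integrable f (measN m) := by
  have := sigmaFinite_haar n m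
  have hfin : IsFiniteMeasureOnCompacts (measX (n := n) m) := by
    unfold measX
    exact IsFiniteMeasureOnCompacts.smul _ (densityAtOne_ne_top hO)
  have := sigmaFinite_measX (G := G) hO
  have hs : Function.support f ⊆ K ×ˢ C := fun y hy => h0 y hy
  rw [← integrableOn_iff_integrable_of_support_subset hs]
  refine Measure.integrableOn_of_bounded (M := M) ?_ hf (Eventually.of_forall hM)
  exact ((hK.prod hC).measure_lt_top (μ := m.prod (measX m))).ne

/-- The symbol is bounded with relatively compact support. Integrability is needed because the `L²`
transform is given by an honest integral only on `L¹ ∩ L²`. -/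
theorem integrable_symbolTilde {k : G × G → ℂ} (hk : StronglyMeasurable k) {M : ℝ}
    (hM : ∀ x, ‖k x‖ ≤ M) {K₁ K₂ : Set G} (h1 : IsCompact K₁) (h2 : IsCompact K₂)
    (h0 : ∀ x, k x ≠ 0 → x.1 ∈ K₁ ∧ x.2 ∈ K₂) : Integrable (symbolTilde O k) (measN m) := by
  have := topologicalGroup_of_lieGroup (𝓡 n) ∞ (G := G)
  have hexp := continuous_lieExp (G := G) hO
  have hC := isCompact_closure_preimage_inv_mul hO h1 h2
  set C := closure (O ∩ (lieExp : LieAlg n → G) ⁻¹'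
      (expImage G O ∩ (fun x : G × G => x.1⁻¹ * x.2) '' (K₁ ×ˢ K₂))) with hCdef
  have hK : IsCompact ((fun z : G × LieAlg n => z.1 * lieExp ((1 / 2 : ℝ) • z.2)) '' (K₁ ×ˢ C)) :=
    (h1.prod hC).image (by fun_prop)
  obtain ⟨B, hB⟩ := hC.exists_bound_of_continuousOn (continuous_weightF (G := G) hO).continuousOn
  have hsupp : ∀ y, symbolTilde O k y ≠ 0 →
      y.1 ∈ (fun z : G × LieAlg n => z.1 * lieExp ((1 / 2 : ℝ) • z.2)) '' (K₁ ×ˢ C) ∧ y.2 ∈ C := by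
    rintro ⟨q, X⟩ hy
    rw [symbolTilde_eq_indicator] at hy
    have hX : X ∈ O := by
      by_contra hX
      exact hy (Set.indicator_of_notMem (fun h => hX h.2) _)
    rw [Set.indicator_of_mem (by exact ⟨trivial, hX⟩)] at hy
    obtain ⟨ha, hb⟩ := h0 _ (left_ne_zero_of_mul hy)
    have hXC : X ∈ C := subset_closure ⟨hX, lieExp_mem_expImage hX, _, ⟨ha, hb⟩,
      endpoints_inv_mul q X⟩
    refine ⟨⟨((endpoints (q, X)).1, X), ⟨ha, hXC⟩, ?_⟩, hXC⟩
    simp only [endpoints, lieExp_neg_half, inv_mul_cancel_right]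
  refine integrable_of_bounded_of_compact hO (M := |M| * |B|)
    (aestronglyMeasurable_symbolTilde hO hk.aestronglyMeasurable) hK hC (fun y => ?_) hsupp
  by_cases hy : symbolTilde O k y = 0
  · rw [hy, norm_zero]; positivity
  · have hyC := (hsupp y hy).2
    rw [symbolTilde_eq_indicator]
    refine (norm_indicator_le_norm_self _ _).trans ?_
    rw [norm_mul, Complex.norm_real]
    exact mul_le_mul ((hM _).trans (le_abs_self M)) ((hB _ hyC).trans (le_abs_self B))
      (norm_nonneg _) (abs_nonneg M)

end TestKernel
end LieWigner
end

/-! ### The star formula rewritten as an integral over `G`. -/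

noncomputable section
namespace LieWigner

section StarFormula

variable {n : ℕ} {G : Type*} [TopologicalSpace G] [ChartedSpace (EuclideanSpace ℝ (Fin n)) G]
  [Group G] {O : Set (LieAlg n)} [MeasurableSpace G] {m : Measure G}
  [LieGroup (𝓡 n) ∞ G] [T2Space G] [BorelSpace G]
  (hO : IsWeaklyExponential m O) [SecondCountableTopology G] [m.IsHaarMeasure] {ℏ : ℝ}

variable (G O m) in
/-- The Haar measure in exponential coordinates. -/
def haarCoord : Measure (LieAlg n) :=
  ((measX m).restrict O).withDensity fun X => ((expJac G O X).toNNReal : ℝ≥0∞)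

include hO

theorem measurable_toNNReal_expJac :
    Measurable fun X : LieAlg n => (expJac G O X).toNNReal :=
  (continuous_expJac hO).measurable.real_toNNReal

theorem sigmaFinite_haarCoord : SigmaFinite (haarCoord (n := n) G O m) := by
  have := sigmaFinite_measX (G := G) hO
  exact SigmaFinite.withDensity (μ := (measX m).restrict O)
    (fun X => (expJac G O X).toNNReal)

theorem measurePreserving_lieExp :
    MeasurePreserving (lieExp : LieAlg n → G) (haarCoord G O m) m := by
  have hexp := measurable_lieExp (G := G) hO
  refine ⟨hexp, Measure.ext fun s hs => ?_⟩
  rw [Measure.map_apply hexp hs, ← lintegral_indicator_one hs,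
    lintegral_haar hO ((measurable_one (β := G) (α := ℝ≥0∞)).indicator hs), haarCoord, withDensity_apply _ (hexp hs),
    ← lintegral_indicator (hexp hs)]
  refine lintegral_congr fun X => ?_
  by_cases hX : lieExp X ∈ s
  · rw [Set.indicator_of_mem (by exact hX), Set.indicator_of_mem hX, Pi.one_apply, mul_one]
    rfl
  · rw [Set.indicator_of_notMem (by exact hX), Set.indicator_of_notMem hX, mul_zero]

theorem integral_haarCoord_prod (f : LieAlg n × LieAlg n → ℂ) :
    ∫ z, f z ∂((haarCoord G O m).prod (haarCoord G O m)) =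
      ∫ z in O ×ˢ O, ((expJac G O z.1 * expJac G O z.2 : ℝ) : ℂ) * f z
        ∂((measX m).prod (measX m)) := by
  have := sigmaFinite_measX (G := G) hO
  have hJ := measurable_toNNReal_expJac (G := G) hO
  rw [haarCoord, prod_withDensity₀ hJ.coe_nnreal_ennreal.aemeasurable
    hJ.coe_nnreal_ennreal.aemeasurable, Measure.prod_restrict]
  have h1 : (fun z : LieAlg n × LieAlg n => ((expJac G O z.1).toNNReal : ℝ≥0∞) *
      ((expJac G O z.2).toNNReal : ℝ≥0∞)) =
      fun z => (((expJac G O z.1).toNNReal * (expJac G O z.2).toNNReal : NNReal) : ℝ≥0∞) := by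
    ext1 z; push_cast; rfl
  have hm : Measurable fun z : LieAlg n × LieAlg n =>
      (expJac G O z.1).toNNReal * (expJac G O z.2).toNNReal :=
    (hJ.comp measurable_fst).mul (hJ.comp measurable_snd)
  rw [h1, integral_withDensity_eq_integral_smul hm]
  congr 1
  ext1 z
  rw [NNReal.smul_def, NNReal.coe_mul, Real.coe_toNNReal _ (expJac_nonneg _),
    Real.coe_toNNReal _ (expJac_nonneg _), Complex.real_smul]

theorem integral_prod_haarCoord (f : G × LieAlg n → ℂ) :
    ∫ z, f z ∂(m.prod (haarCoord G O m)) =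
      ∫ z in Set.univ ×ˢ O, ((expJac G O z.2 : ℝ) : ℂ) * f z ∂(measN m) := by
  have := sigmaFinite_measX (G := G) hO
  have := sigmaFinite_haar n m
  have hJ := measurable_toNNReal_expJac (G := G) hO
  have hm : Measurable fun z : G × LieAlg n => (expJac G O z.2).toNNReal := hJ.comp measurable_snd
  rw [haarCoord, prod_withDensity_right₀ hJ.coe_nnreal_ennreal.aemeasurable,
    integral_withDensity_eq_integral_smul hm, measN_restrict]
  congr 1
  ext1 z
  rw [NNReal.smul_def, Real.coe_toNNReal _ (expJac_nonneg _), Complex.real_smul]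

/-- Integration over `𝔤 × 𝔤` in terms of the factors `exp X` and `exp X exp Y` in `G`. -/
theorem integral_expJac_mul (Ψ : G × G → ℂ) (hΨ : Measurable Ψ) :
    ∫ z in O ×ˢ O, ((expJac G O z.1 * expJac G O z.2 : ℝ) : ℂ) *
        Ψ (lieExp z.1, lieExp z.1 * lieExp z.2) ∂((measX m).prod (measX m)) =
      ∫ z in Set.univ ×ˢ O, ((expJac G O z.2 : ℝ) : ℂ) * Ψ (z.1, lieExp z.2) ∂(measN m) := by
  have := topologicalGroup_of_lieGroup (𝓡 n) ∞ (G := G)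
  have := sigmaFinite_haarCoord (G := G) hO
  have := sigmaFinite_haar n m
  have hp := measurePreserving_lieExp hO
  rw [← integral_haarCoord_prod hO (fun z => Ψ (lieExp z.1, lieExp z.1 * lieExp z.2)),
    ← integral_prod_haarCoord hO (fun z => Ψ (z.1, lieExp z.2))]
  -- By left invariance the shear `(x, y) ↦ (x, x y)` preserves `m × m`. Both integrals are
  -- therefore the integral of `Ψ` over `G × G`, with two or one of the variables in exponential
  -- coordinates.
  have h1 : MeasurePreserving (fun z : LieAlg n × LieAlg n =>
      ((lieExp z.1 : G), (lieExp z.1 * lieExp z.2 : G)))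
      ((haarCoord G O m).prod (haarCoord G O m)) (m.prod m) :=
    (measurePreserving_prod_mul m m).comp (hp.prod hp)
  have h2 : MeasurePreserving (fun z : G × LieAlg n => (z.1, (lieExp z.2 : G)))
      (m.prod (haarCoord G O m)) (m.prod m) := (MeasurePreserving.id m).prod hp
  have e1 := integral_map (μ := (haarCoord G O m).prod (haarCoord G O m)) h1.measurable.aemeasurable (f := Ψ) hΨ.aestronglyMeasurable
  have e2 := integral_map (μ := m.prod (haarCoord G O m)) h2.measurable.aemeasurable (f := Ψ) hΨ.aestronglyMeasurable
  rw [h1.map_eq] at e1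
  rw [h2.map_eq] at e2
  exact e1.symm.trans e2

omit hO in
/-- The integrand of the star product of two kernels in the variables `exp X` and
`exp X exp Y`. -/
def starIntegrand (O : Set (LieAlg n)) (ℏ : ℝ) (k l : G × G → ℂ) (q : G) (p : LieDual n)
    (x : G × G) : ℂ :=
  (expImage G O).indicator (1 : G → ℂ) x.2 *
    (k (q * lieExp ((-(1 / 2) : ℝ) • (expImage G O).indicator (lieLog O) x.2),
      q * lieExp ((-(1 / 2) : ℝ) • (expImage G O).indicator (lieLog O) x.2) * x.1) *
    l (q * lieExp ((-(1 / 2) : ℝ) • (expImage G O).indicator (lieLog O) x.2) * x.1,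
      q * lieExp ((1 / 2 : ℝ) • (expImage G O).indicator (lieLog O) x.2)) *
    phase ℏ p ((expImage G O).indicator (lieLog O) x.2) *
    ((absDetAd n (lieExp ((1 / 2 : ℝ) • (expImage G O).indicator (lieLog O) x.2) : G) /
      weightF G ((expImage G O).indicator (lieLog O) x.2) : ℝ) : ℂ))

theorem measurable_starIntegrand {k l : G × G → ℂ} (hk : Measurable k) (hl : Measurable l)
    (q : G) (p : LieDual n) : Measurable (starIntegrand O ℏ k l q p) := by
  have := topologicalGroup_of_lieGroup (𝓡 n) ∞ (G := G)
  have hexp := measurable_lieExp (G := G) hO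
  have hL := measurable_indicator_lieLog (G := G) hO
  have hF : Measurable (weightF G : LieAlg n → ℝ) := (continuous_weightF (G := G) hO).measurable
  have hp : Measurable fun X : LieAlg n => phase ℏ p X :=
    ((continuous_phase ℏ).comp (Continuous.prodMk_right p)).measurable
  have hd : Measurable fun X : LieAlg n => absDetAd n (lieExp X : G) :=
    (continuous_absDetAd_lieExp hO).measurable
  have h1 : Measurable ((expImage G O).indicator (1 : G → ℂ)) :=
    measurable_one.indicator (measurableSet_expImage hO)
  have e1 : Measurable fun x : G × G => (expImage G O).indicator (lieLog O : G → LieAlg n) x.2 :=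
    hL.comp measurable_snd
  have e2 : Measurable fun x : G × G =>
      q * (lieExp ((-(1 / 2) : ℝ) • (expImage G O).indicator (lieLog O) x.2) : G) :=
    (hexp.comp (e1.const_smul (-(1 / 2) : ℝ))).const_mul q
  have e3 : Measurable fun x : G × G =>
      q * (lieExp ((1 / 2 : ℝ) • (expImage G O).indicator (lieLog O) x.2) : G) :=
    (hexp.comp (e1.const_smul (1 / 2 : ℝ))).const_mul q
  have e4 := e2.mul measurable_fst
  have e5 : Measurable fun x : G × G => absDetAd n
      (lieExp ((1 / 2 : ℝ) • (expImage G O).indicator (lieLog O) x.2) : G) :=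
    hd.comp (e1.const_smul (1 / 2 : ℝ))
  exact (h1.comp measurable_snd).mul ((((hk.comp (e2.prodMk e4)).mul (hl.comp (e4.prodMk e3))).mul
    (hp.comp e1)).mul (Complex.measurable_ofReal.comp (e5.div (hF.comp e1))))

/-- The Jacobian of the outer variable times `|det Ad_{exp(Z/2)}|` is `F(Z)²`; division by `F(Z)`
leaves exactly the weight of the symbol of the product. -/
theorem expJac_mul_starIntegrand (k l : G × G → ℂ) (q : G) (p : LieDual n) (x : G)
    {Z : LieAlg n} (hZ : Z ∈ O) :
    ((expJac G O Z : ℝ) : ℂ) * starIntegrand O ℏ k l q p (x, lieExp Z) =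
      k ((endpoints (q, Z)).1, (endpoints (q, Z)).1 * x) *
        l ((endpoints (q, Z)).1 * x, (endpoints (q, Z)).2) * phase ℏ p Z * (weightF G Z : ℂ) := by
  have hF := weightF_pos (G := G) hO hZ
  have h1 : ((expJac G O Z : ℝ) : ℂ) *
      ((absDetAd n (lieExp ((1 / 2 : ℝ) • Z) : G) / weightF G Z : ℝ) : ℂ) = (weightF G Z : ℂ) := by
    rw [← Complex.ofReal_mul, ← mul_div_assoc, ← weightF_sq hO, mul_div_assoc, div_self hF.ne',
      mul_one]
  rw [starIntegrand]
  simp only [Set.indicator_of_mem (lieExp_mem_expImage (G := G) hZ), lieLog_lieExp hO hZ,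
    Pi.one_apply, one_mul, endpoints]
  rw [mul_left_comm, h1]

/-- In general `exp(X/2) exp(Y/2)` is not `exp(Z/2)`, but `|det Ad|` is multiplicative and positive,
so it is enough to compare squares. -/
theorem absDetAd_half_mul_half {X Y Z : LieAlg n}
    (h : (lieExp X * lieExp Y : G) = lieExp Z) :
    absDetAd n (lieExp ((1 / 2 : ℝ) • X) : G) * absDetAd n (lieExp ((1 / 2 : ℝ) • Y) : G) =
      absDetAd n (lieExp ((1 / 2 : ℝ) • Z) : G) := by
  have hs : ∀ W : LieAlg n, absDetAd n (lieExp ((1 / 2 : ℝ) • W) : G) ^ 2 =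
      absDetAd n (lieExp W : G) := by
    intro W
    rw [sq, ← absDetAd_mul hO, lieExp_half_mul_half]
  refine (pow_left_inj₀ (mul_nonneg (absDetAd_nonneg _) (absDetAd_nonneg _))
    (absDetAd_nonneg _) two_ne_zero).1 ?_
  rw [mul_pow, hs, hs, hs, ← absDetAd_mul hO, h]

/-- With `Z = X ⋄ Y`, the first kernel is evaluated at `(q exp(-Z/2), c)` and the second at `(c, q
exp(Z/2))` with the same `c = q exp(-Z/2) exp X`: the shifts in the star formula are chosen so that
the inner endpoints coincide. The weights combine by `F(X)² F(Y)² = J(X) J(Y) |det Ad_{exp(Z/2)}|`,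
where `J` is `expJac`. -/
theorem starFormula_integrand_eq (k l : G × G → ℂ) (q : G) (p : LieDual n)
    {X Y : LieAlg n} (hX : X ∈ O) (hY : Y ∈ O) :
    symbolTilde O k (q * lieExp ((-(1 / 2) : ℝ) • bch G O X Y) * lieExp ((1 / 2 : ℝ) • X), X) *
    symbolTilde O l (q * lieExp ((1 / 2 : ℝ) • bch G O X Y) * lieExp ((-(1 / 2) : ℝ) • Y), Y) *
    phase ℏ p (bch G O X Y) * (weightL G O X Y : ℂ) =
    ((expJac G O X * expJac G O Y : ℝ) : ℂ) *
        starIntegrand O ℏ k l q p (lieExp X, lieExp X * lieExp Y) := by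
  by_cases hU : (lieExp X * lieExp Y : G) ∈ expImage G O
  swap
  · rw [weightL, if_neg (fun h => hU h.2.2), starIntegrand, Set.indicator_of_notMem hU]
    simp
  have hZ : bch G O X Y = lieLog O (lieExp X * lieExp Y : G) := rfl
  set Z := bch G O X Y with hZdef
  have hZe : (lieExp X * lieExp Y : G) = lieExp Z := by rw [hZ, lieExp_lieLog hU]
  have hZO : Z ∈ O := hZ ▸ lieLog_mem hU
  have hFZ := weightF_pos (G := G) hO hZO
  have hc : q * lieExp ((1 / 2 : ℝ) • Z) * lieExp ((-(1 / 2) : ℝ) • Y) *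
      (lieExp ((-(1 / 2) : ℝ) • Y) : G) =
      q * lieExp ((-(1 / 2) : ℝ) • Z) * lieExp X := by
    have h1 : (lieExp ((1 / 2 : ℝ) • Z) : G) =
        lieExp ((-(1 / 2) : ℝ) • Z) * (lieExp X * lieExp Y) := by
      rw [hZe, lieExp_neg_half]
      exact (eq_inv_mul_iff_mul_eq.2 (lieExp_half_mul_half Z))
    rw [h1, ← lieExp_half_mul_half Y, lieExp_neg_half Y]
    group
  have hX2 : q * lieExp ((-(1 / 2) : ℝ) • Z) * lieExp ((1 / 2 : ℝ) • X) *
      (lieExp ((1 / 2 : ℝ) • X) : G) = q * lieExp ((-(1 / 2) : ℝ) • Z) * lieExp X := by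
    rw [mul_assoc, lieExp_half_mul_half]
  have hX1 : q * lieExp ((-(1 / 2) : ℝ) • Z) * lieExp ((1 / 2 : ℝ) • X) *
      (lieExp ((-(1 / 2) : ℝ) • X) : G) = q * lieExp ((-(1 / 2) : ℝ) • Z) := by
    rw [lieExp_neg_half X, mul_inv_cancel_right]
  have hY1 : q * lieExp ((1 / 2 : ℝ) • Z) * lieExp ((-(1 / 2) : ℝ) • Y) *
      (lieExp ((1 / 2 : ℝ) • Y) : G) = q * lieExp ((1 / 2 : ℝ) • Z) := by
    rw [lieExp_neg_half Y, inv_mul_cancel_right]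
  have hwt : weightF G X * weightF G Y * weightL G O X Y =
      expJac G O X * expJac G O Y *
        (absDetAd n (lieExp ((1 / 2 : ℝ) • Z) : G) / weightF G Z) := by
    rw [weightL, if_pos ⟨hX, hY, hU⟩, ← absDetAd_half_mul_half hO hZe, ← hZdef]
    have e1 := weightF_sq (G := G) hO X
    have e2 := weightF_sq (G := G) hO Y
    rw [← mul_div_assoc, ← mul_div_assoc]
    congr 1
    linear_combination weightF G Y * weightF G Y * e1 +
      expJac G O X * absDetAd n (lieExp ((1 / 2 : ℝ) • X) : G) * e2
  rw [symbolTilde, symbolTilde, if_pos hX, if_pos hY, starIntegrand]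
  simp only [hZe, Set.indicator_of_mem (lieExp_mem_expImage (G := G) hZO), lieLog_lieExp hO hZO,
    Pi.one_apply, one_mul, hX1, hX2, hY1, hc]
  have hwt' := congrArg (fun r : ℝ => (r : ℂ)) hwt
  simp only [Complex.ofReal_mul] at hwt' ⊢
  linear_combination (k (q * lieExp ((-(1 / 2) : ℝ) • Z),
    q * lieExp ((-(1 / 2) : ℝ) • Z) * lieExp X) *
    l (q * lieExp ((-(1 / 2) : ℝ) • Z) * lieExp X, q * lieExp ((1 / 2 : ℝ) • Z)) *
    phase ℏ p Z) * hwt'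

theorem starFormula_eq_integral {k l : G × G → ℂ} (hk : Measurable k) (hl : Measurable l)
    (x : G × LieDual n) :
    starFormula m ℏ O (symbolTilde O k) (symbolTilde O l) x =
      ∫ z in Set.univ ×ˢ O, k ((endpoints (x.1, z.2)).1, (endpoints (x.1, z.2)).1 * z.1) *
        l ((endpoints (x.1, z.2)).1 * z.1, (endpoints (x.1, z.2)).2) * phase ℏ x.2 z.2 *
          (weightF G z.2 : ℂ) ∂(measN m) := by
  have hOm := hO.isOpen.measurableSet
  rw [starFormula, ← setIntegral_eq_integral_of_forall_compl_eq_zero (s := O ×ˢ O)]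
  swap
  · intro z hz
    rw [weightL, if_neg fun h => hz ⟨h.1, h.2.1⟩, Complex.ofReal_zero, mul_zero]
  rw [setIntegral_congr_fun (hOm.prod hOm)
    (fun z hz => starFormula_integrand_eq hO k l x.1 x.2 hz.1 hz.2),
    integral_expJac_mul hO _ (measurable_starIntegrand hO hk hl x.1 x.2)]
  exact setIntegral_congr_fun (MeasurableSet.univ.prod hOm)
    (fun z hz => expJac_mul_starIntegrand hO k l x.1 x.2 z.1 hz.2)

end StarFormula
end LieWigner
end

/-! ### The star product as composition of kernels. -/

noncomputable section
namespace LieWigner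

section StarProduct

variable {n : ℕ} {G : Type*} [TopologicalSpace G] [ChartedSpace (EuclideanSpace ℝ (Fin n)) G]
  [Group G] {O : Set (LieAlg n)} [MeasurableSpace G] {m : Measure G}
  [LieGroup (𝓡 n) ∞ G] [T2Space G] [BorelSpace G]
  (hO : IsWeaklyExponential m O) [SecondCountableTopology G] [m.IsHaarMeasure] {ℏ : ℝ}
include hO

theorem integrable_starIntegrand {k l : G × G → ℂ} (hk : Continuous k) (hk' : HasCompactSupport k)
    (hl : Continuous l) (hl' : HasCompactSupport l) (q : G) (p : LieDual n) :
    IntegrableOn (fun z : G × LieAlg n =>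
      k ((endpoints (q, z.2)).1, (endpoints (q, z.2)).1 * z.1) *
        l ((endpoints (q, z.2)).1 * z.1, (endpoints (q, z.2)).2) * phase ℏ p z.2 *
          (weightF G z.2 : ℂ)) (Set.univ ×ˢ O) (measN m) := by
  have := topologicalGroup_of_lieGroup (𝓡 n) ∞ (G := G)
  have hexp := continuous_lieExp (G := G) hO
  have hF := continuous_weightF (G := G) hO
  have hOm := hO.isOpen.measurableSet
  set f : G × LieAlg n → ℂ := fun z =>
    k ((endpoints (q, z.2)).1, (endpoints (q, z.2)).1 * z.1) *
        l ((endpoints (q, z.2)).1 * z.1, (endpoints (q, z.2)).2) * phase ℏ p z.2 *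
          (weightF G z.2 : ℂ) with hf
  have hfc : Continuous f := by
    have hend := continuous_endpoints (G := G) hO
    have hph := continuous_phase (n := n) ℏ
    have h1 : Continuous fun z : G × LieAlg n => phase ℏ p z.2 :=
      hph.comp (continuous_const.prodMk continuous_snd)
    fun_prop
  obtain ⟨Mk, hMk⟩ := hk'.exists_bound_of_continuous hk
  obtain ⟨Ml, hMl⟩ := hl'.exists_bound_of_continuous hl
  have hK1 := hk'.image continuous_fst
  have hK2 := hl'.image continuous_snd
  have hK3 := hk'.image continuous_snd
  set K₁ := Prod.fst '' tsupport k
  set K₂ := Prod.snd '' tsupport l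
  set K₃ := Prod.snd '' tsupport k
  have hC := isCompact_closure_preimage_inv_mul hO hK1 hK2
  set C := closure (O ∩ (lieExp : LieAlg n → G) ⁻¹'
      (expImage G O ∩ (fun x : G × G => x.1⁻¹ * x.2) '' (K₁ ×ˢ K₂))) with hCdef
  have hK : IsCompact ((fun z : G × LieAlg n => (endpoints (q, z.2)).1⁻¹ * z.1) '' (K₃ ×ˢ C)) := by
    have hend := continuous_endpoints (G := G) hO
    exact (hK3.prod hC).image (by fun_prop)
  obtain ⟨B, hB⟩ := hC.exists_bound_of_continuousOn hF.continuousOn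
  rw [← integrable_indicator_iff (MeasurableSet.univ.prod hOm)]
  have hsupp : ∀ z, (Set.univ ×ˢ O).indicator f z ≠ 0 →
      z.1 ∈ (fun z : G × LieAlg n => (endpoints (q, z.2)).1⁻¹ * z.1) '' (K₃ ×ˢ C) ∧ z.2 ∈ C := by
    rintro ⟨x, Z⟩ hz
    have hZ : Z ∈ O := by
      by_contra hZ
      exact hz (Set.indicator_of_notMem (fun h => hZ h.2) _)
    rw [Set.indicator_of_mem (by exact ⟨trivial, hZ⟩)] at hz
    have h1 := left_ne_zero_of_mul (left_ne_zero_of_mul hz)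
    have hk0 := subset_tsupport k (left_ne_zero_of_mul h1)
    have hl0 := subset_tsupport l (right_ne_zero_of_mul h1)
    have hZC : Z ∈ C := subset_closure ⟨hZ, lieExp_mem_expImage hZ, endpoints (q, Z),
      ⟨⟨_, hk0, rfl⟩, ⟨_, hl0, rfl⟩⟩, endpoints_inv_mul q Z⟩
    exact ⟨⟨((endpoints (q, Z)).1 * x, Z), ⟨⟨_, hk0, rfl⟩, hZC⟩, inv_mul_cancel_left _ _⟩, hZC⟩
  refine integrable_of_bounded_of_compact hO (M := |Mk| * |Ml| * 1 * |B|)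
    (hfc.aestronglyMeasurable.indicator (MeasurableSet.univ.prod hOm)) hK hC (fun z => ?_) hsupp
  by_cases hz : (Set.univ ×ˢ O).indicator f z = 0
  · rw [hz, norm_zero]; positivity
  · have hzC := (hsupp z hz).2
    refine (norm_indicator_le_norm_self _ _).trans ?_
    simp only [hf, norm_mul, Complex.norm_real, norm_phase]
    gcongr
    · exact (hMk _).trans (le_abs_self _)
    · exact (hMl _).trans (le_abs_self _)
    · exact (hB _ hzC).trans (le_abs_self _)

/-- For fixed `Z` the integral over the group variable is, after a left translation, the composition
integral at the endpoints of `(q, Z)`; what remains is the Fourier integral over `Z`. Fubini is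
legitimate because the supports are compact. -/
theorem starFormula_eq_momentumIntegral {k l : G × G → ℂ} (hk : Continuous k)
    (hk' : HasCompactSupport k) (hl : Continuous l) (hl' : HasCompactSupport l)
    (x : G × LieDual n) :
    starFormula m ℏ O (symbolTilde O k) (symbolTilde O l) x =
      momentumIntegral m ℏ (symbolTilde O (kernelComp m k l)) x := by
  have := topologicalGroup_of_lieGroup (𝓡 n) ∞ (G := G)
  have := sigmaFinite_measX (G := G) hO
  have := sigmaFinite_haar n m
  have hint := integrable_starIntegrand hO (ℏ := ℏ) hk hk' hl hl' x.1 x.2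
  rw [IntegrableOn, measN_restrict] at hint
  rw [starFormula_eq_integral hO hk.measurable hl.measurable, measN_restrict,
    integral_prod_symm _ hint, momentumIntegral, ← integral_indicator hO.isOpen.measurableSet]
  congr 1
  ext1 Z
  by_cases hZ : Z ∈ O
  · rw [Set.indicator_of_mem hZ, symbolTilde, if_pos hZ]
    dsimp only
    rw [integral_mul_const, integral_mul_const]
    have h1 := integral_mul_left_eq_self (μ := m) (fun c => k ((endpoints (x.1, Z)).1, c) *
      l (c, (endpoints (x.1, Z)).2)) (endpoints (x.1, Z)).1
    rw [h1]
    change kernelComp m k l (endpoints (x.1, Z)) * _ * _ = kernelComp m k l (endpoints (x.1, Z)) * _ * _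
    ring
  · rw [Set.indicator_of_notMem hZ, symbolTilde, if_neg hZ, zero_mul]

/-- The composed kernel is bounded and vanishes outside the product of the first projection of the
support of `k` and the second projection of that of `l`. -/
theorem integrable_symbolTilde_kernelComp {k l : G × G → ℂ} (hk : Continuous k)
    (hk' : HasCompactSupport k) (hl : Continuous l) (hl' : HasCompactSupport l) :
    Integrable (symbolTilde O (kernelComp m k l)) (measN (n := n) m) := by
  have := sigmaFinite_haar n m
  obtain ⟨Mk, hMk⟩ := hk'.exists_bound_of_continuous hk
  obtain ⟨Ml, hMl⟩ := hl'.exists_bound_of_continuous hl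
  have hK3 := hk'.image continuous_snd
  refine integrable_symbolTilde hO (stronglyMeasurable_kernelComp hk.stronglyMeasurable
    hl.stronglyMeasurable) (M := |Mk| * |Ml| * m.real (Prod.snd '' tsupport k)) (fun x => ?_)
    (hk'.image continuous_fst) (hl'.image continuous_snd) (fun x hx => ?_)
  · rw [kernelComp, ← setIntegral_eq_integral_of_forall_compl_eq_zero
      (s := Prod.snd '' tsupport k)]
    · refine norm_setIntegral_le_of_norm_le_const hK3.measure_lt_top fun c _ => ?_
      rw [norm_mul]
      exact mul_le_mul ((hMk _).trans (le_abs_self _)) ((hMl _).trans (le_abs_self _))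
        (norm_nonneg _) (abs_nonneg _)
    · intro c hc
      have : k (x.1, c) = 0 := by
        by_contra h
        exact hc ⟨_, subset_tsupport k h, rfl⟩
      rw [this, zero_mul]
  · constructor
    · by_contra h
      refine hx (integral_eq_zero_of_ae (Eventually.of_forall fun c => ?_))
      have : k (x.1, c) = 0 := by
        by_contra h'
        exact h ⟨_, subset_tsupport k h', rfl⟩
      simp [this]
    · by_contra h
      refine hx (integral_eq_zero_of_ae (Eventually.of_forall fun c => ?_))
      have : l (c, x.2) = 0 := by
        by_contra h'
        exact h ⟨_, subset_tsupport l h', rfl⟩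
      simp [this]

/-- The composition of kernels, transported to `L(M)`. -/
def kernelStar (hℏ : ℏ ≠ 0) :
    LM (n := n) m ℏ O →L[ℂ] LM (n := n) m ℏ O →L[ℂ] LM (n := n) m ℏ O :=
  haveI := sigmaFinite_haar n m
  letI e : LM (n := n) m ℏ O →L[ℂ] Lp ℂ 2 (m.prod m) :=
    ((kernelIso hO hℏ).symm.toContinuousLinearEquiv : LM (n := n) m ℏ O →L[ℂ] Lp ℂ 2 (m.prod m))
  letI e' : Lp ℂ 2 (m.prod m) →L[ℂ] LM (n := n) m ℏ O :=
    ((kernelIso hO hℏ).toContinuousLinearEquiv : Lp ℂ 2 (m.prod m) →L[ℂ] LM (n := n) m ℏ O)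
  ((ContinuousLinearMap.compL ℂ _ _ _ e').comp ((kernelCompL m).bilinearComp e e))

theorem kernelStar_kernelIso (hℏ : ℏ ≠ 0) (k l : Lp ℂ 2 (m.prod m)) :
    haveI := sigmaFinite_haar n m
    kernelStar hO hℏ (kernelIso hO hℏ k) (kernelIso hO hℏ l) =
      kernelIso hO hℏ (kernelCompL m k l) := by
  have := sigmaFinite_haar n m
  have h : ∀ a b, kernelStar hO hℏ a b = kernelIso hO hℏ (kernelCompL m
    ((kernelIso hO hℏ).symm a) ((kernelIso hO hℏ).symm b)) := fun a b => rfl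
  rw [h, LinearIsometryEquiv.symm_apply_apply, LinearIsometryEquiv.symm_apply_apply]

theorem kernelStar_symbol (hℏ : ℏ ≠ 0) {k l : G × G → ℂ} (hk : MemLp k 2 (m.prod m))
    (hl : MemLp l 2 (m.prod m)) :
    kernelStar hO hℏ (symbol m ℏ O k) (symbol m ℏ O l) = symbol m ℏ O (kernelComp m k l) := by
  have := sigmaFinite_haar n m
  rw [← kernelIso_toLp hO hℏ hk, ← kernelIso_toLp hO hℏ hl, kernelStar_kernelIso,
    kernelCompL_toLp, kernelIso_toLp]

theorem isStarProduct_kernelStar (hℏ : ℏ ≠ 0) :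
    IsStarProduct m ℏ O (kernelStar hO hℏ) := by
  have := sigmaFinite_haar n m
  intro k l hk hl
  rw [kernelStar_symbol hO hℏ hk.memLp hl.memLp,
    ← kernelIso_toLp hO hℏ (memLp_kernelComp hk.memLp hl.memLp), coe_kernelIso_toLp]
  refine (invMomentumFourier_toLp hO hℏ (integrable_symbolTilde_kernelComp hO hk.1.continuous hk.2
    hl.1.continuous hl.2) _).trans (Eventually.of_forall fun x => ?_)
  exact (starFormula_eq_momentumIntegral hO hk.1.continuous hk.2 hl.1.continuous hl.2 x).symm

/-- The formula fixes the product on pairs of test kernels; density and continuity extend the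
equality in one argument and then in the other. -/
theorem IsStarProduct.eq_kernelStar (hℏ : ℏ ≠ 0)
    {B : LM (n := n) m ℏ O →L[ℂ] LM (n := n) m ℏ O →L[ℂ] LM (n := n) m ℏ O}
    (hB : IsStarProduct m ℏ O B) : B = kernelStar hO hℏ := by
  have := sigmaFinite_haar n m
  have h1 : ∀ k l : G × G → ℂ, IsTestKernel (n := n) k → IsTestKernel (n := n) l →
      B (symbol m ℏ O k) (symbol m ℏ O l) =
        kernelStar hO hℏ (symbol m ℏ O k) (symbol m ℏ O l) := fun k l hk hl =>
    Subtype.ext (Lp.ext ((hB k l hk hl).trans (isStarProduct_kernelStar hO hℏ k l hk hl).symm))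
  have hc := (kernelIso hO hℏ).continuous
  have h2 : ∀ k : G × G → ℂ, IsTestKernel (n := n) k →
      (fun u => B (symbol m ℏ O k) (kernelIso hO hℏ u)) =
        fun u => kernelStar hO hℏ (symbol m ℏ O k) (kernelIso hO hℏ u) := by
    intro k hk
    refine eq_of_eq_on_testKernels (n := n) (by fun_prop) (by fun_prop) fun l hl => ?_
    rw [kernelIso_toLp]
    exact h1 k l hk hl
  have h3 : ∀ u, (fun v => B (kernelIso hO hℏ v) (kernelIso hO hℏ u)) =
      fun v => kernelStar hO hℏ (kernelIso hO hℏ v) (kernelIso hO hℏ u) := by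
    intro u
    refine eq_of_eq_on_testKernels (n := n) (by fun_prop) (by fun_prop) fun k hk => ?_
    rw [kernelIso_toLp]
    exact congrFun (h2 k hk) u
  ext1 a
  ext1 b
  obtain ⟨v, rfl⟩ := (kernelIso hO hℏ).surjective a
  obtain ⟨u, rfl⟩ := (kernelIso hO hℏ).surjective b
  exact congrFun (h3 u) v

theorem existsUnique_isStarProduct (hℏ : ℏ ≠ 0) : ∃! B, IsStarProduct (n := n) m ℏ O B :=
  ⟨kernelStar hO hℏ, isStarProduct_kernelStar hO hℏ, fun _ hB => hB.eq_kernelStar hO hℏ⟩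

theorem starProd_symbol (hℏ : ℏ ≠ 0) {k l : G × G → ℂ} (hk : MemLp k 2 (m.prod m))
    (hl : MemLp l 2 (m.prod m)) :
    starProd m ℏ O (symbol m ℏ O k) (symbol m ℏ O l) = symbol m ℏ O (kernelComp m k l) := by
  have h : IsStarProduct m ℏ O (starProd (n := n) m ℏ O) :=
    Classical.epsilon_spec (existsUnique_isStarProduct hO hℏ).exists
  rw [h.eq_kernelStar hO hℏ, kernelStar_symbol hO hℏ hk hl]

theorem symbol_congr (hℏ : ℏ ≠ 0) {k l : G × G → ℂ} (hk : MemLp k 2 (m.prod m))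
    (h : k =ᵐ[m.prod m] l) : symbol m ℏ O k = symbol m ℏ O l := by
  rw [← kernelIso_toLp hO hℏ hk, ← kernelIso_toLp hO hℏ ((memLp_congr_ae h).1 hk),
    (MemLp.toLp_eq_toLp_iff _ _).2 h]

theorem starProd_wigner_wigner (hℏ : ℏ ≠ 0) (φ ψ η χ : Lp ℂ 2 m) :
    starProd m ℏ O (wigner ℏ O φ ψ) (wigner ℏ O η χ) =
      (inner ℂ φ χ : ℂ) • wigner ℏ O η ψ := by
  have := sigmaFinite_haar n m
  rw [wigner, wigner, starProd_symbol hO hℏ (memLp_rankOneKernel φ ψ) (memLp_rankOneKernel η χ),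
    kernelComp_rankOneKernel, wigner, ← kernelIso_toLp hO hℏ (memLp_rankOneKernel η ψ),
    ← kernelIso_toLp hO hℏ ((memLp_rankOneKernel η ψ).const_smul _), MemLp.toLp_const_smul,
    map_smul]

theorem starProd_symbol_wigner (hℏ : ℏ ≠ 0) {k : G × G → ℂ} (hk : MemLp k 2 (m.prod m))
    (φ ψ : Lp ℂ 2 m) : starProd m ℏ O (symbol m ℏ O k) (wigner ℏ O φ ψ) =
      wigner ℏ O φ (integralOperator m k ψ) := by
  have := sigmaFinite_haar n m
  rw [wigner, starProd_symbol hO hℏ hk (memLp_rankOneKernel φ ψ), wigner]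
  exact symbol_congr hO hℏ (memLp_kernelComp hk (memLp_rankOneKernel φ ψ))
    (kernelComp_rankOneKernel_right (integralOperator_spec hk) φ ψ)

theorem starProd_wigner_symbol (hℏ : ℏ ≠ 0) {k : G × G → ℂ} (hk : MemLp k 2 (m.prod m))
    (φ ψ : Lp ℂ 2 m) : starProd m ℏ O (wigner ℏ O φ ψ) (symbol m ℏ O k) =
      wigner ℏ O (ContinuousLinearMap.adjoint (integralOperator m k) φ) ψ := by
  have := sigmaFinite_haar n m
  rw [wigner, starProd_symbol hO hℏ (memLp_rankOneKernel φ ψ) hk, wigner]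
  exact symbol_congr hO hℏ (memLp_kernelComp (memLp_rankOneKernel φ ψ) hk)
    (kernelComp_rankOneKernel_left hk (integralOperator_spec hk) φ ψ)

theorem inner_wigner (hℏ : ℏ ≠ 0) (φ ψ η χ : Lp ℂ 2 m) :
    inner ℂ (wigner (n := n) ℏ O φ ψ) (wigner ℏ O η χ) =
      (starRingEnd ℂ) (inner ℂ φ η) * inner ℂ ψ χ := by
  have := sigmaFinite_haar n m
  rw [wigner, wigner, ← kernelIso_toLp hO hℏ (memLp_rankOneKernel φ ψ),
    ← kernelIso_toLp hO hℏ (memLp_rankOneKernel η χ), LinearIsometryEquiv.inner_map_map,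
    inner_rankOneKernel]

end StarProduct
end LieWigner
end

/-! ### Pairing the momentum transform with test functions in almost every fibre. -/

noncomputable section
namespace LieWigner

section FiberConvergence

variable {α β : Type*} [MeasurableSpace α] [MeasurableSpace β] {μ : Measure α} {ν : Measure β}

/-- Summable squared norms give, by Tonelli, a finite sum of fibre norms for almost every `q`, and
the terms of a convergent series tend to zero. No subsequence is needed. -/
theorem ae_tendsto_fiber_sq [SFinite ν] {w : ℕ → α × β → ℂ}
    (hw : ∀ j, AEStronglyMeasurable (w j) (μ.prod ν))
    (hs : ∑' j, ∫⁻ x, ‖w j x‖ₑ ^ 2 ∂(μ.prod ν) ≠ ⊤) :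
    ∀ᵐ q ∂μ, Tendsto (fun j => ∫⁻ y, ‖w j (q, y)‖ₑ ^ 2 ∂ν) atTop (𝓝 0) := by
  have hm : ∀ j, AEMeasurable (fun x => ‖w j x‖ₑ ^ 2) (μ.prod ν) :=
    fun j => (hw j).enorm.pow_const 2
  have h1 : ∫⁻ q, ∑' j, ∫⁻ y, ‖w j (q, y)‖ₑ ^ 2 ∂ν ∂μ ≠ ⊤ := by
    rw [lintegral_tsum fun j => (hm j).lintegral_prod_right']
    simp_rw [← lintegral_prod _ (hm _)]
    exact hs
  filter_upwards [ae_lt_top' (AEMeasurable.ennreal_tsum fun j => (hm j).lintegral_prod_right') h1]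
    with q hq
  exact ENNReal.tendsto_atTop_zero_of_tsum_ne_top hq.ne

theorem tendsto_integral_mul_of_tendsto_sq {f : ℕ → β → ℂ} {f₀ g : β → ℂ}
    (hf : ∀ j, MemLp (f j) 2 ν) (hf₀ : MemLp f₀ 2 ν) (hg : MemLp g 2 ν)
    (h : Tendsto (fun j => ∫⁻ y, ‖f j y - f₀ y‖ₑ ^ 2 ∂ν) atTop (𝓝 0)) :
    Tendsto (fun j => ∫ y, f j y * g y ∂ν) atTop (𝓝 (∫ y, f₀ y * g y ∂ν)) := by
  rw [tendsto_iff_edist_tendsto_0]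
  have h1 : ∀ j, edist (∫ y, f j y * g y ∂ν) (∫ y, f₀ y * g y ∂ν) ^ 2 ≤
      (∫⁻ y, ‖f j y - f₀ y‖ₑ ^ 2 ∂ν) * ∫⁻ y, ‖g y‖ₑ ^ 2 ∂ν := by
    intro j
    have i1 : Integrable (fun y => f j y * g y) ν := (hf j).integrable_mul hg
    have i2 : Integrable (fun y => f₀ y * g y) ν := hf₀.integrable_mul hg
    rw [edist_eq_enorm_sub, ← integral_sub i1 i2]
    simp_rw [← sub_mul]
    exact enorm_integral_mul_sq_le ((hf j).1.sub hf₀.1) hg.1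
  have h2 : Tendsto (fun j => edist (∫ y, f j y * g y ∂ν) (∫ y, f₀ y * g y ∂ν) ^ 2) atTop
      (𝓝 0) := by
    refine tendsto_of_tendsto_of_tendsto_of_le_of_le tendsto_const_nhds ?_ (fun _ => zero_le) h1
    have := ENNReal.Tendsto.mul_const (b := ∫⁻ y, ‖g y‖ₑ ^ 2 ∂ν) h
      (Or.inr ((memLp_two_iff hg.1).1 hg).ne)
    rwa [zero_mul] at this
  have h3 := ((ENNReal.continuous_rpow_const (y := (1 / 2 : ℝ))).tendsto 0).comp h2
  rw [ENNReal.zero_rpow_of_pos (by norm_num)] at h3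
  refine h3.congr fun j => ?_
  simp only [Function.comp_apply]
  rw [← ENNReal.rpow_natCast, ← ENNReal.rpow_mul]
  norm_num

end FiberConvergence

section Fiber

variable {n : ℕ} {G : Type*} [TopologicalSpace G] [ChartedSpace (EuclideanSpace ℝ (Fin n)) G]
  [Group G] {O : Set (LieAlg n)} [MeasurableSpace G] {m : Measure G}
  [LieGroup (𝓡 n) ∞ G] [T2Space G] [BorelSpace G]
  (hO : IsWeaklyExponential m O) [SecondCountableTopology G] [m.IsHaarMeasure] {ℏ : ℝ}

theorem ofReal_inv_two_pi_pow_ne_zero (n : ℕ) (hℏ : ℏ ≠ 0) :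
    ENNReal.ofReal (|2 * Real.pi * ℏ| ^ n)⁻¹ ≠ 0 := by
  have := Real.pi_ne_zero
  simp only [ne_eq, ENNReal.ofReal_eq_zero, not_le]
  positivity

include hO

theorem integral_momentumIntegral_mul {h : G × LieAlg n → ℂ} {q : G}
    (h1 : Integrable (fun X => h (q, X)) (measX m)) {E : LieDual n → ℂ}
    (hE : Integrable E (measP m)) :
    ∫ p, momentumIntegral m ℏ h (q, p) * E p ∂(measP m) =
      ∫ X, h (q, X) * ∫ p, phase ℏ p X * E p ∂(measP m) ∂(measX m) := by
  have := sigmaFinite_measX (G := G) hO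
  have := sigmaFinite_measP (G := G) hO
  have hint : Integrable (fun z : LieDual n × LieAlg n =>
      E z.1 * h (q, z.2) * phase ℏ z.1 z.2) ((measP m).prod (measX m)) := by
    refine (hE.mul_prod h1).mul_bdd (c := 1) (continuous_phase ℏ).aestronglyMeasurable
      (Eventually.of_forall fun z => (norm_phase ℏ z.1 z.2).le)
  have h2 := integral_integral_swap
    (f := fun p X => E p * h (q, X) * phase ℏ p X) hint
  have e1 : ∀ p, momentumIntegral m ℏ h (q, p) * E p =
      ∫ X, E p * h (q, X) * phase ℏ p X ∂(measX m) := by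
    intro p
    rw [momentumIntegral, ← integral_mul_const]
    congr 1
    ext1 X
    ring
  have e2 : ∀ X, h (q, X) * ∫ p, phase ℏ p X * E p ∂(measP m) =
      ∫ p, E p * h (q, X) * phase ℏ p X ∂(measP m) := by
    intro X
    rw [← integral_const_mul]
    congr 1
    ext1 p
    ring
  simp_rw [e1, e2]
  exact h2

theorem ae_memLp_fiber {h : G × LieAlg n → ℂ} (h2 : MemLp h 2 (measN m)) :
    ∀ᵐ q ∂m, MemLp (fun X => h (q, X)) 2 (measX m) := by
  have := sigmaFinite_measX (G := G) hO
  have := sigmaFinite_haar n m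
  filter_upwards [ae_fiber_sq_lt_top hO h2, h2.1.prodMk_left] with q h3 h4
  exact (memLp_two_iff h4).2 h3

theorem ae_prod_of_ae_measL (hℏ : ℏ ≠ 0) {p : G × LieDual n → Prop}
    (h : ∀ᵐ x ∂(measL (n := n) m ℏ), p x) : ∀ᵐ q ∂m, ∀ᵐ y ∂(measP m), p (q, y) := by
  have := sigmaFinite_measP (G := G) hO
  rw [measL, Measure.ae_ennreal_smul_measure_iff (ofReal_inv_two_pi_pow_ne_zero n hℏ)] at h
  exact Measure.ae_ae_of_ae_prod h

theorem aestronglyMeasurable_prod_of_measL (hℏ : ℏ ≠ 0) {f : G × LieDual n → ℂ}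
    (hf : AEStronglyMeasurable f (measL m ℏ)) : AEStronglyMeasurable f (m.prod (measP m)) := by
  refine hf.mono_ac ?_
  exact Measure.absolutelyContinuous_smul (ofReal_inv_two_pi_pow_ne_zero n hℏ)

theorem lintegral_prod_eq_measL (hℏ : ℏ ≠ 0) (f : G × LieDual n → ℝ≥0∞) :
    ∫⁻ x, f x ∂(m.prod (measP m)) =
      (ENNReal.ofReal (|2 * Real.pi * ℏ| ^ n)⁻¹)⁻¹ * ∫⁻ x, f x ∂(measL m ℏ) := by
  rw [measL, lintegral_smul_measure, smul_eq_mul, ENNReal.inv_mul_cancel_left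
    (ofReal_inv_two_pi_pow_ne_zero n hℏ) ENNReal.ofReal_ne_top]

theorem ae_memLp_fiber_measL (hℏ : ℏ ≠ 0) {f : G × LieDual n → ℂ}
    (hf : MemLp f 2 (measL m ℏ)) : ∀ᵐ q ∂m, MemLp (fun p => f (q, p)) 2 (measP m) := by
  have := sigmaFinite_measP (G := G) hO
  have := sigmaFinite_haar n m
  have h1 := aestronglyMeasurable_prod_of_measL hO hℏ hf.1
  have h2 : AEMeasurable (fun x => ‖f x‖ₑ ^ 2) (m.prod (measP m)) := h1.enorm.pow_const 2
  have h3 : ∫⁻ x, ‖f x‖ₑ ^ 2 ∂(m.prod (measP m)) < ⊤ := by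
    rw [lintegral_prod_eq_measL hO hℏ]
    exact ENNReal.mul_lt_top (by simpa using ofReal_inv_two_pi_pow_ne_zero n hℏ |> pos_iff_ne_zero.2)
      ((memLp_two_iff hf.1).1 hf)
  rw [lintegral_prod _ h2] at h3
  filter_upwards [ae_lt_top' h2.lintegral_prod_right' h3.ne, h1.prodMk_left] with q h4 h5
  exact (memLp_two_iff h5).2 h4

/-- For integrable `h` the identity is Fubini. In general, rapid approximation by integrable
functions converges in `L²` of almost every fibre, on both sides of the transform. The exceptional
set does not depend on `E`, which is essential: the improper integrals involve uncountably many
Gaussians at once. -/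
theorem ae_integral_invMomentumFourier_mul (hℏ : ℏ ≠ 0) (h : Lp ℂ 2 (measN (n := n) m)) :
    ∀ᵐ q ∂m, ∀ E : LieDual n → ℂ, Integrable E (measP m) → MemLp E 2 (measP m) →
      MemLp (fun X => ∫ p, phase ℏ p X * E p ∂(measP m)) 2 (measX m) →
      Integrable (fun p => invMomentumFourier m ℏ h (q, p) * E p) (measP m) ∧
      ∫ p, invMomentumFourier m ℏ h (q, p) * E p ∂(measP m) =
        ∫ X, h (q, X) * ∫ p, phase ℏ p X * E p ∂(measP m) ∂(measX m) := by
  have := sigmaFinite_measX (G := G) hO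
  have := sigmaFinite_measP (G := G) hO
  have := sigmaFinite_haar n m
  -- The rate `2⁻ʲ` makes the squared errors summable, as required by `ae_tendsto_fiber_sq`.
  have hex : ∀ j : ℕ, ∃ k : integrableLp (measN (n := n) m),
      ‖(k : Lp ℂ 2 (measN (n := n) m)) - h‖ₑ ^ 2 ≤ (2 : ℝ≥0∞)⁻¹ ^ j := by
    intro j
    have h1 : (0 : ℝ) < (2⁻¹ : ℝ) ^ j := by positivity
    obtain ⟨k, hk⟩ := (denseRange_integrableLp (measN (n := n) m)).exists_dist_lt h h1
    refine ⟨k, ?_⟩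
    rw [dist_comm, dist_eq_norm, Submodule.subtype_apply] at hk
    have h2 : ‖(k : Lp ℂ 2 (measN (n := n) m)) - h‖ₑ ≤ (2 : ℝ≥0∞)⁻¹ ^ j := by
      rw [← ofReal_norm]
      refine (ENNReal.ofReal_le_ofReal hk.le).trans_eq ?_
      rw [ENNReal.ofReal_pow (by norm_num), ENNReal.ofReal_inv_of_pos two_pos,
        ENNReal.ofReal_ofNat]
    have h3 : (2 : ℝ≥0∞)⁻¹ ^ j ≤ 1 := pow_le_one' (by simp) j
    calc ‖(k : Lp ℂ 2 (measN (n := n) m)) - h‖ₑ ^ 2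
        ≤ ((2 : ℝ≥0∞)⁻¹ ^ j) ^ 2 := pow_le_pow_left₀ zero_le h2 2
      _ = (2 : ℝ≥0∞)⁻¹ ^ j * (2 : ℝ≥0∞)⁻¹ ^ j := sq _
      _ ≤ (2 : ℝ≥0∞)⁻¹ ^ j * 1 := by gcongr
      _ = _ := mul_one _
  choose k hk using hex
  have hsum : ∑' j : ℕ, (2 : ℝ≥0∞)⁻¹ ^ j ≠ ⊤ := by
    rw [ENNReal.tsum_geometric, ENNReal.one_sub_inv_two, inv_inv]
    exact ENNReal.ofNat_ne_top
  set T := invMomentumFourier (n := n) m ℏ with hT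
  have hsq1 : ∀ j, ∫⁻ x, ‖((k j : Lp ℂ 2 (measN (n := n) m)) - h : Lp ℂ 2 (measN (n := n) m)) x‖ₑ ^ 2
      ∂(m.prod (measX m)) ≤ (2 : ℝ≥0∞)⁻¹ ^ j := by
    intro j
    rw [← eLpNorm_two_sq]
    refine le_trans (le_of_eq ?_) (hk j)
    rw [Lp.enorm_def]
    rfl
  have hsq2 : ∀ j, ∫⁻ x, ‖(T (k j) - T h : Lp ℂ 2 (measL (n := n) m ℏ)) x‖ₑ ^ 2
      ∂(m.prod (measP m)) ≤
        (ENNReal.ofReal (|2 * Real.pi * ℏ| ^ n)⁻¹)⁻¹ * (2 : ℝ≥0∞)⁻¹ ^ j := by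
    intro j
    rw [lintegral_prod_eq_measL hO hℏ, ← eLpNorm_two_sq, ← Lp.enorm_def, ← map_sub]
    refine mul_le_mul' le_rfl (le_trans (le_of_eq ?_) (hk j))
    rw [← ofReal_norm, norm_invMomentumFourier hO hℏ, ofReal_norm]
  have hc1 := ae_tendsto_fiber_sq (μ := m) (ν := measX m)
    (w := fun j => ((k j : Lp ℂ 2 (measN (n := n) m)) - h : Lp ℂ 2 (measN (n := n) m)))
    (fun j => (Lp.memLp _).1) (ne_top_of_le_ne_top hsum (ENNReal.tsum_le_tsum hsq1))
  have hc2 := ae_tendsto_fiber_sq (μ := m) (ν := measP m)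
    (w := fun j => (T (k j) - T h : Lp ℂ 2 (measL (n := n) m ℏ)))
    (fun j => aestronglyMeasurable_prod_of_measL hO hℏ (Lp.memLp _).1)
    (ne_top_of_le_ne_top (by
      rw [ENNReal.tsum_mul_left]
      exact ENNReal.mul_ne_top (by simpa using ofReal_inv_two_pi_pow_ne_zero n hℏ |> pos_iff_ne_zero.2)
        hsum) (ENNReal.tsum_le_tsum hsq2))
  have hd1 : ∀ᵐ q ∂m, ∀ j, ∀ᵐ X ∂(measX m),
      ((k j : Lp ℂ 2 (measN (n := n) m)) - h : Lp ℂ 2 (measN (n := n) m)) (q, X) =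
        (k j : Lp ℂ 2 (measN (n := n) m)) (q, X) - h (q, X) :=
    ae_all_iff.2 fun j => Measure.ae_ae_of_ae_prod (Lp.coeFn_sub _ _)
  have hd2 : ∀ᵐ q ∂m, ∀ j, ∀ᵐ p ∂(measP m),
      (T (k j) - T h : Lp ℂ 2 (measL (n := n) m ℏ)) (q, p) = T (k j) (q, p) - T h (q, p) :=
    ae_all_iff.2 fun j => ae_prod_of_ae_measL hO hℏ (Lp.coeFn_sub _ _)
  have hd3 : ∀ᵐ q ∂m, ∀ j, ∀ᵐ p ∂(measP m), T (k j) (q, p) =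
      momentumIntegral m ℏ (k j : Lp ℂ 2 (measN (n := n) m)) (q, p) :=
    ae_all_iff.2 fun j => ae_prod_of_ae_measL hO hℏ (invMomentumFourier_spec hO hℏ _ (k j).2)
  filter_upwards [hc1, hc2, hd1, hd2, hd3,
    ae_all_iff.2 fun j => ae_integrable_fiber hO (k j).2,
    ae_all_iff.2 fun j => ae_memLp_fiber hO (Lp.memLp (k j : Lp ℂ 2 (measN (n := n) m))),
    ae_memLp_fiber hO (Lp.memLp h), ae_memLp_fiber_measL hO hℏ (Lp.memLp (T h)),
    ae_all_iff.2 fun j => ae_memLp_fiber_measL hO hℏ (Lp.memLp (T (k j)))]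
    with q g1 g2 g3 g4 g5 g6 g7 g8 g9 g10 E hE1 hE2 hK
  refine ⟨g9.integrable_mul hE2, ?_⟩
  have t1 := tendsto_integral_mul_of_tendsto_sq g10 g9 hE2 (g2.congr fun j =>
    lintegral_congr_ae (by filter_upwards [g4 j] with p hp; rw [hp]))
  have t2 := tendsto_integral_mul_of_tendsto_sq g7 g8 hK (g1.congr fun j =>
    lintegral_congr_ae (by filter_upwards [g3 j] with X hX; rw [hX]))
  refine tendsto_nhds_unique t1 (t2.congr fun j => ?_)
  rw [← integral_momentumIntegral_mul hO (g6 j) hE1]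
  refine integral_congr_ae ?_
  filter_upwards [g5 j] with p hp
  rw [hp]

end Fiber
end LieWigner
end

/-! ### Complex conjugation of Wigner functions. -/

noncomputable section
namespace LieWigner

section Conj

variable {n : ℕ} {G : Type*} [TopologicalSpace G] [ChartedSpace (EuclideanSpace ℝ (Fin n)) G]
  [Group G] {O : Set (LieAlg n)} [MeasurableSpace G] {m : Measure G}
  [LieGroup (𝓡 n) ∞ G] [T2Space G] [BorelSpace G]
  (hO : IsWeaklyExponential m O) [SecondCountableTopology G] [m.IsHaarMeasure] {ℏ : ℝ}

/-- Complex conjugation on `L²`. -/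
def conjLp {α : Type*} [MeasurableSpace α] (μ : Measure α) : Lp ℂ 2 μ →L[ℝ] Lp ℂ 2 μ :=
  ContinuousLinearMap.compLpL 2 μ (Complex.conjCLE : ℂ →L[ℝ] ℂ)

theorem coeFn_conjLp {α : Type*} [MeasurableSpace α] {μ : Measure α} (f : Lp ℂ 2 μ) :
    conjLp μ f =ᵐ[μ] fun x => (starRingEnd ℂ) (f x) :=
  ContinuousLinearMap.coeFn_compLpL _ f

theorem phase_neg (ℏ : ℝ) (p : LieDual n) (X : LieAlg n) :
    phase ℏ p (-X) = (starRingEnd ℂ) (phase ℏ p X) := by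
  rw [phase, phase, ← Complex.exp_conj, map_neg]
  congr 1
  simp [map_div₀]
  ring

theorem measurePreserving_neg_measX :
    MeasurePreserving (fun X : LieAlg n => -X) (measX m) (measX m) :=
  (Measure.measurePreserving_neg (volume : Measure (LieAlg n))).smul_measure _

include hO

theorem measurePreserving_neg_measN :
    MeasurePreserving (fun y : G × LieAlg n => (y.1, -y.2)) (measN m) (measN m) := by
  have := sigmaFinite_measX (G := G) hO
  have := sigmaFinite_haar n m
  exact (MeasurePreserving.id m).prod measurePreserving_neg_measX

theorem momentumIntegral_conj (h : G × LieAlg n → ℂ) (x : G × LieDual n) :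
    momentumIntegral m ℏ (fun y => (starRingEnd ℂ) (h (y.1, -y.2))) x =
      (starRingEnd ℂ) (momentumIntegral m ℏ h x) := by
  rw [momentumIntegral, momentumIntegral, ← integral_conj]
  have h1 := (measurePreserving_neg_measX (n := n) (m := m)).integral_comp
    (MeasurableEquiv.neg (LieAlg n)).measurableEmbedding
    (fun X => (starRingEnd ℂ) (h (x.1, X) * phase ℏ x.2 X))
  rw [← h1]
  congr 1
  ext1 X
  rw [map_mul, ← phase_neg, neg_neg]

/-- On integrable functions this is the substitution `X ↦ -X` in the Fourier integral; both sides
are continuous in `h`. -/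
theorem conj_invMomentumFourier (hℏ : ℏ ≠ 0) (h : Lp ℂ 2 (measN (n := n) m)) :
    conjLp _ (invMomentumFourier m ℏ h) = invMomentumFourier m ℏ (conjLp _
      (Lp.compMeasurePreserving (fun y : G × LieAlg n => (y.1, -y.2))
        (measurePreserving_neg_measN hO) h)) := by
  have hneg := measurePreserving_neg_measN (m := m) hO
  have hc := (Lp.isometry_compMeasurePreserving (E := ℂ) (p := 2) hneg).continuous
  refine (denseRange_integrableLp (measN (n := n) m)).induction_on
    (p := fun h => conjLp _ (invMomentumFourier m ℏ h) = invMomentumFourier m ℏ (conjLp _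
      (Lp.compMeasurePreserving (fun y : G × LieAlg n => (y.1, -y.2)) hneg h))) h
    (isClosed_eq (by fun_prop) ?_) fun k => ?_
  · exact (invMomentumFourier m ℏ).continuous.comp ((conjLp _).continuous.comp hc)
  set k' : Lp ℂ 2 (measN (n := n) m) := (integrableLp (measN (n := n) m)).subtype k with hk'
  have hki : Integrable k' (measN (n := n) m) := k.2
  have e1 : (conjLp _ (Lp.compMeasurePreserving (fun y : G × LieAlg n => (y.1, -y.2)) hneg k') :
      G × LieAlg n → ℂ) =ᵐ[measN m] fun y => (starRingEnd ℂ) (k' (y.1, -y.2)) := by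
    filter_upwards [coeFn_conjLp (Lp.compMeasurePreserving _ hneg k'),
      Lp.coeFn_compMeasurePreserving k' hneg] with y h1 h2
    rw [h1, h2]; rfl
  have hi : Integrable (fun y : G × LieAlg n => (starRingEnd ℂ) (k' (y.1, -y.2))) (measN m) := by
    have h1 := hneg.integrable_comp_of_integrable hki
    exact Complex.conjCLE.integrable_comp_iff.2 h1
  refine Lp.ext ?_
  filter_upwards [coeFn_conjLp (invMomentumFourier m ℏ k'), invMomentumFourier_spec hO hℏ k' hki,
    invMomentumFourier_spec hO hℏ _ (hi.congr e1.symm), momentumIntegral_congr hO (ℏ := ℏ) e1]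
    with x h1 h2 h3 h4
  rw [h1, h2, h3]
  refine Eq.trans ?_ h4.symm
  rw [momentumIntegral_conj hO]
  rfl

/-- Replacing `X` by `-X` exchanges the endpoints, hence `φ` and `ψ` up to conjugation, while `O` is
symmetric and `F` is even. -/
theorem conj_wigner (hℏ : ℏ ≠ 0) (φ ψ : Lp ℂ 2 m) : ∀ᵐ x ∂(measL (n := n) m ℏ),
    (starRingEnd ℂ) ((wigner ℏ O φ ψ : Lp ℂ 2 (measL (n := n) m ℏ)) x) =
      (wigner ℏ O ψ φ : Lp ℂ 2 (measL (n := n) m ℏ)) x := by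
  have := sigmaFinite_haar n m
  have hneg := measurePreserving_neg_measN (m := m) hO
  have h1 := memLp_symbolTilde hO (memLp_rankOneKernel φ ψ)
  have h2 := memLp_symbolTilde hO (memLp_rankOneKernel ψ φ)
  have e : conjLp _ (Lp.compMeasurePreserving (fun y : G × LieAlg n => (y.1, -y.2)) hneg
      (h1.toLp _)) = h2.toLp _ := by
    refine Lp.ext ?_
    filter_upwards [coeFn_conjLp (Lp.compMeasurePreserving _ hneg (h1.toLp _)),
      Lp.coeFn_compMeasurePreserving (h1.toLp _) hneg, h2.coeFn_toLp,
      hneg.quasiMeasurePreserving.ae h1.coeFn_toLp] with y g1 g2 g3 g4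
    rw [g1, g2, g3, Function.comp_apply, g4]
    by_cases hy : y.2 ∈ O
    · rw [symbolTilde, if_pos (by exact (neg_mem_O_iff hO).2 hy), symbolTilde, if_pos hy]
      simp only [rankOneKernel, map_mul, Complex.conj_conj, Complex.conj_ofReal, smul_neg,
        weightF_neg hO, neg_smul, neg_neg]
      ring
    · rw [symbolTilde, if_neg (by exact fun h => hy ((neg_mem_O_iff hO).1 h)), symbolTilde,
        if_neg hy, map_zero]
  have h3 := conj_invMomentumFourier hO hℏ (h1.toLp _)
  rw [e] at h3
  have h4 : (wigner ℏ O φ ψ : Lp ℂ 2 (measL (n := n) m ℏ)) = invMomentumFourier m ℏ (h1.toLp _) := by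
    rw [wigner, ← kernelIso_toLp hO hℏ (memLp_rankOneKernel φ ψ), coe_kernelIso_toLp]
  have h5 : (wigner ℏ O ψ φ : Lp ℂ 2 (measL (n := n) m ℏ)) = invMomentumFourier m ℏ (h2.toLp _) := by
    rw [wigner, ← kernelIso_toLp hO hℏ (memLp_rankOneKernel ψ φ), coe_kernelIso_toLp]
  rw [h4, h5, ← h3]
  filter_upwards [coeFn_conjLp (invMomentumFourier m ℏ (h1.toLp _))] with x hx
  exact hx.symm

end Conj
end LieWigner
end

/-! ### Gaussians for arbitrary Euclidean norms and their Fourier transforms. -/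

noncomputable section
namespace LieWigner

section Gaussian
open FourierTransform

variable {V : Type*} [NormedAddCommGroup V] [InnerProductSpace ℝ V] [FiniteDimensional ℝ V]
  [MeasurableSpace V] [BorelSpace V]

theorem exists_map_equiv_volume (B : V ≃L[ℝ] V) : ∃ a : ℝ, 0 ≤ a ∧
    (volume : Measure V).map B = ENNReal.ofReal a • (volume : Measure V) :=
  ⟨_, abs_nonneg _, Measure.map_linearMap_addHaar_eq_smul_addHaar volume
    (f := ((B : V →L[ℝ] V) : V →ₗ[ℝ] V)) (LinearEquiv.isUnit_det' B.toLinearEquiv).ne_zero⟩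

theorem integrable_comp_equiv {E : Type*} [NormedAddCommGroup E] {f : V → E}
    (hf : Integrable f) (B : V ≃L[ℝ] V) : Integrable (fun Y => f (B Y)) := by
  obtain ⟨a, -, h⟩ := exists_map_equiv_volume B
  have h1 : Integrable f ((volume : Measure V).map B) := by
    rw [h]; exact hf.smul_measure ENNReal.ofReal_ne_top
  exact (B.toHomeomorph.measurableEmbedding.integrable_map_iff).1 h1

/-- The function `exp(-‖B Y‖²)`. -/
def gauss (B : V ≃L[ℝ] V) (Y : V) : ℝ := Real.exp (-‖B Y‖ ^ 2)

theorem continuous_gauss (B : V ≃L[ℝ] V) : Continuous (gauss B) := by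
  unfold gauss
  fun_prop

theorem integrable_gauss (B : V ≃L[ℝ] V) : Integrable (gauss B) := by
  have h1 : Integrable fun Y : V => Real.exp (-‖Y‖ ^ 2) := by
    have := (GaussianFourier.integrable_cexp_neg_mul_sq_norm_add (V := V) (b := 1) (by simp) 0 0).re
    refine this.congr (Eventually.of_forall fun Y => ?_)
    simp only [RCLike.re_eq_complex_re]
    rw [← Complex.ofReal_re (Real.exp (-‖Y‖ ^ 2))]
    congr 1
    push_cast
    simp
  exact integrable_comp_equiv h1 B

/-- The substitution `Z = B Y` reduces to the standard Gaussian, and `D` is `π` times the adjoint of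
`B⁻¹`. The value of `κ` is not recorded; the normalization comes from Fourier inversion. -/
theorem exists_fourier_gauss (B : V ≃L[ℝ] V) : ∃ (κ : ℝ) (D : V ≃L[ℝ] V), 0 ≤ κ ∧
    ∀ W, 𝓕 (fun Y => (gauss B Y : ℂ)) W = ((κ * gauss D W : ℝ) : ℂ) := by
  obtain ⟨a, ha, hB⟩ := exists_map_equiv_volume B
  let D₀ : V ≃L[ℝ] V := (LinearEquiv.ofBijective
    ((ContinuousLinearMap.adjoint (B.symm : V →L[ℝ] V) : V →L[ℝ] V) : V →ₗ[ℝ] V) (by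
      have : Function.Injective (ContinuousLinearMap.adjoint (B.symm : V →L[ℝ] V)) := by
        rw [injective_iff_map_eq_zero]
        intro W hW
        rw [← inner_self_eq_zero (𝕜 := ℝ)]
        have := ContinuousLinearMap.adjoint_inner_right (B.symm : V →L[ℝ] V) (B W) W
        rw [hW, inner_zero_right] at this
        simpa using this.symm
      exact ⟨this, LinearMap.injective_iff_surjective.1 this⟩)).toContinuousLinearEquiv
  have hD₀ : ∀ Z W, inner ℝ (B.symm Z) W = inner ℝ Z (D₀ W) := fun Z W =>
    (ContinuousLinearMap.adjoint_inner_right (B.symm : V →L[ℝ] V) Z W).symm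
  refine ⟨a * Real.pi ^ (Module.finrank ℝ V / 2 : ℝ), (ContinuousLinearEquiv.smulLeft
    (Units.mk0 Real.pi Real.pi_ne_zero)) |>.trans D₀, by positivity, fun W => ?_⟩
  have h1 : 𝓕 (fun Y => (gauss B Y : ℂ)) W =
      a • 𝓕 (fun Z : V => Complex.exp (-(1 : ℂ) * ‖Z‖ ^ 2)) (D₀ W) := by
    rw [Real.fourier_eq', Real.fourier_eq', ← ENNReal.toReal_ofReal ha,
      ← integral_smul_measure, ← hB]
    refine Eq.trans ?_ (B.toHomeomorph.measurableEmbedding.integral_map _).symm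
    congr 1
    ext1 Y
    change _ = Complex.exp (((-2 * Real.pi * inner ℝ (B Y) (D₀ W) : ℝ) : ℂ) * Complex.I) •
      Complex.exp (-(1 : ℂ) * ‖B Y‖ ^ 2)
    rw [← hD₀, B.symm_apply_apply, gauss]
    push_cast
    simp
  rw [h1, fourier_gaussian_innerProductSpace (by simp)]
  have h2 : ‖(ContinuousLinearEquiv.smulLeft (Units.mk0 Real.pi Real.pi_ne_zero) :
      V ≃L[ℝ] V).trans D₀ W‖ = Real.pi * ‖D₀ W‖ := by
    change ‖D₀ (Real.pi • W)‖ = _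
    rw [map_smul, norm_smul, Real.norm_of_nonneg Real.pi_pos.le]
  rw [gauss, h2, Complex.real_smul]
  push_cast
  rw [Complex.ofReal_cpow Real.pi_pos.le]
  push_cast
  rw [div_one, div_one, mul_assoc]
  congr 4
  ring

/-- Fourier inversion at the origin, where the Gaussian equals `1`. -/
theorem integral_fourier_gauss (B : V ≃L[ℝ] V) :
    ∫ W, 𝓕 (fun Y => (gauss B Y : ℂ)) W = 1 := by
  obtain ⟨κ, D, hκ, h⟩ := exists_fourier_gauss B
  have h1 : Integrable (𝓕 (fun Y => (gauss B Y : ℂ))) := by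
    rw [funext h]
    exact ((integrable_gauss D).const_mul κ).ofReal
  have h2 := congrFun (Continuous.fourierInv_fourier_eq (f := fun Y => (gauss B Y : ℂ))
    (Complex.continuous_ofReal.comp (continuous_gauss B)) (integrable_gauss B).ofReal h1) 0
  rw [Real.fourierInv_eq'] at h2
  simpa [gauss] using h2

theorem exists_gauss_le (D : V ≃L[ℝ] V) : ∃ b : ℝ, 0 < b ∧
    ∀ X, gauss D X ≤ Real.exp (-b * ‖X‖ ^ 2) := by
  refine ⟨((‖(D.symm : V →L[ℝ] V)‖ + 1)⁻¹) ^ 2, by positivity, fun X => ?_⟩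
  rw [gauss, Real.exp_le_exp, neg_mul, neg_le_neg_iff, ← mul_pow]
  refine pow_le_pow_left₀ (by positivity) ?_ 2
  rw [inv_mul_le_iff₀ (by positivity)]
  have h1 := (D.symm : V →L[ℝ] V).le_opNorm (D X)
  simp only [ContinuousLinearEquiv.coe_coe, D.symm_apply_apply] at h1
  nlinarith [norm_nonneg (D X)]

end Gaussian

section Kernel

variable {n : ℕ} {G : Type*} [TopologicalSpace G] [ChartedSpace (EuclideanSpace ℝ (Fin n)) G]
  [Group G] {O : Set (LieAlg n)} [MeasurableSpace G] {m : Measure G}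

/-- The functions `δ⁻ⁿ k(X / δ)` are, up to the factor `|2πℏ|ⁿ`, the momentum Fourier transforms of
the Gaussians `exp(-δ² ‖A p‖²)`. -/
structure IsGaussianKernel (m : Measure G) (ℏ : ℝ) (A : LieDual n ≃L[ℝ] EuclideanSpace ℝ (Fin n))
    (k : LieAlg n → ℝ) (κ b : ℝ) : Prop where
  continuous : Continuous k
  nonneg : ∀ X, 0 ≤ k X
  kappa_nonneg : 0 ≤ κ
  b_pos : 0 < b
  le : ∀ X, k X ≤ κ * Real.exp (-b * ‖X‖ ^ 2)
  integral_eq_one : ∫ X, k X ∂(measX m) = 1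
  fourier : ∀ δ : ℝ, 0 < δ →
    Integrable (fun p => (Real.exp (-δ ^ 2 * ‖A p‖ ^ 2) : ℂ)) (measP m) ∧
    MemLp (fun p => (Real.exp (-δ ^ 2 * ‖A p‖ ^ 2) : ℂ)) 2 (measP m) ∧
    ∀ X, ∫ p, phase ℏ p X * (Real.exp (-δ ^ 2 * ‖A p‖ ^ 2) : ℂ) ∂(measP m) =
      ((|2 * Real.pi * ℏ| ^ n * ((δ ^ n)⁻¹ * k (δ⁻¹ • X)) : ℝ) : ℂ)

variable [LieGroup (𝓡 n) ∞ G] [T2Space G] [BorelSpace G]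
  (hO : IsWeaklyExponential m O) [SecondCountableTopology G] [m.IsHaarMeasure] {ℏ : ℝ}
include hO

open FourierTransform in
theorem exists_gaussian_kernel (hℏ : ℏ ≠ 0) (A : LieDual n ≃L[ℝ] EuclideanSpace ℝ (Fin n)) :
    ∃ (k : LieAlg n → ℝ) (κ b : ℝ), IsGaussianKernel m ℏ A k κ b := by
  have hc0 : densityAtOne (n := n) m ≠ 0 := densityAtOne_ne_zero hO
  have hct : densityAtOne (n := n) m ≠ ⊤ := densityAtOne_ne_top hO
  have hc : 0 < (densityAtOne (n := n) m).toReal := ENNReal.toReal_pos hc0 hct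
  set c := (densityAtOne (n := n) m).toReal with hcdef
  have hl : 0 < |2 * Real.pi * ℏ| := by
    have := Real.pi_ne_zero
    positivity
  let B : LieAlg n ≃L[ℝ] LieAlg n :=
    (InnerProductSpace.toDual ℝ (LieAlg n)).toContinuousLinearEquiv.trans A
  have hB : ∀ Y, B Y = A (dualEquiv n Y) := fun Y => rfl
  obtain ⟨κ, D, hκ, hD⟩ := exists_fourier_gauss B
  obtain ⟨b, hb, hDb⟩ := exists_gauss_le D
  have hk0 : ∀ X, 0 ≤ κ * gauss D X := fun X => mul_nonneg hκ (Real.exp_pos _).le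
  have hmeas : ∀ δ : ℝ, Measurable (fun p : LieDual n => (Real.exp (-δ ^ 2 * ‖A p‖ ^ 2) : ℂ)) :=
    fun δ => Continuous.measurable (by fun_prop)
  have hEg : ∀ (δ : ℝ) (Y : LieAlg n),
      Real.exp (-δ ^ 2 * ‖A (dualEquiv n Y)‖ ^ 2) = gauss B (δ • Y) := by
    intro δ Y
    rw [gauss, map_smul, norm_smul, mul_pow, hB, Real.norm_eq_abs, sq_abs, neg_mul]
  have hint : ∀ (δ : ℝ) , 0 < δ →
      Integrable (fun p => (Real.exp (-δ ^ 2 * ‖A p‖ ^ 2) : ℂ)) (measP m) := by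
    intro δ hδ
    rw [measP_eq]
    refine Integrable.smul_measure ?_ (ENNReal.inv_ne_top.2 hc0)
    rw [(dualEquiv n).measurableEmbedding.integrable_map_iff]
    refine Integrable.ofReal ((integrable_gauss B).comp_smul hδ.ne' |>.congr
      (Eventually.of_forall fun Y => (hEg δ Y).symm))
  -- The witness is the Fourier transform of `gauss B` at `X/(2πℏ)`. The factor `c⁻¹` comes from
  -- `measP` and cancels the `c` of `measX`; `|2πℏ|⁻ⁿ` offsets the dilation and makes the total mass
  -- one.
  refine ⟨fun X => c⁻¹ * (|2 * Real.pi * ℏ| ^ n)⁻¹ * (κ * gauss D ((2 * Real.pi * ℏ)⁻¹ • X)),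
    c⁻¹ * (|2 * Real.pi * ℏ| ^ n)⁻¹ * κ, b * ((2 * Real.pi * ℏ)⁻¹) ^ 2, ⟨?_, ?_, ?_, ?_, ?_, ?_, ?_⟩⟩
  · have := continuous_gauss D
    fun_prop
  · intro X
    have := hk0 ((2 * Real.pi * ℏ)⁻¹ • X)
    positivity
  · positivity
  · have := Real.pi_ne_zero
    positivity
  · intro X
    rw [mul_assoc _ κ]
    refine mul_le_mul_of_nonneg_left (mul_le_mul_of_nonneg_left ?_ hκ) (by positivity)
    refine (hDb _).trans_eq ?_
    rw [norm_smul, mul_pow, Real.norm_eq_abs, sq_abs]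
    congr 1
    ring
  · have h1 : ∫ W, κ * gauss D W = 1 := by
      have := integral_fourier_gauss B
      simp_rw [hD] at this
      rw [integral_complex_ofReal] at this
      exact_mod_cast this
    rw [measX, integral_smul_measure, integral_const_mul,
      Measure.integral_comp_inv_smul volume (fun X => κ * gauss D X), h1, ← hcdef,
      finrank_euclideanSpace_fin, abs_pow]
    simp only [smul_eq_mul]
    field_simp
  · intro δ hδ
    refine ⟨hint δ hδ, (memLp_two_iff (hmeas δ).aestronglyMeasurable).2 ?_, fun X => ?_⟩
    · refine lt_of_le_of_lt (lintegral_mono fun p => ?_) (hint δ hδ).2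
      rw [← ofReal_norm, Complex.norm_of_nonneg (Real.exp_pos _).le, sq]
      refine mul_le_of_le_one_right' ?_
      rw [ENNReal.ofReal_le_one, Real.exp_le_one_iff, neg_mul, neg_nonpos]
      positivity
    · rw [measP_eq, integral_smul_measure, (dualEquiv n).measurableEmbedding.integral_map,
        ENNReal.toReal_inv, ← hcdef]
      have h1 : ∀ Y, phase ℏ (dualEquiv n Y) X *
          (Real.exp (-δ ^ 2 * ‖A (dualEquiv n Y)‖ ^ 2) : ℂ) =
          (fun Z => Complex.exp (((-2 * Real.pi *
            inner ℝ Z ((2 * Real.pi * ℏ)⁻¹ • δ⁻¹ • X) : ℝ) : ℂ) * Complex.I) • (gauss B Z : ℂ))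
            (δ • Y) := by
        intro Y
        rw [hEg, phase_dualEquiv]
        simp only [smul_eq_mul]
        congr 5
        rw [inner_smul_right, inner_smul_right, inner_smul_right, real_inner_smul_left,
          real_inner_comm]
        field_simp
      rw [integral_congr_ae (ae_of_all _ h1), Measure.integral_comp_smul_of_nonneg volume
        (fun Z => Complex.exp (((-2 * Real.pi *
            inner ℝ Z ((2 * Real.pi * ℏ)⁻¹ • δ⁻¹ • X) : ℝ) : ℂ) * Complex.I) • (gauss B Z : ℂ))
        (hR := hδ.le), ← Real.fourier_eq', hD,
        finrank_euclideanSpace_fin, Complex.real_smul, Complex.real_smul]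
      norm_cast
      field_simp

end Kernel
end LieWigner
end

/-! ### The overlap of translated wave functions. -/

noncomputable section
namespace LieWigner

section Overlap

/-- An `ε/3` argument: with a common Lipschitz constant, convergence need only be checked on a dense
set. -/
theorem isClosed_setOf_tendsto_of_lipschitz {ι E : Type*} [SeminormedAddCommGroup E]
    {T : ι → E → ℂ} {T₀ : E → ℂ} {l : Filter ι} {C : ℝ}
    (hT : ∀ i a b, ‖T i a - T i b‖ ≤ C * ‖a - b‖) (hT₀ : ∀ a b, ‖T₀ a - T₀ b‖ ≤ C * ‖a - b‖) :
    IsClosed {a | Tendsto (fun i => T i a) l (𝓝 (T₀ a))} := by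
  refine isClosed_of_closure_subset fun a ha => ?_
  rw [Set.mem_ofPred_eq, Metric.tendsto_nhds]
  intro ε hε
  have hC : 0 < |C| + 1 := by positivity
  obtain ⟨b, hb, hab⟩ := SeminormedAddCommGroup.mem_closure_iff.1 ha (ε / (3 * (|C| + 1)))
    (by positivity)
  have hle : C * ‖a - b‖ ≤ ε / 3 := by
    calc C * ‖a - b‖ ≤ (|C| + 1) * (ε / (3 * (|C| + 1))) :=
          mul_le_mul ((le_abs_self C).trans (by linarith)) hab.le (norm_nonneg _) hC.le
      _ = ε / 3 := by field_simp
  filter_upwards [(Metric.tendsto_nhds.1 hb) (ε / 3) (by positivity)] with i hi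
  have h1 := hT i a b
  have h2 := hT₀ a b
  rw [dist_eq_norm] at hi ⊢
  have : T i a - T₀ a = (T i a - T i b) + (T i b - T₀ b) - (T₀ a - T₀ b) := by ring
  rw [this]
  have h3 := norm_sub_le ((T i a - T i b) + (T i b - T₀ b)) (T₀ a - T₀ b)
  have h4 := norm_add_le (T i a - T i b) (T i b - T₀ b)
  linarith

variable {n : ℕ} {G : Type*} [TopologicalSpace G] [ChartedSpace (EuclideanSpace ℝ (Fin n)) G]
  [Group G] {O : Set (LieAlg n)} [MeasurableSpace G] {m : Measure G}
  [LieGroup (𝓡 n) ∞ G] [T2Space G] [BorelSpace G]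
  (hO : IsWeaklyExponential m O) [SecondCountableTopology G] [m.IsHaarMeasure] {ℏ : ℝ}

/-- `∫ ψ(q exp(-X/2)) conj φ(q exp(X/2)) dm(q)`. -/
def overlap (m : Measure G) (φ ψ : G → ℂ) (X : LieAlg n) : ℂ :=
  ∫ q, ψ (q * lieExp ((-(1 / 2) : ℝ) • X)) * (starRingEnd ℂ) (φ (q * lieExp ((1 / 2 : ℝ) • X))) ∂m

theorem overlap_congr {φ φ' ψ ψ' : G → ℂ} (h1 : φ =ᵐ[m] φ') (h2 : ψ =ᵐ[m] ψ') (X : LieAlg n) :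
    overlap m φ ψ X = overlap m φ' ψ' X := by
  have := topologicalGroup_of_lieGroup (𝓡 n) ∞ (G := G)
  have := sigmaFinite_haar n m
  refine integral_congr_ae ?_
  filter_upwards [(quasiMeasurePreserving_mul_right m (lieExp ((1 / 2 : ℝ) • X))).ae h1,
    (quasiMeasurePreserving_mul_right m (lieExp ((-(1 / 2) : ℝ) • X))).ae h2] with q h3 h4
  rw [h3, h4]

include hO

/-- Cauchy-Schwarz; the modular factors of the translations by `exp(-X/2)` and `exp(X/2)` are
inverse to each other, so the bound is uniform in `X`. -/
theorem lintegral_overlap_sq_le {φ ψ : G → ℂ} (hφ : Measurable φ) (hψ : Measurable ψ)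
    (X : LieAlg n) :
    (∫⁻ q, ‖ψ (q * lieExp ((-(1 / 2) : ℝ) • X)) *
      (starRingEnd ℂ) (φ (q * lieExp ((1 / 2 : ℝ) • X)))‖ₑ ∂m) ^ 2 ≤
      (eLpNorm φ 2 m * eLpNorm ψ 2 m) ^ 2 := by
  have := topologicalGroup_of_lieGroup (𝓡 n) ∞ (G := G)
  simp_rw [enorm_mul, RCLike.enorm_conj]
  refine (lintegral_mul_sq_le (by fun_prop) (by fun_prop)).trans ?_
  rw [lintegral_mul_right hO (f := fun x => ‖ψ x‖ₑ ^ 2) (by fun_prop),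
    lintegral_mul_right hO (f := fun x => ‖φ x‖ₑ ^ 2) (by fun_prop), mul_pow, eLpNorm_two_sq,
    eLpNorm_two_sq]
  have h1 : ENNReal.ofReal (absDetAd n (lieExp ((-(1 / 2) : ℝ) • X) : G)) *
      ENNReal.ofReal (absDetAd n (lieExp ((1 / 2 : ℝ) • X) : G)) = 1 := by
    rw [← ENNReal.ofReal_mul (absDetAd_nonneg _), lieExp_neg_half, absDetAd_inv_mul hO,
      ENNReal.ofReal_one]
  refine le_of_eq ?_
  calc _ = (ENNReal.ofReal (absDetAd n (lieExp ((-(1 / 2) : ℝ) • X) : G)) *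
      ENNReal.ofReal (absDetAd n (lieExp ((1 / 2 : ℝ) • X) : G))) *
      ((∫⁻ x, ‖φ x‖ₑ ^ 2 ∂m) * ∫⁻ x, ‖ψ x‖ₑ ^ 2 ∂m) := by ring
    _ = _ := by rw [h1, one_mul]

theorem lintegral_overlap_le (φ ψ : Lp ℂ 2 m) (X : LieAlg n) :
    ∫⁻ q, ‖ψ (q * lieExp ((-(1 / 2) : ℝ) • X)) *
      (starRingEnd ℂ) (φ (q * lieExp ((1 / 2 : ℝ) • X)))‖ₑ ∂m ≤ ENNReal.ofReal (‖φ‖ * ‖ψ‖) := by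
  have h := (ENNReal.pow_le_pow_left_iff two_ne_zero).1 (lintegral_overlap_sq_le hO
    (Lp.stronglyMeasurable φ).measurable (Lp.stronglyMeasurable ψ).measurable X)
  refine h.trans_eq ?_
  rw [ENNReal.ofReal_mul (norm_nonneg _), Lp.norm_def, Lp.norm_def,
    ENNReal.ofReal_toReal (Lp.eLpNorm_ne_top _), ENNReal.ofReal_toReal (Lp.eLpNorm_ne_top _)]

theorem norm_overlap_le (φ ψ : Lp ℂ 2 m) (X : LieAlg n) : ‖overlap m φ ψ X‖ ≤ ‖φ‖ * ‖ψ‖ := by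
  have h := (enorm_integral_le_lintegral_enorm _).trans (lintegral_overlap_le hO φ ψ X)
  rw [← ofReal_norm, ENNReal.ofReal_le_ofReal_iff (by positivity)] at h
  exact h

theorem integrable_overlap (φ ψ : Lp ℂ 2 m) (X : LieAlg n) :
    Integrable (fun q => ψ (q * lieExp ((-(1 / 2) : ℝ) • X)) *
      (starRingEnd ℂ) (φ (q * lieExp ((1 / 2 : ℝ) • X)))) m := by
  have := topologicalGroup_of_lieGroup (𝓡 n) ∞ (G := G)
  have h1 := (Lp.stronglyMeasurable φ).measurable
  have h2 := (Lp.stronglyMeasurable ψ).measurable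
  have h3 : Measurable fun q => ψ (q * lieExp ((-(1 / 2) : ℝ) • X)) *
      (starRingEnd ℂ) (φ (q * lieExp ((1 / 2 : ℝ) • X))) :=
    (h2.comp (measurable_mul_const _)).mul
      (Complex.continuous_conj.measurable.comp (h1.comp (measurable_mul_const _)))
  exact ⟨h3.aestronglyMeasurable, (lintegral_overlap_le hO φ ψ X).trans_lt ENNReal.ofReal_lt_top⟩

theorem overlap_sub_left (φ φ' ψ : Lp ℂ 2 m) (X : LieAlg n) :
    overlap m φ ψ X - overlap m φ' ψ X = overlap m (φ - φ' : Lp ℂ 2 m) ψ X := by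
  rw [overlap_congr (Lp.coeFn_sub φ φ') (EventuallyEq.refl _ (ψ : G → ℂ)), overlap, overlap,
    ← integral_sub (integrable_overlap hO φ ψ X) (integrable_overlap hO φ' ψ X)]
  refine integral_congr_ae (Eventually.of_forall fun q => ?_)
  simp only [Pi.sub_apply, map_sub]
  ring

theorem overlap_sub_right (φ ψ ψ' : Lp ℂ 2 m) (X : LieAlg n) :
    overlap m φ ψ X - overlap m φ ψ' X = overlap m φ (ψ - ψ' : Lp ℂ 2 m) X := by
  rw [overlap_congr (EventuallyEq.refl _ (φ : G → ℂ)) (Lp.coeFn_sub ψ ψ'), overlap, overlap,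
    ← integral_sub (integrable_overlap hO φ ψ X) (integrable_overlap hO φ ψ' X)]
  refine integral_congr_ae (Eventually.of_forall fun q => ?_)
  simp only [Pi.sub_apply]
  ring

theorem continuous_overlap_of_hasCompactSupport {f g : G → ℂ} (hf : Continuous f)
    (hg : Continuous g) (hgc : HasCompactSupport g) : Continuous (overlap (n := n) m f g) := by
  have := topologicalGroup_of_lieGroup (𝓡 n) ∞ (G := G)
  have := locallyCompactSpace_of_charted n G
  have hexp := continuous_lieExp (G := G) hO
  rw [continuous_iff_continuousAt]
  intro X₀
  have hK : IsCompact (Metric.closedBall X₀ 1) := isCompact_closedBall X₀ 1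
  let k : Set G := (fun z : G × LieAlg n => z.1 * lieExp ((1 / 2 : ℝ) • z.2)) ''
    (tsupport g ×ˢ Metric.closedBall X₀ 1)
  have hk : IsCompact k := (hgc.isCompact.prod hK).image (by fun_prop)
  refine (continuousOn_integral_of_compact_support (s := Metric.closedBall X₀ 1) (μ := m)
    (f := fun X q => g (q * lieExp ((-(1 / 2) : ℝ) • X)) *
      (starRingEnd ℂ) (f (q * lieExp ((1 / 2 : ℝ) • X)))) hk ?_ ?_).continuousAt
      (Metric.closedBall_mem_nhds X₀ one_pos)
  · refine Continuous.continuousOn ?_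
    have h1 : Continuous fun z : LieAlg n × G => g (z.2 * lieExp ((-(1 / 2) : ℝ) • z.1)) :=
      hg.comp (by fun_prop)
    have h2 : Continuous fun z : LieAlg n × G => f (z.2 * lieExp ((1 / 2 : ℝ) • z.1)) :=
      hf.comp (by fun_prop)
    exact h1.mul (Complex.continuous_conj.comp h2)
  · intro X q hX hq
    rw [image_eq_zero_of_notMem_tsupport (f := g), zero_mul]
    intro h
    refine hq ⟨(_, X), ⟨h, hX⟩, ?_⟩
    simp only
    rw [mul_assoc, lieExp_neg_half, inv_mul_cancel, mul_one]

/-- The overlap is Lipschitz in each argument uniformly in `X`, so `φ` and then `ψ` may be taken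
continuous with compact support, where the integral depends continuously on `X`. -/
theorem tendsto_overlap (φ ψ : Lp ℂ 2 m) :
    Tendsto (fun X : LieAlg n => overlap m φ ψ X) (𝓝 0) (𝓝 (overlap m φ ψ (0 : LieAlg n))) := by
  have := topologicalGroup_of_lieGroup (𝓡 n) ∞ (G := G)
  have := locallyCompactSpace_of_charted n G
  have hdense : ∀ (S : Set (Lp ℂ 2 m)), IsClosed S →
      (∀ (g : G → ℂ) (hg : MemLp g 2 m), Continuous g → HasCompactSupport g → hg.toLp g ∈ S) →
      ∀ f, f ∈ S := by
    intro S hS h f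
    rw [← hS.closure_eq, Metric.mem_closure_iff]
    intro ε hε
    obtain ⟨g, hgc, hfg, hg, hgm⟩ := (Lp.memLp f).exists_hasCompactSupport_eLpNorm_sub_le
      (by norm_num) (ε := ENNReal.ofReal (ε / 2)) (by simpa using hε)
    refine ⟨_, h g hgm hg hgc, ?_⟩
    rw [dist_edist, ← Lp.toLp_coeFn f (Lp.memLp f), Lp.edist_toLp_toLp]
    exact (ENNReal.toReal_le_of_le_ofReal (by positivity) hfg).trans_lt (by linarith)
  refine hdense {φ | _} (isClosed_setOf_tendsto_of_lipschitz (C := ‖ψ‖)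
    (T := fun X (φ : Lp ℂ 2 m) => overlap m φ ψ X) (T₀ := fun φ => overlap m φ ψ (0 : LieAlg n))
    (fun X a b => ?_) (fun a b => ?_)) (fun f hf hfc _ => ?_) φ
  · rw [overlap_sub_left hO, mul_comm]; exact norm_overlap_le hO _ _ _
  · rw [overlap_sub_left hO, mul_comm]; exact norm_overlap_le hO _ _ _
  refine hdense {ψ | _} (isClosed_setOf_tendsto_of_lipschitz (C := ‖hf.toLp f‖)
    (T := fun X (ψ : Lp ℂ 2 m) => overlap m (hf.toLp f) ψ X)
    (T₀ := fun ψ => overlap m (hf.toLp f) ψ (0 : LieAlg n))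
    (fun X a b => ?_) (fun a b => ?_)) (fun g hg hgc hgs => ?_) ψ
  · rw [overlap_sub_right hO]; exact norm_overlap_le hO _ _ _
  · rw [overlap_sub_right hO]; exact norm_overlap_le hO _ _ _
  have h1 : ∀ X : LieAlg n, overlap m (hf.toLp f) (hg.toLp g) X = overlap m f g X :=
    fun X => overlap_congr hf.coeFn_toLp hg.coeFn_toLp X
  simp only [Set.mem_ofPred_eq, h1]
  exact (continuous_overlap_of_hasCompactSupport hO hfc hgc hgs).tendsto 0

end Overlap
end LieWigner
end

/-! ### The improper integral of a Wigner function over phase space. -/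

noncomputable section
namespace LieWigner

section PhaseSpaceIntegral

/-- Completing the square: `C‖X‖ ≤ C²/(2b) + (b/2)‖X‖²`, so half of the Gaussian decay remains. -/
theorem integrable_exp_mul_exp_neg {V : Type*} [NormedAddCommGroup V] [InnerProductSpace ℝ V]
    [FiniteDimensional ℝ V] [MeasurableSpace V] [BorelSpace V] (C : ℝ) {b : ℝ} (hb : 0 < b) :
    Integrable fun X : V => Real.exp (C * ‖X‖) * Real.exp (-b * ‖X‖ ^ 2) := by
  have h1 := (integrable_gauss (V := V) (ContinuousLinearEquiv.smulLeft
    (Units.mk0 (√(b / 2)) (by positivity)))).const_mul (Real.exp (C ^ 2 / (2 * b)))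
  refine h1.mono' (by fun_prop) (Eventually.of_forall fun X => ?_)
  have h2 : ‖(ContinuousLinearEquiv.smulLeft (Units.mk0 (√(b / 2))
      (by positivity : √(b / 2) ≠ 0)) : V ≃L[ℝ] V) X‖ ^ 2 = b / 2 * ‖X‖ ^ 2 := by
    change ‖√(b / 2) • X‖ ^ 2 = _
    rw [norm_smul, mul_pow, Real.norm_eq_abs, sq_abs, Real.sq_sqrt (by positivity)]
  rw [gauss, h2, ← Real.exp_add, ← Real.exp_add, Real.norm_of_nonneg (Real.exp_pos _).le,
    Real.exp_le_exp]
  have h3 : C ^ 2 / (2 * b) + -(b / 2 * ‖X‖ ^ 2) - (C * ‖X‖ + -b * ‖X‖ ^ 2) =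
      (C - b * ‖X‖) ^ 2 / (2 * b) := by
    field_simp
    ring
  have h4 : 0 ≤ (C - b * ‖X‖) ^ 2 / (2 * b) := by positivity
  linarith

variable {n : ℕ} {G : Type*} [TopologicalSpace G] [ChartedSpace (EuclideanSpace ℝ (Fin n)) G]
  [Group G] {O : Set (LieAlg n)} [MeasurableSpace G] {m : Measure G}
  [LieGroup (𝓡 n) ∞ G] [T2Space G] [BorelSpace G]
  (hO : IsWeaklyExponential m O) [SecondCountableTopology G] [m.IsHaarMeasure] {ℏ : ℝ}

namespace IsGaussianKernel

variable {A : LieDual n ≃L[ℝ] EuclideanSpace ℝ (Fin n)} {k : LieAlg n → ℝ} {κ b : ℝ}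
  (hk : IsGaussianKernel m ℏ A k κ b)
include hk

omit [LieGroup (𝓡 n) ∞ G] [T2Space G] [BorelSpace G] [SecondCountableTopology G]
  [m.IsHaarMeasure] in
theorem scaled_nonneg {δ : ℝ} (hδ : 0 < δ) (X : LieAlg n) : 0 ≤ (δ ^ n)⁻¹ * k (δ⁻¹ • X) :=
  mul_nonneg (by positivity) (hk.nonneg _)

omit [LieGroup (𝓡 n) ∞ G] [T2Space G] [BorelSpace G] [SecondCountableTopology G]
  [m.IsHaarMeasure] in
theorem scaled_le {δ : ℝ} (hδ : 0 < δ) (X : LieAlg n) :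
    (δ ^ n)⁻¹ * k (δ⁻¹ • X) ≤ (δ ^ n)⁻¹ * κ * Real.exp (-(b / δ ^ 2) * ‖X‖ ^ 2) := by
  rw [mul_assoc]
  refine mul_le_mul_of_nonneg_left ((hk.le _).trans_eq ?_) (by positivity)
  rw [norm_smul, mul_pow, norm_inv, Real.norm_eq_abs, inv_pow, sq_abs]
  congr 2
  field_simp

include hO

theorem integrable_weight_mul_scaled {δ : ℝ} (hδ : 0 < δ) :
    Integrable (fun X => weightF G X * ((δ ^ n)⁻¹ * k (δ⁻¹ • X))) (measX m) := by
  obtain ⟨C, -, hC⟩ := exists_exp_bound (G := G) hO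
  refine Integrable.smul_measure ?_ (densityAtOne_ne_top hO)
  have h1 := (integrable_exp_mul_exp_neg (V := LieAlg n) C
    (show 0 < b / δ ^ 2 by have := hk.b_pos; positivity)).const_mul ((δ ^ n)⁻¹ * κ)
  have hc := hk.continuous
  have hF := continuous_weightF (G := G) hO
  refine h1.mono' (by fun_prop) (Eventually.of_forall fun X => ?_)
  rw [Real.norm_of_nonneg (mul_nonneg (weightF_nonneg X) (hk.scaled_nonneg hδ X))]
  refine (mul_le_mul (hC X) (hk.scaled_le hδ X) (hk.scaled_nonneg hδ X)
    (Real.exp_pos _).le).trans_eq (by ring)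

theorem integrable_scaled {δ : ℝ} (hδ : 0 < δ) :
    Integrable (fun X => (δ ^ n)⁻¹ * k (δ⁻¹ • X)) (measX m) := by
  refine Integrable.smul_measure ?_ (densityAtOne_ne_top hO)
  have h1 := (integrable_exp_mul_exp_neg (V := LieAlg n) 0
    (show 0 < b / δ ^ 2 by have := hk.b_pos; positivity)).const_mul ((δ ^ n)⁻¹ * κ)
  have hc := hk.continuous
  refine h1.mono' (by fun_prop) (Eventually.of_forall fun X => ?_)
  rw [Real.norm_of_nonneg (hk.scaled_nonneg hδ X)]
  simpa using hk.scaled_le hδ X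

theorem memLp_scaled {δ : ℝ} (hδ : 0 < δ) :
    MemLp (fun X => (((δ ^ n)⁻¹ * k (δ⁻¹ • X) : ℝ) : ℂ)) 2 (measX m) := by
  have hc := hk.continuous
  have hi := hk.integrable_scaled hO hδ
  have hmeas : AEStronglyMeasurable (fun X => (((δ ^ n)⁻¹ * k (δ⁻¹ • X) : ℝ) : ℂ)) (measX m) :=
    Continuous.aestronglyMeasurable (by fun_prop)
  have hκ := hk.kappa_nonneg
  refine (memLp_two_iff hmeas).2 (lt_of_le_of_lt (lintegral_mono fun X => ?_)
    ((hi.const_mul ((δ ^ n)⁻¹ * κ)).2))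
  have h0 := hk.scaled_nonneg hδ X
  rw [← ofReal_norm, Complex.norm_of_nonneg h0, Real.enorm_of_nonneg (by positivity), sq,
    ← ENNReal.ofReal_mul h0]
  refine ENNReal.ofReal_le_ofReal (mul_le_mul_of_nonneg_right ?_ h0)
  refine (hk.scaled_le hδ X).trans (mul_le_of_le_one_right (by positivity) ?_)
  rw [Real.exp_le_one_iff, neg_mul, neg_nonpos]
  have := hk.b_pos
  positivity

omit [T2Space G] hO [LieGroup (𝓡 n) ∞ G] [BorelSpace G] [SecondCountableTopology G]
  [m.IsHaarMeasure] hk in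
theorem integral_mul_scaled {δ : ℝ} (hδ : 0 < δ) (H : LieAlg n → ℂ) :
    ∫ X, H X * (((δ ^ n)⁻¹ * k (δ⁻¹ • X) : ℝ) : ℂ) ∂(measX m) =
      ∫ X, H (δ • X) * (k X : ℂ) ∂(measX m) := by
  rw [measX, integral_smul_measure, integral_smul_measure]
  congr 1
  have h := Measure.integral_comp_smul_of_nonneg (volume : Measure (LieAlg n))
    (fun X => H X * (k (δ⁻¹ • X) : ℂ)) δ (hR := hδ.le)
  simp only [inv_smul_smul₀ hδ.ne', finrank_euclideanSpace_fin] at h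
  rw [h, ← integral_smul]
  congr 1
  ext1 X
  rw [Complex.real_smul]
  push_cast
  ring

end IsGaussianKernel

include hO

theorem coe_wigner [SFinite m] (hℏ : ℏ ≠ 0) (φ ψ : Lp ℂ 2 m) :
    (wigner ℏ O φ ψ : Lp ℂ 2 (measL (n := n) m ℏ)) = invMomentumFourier m ℏ
      ((memLp_symbolTilde hO (memLp_rankOneKernel φ ψ)).toLp _) := by
  rw [← coe_kernelIso_toLp hO hℏ (memLp_rankOneKernel φ ψ), kernelIso_toLp]
  rfl

theorem ae_integral_wigner_mul_gaussian (hℏ : ℏ ≠ 0) (φ ψ : Lp ℂ 2 m) :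
    ∀ᵐ q ∂m, ∀ (A : LieDual n ≃L[ℝ] EuclideanSpace ℝ (Fin n)) (k : LieAlg n → ℝ) (κ b : ℝ),
      IsGaussianKernel m ℏ A k κ b → ∀ δ : ℝ, 0 < δ →
      Integrable (fun p => (wigner ℏ O φ ψ : Lp ℂ 2 (measL (n := n) m ℏ)) (q, p) *
        (Real.exp (-δ ^ 2 * ‖A p‖ ^ 2) : ℂ)) (measP m) ∧
      ∫ p, (wigner ℏ O φ ψ : Lp ℂ 2 (measL (n := n) m ℏ)) (q, p) *
        (Real.exp (-δ ^ 2 * ‖A p‖ ^ 2) : ℂ) ∂(measP m) =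
      ((|2 * Real.pi * ℏ| ^ n : ℝ) : ℂ) * ∫ X, symbolTilde O (rankOneKernel φ ψ) (q, X) *
        (((δ ^ n)⁻¹ * k (δ⁻¹ • X) : ℝ) : ℂ) ∂(measX m) := by
  have := sigmaFinite_measX (G := G) hO
  have := sigmaFinite_haar n m
  have hm := memLp_symbolTilde hO (memLp_rankOneKernel φ ψ)
  filter_upwards [ae_integral_invMomentumFourier_mul hO hℏ (hm.toLp _),
    Measure.ae_ae_of_ae_prod hm.coeFn_toLp] with q hq hq' A k κ b hk δ hδ
  obtain ⟨h1, h2, h3⟩ := hk.fourier δ hδ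
  have h4 := hq _ h1 h2 (by
    simp_rw [h3, Complex.ofReal_mul (|2 * Real.pi * ℏ| ^ n)]
    exact (hk.memLp_scaled hO hδ).const_mul _)
  rw [coe_wigner hO hℏ]
  refine ⟨h4.1, h4.2.trans ?_⟩
  rw [← integral_const_mul]
  refine integral_congr_ae ?_
  filter_upwards [hq'] with X hX
  rw [hX, h3, Complex.ofReal_mul]
  ring

theorem overlap_zero (φ ψ : Lp ℂ 2 m) : overlap m φ ψ (0 : LieAlg n) = inner ℂ φ ψ := by
  have := sigmaFinite_haar n m
  rw [inner_Lp_eq, overlap]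
  simp_rw [smul_zero, lieExp_zero, mul_one, mul_comm]

omit hO in
theorem integral_symbolTilde_rankOneKernel (φ ψ : Lp ℂ 2 m) (X : LieAlg n) :
    ∫ q, symbolTilde O (rankOneKernel φ ψ) (q, X) ∂m =
      O.indicator (fun X => overlap m φ ψ X * (weightF G X : ℂ)) X := by
  classical
  by_cases hX : X ∈ O
  · simp only [symbolTilde, hX, if_true, Set.indicator_of_mem, rankOneKernel, overlap]
    rw [integral_mul_const]
  · simp [symbolTilde, hX]

theorem stronglyMeasurable_symbolTilde_rankOneKernel (φ ψ : Lp ℂ 2 m) :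
    StronglyMeasurable (symbolTilde O (rankOneKernel φ ψ)) := by
  have h1 : Measurable (rankOneKernel φ ψ) :=
    ((Lp.stronglyMeasurable ψ).measurable.comp measurable_fst).mul
      (Complex.continuous_conj.measurable.comp
        ((Lp.stronglyMeasurable φ).measurable.comp measurable_snd))
  rw [symbolTilde_eq_indicator]
  refine (Measurable.indicator ?_
    (MeasurableSet.univ.prod hO.isOpen.measurableSet)).stronglyMeasurable
  exact (h1.comp (continuous_endpoints hO).measurable).mul (Complex.continuous_ofReal.measurable.comp
    ((continuous_weightF (G := G) hO).measurable.comp measurable_snd))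

/-- As `K` does not depend on `q`, Hölder on `G × 𝔤` is unavailable. Integrating over `q` first, the
overlap bound leaves only `∫ F |K|`. -/
theorem integrable_symbolTilde_mul (φ ψ : Lp ℂ 2 m) {K : LieAlg n → ℝ}
    (hK : Continuous K) (hFK : Integrable (fun X => weightF G X * K X) (measX m)) :
    Integrable (fun y => symbolTilde O (rankOneKernel φ ψ) y * (K y.2 : ℂ)) (measN m) := by
  classical
  have := sigmaFinite_measX (G := G) hO
  have := sigmaFinite_haar n m
  have hm := (memLp_symbolTilde hO (memLp_rankOneKernel φ ψ)).1
  have hmeas : AEStronglyMeasurable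
      (fun y => symbolTilde O (rankOneKernel φ ψ) y * (K y.2 : ℂ)) (measN m) :=
    hm.mul (Complex.continuous_ofReal.comp (hK.comp continuous_snd)).aestronglyMeasurable
  refine ⟨hmeas, ?_⟩
  change ∫⁻ y, _ ∂(m.prod (measX m)) < ⊤
  rw [lintegral_prod_symm _ hmeas.enorm]
  refine lt_of_le_of_lt (b := ∫⁻ X, ENNReal.ofReal (‖φ‖ * ‖ψ‖) * ‖weightF G X * K X‖ₑ ∂(measX m))
    (lintegral_mono fun X => ?_) ?_
  · by_cases hX : X ∈ O
    · simp only [symbolTilde, hX, if_true, rankOneKernel]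
      have h1 : ∀ q, ‖ψ (q * lieExp ((-(1 / 2) : ℝ) • X)) *
          (starRingEnd ℂ) (φ (q * lieExp ((1 / 2 : ℝ) • X))) * (weightF G X : ℂ) * (K X : ℂ)‖ₑ =
          ‖ψ (q * lieExp ((-(1 / 2) : ℝ) • X)) *
          (starRingEnd ℂ) (φ (q * lieExp ((1 / 2 : ℝ) • X)))‖ₑ * ‖weightF G X * K X‖ₑ := by
        intro q
        rw [mul_assoc _ (weightF G X : ℂ), enorm_mul, ← Complex.ofReal_mul]
        congr 1
        rw [← ofReal_norm, Complex.norm_real, ofReal_norm]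
      simp_rw [h1]
      rw [lintegral_mul_const' _ _ enorm_ne_top]
      exact mul_le_mul_left (lintegral_overlap_le hO φ ψ X) _
    · simp [symbolTilde, hX]
  · rw [lintegral_const_mul' _ _ ENNReal.ofReal_ne_top]
    exact ENNReal.mul_lt_top ENNReal.ofReal_lt_top hFK.2

/-- After Fubini the regularized integral is `∫ H(δX) k(X) dX`, where `H` is the overlap times `F`
on `O` and zero elsewhere. `H` is continuous at `0` with value `(φ, ψ)` and grows at most
exponentially, so dominated convergence applies. -/
theorem hasPhaseSpaceIntegral_wigner (hℏ : ℏ ≠ 0) (φ ψ : Lp ℂ 2 m) :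
    HasPhaseSpaceIntegral m ℏ (wigner ℏ O φ ψ : Lp ℂ 2 (measL (n := n) m ℏ)) (inner ℂ φ ψ) := by
  intro A
  have := sigmaFinite_measX (G := G) hO
  have := sigmaFinite_haar n m
  obtain ⟨k, κ, b, hk⟩ := exists_gaussian_kernel (m := m) hO hℏ A
  have hae := ae_integral_wigner_mul_gaussian hO hℏ φ ψ
  have hl : 0 < |2 * Real.pi * ℏ| ^ n := by
    have := Real.pi_ne_zero
    positivity
  have hint : ∀ δ : ℝ, 0 < δ → Integrable (fun y => symbolTilde O (rankOneKernel φ ψ) y *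
      (((δ ^ n)⁻¹ * k (δ⁻¹ • y.2) : ℝ) : ℂ)) (m.prod (measX m)) := fun δ hδ =>
    integrable_symbolTilde_mul hO φ ψ (K := fun X => (δ ^ n)⁻¹ * k (δ⁻¹ • X))
      (by have := hk.continuous; fun_prop) (hk.integrable_weight_mul_scaled hO hδ)
  let H : LieAlg n → ℂ := fun X => ∫ q, symbolTilde O (rankOneKernel φ ψ) (q, X) ∂m
  have hH : ∀ X, H X = O.indicator (fun X => overlap m φ ψ X * (weightF G X : ℂ)) X :=
    integral_symbolTilde_rankOneKernel φ ψ
  have hval : ∀ δ : ℝ, 0 < δ → ((|2 * Real.pi * ℏ| ^ n : ℝ) : ℂ)⁻¹ *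
      ∫ q, ∫ p, (wigner ℏ O φ ψ : Lp ℂ 2 (measL (n := n) m ℏ)) (q, p) *
        (Real.exp (-δ ^ 2 * ‖A p‖ ^ 2) : ℂ) ∂(measP m) ∂m =
      ∫ X, H (δ • X) * (k X : ℂ) ∂(measX m) := by
    intro δ hδ
    have h1 := integral_congr_ae (hae.mono fun q hq => (hq A k κ b hk δ hδ).2)
    rw [h1, integral_const_mul, inv_mul_cancel_left₀ (by exact_mod_cast hl.ne'),
      integral_integral_swap (hint δ hδ), ← IsGaussianKernel.integral_mul_scaled hδ]
    simp_rw [integral_mul_const]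
    rfl
  -- The width of the kernel is `δ = √ε`.
  refine ⟨fun ε hε => ?_, ?_⟩
  · have hδ : 0 < √ε := Real.sqrt_pos.2 hε
    have hsq : -(√ε) ^ 2 = -ε := by rw [Real.sq_sqrt hε.le]
    rw [← hsq]
    refine ⟨hae.mono fun q hq => (hq A k κ b hk _ hδ).1, ?_⟩
    exact ((hint _ hδ).integral_prod_left.const_mul _).congr
      (hae.mono fun q hq => (hq A k κ b hk _ hδ).2.symm)
  have hHm : StronglyMeasurable H :=
    (stronglyMeasurable_symbolTilde_rankOneKernel hO φ ψ).integral_prod_left'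
  obtain ⟨C, hC0, hC⟩ := exists_exp_bound (G := G) hO
  have hbd : ∀ X, ‖H X‖ ≤ ‖φ‖ * ‖ψ‖ * Real.exp (C * ‖X‖) := by
    intro X
    rw [hH]
    refine (norm_indicator_le_norm_self _ _).trans ?_
    rw [norm_mul, Complex.norm_of_nonneg (weightF_nonneg X)]
    exact mul_le_mul (norm_overlap_le hO φ ψ X) (hC X) (weightF_nonneg X) (by positivity)
  have hH0 : Tendsto H (𝓝 0) (𝓝 (inner ℂ φ ψ)) := by
    have h1 : Tendsto (fun X : LieAlg n => overlap m φ ψ X * (weightF G X : ℂ)) (𝓝 0)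
        (𝓝 (inner ℂ φ ψ)) := by
      have h2 : Tendsto (fun X : LieAlg n => (weightF G X : ℂ)) (𝓝 0) (𝓝 1) := by
        have := (Complex.continuous_ofReal.comp (continuous_weightF (G := G) hO)).tendsto 0
        simpa only [Function.comp_def, weightF_zero hO, Complex.ofReal_one] using this
      have := (tendsto_overlap hO φ ψ).mul h2
      rwa [overlap_zero hO, mul_one] at this
    refine h1.congr' ?_
    filter_upwards [mem_nhds_zero hO] with X hX
    rw [hH, Set.indicator_of_mem hX]
  have hlim : Tendsto (fun ε : ℝ => ∫ X, H (√ε • X) * (k X : ℂ) ∂(measX m)) (𝓝[>] 0)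
      (𝓝 (inner ℂ φ ψ)) := by
    have h1 : (inner ℂ φ ψ : ℂ) = ∫ X, inner ℂ φ ψ * (k X : ℂ) ∂(measX m) := by
      rw [integral_const_mul, integral_complex_ofReal, hk.integral_eq_one]; simp
    rw [h1]
    refine tendsto_integral_filter_of_dominated_convergence
      (fun X => ‖φ‖ * ‖ψ‖ * κ * (Real.exp (C * ‖X‖) * Real.exp (-b * ‖X‖ ^ 2)))
      (Eventually.of_forall fun ε => ?_) ?_ ?_ (Eventually.of_forall fun X => ?_)
    · have h2 : StronglyMeasurable fun X : LieAlg n => H (√ε • X) :=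
        hHm.comp_measurable (measurable_const_smul _)
      exact (h2.mul (Complex.continuous_ofReal.comp
        hk.continuous).stronglyMeasurable).aestronglyMeasurable
    · filter_upwards [Ioo_mem_nhdsGT (zero_lt_one' ℝ)] with ε hε
      refine Eventually.of_forall fun X => ?_
      rw [norm_mul, Complex.norm_of_nonneg (hk.nonneg X)]
      have h2 : ‖H (√ε • X)‖ ≤ ‖φ‖ * ‖ψ‖ * Real.exp (C * ‖X‖) := by
        refine (hbd _).trans ?_
        refine mul_le_mul_of_nonneg_left (Real.exp_le_exp.2 ?_) (by positivity)
        refine mul_le_mul_of_nonneg_left ?_ hC0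
        rw [norm_smul, Real.norm_of_nonneg (Real.sqrt_nonneg _)]
        refine mul_le_of_le_one_left (norm_nonneg _) ?_
        rw [Real.sqrt_le_one]
        exact hε.2.le
      refine (mul_le_mul h2 (hk.le X) (hk.nonneg X) (by positivity)).trans_eq (by ring)
    · exact Integrable.smul_measure ((integrable_exp_mul_exp_neg C hk.b_pos).const_mul _)
        (densityAtOne_ne_top hO)
    · refine Tendsto.mul_const _ (hH0.comp ?_)
      have h2 : Continuous fun ε : ℝ => √ε • X := by fun_prop
      have := h2.tendsto 0
      rw [Real.sqrt_zero, zero_smul] at this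
      exact this.mono_left nhdsWithin_le_nhds
  refine hlim.congr' ?_
  filter_upwards [self_mem_nhdsWithin] with ε hε
  rw [← hval _ (Real.sqrt_pos.2 hε), Real.sq_sqrt (le_of_lt hε)]

end PhaseSpaceIntegral
end LieWigner
end

/-! ### Comparison of small balls in exponential coordinates at different centres. -/

noncomputable section
namespace LieWigner

section Lebesgue

variable {n : ℕ} {G : Type*} [TopologicalSpace G] [ChartedSpace (EuclideanSpace ℝ (Fin n)) G]
  [Group G] {O : Set (LieAlg n)} [MeasurableSpace G] {m : Measure G}
  [LieGroup (𝓡 n) ∞ G] [T2Space G] [BorelSpace G]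
  (hO : IsWeaklyExponential m O) [SecondCountableTopology G] [m.IsHaarMeasure] {ℏ : ℝ}
include hO

theorem ae_of_ae_lieExp {P : G → Prop} (h : ∀ᵐ X : LieAlg n, X ∈ O → P (lieExp X)) :
    ∀ᵐ q ∂m, P q := by
  set N := toMeasurable (volume : Measure (LieAlg n)) {X | ¬(X ∈ O → P (lieExp X))} with hN
  have hN0 : volume N = 0 := by rw [hN, measure_toMeasurable]; exact h
  have hNm : MeasurableSet N := measurableSet_toMeasurable _ _
  have hf : Measurable fun q : G =>
      N.indicator (1 : LieAlg n → ℝ≥0∞) ((expImage G O).indicator (lieLog O) q) :=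
    (measurable_one.indicator hNm).comp (measurable_indicator_lieLog hO)
  have h0 : ∫⁻ q, N.indicator (1 : LieAlg n → ℝ≥0∞)
      ((expImage G O).indicator (lieLog O) q) ∂m = 0 := by
    rw [lintegral_haar hO hf, measX, Measure.restrict_smul, lintegral_smul_measure]
    have h1 : ∀ᵐ X : LieAlg n, X ∉ N := measure_eq_zero_iff_ae_notMem.1 hN0
    have h2 : ∫⁻ X : LieAlg n in O, ENNReal.ofReal (expJac G O X) * N.indicator (1 : LieAlg n → ℝ≥0∞)
        ((expImage G O).indicator (lieLog O) (lieExp X : G)) = 0 := by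
      rw [setLIntegral_congr_fun_ae hO.isOpen.measurableSet (g := fun _ => 0)]
      · simp
      · filter_upwards [h1] with X hX hXO
        rw [Set.indicator_of_mem (lieExp_mem_expImage hXO), lieLog_lieExp hO hXO,
          Set.indicator_of_notMem hX, mul_zero]
    rw [h2, smul_zero]
  filter_upwards [ae_mem_expImage hO, (lintegral_eq_zero_iff hf).1 h0] with q hq hq0
  rw [Set.indicator_of_mem hq] at hq0
  by_contra hP
  have h3 : lieLog O q ∈ N := by
    refine subset_toMeasurable _ _ ?_
    change ¬(_ → _)
    rw [lieExp_lieLog hq]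
    exact fun h => hP (h (lieLog_mem hq))
  simp [h3] at hq0

/-- The map `(Y, X) ↦ log(exp Y exp X)` is smooth near the origin and equals `Y` at `X = 0`.
Translated balls thus sit inside Euclidean balls of comparable radius in one fixed chart. -/
theorem exists_lieLog_mul_lipschitz : ∃ r₁ > 0, ∃ ρ > 0, ∃ L : ℝ, 0 < L ∧ ρ ≤ r₁ ∧
    Metric.closedBall 0 r₁ ⊆ O ∧
    (∀ X ∈ Metric.closedBall (0 : LieAlg n) r₁, 1 / 2 ≤ expJac G O X ∧ expJac G O X ≤ 2) ∧
    ∀ Y ∈ Metric.ball (0 : LieAlg n) ρ, ∀ X ∈ Metric.ball (0 : LieAlg n) ρ,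
      (lieExp Y * lieExp X : G) ∈ expImage G O ∧
      lieLog O (lieExp Y * lieExp X : G) ∈ Metric.ball 0 r₁ ∧
      ‖lieLog O (lieExp Y * lieExp X : G) - Y‖ ≤ L * ‖X‖ := by
  have := topologicalGroup_of_lieGroup (𝓡 n) ∞ (G := G)
  obtain ⟨r₁, hr₁, hr₁O, hJ⟩ := exists_ball_expJac (G := G) hO
  have e1 : (lieExp (0 : LieAlg n) : G) = 1 := lieExp_zero
  have hexp := continuous_lieExp (G := G) hO
  have h1 : ContMDiffAt 𝓘(ℝ, LieAlg n × LieAlg n) (𝓡 n) ∞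
      (fun p : LieAlg n × LieAlg n => (lieExp p.1 * lieExp p.2 : G)) 0 :=
    (contMDiffAt_lieExp hO contDiff_fst.contDiffAt).mul
      (contMDiffAt_lieExp hO contDiff_snd.contDiffAt)
  have h2 : ContDiffAt ℝ ∞
      (fun p : LieAlg n × LieAlg n => lieLog O (lieExp p.1 * lieExp p.2 : G)) 0 :=
    contDiffAt_lieLog hO h1 (by simpa [e1] using one_mem_expImage hO)
  obtain ⟨K, t, ht, hK⟩ := (h2.of_le (m := 1) (by exact_mod_cast le_top)).exists_lipschitzOnWith
  have h3 : ∀ᶠ p : LieAlg n × LieAlg n in 𝓝 0, (lieExp p.1 * lieExp p.2 : G) ∈ expImage G O := by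
    have hc : Continuous fun p : LieAlg n × LieAlg n => (lieExp p.1 * lieExp p.2 : G) := by
      fun_prop
    refine hc.continuousAt.eventually_mem (hO.isOpen_image.mem_nhds ?_)
    simp only [Prod.fst_zero, Prod.snd_zero, e1, mul_one]
    exact one_mem_expImage hO
  have h4 : ∀ᶠ p : LieAlg n × LieAlg n in 𝓝 0,
      lieLog O (lieExp p.1 * lieExp p.2 : G) ∈ Metric.ball 0 r₁ := by
    refine h2.continuousAt.eventually_mem (Metric.isOpen_ball.mem_nhds ?_)
    have := lieLog_lieExp (G := G) hO hO.zero_mem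
    rw [e1] at this
    simpa [e1, this] using hr₁
  obtain ⟨ρ, hρ, h5⟩ := Metric.mem_nhds_iff.1 (Filter.inter_mem ht (h3.and h4))
  -- The local Lipschitz constant `K` may be zero; `K + 1` is positive.
  refine ⟨r₁, hr₁, min ρ r₁, lt_min hρ hr₁, K + 1, by positivity, min_le_right _ _, hr₁O, hJ,
    fun Y hY X hX => ?_⟩
  have hYρ : ‖Y‖ < ρ := (mem_ball_zero_iff.1 hY).trans_le (min_le_left _ _)
  have hXρ : ‖X‖ < ρ := (mem_ball_zero_iff.1 hX).trans_le (min_le_left _ _)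
  have hYO : Y ∈ O := hr₁O (mem_closedBall_zero_iff.2
    ((mem_ball_zero_iff.1 hY).trans_le (min_le_right _ _)).le)
  have m1 : ((Y, X) : LieAlg n × LieAlg n) ∈ Metric.ball (0 : LieAlg n × LieAlg n) ρ := by
    rw [mem_ball_zero_iff, Prod.norm_def]; exact max_lt hYρ hXρ
  have m2 : ((Y, 0) : LieAlg n × LieAlg n) ∈ Metric.ball (0 : LieAlg n × LieAlg n) ρ := by
    rw [mem_ball_zero_iff, Prod.norm_def]; exact max_lt hYρ (by simpa using hρ)
  refine ⟨(h5 m1).2.1, (h5 m1).2.2, ?_⟩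
  have h6 := hK.dist_le_mul _ (h5 m1).1 _ (h5 m2).1
  simp only [e1, mul_one, lieLog_lieExp hO hYO, dist_eq_norm] at h6
  refine h6.trans ?_
  rw [Prod.mk_sub_mk, sub_self, sub_zero, Prod.norm_def]
  simp only [norm_zero, norm_nonneg, sup_of_le_right]
  nlinarith [norm_nonneg X]

theorem lintegral_ball_le {r₁ : ℝ} (hr₁O : Metric.closedBall 0 r₁ ⊆ O)
    (hJ : ∀ X ∈ Metric.closedBall (0 : LieAlg n) r₁, 1 / 2 ≤ expJac G O X ∧ expJac G O X ≤ 2)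
    {r : ℝ} (hr : r ≤ r₁) {v : G → ℝ≥0∞} (hv : Measurable v) :
    ∫⁻ X in Metric.ball (0 : LieAlg n) r, v (lieExp X) ∂(measX m) ≤
      2 * ∫⁻ x, ((lieExp : LieAlg n → G) '' Metric.ball 0 r).indicator v x ∂m := by
  have hball : Metric.ball (0 : LieAlg n) r ⊆ Metric.closedBall 0 r₁ :=
    (Metric.ball_subset_ball hr).trans Metric.ball_subset_closedBall
  set S : Set G := (lieExp : LieAlg n → G) '' Metric.ball 0 r with hS
  have hSm : MeasurableSet S :=
    (isOpen_lieExp_image hO Metric.isOpen_ball (hball.trans hr₁O)).measurableSet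
  calc ∫⁻ X in Metric.ball (0 : LieAlg n) r, v (lieExp X) ∂(measX m)
      ≤ ∫⁻ X in Metric.ball (0 : LieAlg n) r, 2 * (ENNReal.ofReal (expJac G O X) *
          S.indicator v (lieExp X)) ∂(measX m) := by
        refine setLIntegral_mono' measurableSet_ball fun X hX => ?_
        rw [Set.indicator_of_mem (Set.mem_image_of_mem _ hX), ← mul_assoc]
        refine le_mul_of_one_le_left' ?_
        have h1 := (hJ X (hball hX)).1
        rw [← ENNReal.ofReal_ofNat, ← ENNReal.ofReal_mul (by norm_num), ENNReal.one_le_ofReal]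
        linarith
    _ ≤ ∫⁻ X in O, 2 * (ENNReal.ofReal (expJac G O X) * S.indicator v (lieExp X)) ∂(measX m) :=
        lintegral_mono_set (hball.trans hr₁O)
    _ = 2 * ∫⁻ x, S.indicator v x ∂m := by
        rw [lintegral_const_mul' _ _ (by norm_num), lintegral_haar hO (hv.indicator hSm)]

/-- The integral passes to Haar measure, is left translated by `exp Y` and returns to the chart. The
bounds `1/2 ≤ expJac ≤ 2` cost a factor `2` in each direction, hence `4`. -/
theorem lintegral_ball_translate_le {r₁ ρ L : ℝ} (hρr : ρ ≤ r₁)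
    (hr₁O : Metric.closedBall 0 r₁ ⊆ O)
    (hJ : ∀ X ∈ Metric.closedBall (0 : LieAlg n) r₁, 1 / 2 ≤ expJac G O X ∧ expJac G O X ≤ 2)
    (hlog : ∀ Y ∈ Metric.ball (0 : LieAlg n) ρ, ∀ X ∈ Metric.ball (0 : LieAlg n) ρ,
      (lieExp Y * lieExp X : G) ∈ expImage G O ∧
      lieLog O (lieExp Y * lieExp X : G) ∈ Metric.ball 0 r₁ ∧
      ‖lieLog O (lieExp Y * lieExp X : G) - Y‖ ≤ L * ‖X‖) (hL : 0 < L)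
    {Y : LieAlg n} (hY : Y ∈ Metric.ball (0 : LieAlg n) ρ) {r : ℝ} (hr : r ≤ ρ) {v : G → ℝ≥0∞}
    (hv : Measurable v) :
    ∫⁻ X : LieAlg n in Metric.ball 0 r, v (lieExp Y * lieExp X : G) ∂(measX m) ≤
      4 * ∫⁻ W : LieAlg n in Metric.closedBall Y (L * r) ∩ Metric.ball 0 r₁, v (lieExp W) ∂(measX m) := by
  have := topologicalGroup_of_lieGroup (𝓡 n) ∞ (G := G)
  have hball : Metric.ball (0 : LieAlg n) r ⊆ Metric.closedBall 0 r₁ :=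
    (Metric.ball_subset_ball (hr.trans hρr)).trans Metric.ball_subset_closedBall
  set S : Set G := (lieExp : LieAlg n → G) '' Metric.ball 0 r with hS
  have hSm : MeasurableSet S :=
    (isOpen_lieExp_image hO Metric.isOpen_ball (hball.trans hr₁O)).measurableSet
  have hmul : Measurable fun x : G => v (lieExp Y * x) := hv.comp (measurable_const_mul _)
  have hmem : ∀ X ∈ O, (lieExp X : G) ∈ S → X ∈ Metric.ball (0 : LieAlg n) r := by
    rintro X hX ⟨X', hX', he⟩
    rwa [← hO.injOn (hr₁O (hball hX')) hX he]
  have hcomp : Measurable fun x : G =>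
      S.indicator (fun x => v (lieExp Y * x)) ((lieExp Y)⁻¹ * x) :=
    (hmul.indicator hSm).comp (measurable_const_mul _)
  calc ∫⁻ X : LieAlg n in Metric.ball 0 r, v (lieExp Y * lieExp X) ∂(measX m)
      ≤ 2 * ∫⁻ x, S.indicator (fun x => v (lieExp Y * x)) x ∂m :=
        lintegral_ball_le hO hr₁O hJ (hr.trans hρr) hmul
    _ = 2 * ∫⁻ x, S.indicator (fun x => v (lieExp Y * x)) ((lieExp Y)⁻¹ * x) ∂m := by
        rw [lintegral_mul_left_eq_self]
    _ = 2 * ∫⁻ W : LieAlg n in O, ENNReal.ofReal (expJac G O W) *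
          S.indicator (fun x => v (lieExp Y * x)) ((lieExp Y)⁻¹ * lieExp W) ∂(measX m) := by
        rw [lintegral_haar hO hcomp]
    _ ≤ 2 * ∫⁻ W : LieAlg n in O, (Metric.closedBall Y (L * r) ∩ Metric.ball 0 r₁).indicator
          (fun W : LieAlg n => 2 * v (lieExp W)) W ∂(measX m) := by
        refine mul_le_mul_right (setLIntegral_mono' hO.isOpen.measurableSet fun W hW => ?_) _
        by_cases hWS : (lieExp Y)⁻¹ * (lieExp W : G) ∈ S
        · obtain ⟨X, hX, he⟩ := hWS
          have he' : (lieExp W : G) = lieExp Y * lieExp X := by rw [he, mul_inv_cancel_left]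
          have h2 := hlog Y hY X (Metric.ball_subset_ball hr hX)
          rw [← he', lieLog_lieExp hO hW] at h2
          have h3 : W ∈ Metric.closedBall Y (L * r) ∩ Metric.ball 0 r₁ := by
            refine ⟨?_, h2.2.1⟩
            rw [mem_closedBall_iff_norm]
            exact h2.2.2.trans (mul_le_mul_of_nonneg_left (mem_ball_zero_iff.1 hX).le hL.le)
          rw [Set.indicator_of_mem h3, Set.indicator_of_mem (show (lieExp Y)⁻¹ * lieExp W ∈ S from ⟨X, hX, he⟩),
            mul_inv_cancel_left]
          refine mul_le_mul_left ?_ _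
          rw [← ENNReal.ofReal_ofNat]
          exact ENNReal.ofReal_le_ofReal (hJ W (Metric.ball_subset_closedBall h2.2.1)).2
        · rw [Set.indicator_of_notMem hWS, mul_zero]
          exact zero_le
    _ ≤ 2 * ∫⁻ W : LieAlg n, (Metric.closedBall Y (L * r) ∩ Metric.ball 0 r₁).indicator
          (fun W : LieAlg n => 2 * v (lieExp W)) W ∂(measX m) :=
        mul_le_mul_right (setLIntegral_le_lintegral _ _) _
    _ = 4 * ∫⁻ W : LieAlg n in Metric.closedBall Y (L * r) ∩ Metric.ball 0 r₁, v (lieExp W) ∂(measX m) := by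
        rw [lintegral_indicator (measurableSet_closedBall.inter measurableSet_ball),
          lintegral_const_mul' _ _ (by norm_num), ← mul_assoc]
        norm_num

omit hO [T2Space G] [BorelSpace G] [SecondCountableTopology G] [m.IsHaarMeasure]
  [LieGroup (𝓡 n) ∞ G] in
theorem setLIntegral_enorm_eq_average {E : Type*} [NormedAddCommGroup E] {u : LieAlg n → E}
    {S : Set (LieAlg n)} (hu : IntegrableOn u S) (h0 : volume S ≠ 0) (ht : volume S ≠ ⊤) :
    ∫⁻ W in S, ‖u W‖ₑ = volume S * ENNReal.ofReal (⨍ W in S, ‖u W‖) := by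
  have h1 : 0 < volume.real S := ENNReal.toReal_pos h0 ht
  rw [setAverage_eq, smul_eq_mul, ENNReal.ofReal_mul (by positivity), ← mul_assoc,
    ofReal_integral_norm_eq_lintegral_enorm hu, ENNReal.ofReal_inv_of_pos h1, Measure.real,
    ENNReal.ofReal_toReal ht, ENNReal.mul_inv_cancel h0 ht, one_mul]

end Lebesgue

/-! ### Lebesgue points on the group. -/

section LebesguePoint

variable {n : ℕ} {G : Type*} [TopologicalSpace G] [ChartedSpace (EuclideanSpace ℝ (Fin n)) G]
  [Group G] {O : Set (LieAlg n)} [MeasurableSpace G] {m : Measure G}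
  {E : Type*} [NormedAddCommGroup E]

/-- `q` is a Lebesgue point of `f`, in exponential coordinates centred at `q`. -/
def IsLebesguePoint (n : ℕ) {G : Type*} [TopologicalSpace G]
    [ChartedSpace (EuclideanSpace ℝ (Fin n)) G] [Group G] [MeasurableSpace G]
    (m : Measure G) (f : G → E) (q : G) : Prop :=
  Tendsto (fun r : ℝ => ENNReal.ofReal (r ^ n)⁻¹ *
    ∫⁻ X in Metric.ball (0 : LieAlg n) r, ‖f (q * lieExp X) - f q‖ₑ ∂(measX m)) (𝓝[>] 0) (𝓝 0)

theorem isLebesguePoint_translate (f : G → E) (q₀ q : G) :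
    IsLebesguePoint n m (fun x => f (q₀ * x)) q ↔ IsLebesguePoint n m f (q₀ * q) := by
  simp only [IsLebesguePoint, mul_assoc]

variable [LieGroup (𝓡 n) ∞ G] [T2Space G] [BorelSpace G]
  (hO : IsWeaklyExponential m O) [SecondCountableTopology G] [m.IsHaarMeasure]
include hO

/-- Near the identity `f` becomes a function on `𝔤` through `exp`, and the Euclidean differentiation
theorem applies to it. The ball of radius `r` at `q = exp Y` lies in the Euclidean ball of radius `L
r` at `Y`, whose volume differs from that of a ball of radius `r` by the fixed factor `Lⁿ`. -/
theorem exists_nhds_ae_isLebesguePoint {f : G → E} (hf : StronglyMeasurable f)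
    (hl : LocallyIntegrable f m) :
    ∃ U ∈ 𝓝 (1 : G), ∀ᵐ q ∂m, q ∈ U → IsLebesguePoint n m f q := by
  obtain ⟨r₁, hr₁, ρ, hρ, L, hL, hρr, hr₁O, hJ, hlog⟩ := exists_lieLog_mul_lipschitz (G := G) hO
  have hexp := continuous_lieExp (G := G) hO
  have hc0 := densityAtOne_ne_zero hO
  have hct := densityAtOne_ne_top hO
  set g : LieAlg n → E := (Metric.ball 0 r₁).indicator fun W => f (lieExp W) with hgdef
  have hgm : StronglyMeasurable g :=
    (hf.comp_measurable hexp.measurable).indicator measurableSet_ball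
  have hg : Integrable g := by
    refine (integrable_smul_measure hc0 hct).1 (?_ : Integrable g (measX m))
    refine ⟨hgm.aestronglyMeasurable, ?_⟩
    have h1 : ∫⁻ W, ‖g W‖ₑ ∂(measX m) =
        ∫⁻ W in Metric.ball (0 : LieAlg n) r₁, ‖f (lieExp W)‖ₑ ∂(measX m) := by
      rw [← lintegral_indicator measurableSet_ball]
      simp_rw [hgdef, enorm_indicator_eq_indicator_enorm]
    change ∫⁻ W, ‖g W‖ₑ ∂(measX m) < ⊤
    rw [h1]
    refine (lintegral_ball_le hO hr₁O hJ le_rfl hf.enorm).trans_lt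
      (ENNReal.mul_lt_top (by norm_num) ?_)
    have h2 : IsCompact ((lieExp : LieAlg n → G) '' Metric.closedBall 0 r₁) :=
      (isCompact_closedBall _ _).image hexp
    refine lt_of_le_of_lt ?_ (hl.integrableOn_isCompact h2).2
    rw [← lintegral_indicator h2.measurableSet]
    refine lintegral_mono fun x => ?_
    exact Set.indicator_le_indicator_of_subset (Set.image_mono Metric.ball_subset_closedBall)
      (fun _ => zero_le) x
  have hd := IsUnifLocDoublingMeasure.ae_tendsto_average_norm_sub volume hg.locallyIntegrable 1
  have hbO : Metric.ball (0 : LieAlg n) ρ ⊆ O :=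
    ((Metric.ball_subset_ball hρr).trans Metric.ball_subset_closedBall).trans hr₁O
  refine ⟨(lieExp : LieAlg n → G) '' Metric.ball 0 ρ,
    (isOpen_lieExp_image hO Metric.isOpen_ball hbO).mem_nhds
      ⟨0, Metric.mem_ball_self hρ, lieExp_zero⟩, ae_of_ae_lieExp hO ?_⟩
  filter_upwards [hd] with Y hY hYO hmem
  obtain ⟨Y', hY', he⟩ := hmem
  obtain rfl : Y' = Y := hO.injOn (hbO hY') hYO he
  have hYr : Y' ∈ Metric.ball (0 : LieAlg n) r₁ := Metric.ball_subset_ball hρr hY'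
  have h1 := hY (l := 𝓝[>] (0 : ℝ)) (fun _ => Y') (fun r => L * r) (by
      refine tendsto_nhdsWithin_iff.2 ⟨?_, ?_⟩
      · have : Tendsto (fun r : ℝ => L * r) (𝓝 0) (𝓝 (L * 0)) := by
          exact (continuous_const_mul L).tendsto 0
        rw [mul_zero] at this
        exact this.mono_left nhdsWithin_le_nhds
      · filter_upwards [self_mem_nhdsWithin] with r hr
        exact mul_pos hL hr) (by
      filter_upwards [self_mem_nhdsWithin] with r hr
      refine Metric.mem_closedBall_self ?_
      rw [one_mul]
      exact (mul_pos hL hr).le)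
  have h2 : Tendsto (fun r : ℝ => 4 * densityAtOne (n := n) m * ENNReal.ofReal (L ^ n) *
      volume (Metric.ball (0 : LieAlg n) 1) *
      ENNReal.ofReal (⨍ W in Metric.closedBall Y' (L * r), ‖g W - g Y'‖)) (𝓝[>] 0) (𝓝 0) := by
    have h3 := ENNReal.tendsto_ofReal h1
    rw [ENNReal.ofReal_zero] at h3
    have h4 := ENNReal.Tendsto.const_mul (a := 4 * densityAtOne (n := n) m *
      ENNReal.ofReal (L ^ n) * volume (Metric.ball (0 : LieAlg n) 1)) h3 (Or.inr (by
        have := (measure_ball_lt_top (μ := volume) (x := (0 : LieAlg n)) (r := 1)).ne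
        finiteness))
    rwa [mul_zero] at h4
  refine tendsto_of_tendsto_of_tendsto_of_le_of_le' tendsto_const_nhds h2
    (Eventually.of_forall fun _ => zero_le) ?_
  filter_upwards [Ioo_mem_nhdsGT hρ] with r hr
  have hr0 : 0 < r := hr.1
  have hLr : 0 < L * r := mul_pos hL hr0
  have hvm : Measurable fun x => ‖f x - f (lieExp Y')‖ₑ :=
    (hf.sub stronglyMeasurable_const).enorm
  have h5 := lintegral_ball_translate_le (m := m) hO hρr hr₁O hJ hlog hL hY' hr.2.le hvm
  have h6 : ∫⁻ W in Metric.closedBall Y' (L * r) ∩ Metric.ball 0 r₁,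
      ‖f (lieExp W) - f (lieExp Y')‖ₑ ∂(measX m) ≤
      densityAtOne (n := n) m * ∫⁻ W in Metric.closedBall Y' (L * r), ‖g W - g Y'‖ₑ := by
    rw [measX, Measure.restrict_smul, lintegral_smul_measure, smul_eq_mul]
    refine mul_le_mul_right (le_trans (le_of_eq ?_)
      (lintegral_mono_set
      (Set.inter_subset_left (t := Metric.ball 0 r₁)))) _
    refine setLIntegral_congr_fun (measurableSet_closedBall.inter measurableSet_ball)
      fun W hW => ?_
    simp only [hgdef]
    rw [Set.indicator_of_mem hW.2, Set.indicator_of_mem hYr]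
  have h7 : volume (Metric.closedBall Y' (L * r)) =
      ENNReal.ofReal (L ^ n) * ENNReal.ofReal (r ^ n) * volume (Metric.ball (0 : LieAlg n) 1) := by
    rw [Measure.addHaar_closedBall volume Y' hLr.le, finrank_euclideanSpace_fin, mul_pow,
      ENNReal.ofReal_mul (by positivity)]
  have hfin : volume (Metric.closedBall Y' (L * r)) ≠ ⊤ := measure_closedBall_lt_top.ne
  have h9 : IntegrableOn (fun W => g W - g Y') (Metric.closedBall Y' (L * r)) :=
    hg.integrableOn.sub (integrableOn_const hfin)
  rw [setLIntegral_enorm_eq_average h9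
    (Metric.measure_closedBall_pos _ _ hLr).ne' hfin, h7] at h6
  have h8 : ENNReal.ofReal (r ^ n)⁻¹ * ENNReal.ofReal (r ^ n) = 1 := by
    rw [← ENNReal.ofReal_mul (by positivity), inv_mul_cancel₀ (by positivity), ENNReal.ofReal_one]
  calc _ ≤ ENNReal.ofReal (r ^ n)⁻¹ * (4 * (densityAtOne (n := n) m * (ENNReal.ofReal (L ^ n) *
        ENNReal.ofReal (r ^ n) * volume (Metric.ball (0 : LieAlg n) 1) *
        ENNReal.ofReal (⨍ W in Metric.closedBall Y' (L * r), ‖g W - g Y'‖)))) :=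
        mul_le_mul_right (h5.trans (mul_le_mul_right h6 _)) _
    _ = (ENNReal.ofReal (r ^ n)⁻¹ * ENNReal.ofReal (r ^ n)) * (4 * densityAtOne (n := n) m *
        ENNReal.ofReal (L ^ n) * volume (Metric.ball (0 : LieAlg n) 1) *
        ENNReal.ofReal (⨍ W in Metric.closedBall Y' (L * r), ‖g W - g Y'‖)) := by ring
    _ = _ := by rw [h8, one_mul]

/-- The condition is invariant under left translation, so the statement near `1` holds near every
point, and local null sets suffice. -/
theorem ae_isLebesguePoint {f : G → E} (hf : StronglyMeasurable f)
    (hl : LocallyIntegrable f m) : ∀ᵐ q ∂m, IsLebesguePoint n m f q := by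
  have := topologicalGroup_of_lieGroup (𝓡 n) ∞ (G := G)
  refine measure_null_of_locally_null _ fun q₀ _ => ?_
  have hl' : LocallyIntegrable (fun x => f (q₀ * x)) m := by
    have h1 := locallyIntegrable_map_homeomorph (f := f) (Homeomorph.mulLeft q₀) (μ := m)
    have h2 : m.map (Homeomorph.mulLeft q₀) = m := map_mul_left_eq_self m q₀
    rw [h2] at h1
    exact h1.1 hl
  obtain ⟨U, hU, h⟩ := exists_nhds_ae_isLebesguePoint hO
    (hf.comp_measurable (measurable_const_mul q₀)) hl'
  refine ⟨(fun x => q₀⁻¹ * x) ⁻¹' {q | ¬(q ∈ U → IsLebesguePoint n m (fun x => f (q₀ * x)) q)},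
    ?_, ?_⟩
  · have hc : (fun x => q₀⁻¹ * x) ⁻¹' U ∈ 𝓝 q₀ := by
      refine (continuous_const_mul q₀⁻¹).continuousAt.preimage_mem_nhds ?_
      rwa [inv_mul_cancel]
    filter_upwards [mem_nhdsWithin_of_mem_nhds hc, self_mem_nhdsWithin] with x hx hx'
    intro hc
    have := hc hx
    rw [isLebesguePoint_translate, mul_inv_cancel_left] at this
    exact hx' this
  · rw [measure_preimage_mul]
    exact h

end LebesguePoint
end LieWigner
end

/-! ### Gaussian approximate identities at points with vanishing mean values. -/

noncomputable section
namespace LieWigner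

section ApproximateIdentity

theorem tendsto_tsum_of_dominated {f : ℝ → ℕ → ℝ≥0∞} {l : Filter ℝ} [l.IsCountablyGenerated]
    {g : ℕ → ℝ≥0∞} (hg : ∑' j, g j ≠ ⊤) (hfg : ∀ᶠ δ in l, ∀ j, f δ j ≤ g j)
    (hf : ∀ j, Tendsto (fun δ => f δ j) l (𝓝 0)) :
    Tendsto (fun δ => ∑' j, f δ j) l (𝓝 0) := by
  have h := tendsto_lintegral_filter_of_dominated_convergence (μ := Measure.count) (l := l)
    (F := f) (f := fun _ => 0) g (Eventually.of_forall fun _ => measurable_of_countable _)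
    (hfg.mono fun δ hδ => Eventually.of_forall hδ) (by rwa [lintegral_count])
    (Eventually.of_forall hf)
  simpa [lintegral_count] using h

/-- The exponent satisfies `-b j² + (b/8)(j+1)² ≤ 2b - (b/2)(j+1)`, so the series is dominated by a
polynomial times a geometric decay. -/
theorem summable_succ_pow_mul_exp (n : ℕ) {b : ℝ} (hb : 0 < b) :
    Summable fun j : ℕ => ((j : ℝ) + 1) ^ n *
      (Real.exp (-b * (j : ℝ) ^ 2) * Real.exp (b / 8 * ((j : ℝ) + 1) ^ 2)) := by
  have h1 := ((summable_nat_add_iff 1).2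
    (Real.summable_pow_mul_exp_neg_nat_mul n (show 0 < b / 2 by positivity))).mul_left
      (Real.exp (2 * b))
  refine Summable.of_nonneg_of_le (fun j => by positivity) (fun j => ?_) h1
  rw [← Real.exp_add, mul_left_comm, ← Real.exp_add]
  push_cast
  refine mul_le_mul_of_nonneg_left (Real.exp_le_exp.2 ?_) (by positivity)
  have h2 : (j : ℝ) ≤ (j : ℝ) ^ 2 := by
    exact_mod_cast Nat.le_self_pow two_ne_zero j
  nlinarith [sq_nonneg ((j : ℝ) - 1)]

variable {n : ℕ} {G : Type*} [TopologicalSpace G] [ChartedSpace (EuclideanSpace ℝ (Fin n)) G]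
  [Group G] {O : Set (LieAlg n)} [MeasurableSpace G] {m : Measure G} {ℏ : ℝ}

/-- Mean values over balls which vanish in the limit of small radii, together with integrability
against Gaussians, give a growth bound. -/
theorem exists_mean_le {v : LieAlg n → ℝ≥0∞} {b : ℝ}
    (hlim : Tendsto (fun r : ℝ => ENNReal.ofReal (r ^ n)⁻¹ *
      ∫⁻ X in Metric.ball (0 : LieAlg n) r, v X ∂(measX m)) (𝓝[>] 0) (𝓝 0)) (hb : 0 < b)
    (hfin : ∫⁻ X, v X * ENNReal.ofReal (Real.exp (-b * ‖X‖ ^ 2)) ∂(measX m) ≠ ⊤) :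
    ∃ C : ℝ≥0∞, C ≠ ⊤ ∧ ∀ r : ℝ, 0 < r → ENNReal.ofReal (r ^ n)⁻¹ *
      ∫⁻ X in Metric.ball (0 : LieAlg n) r, v X ∂(measX m) ≤
        C * ENNReal.ofReal (Real.exp (b * r ^ 2)) := by
  have h1 := ENNReal.tendsto_nhds_zero.1 hlim 1 one_pos
  obtain ⟨r₁, hr₁, h2⟩ := mem_nhdsGT_iff_exists_Ioo_subset.1 h1
  have hr₁ : 0 < r₁ := hr₁
  refine ⟨1 + ENNReal.ofReal (r₁ ^ n)⁻¹ *
    ∫⁻ X, v X * ENNReal.ofReal (Real.exp (-b * ‖X‖ ^ 2)) ∂(measX m), by finiteness,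
    fun r hr => ?_⟩
  have h3 : 1 ≤ ENNReal.ofReal (Real.exp (b * r ^ 2)) := by
    rw [ENNReal.one_le_ofReal, Real.one_le_exp_iff]; positivity
  rw [add_mul]
  -- Small radii are controlled by the limit. For the others, `1 ≤ exp(b r²) exp(-b‖X‖²)` on the
  -- ball brings in the Gaussian integral of `v`.
  by_cases hrr : r < r₁
  · refine le_add_right ((h2 ⟨hr, hrr⟩ : _ ≤ (1 : ℝ≥0∞)).trans ?_)
    rwa [one_mul]
  · refine le_add_left ?_
    rw [mul_assoc]
    push Not at hrr
    refine mul_le_mul' (ENNReal.ofReal_le_ofReal (by gcongr)) ?_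
    rw [mul_comm, ← lintegral_const_mul' _ _ ENNReal.ofReal_ne_top]
    refine (setLIntegral_mono' measurableSet_ball fun X hX => ?_).trans
      (setLIntegral_le_lintegral _ _)
    have h4 : 1 ≤ ENNReal.ofReal (Real.exp (b * r ^ 2)) *
        ENNReal.ofReal (Real.exp (-b * ‖X‖ ^ 2)) := by
      rw [← ENNReal.ofReal_mul (Real.exp_pos _).le, ← Real.exp_add, ENNReal.one_le_ofReal,
        Real.one_le_exp_iff]
      have h5 := mem_ball_zero_iff.1 hX
      have h6 : ‖X‖ ^ 2 ≤ r ^ 2 := by gcongr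
      nlinarith
    calc v X ≤ v X * (ENNReal.ofReal (Real.exp (b * r ^ 2)) *
        ENNReal.ofReal (Real.exp (-b * ‖X‖ ^ 2))) := le_mul_of_one_le_right' h4
      _ = _ := by ring

/-- The scaled kernel is dominated by a sum over `j` of indicators of balls of radius `δ(j+1)` with
weights decaying like `exp(-b j²)`. The integral is thus at most a weighted sum of mean values of
`v`; each tends to zero, and the growth bound of `exists_mean_le` permits passage to the limit under
the sum. -/
theorem IsGaussianKernel.tendsto_lintegral {A : LieDual n ≃L[ℝ] EuclideanSpace ℝ (Fin n)}
    {k : LieAlg n → ℝ} {κ b : ℝ} (hk : IsGaussianKernel m ℏ A k κ b) {v : LieAlg n → ℝ≥0∞}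
    (hv : Measurable v)
    (hlim : Tendsto (fun r : ℝ => ENNReal.ofReal (r ^ n)⁻¹ *
      ∫⁻ X in Metric.ball (0 : LieAlg n) r, v X ∂(measX m)) (𝓝[>] 0) (𝓝 0))
    (hfin : ∀ b : ℝ, 0 < b →
      ∫⁻ X, v X * ENNReal.ofReal (Real.exp (-b * ‖X‖ ^ 2)) ∂(measX m) ≠ ⊤) :
    Tendsto (fun δ : ℝ => ∫⁻ X, v X * ENNReal.ofReal ((δ ^ n)⁻¹ * k (δ⁻¹ • X)) ∂(measX m))
      (𝓝[>] 0) (𝓝 0) := by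
  set a : ℝ → ℝ≥0∞ := fun r => ENNReal.ofReal (r ^ n)⁻¹ *
      ∫⁻ X in Metric.ball (0 : LieAlg n) r, v X ∂(measX m) with ha
  have hb := hk.b_pos
  have hb8 : 0 < b / 8 := by positivity
  have hκ := hk.kappa_nonneg
  -- The rate `b/8` is small enough that `exp(-b j²)` outweighs the growth `exp((b/8)(j+1)²)` of the
  -- means.
  obtain ⟨C, hC, hCa⟩ := exists_mean_le hlim hb8 (hfin _ hb8)
  let w : ℕ → ℝ := fun j => κ * Real.exp (-b * (j : ℝ) ^ 2)
  have hw : ∀ j, 0 ≤ w j := fun j => by positivity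
  have hpt : ∀ δ : ℝ, 0 < δ → ∀ X : LieAlg n, ENNReal.ofReal ((δ ^ n)⁻¹ * k (δ⁻¹ • X)) ≤
      ∑' j : ℕ, (Metric.ball (0 : LieAlg n) (δ * (j + 1))).indicator
        (fun _ => ENNReal.ofReal ((δ ^ n)⁻¹ * w j)) X := by
    intro δ hδ X
    refine le_trans ?_ (ENNReal.le_tsum ⌊‖X‖ / δ⌋₊)
    have h1 : X ∈ Metric.ball (0 : LieAlg n) (δ * ((⌊‖X‖ / δ⌋₊ : ℕ) + 1)) := by
      rw [mem_ball_zero_iff, ← div_lt_iff₀' hδ]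
      exact Nat.lt_floor_add_one _
    rw [Set.indicator_of_mem h1]
    refine ENNReal.ofReal_le_ofReal (mul_le_mul_of_nonneg_left ((hk.le _).trans ?_)
      (by positivity))
    refine mul_le_mul_of_nonneg_left (Real.exp_le_exp.2 ?_) hκ
    rw [neg_mul, neg_mul, neg_le_neg_iff]
    refine mul_le_mul_of_nonneg_left (pow_le_pow_left₀ (by positivity) ?_ 2) hb.le
    rw [norm_smul, norm_inv, Real.norm_of_nonneg hδ.le, inv_mul_eq_div]
    exact Nat.floor_le (by positivity)
  have hle : ∀ δ : ℝ, 0 < δ →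
      ∫⁻ X, v X * ENNReal.ofReal ((δ ^ n)⁻¹ * k (δ⁻¹ • X)) ∂(measX m) ≤
      ∑' j : ℕ, ENNReal.ofReal (((j : ℝ) + 1) ^ n * w j) * a (δ * (j + 1)) := by
    intro δ hδ
    refine (lintegral_mono fun X => mul_le_mul_right (hpt δ hδ X) (v X)).trans_eq ?_
    simp_rw [← ENNReal.tsum_mul_left]
    have hmeas : ∀ j : ℕ, Measurable fun X => v X *
        (Metric.ball (0 : LieAlg n) (δ * (j + 1))).indicator
          (fun _ => ENNReal.ofReal ((δ ^ n)⁻¹ * w j)) X :=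
      fun j => hv.mul (measurable_const.indicator measurableSet_ball)
    rw [lintegral_tsum fun j => (hmeas j).aemeasurable]
    congr 1
    ext1 j
    have h1 : ∀ X, v X * (Metric.ball (0 : LieAlg n) (δ * (j + 1))).indicator
        (fun _ => ENNReal.ofReal ((δ ^ n)⁻¹ * w j)) X =
        (Metric.ball (0 : LieAlg n) (δ * (j + 1))).indicator
        (fun X => ENNReal.ofReal ((δ ^ n)⁻¹ * w j) * v X) X := by
      intro X
      by_cases hX : X ∈ Metric.ball (0 : LieAlg n) (δ * (j + 1))
      · rw [Set.indicator_of_mem hX, Set.indicator_of_mem hX, mul_comm]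
      · rw [Set.indicator_of_notMem hX, Set.indicator_of_notMem hX, mul_zero]
    simp_rw [h1]
    rw [lintegral_indicator measurableSet_ball, lintegral_const_mul' _ _ ENNReal.ofReal_ne_top,
      ha, ← mul_assoc (ENNReal.ofReal (((j : ℝ) + 1) ^ n * w j)),
      ← ENNReal.ofReal_mul (mul_nonneg (by positivity) (hw j))]
    congr 2
    rw [mul_pow]
    have : (0 : ℝ) < (j : ℝ) + 1 := by positivity
    field_simp
  refine tendsto_of_tendsto_of_tendsto_of_le_of_le' tendsto_const_nhds (h := fun δ : ℝ =>
    ∑' j : ℕ, ENNReal.ofReal (((j : ℝ) + 1) ^ n * w j) * a (δ * (j + 1))) ?_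
    (Eventually.of_forall fun _ => zero_le) (by
      filter_upwards [self_mem_nhdsWithin] with δ hδ using hle δ hδ)
  refine tendsto_tsum_of_dominated (g := fun j : ℕ => C * ENNReal.ofReal (κ * (((j : ℝ) + 1) ^ n *
      (Real.exp (-b * (j : ℝ) ^ 2) * Real.exp (b / 8 * ((j : ℝ) + 1) ^ 2))))) ?_ ?_ ?_
  · rw [ENNReal.tsum_mul_left]
    exact ENNReal.mul_ne_top hC ((summable_succ_pow_mul_exp n hb).mul_left κ).tsum_ofReal_ne_top
  · filter_upwards [Ioo_mem_nhdsGT (zero_lt_one' ℝ)] with δ hδ j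
    have hj : (0 : ℝ) < (j : ℝ) + 1 := by positivity
    have h1 : a (δ * (j + 1)) ≤ C * ENNReal.ofReal (Real.exp (b / 8 * ((j : ℝ) + 1) ^ 2)) := by
      refine (hCa _ (mul_pos hδ.1 hj)).trans (mul_le_mul_right (ENNReal.ofReal_le_ofReal
        (Real.exp_le_exp.2 (mul_le_mul_of_nonneg_left
          (pow_le_pow_left₀ (mul_pos hδ.1 hj).le ?_ 2) hb8.le))) _)
      exact mul_le_of_le_one_left hj.le hδ.2.le
    refine (mul_le_mul_right h1 _).trans_eq ?_
    rw [mul_left_comm, ← ENNReal.ofReal_mul (mul_nonneg (by positivity) (hw j))]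
    congr 2
    simp only [w]
    ring
  · intro j
    have hj : (0 : ℝ) < (j : ℝ) + 1 := by positivity
    have h1 : Tendsto (fun δ : ℝ => a (δ * (j + 1))) (𝓝[>] 0) (𝓝 0) := by
      refine hlim.comp (tendsto_nhdsWithin_iff.2 ⟨?_, ?_⟩)
      · have : Tendsto (fun δ : ℝ => δ * ((j : ℝ) + 1)) (𝓝 0) (𝓝 (0 * ((j : ℝ) + 1))) :=
          (continuous_mul_const ((j : ℝ) + 1)).tendsto 0
        rw [zero_mul] at this
        exact this.mono_left nhdsWithin_le_nhds
      · filter_upwards [self_mem_nhdsWithin] with δ hδ using mul_pos hδ hj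
    have h2 := ENNReal.Tendsto.const_mul (a := ENNReal.ofReal (((j : ℝ) + 1) ^ n * w j)) h1
      (Or.inr ENNReal.ofReal_ne_top)
    rwa [mul_zero] at h2

end ApproximateIdentity
end LieWigner
end

/-! ### The position density as an improper momentum integral. -/

noncomputable section
namespace LieWigner

section MomentumIntegral

variable {n : ℕ} {G : Type*} [TopologicalSpace G] [ChartedSpace (EuclideanSpace ℝ (Fin n)) G]
  [Group G] {O : Set (LieAlg n)} [MeasurableSpace G] {m : Measure G} {ℏ : ℝ}

theorem lintegral_ball_smul {s r : ℝ} (hs : s ≠ 0) (w : LieAlg n → ℝ≥0∞) (hw : Measurable w) :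
    ∫⁻ X in Metric.ball (0 : LieAlg n) r, w (s • X) ∂(measX m) =
      ENNReal.ofReal (|s| ^ n)⁻¹ * ∫⁻ X in Metric.ball (0 : LieAlg n) (|s| * r), w X ∂(measX m) := by
  have h1 : ∀ X : LieAlg n, (Metric.ball (0 : LieAlg n) r).indicator (fun X => w (s • X)) X =
      (Metric.ball (0 : LieAlg n) (|s| * r)).indicator w (s • X) := by
    intro X
    have hs' : 0 < |s| := abs_pos.2 hs
    have h2 : s • X ∈ Metric.ball (0 : LieAlg n) (|s| * r) ↔ X ∈ Metric.ball (0 : LieAlg n) r := by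
      rw [mem_ball_zero_iff, mem_ball_zero_iff, norm_smul, Real.norm_eq_abs,
        mul_lt_mul_iff_right₀ hs']
    by_cases hX : X ∈ Metric.ball (0 : LieAlg n) r
    · rw [Set.indicator_of_mem hX, Set.indicator_of_mem (h2.2 hX)]
    · rw [Set.indicator_of_notMem hX, Set.indicator_of_notMem (fun h => hX (h2.1 h))]
  rw [← lintegral_indicator measurableSet_ball, ← lintegral_indicator measurableSet_ball, measX,
    lintegral_smul_measure, lintegral_smul_measure]
  simp_rw [h1]
  have hm : Measurable ((Metric.ball (0 : LieAlg n) (|s| * r)).indicator w) :=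
    hw.indicator measurableSet_ball
  rw [← lintegral_map (μ := (volume : Measure (LieAlg n))) hm (measurable_const_smul s),
    Measure.map_addHaar_smul volume hs, lintegral_smul_measure, finrank_euclideanSpace_fin,
    abs_inv, abs_pow]
  simp only [smul_eq_mul]
  ring

theorem IsLebesguePoint.comp_smul {E : Type*} [NormedAddCommGroup E] {f : G → E} {q : G}
    (h : IsLebesguePoint n m f q)
    (hm : Measurable fun X : LieAlg n => ‖f (q * lieExp X) - f q‖ₑ) {s : ℝ} (hs : s ≠ 0) :
    Tendsto (fun r : ℝ => ENNReal.ofReal (r ^ n)⁻¹ *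
      ∫⁻ X in Metric.ball (0 : LieAlg n) r, ‖f (q * lieExp (s • X)) - f q‖ₑ ∂(measX m))
      (𝓝[>] 0) (𝓝 0) := by
  have hs' : 0 < |s| := abs_pos.2 hs
  have h1 : Tendsto (fun r : ℝ => |s| * r) (𝓝[>] 0) (𝓝[>] 0) := by
    refine tendsto_nhdsWithin_iff.2 ⟨?_, ?_⟩
    · have := (continuous_const_mul |s|).tendsto 0
      rw [mul_zero] at this
      exact this.mono_left nhdsWithin_le_nhds
    · filter_upwards [self_mem_nhdsWithin] with r hr using mul_pos hs' hr
  refine (Tendsto.comp h h1).congr' ?_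
  filter_upwards [self_mem_nhdsWithin] with r hr
  have hr : 0 < r := hr
  simp only [Function.comp_apply]
  rw [lintegral_ball_smul hs (fun X => ‖f (q * lieExp X) - f q‖ₑ) hm, ← mul_assoc,
    ← ENNReal.ofReal_mul (by positivity), mul_pow, mul_inv, mul_comm (|s| ^ n)⁻¹]

theorem tendsto_mean_of_tendsto {w : LieAlg n → ℝ≥0∞} (hc : densityAtOne (n := n) m ≠ ⊤)
    (hw : Tendsto w (𝓝 0) (𝓝 0)) :
    Tendsto (fun r : ℝ => ENNReal.ofReal (r ^ n)⁻¹ *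
      ∫⁻ X in Metric.ball (0 : LieAlg n) r, w X ∂(measX m)) (𝓝[>] 0) (𝓝 0) := by
  rw [ENNReal.tendsto_nhds_zero]
  intro ε hε
  set M := densityAtOne (n := n) m * volume (Metric.ball (0 : LieAlg n) 1) with hM
  have hMt : M ≠ ⊤ := ENNReal.mul_ne_top hc measure_ball_lt_top.ne
  have h1 := ENNReal.tendsto_nhds_zero.1 hw (ε / M) (ENNReal.div_pos hε.ne' hMt)
  obtain ⟨r₁, hr₁, h2⟩ := Metric.eventually_nhds_iff_ball.1 h1
  filter_upwards [Ioo_mem_nhdsGT hr₁] with r hr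
  have hr0 : 0 < r := hr.1
  have h3 : measX m (Metric.ball (0 : LieAlg n) r) = ENNReal.ofReal (r ^ n) * M := by
    rw [measX, Measure.smul_apply, Measure.addHaar_ball_of_pos volume _ hr0,
      finrank_euclideanSpace_fin, smul_eq_mul, hM]
    ring
  calc ENNReal.ofReal (r ^ n)⁻¹ * ∫⁻ X in Metric.ball (0 : LieAlg n) r, w X ∂(measX m)
      ≤ ENNReal.ofReal (r ^ n)⁻¹ * ∫⁻ X in Metric.ball (0 : LieAlg n) r, ε / M ∂(measX m) :=
        mul_le_mul_right (setLIntegral_mono' measurableSet_ball fun X hX =>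
          h2 X (Metric.ball_subset_ball hr.2.le hX)) _
    _ = (ENNReal.ofReal (r ^ n)⁻¹ * ENNReal.ofReal (r ^ n)) * (ε / M * M) := by
        rw [setLIntegral_const, h3]; ring
    _ ≤ 1 * ε := by
        refine mul_le_mul' (le_of_eq ?_) (by
          rw [div_eq_mul_inv, mul_assoc]
          exact mul_le_of_le_one_right' (ENNReal.inv_mul_le_one M))
        rw [← ENNReal.ofReal_mul (by positivity), inv_mul_cancel₀ (by positivity),
          ENNReal.ofReal_one]
    _ = ε := one_mul ε

/-- From `|z|² - |w|² = |z - w|² + 2 Re(w conj(z - w))`. A common Lebesgue point of `φ` and `|φ|²`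
is thereby a Lebesgue point of `φ` in the quadratic mean. -/
theorem norm_sub_sq_le (z w : ℂ) :
    ‖z - w‖ ^ 2 ≤ ‖‖z‖ ^ 2 - ‖w‖ ^ 2‖ + 2 * ‖w‖ * ‖z - w‖ := by
  have h1 : ‖z‖ ^ 2 - ‖w‖ ^ 2 = ‖z - w‖ ^ 2 + 2 * (w * (starRingEnd ℂ) (z - w)).re := by
    simp only [← Complex.normSq_eq_norm_sq, Complex.normSq_apply]
    simp
    ring
  have h2 : |(w * (starRingEnd ℂ) (z - w)).re| ≤ ‖w‖ * ‖z - w‖ := by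
    refine (Complex.abs_re_le_norm _).trans_eq ?_
    rw [norm_mul, RCLike.norm_conj]
  have h3 := le_abs_self (‖z‖ ^ 2 - ‖w‖ ^ 2)
  have h4 := neg_le_of_abs_le h2
  rw [Real.norm_eq_abs]
  linarith

/-- Expand about `w`. The product `|z₁ - w| |z₂ - w|` is at most half the sum of the squares, each
bounded by `norm_sub_sq_le`, and `F ≤ 2` makes up for the half. -/
theorem norm_mul_conj_sub_le (z₁ z₂ w : ℂ) {F : ℝ} (hF : 0 ≤ F) (hF2 : F ≤ 2) :
    ‖z₁ * (starRingEnd ℂ) z₂ * (F : ℂ) - ((‖w‖ ^ 2 : ℝ) : ℂ)‖ ≤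
      ‖‖z₁‖ ^ 2 - ‖w‖ ^ 2‖ + ‖‖z₂‖ ^ 2 - ‖w‖ ^ 2‖ + 4 * ‖w‖ * ‖z₁ - w‖ +
        4 * ‖w‖ * ‖z₂ - w‖ + ‖w‖ ^ 2 * ‖F - 1‖ := by
  have h0 : z₁ * (starRingEnd ℂ) z₂ * (F : ℂ) - ((‖w‖ ^ 2 : ℝ) : ℂ) =
      (F : ℂ) * ((z₁ - w) * (starRingEnd ℂ) (z₂ - w) + (z₁ - w) * (starRingEnd ℂ) w +
        w * (starRingEnd ℂ) (z₂ - w)) + ((‖w‖ ^ 2 : ℝ) : ℂ) * ((F - 1 : ℝ) : ℂ) := by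
    have : ((‖w‖ ^ 2 : ℝ) : ℂ) = w * (starRingEnd ℂ) w := by
      rw [Complex.mul_conj, Complex.normSq_eq_norm_sq]
    rw [this]
    push_cast
    simp only [map_sub]
    ring
  have h1 := norm_sub_sq_le z₁ w
  have h2 := norm_sub_sq_le z₂ w
  have h3 : ‖(z₁ - w) * (starRingEnd ℂ) (z₂ - w) + (z₁ - w) * (starRingEnd ℂ) w +
        w * (starRingEnd ℂ) (z₂ - w)‖ ≤ ‖z₁ - w‖ * ‖z₂ - w‖ + ‖z₁ - w‖ * ‖w‖ +
        ‖w‖ * ‖z₂ - w‖ := by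
    refine (norm_add₃_le).trans_eq ?_
    simp only [norm_mul, RCLike.norm_conj]
  rw [h0]
  refine (norm_add_le _ _).trans ?_
  rw [norm_mul, norm_mul, Complex.norm_of_nonneg hF, Complex.norm_real, Complex.norm_real,
    Real.norm_of_nonneg (sq_nonneg ‖w‖)]
  have h4 := mul_le_mul hF2 h3 (norm_nonneg _) (by norm_num)
  nlinarith [sq_nonneg (‖z₁ - w‖ - ‖z₂ - w‖)]

variable [LieGroup (𝓡 n) ∞ G] [T2Space G] [BorelSpace G]
  (hO : IsWeaklyExponential m O) [SecondCountableTopology G] [m.IsHaarMeasure]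
include hO

theorem tendsto_mean_symbolTilde_sub (φ : Lp ℂ 2 m) {q : G}
    (h1 : IsLebesguePoint n m (φ : G → ℂ) q)
    (h2 : IsLebesguePoint n m (fun x => ‖(φ : G → ℂ) x‖ ^ 2) q) :
    Tendsto (fun r : ℝ => ENNReal.ofReal (r ^ n)⁻¹ *
      ∫⁻ X in Metric.ball (0 : LieAlg n) r, ‖symbolTilde O (rankOneKernel φ φ) (q, X) -
        ((‖(φ : G → ℂ) q‖ ^ 2 : ℝ) : ℂ)‖ₑ ∂(measX m)) (𝓝[>] 0) (𝓝 0) := by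
  classical
  have := topologicalGroup_of_lieGroup (𝓡 n) ∞ (G := G)
  have hφ := (Lp.stronglyMeasurable φ).measurable
  have hexp : Measurable fun X : LieAlg n => q * (lieExp X : G) :=
    (continuous_const.mul (continuous_lieExp hO)).measurable
  have hw1 : Measurable fun X : LieAlg n => ‖(φ : G → ℂ) (q * lieExp X) - (φ : G → ℂ) q‖ₑ :=
    ((hφ.comp hexp).sub_const _).enorm
  have hw2 : Measurable fun X : LieAlg n =>
      ‖‖(φ : G → ℂ) (q * lieExp X)‖ ^ 2 - ‖(φ : G → ℂ) q‖ ^ 2‖ₑ :=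
    (((hφ.comp hexp).norm.pow_const 2).sub_const _).enorm
  have hs : (-(1 / 2) : ℝ) ≠ 0 := by norm_num
  have hs' : (1 / 2 : ℝ) ≠ 0 := by norm_num
  set c := (φ : G → ℂ) q with hc
  have hF := continuous_weightF (G := G) hO
  have hFt : Tendsto (fun X : LieAlg n => ‖weightF G X - 1‖ₑ) (𝓝 0) (𝓝 0) := by
    have h3 : Continuous fun X : LieAlg n => ‖weightF G X - 1‖ₑ := by fun_prop
    have := h3.tendsto 0
    rwa [weightF_zero hO, sub_self, enorm_zero] at this
  have t1 := h2.comp_smul hw2 hs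
  have t2 := h2.comp_smul hw2 hs'
  have t3 := ENNReal.Tendsto.const_mul (a := ENNReal.ofReal (4 * ‖c‖)) (h1.comp_smul hw1 hs)
    (Or.inr ENNReal.ofReal_ne_top)
  have t4 := ENNReal.Tendsto.const_mul (a := ENNReal.ofReal (4 * ‖c‖)) (h1.comp_smul hw1 hs')
    (Or.inr ENNReal.ofReal_ne_top)
  have t5 := ENNReal.Tendsto.const_mul (a := ENNReal.ofReal (‖c‖ ^ 2))
    (tendsto_mean_of_tendsto (m := m) (densityAtOne_ne_top hO) hFt) (Or.inr ENNReal.ofReal_ne_top)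
  have t := (((t1.add t2).add t3).add t4).add t5
  simp only [mul_zero, add_zero] at t
  refine tendsto_of_tendsto_of_tendsto_of_le_of_le' tendsto_const_nhds t
    (Eventually.of_forall fun _ => zero_le) ?_
  have hev : ∀ᶠ X : LieAlg n in 𝓝 0, X ∈ O ∧ weightF G X ≤ 2 := by
    refine Eventually.and (mem_nhds_zero hO) ?_
    have := hF.continuousAt.eventually (Iio_mem_nhds (show weightF G (0 : LieAlg n) < 2 by
      rw [weightF_zero hO]; norm_num))
    exact this.mono fun X hX => le_of_lt hX
  obtain ⟨r₁, hr₁, hr⟩ := Metric.eventually_nhds_iff_ball.1 hev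
  filter_upwards [Ioo_mem_nhdsGT hr₁] with r hrr
  have hball : ∀ X ∈ Metric.ball (0 : LieAlg n) r, ‖symbolTilde O (rankOneKernel φ φ) (q, X) -
      ((‖c‖ ^ 2 : ℝ) : ℂ)‖ₑ ≤
      ‖‖(φ : G → ℂ) (q * lieExp ((-(1 / 2) : ℝ) • X))‖ ^ 2 - ‖c‖ ^ 2‖ₑ +
      ‖‖(φ : G → ℂ) (q * lieExp ((1 / 2 : ℝ) • X))‖ ^ 2 - ‖c‖ ^ 2‖ₑ +
      ENNReal.ofReal (4 * ‖c‖) * ‖(φ : G → ℂ) (q * lieExp ((-(1 / 2) : ℝ) • X)) - c‖ₑ +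
      ENNReal.ofReal (4 * ‖c‖) * ‖(φ : G → ℂ) (q * lieExp ((1 / 2 : ℝ) • X)) - c‖ₑ +
      ENNReal.ofReal (‖c‖ ^ 2) * ‖weightF G X - 1‖ₑ := by
    intro X hX
    obtain ⟨hXO, hX2⟩ := hr X (Metric.ball_subset_ball hrr.2.le hX)
    have h5 := norm_mul_conj_sub_le ((φ : G → ℂ) (q * lieExp ((-(1 / 2) : ℝ) • X)))
      ((φ : G → ℂ) (q * lieExp ((1 / 2 : ℝ) • X))) c (weightF_nonneg (G := G) X) hX2
    simp only [symbolTilde, hXO, if_true, rankOneKernel]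
    simp only [← ofReal_norm]
    rw [← ENNReal.ofReal_mul (by positivity), ← ENNReal.ofReal_mul (by positivity),
      ← ENNReal.ofReal_mul (by positivity), ← ENNReal.ofReal_add (by positivity) (by positivity),
      ← ENNReal.ofReal_add (by positivity) (by positivity),
      ← ENNReal.ofReal_add (by positivity) (by positivity),
      ← ENNReal.ofReal_add (by positivity) (by positivity)]
    exact ENNReal.ofReal_le_ofReal h5
  refine (mul_le_mul_right (setLIntegral_mono' measurableSet_ball hball) _).trans_eq ?_
  have m1 := hw2.comp (measurable_const_smul (-(1 / 2) : ℝ))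
  have m2 := hw2.comp (measurable_const_smul (1 / 2 : ℝ))
  have m3 := (hw1.comp (measurable_const_smul (-(1 / 2) : ℝ))).const_mul
    (ENNReal.ofReal (4 * ‖c‖))
  have m4 := (hw1.comp (measurable_const_smul (1 / 2 : ℝ))).const_mul
    (ENNReal.ofReal (4 * ‖c‖))
  have m5 : Measurable fun X : LieAlg n => ENNReal.ofReal (‖c‖ ^ 2) * ‖weightF G X - 1‖ₑ :=
    (hF.measurable.sub_const 1).enorm.const_mul _
  simp only [Function.comp_def] at m1 m2 m3 m4
  rw [lintegral_add_right _ m5, lintegral_add_right _ m4, lintegral_add_right _ m3,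
    lintegral_add_right _ m2, lintegral_const_mul' _ _ ENNReal.ofReal_ne_top,
    lintegral_const_mul' _ _ ENNReal.ofReal_ne_top, lintegral_const_mul' _ _ ENNReal.ofReal_ne_top]
  ring

/-- At a common Lebesgue point `q` of `φ` and `|φ|²` the fibre of the symbol has mean oscillation
about `|φ(q)|²` tending to zero, so its integral against the kernels of mass one tends to `|φ(q)|²`.
The exceptional set of `q` is chosen before the Euclidean norm. -/
theorem ae_hasMomentumIntegral_wigner (hℏ : ℏ ≠ 0) (φ : Lp ℂ 2 m) :
    ∀ᵐ q ∂m, HasMomentumIntegral m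
      (fun p => ((|2 * Real.pi * ℏ| ^ n : ℝ) : ℂ)⁻¹ *
        (wigner ℏ O φ φ : Lp ℂ 2 (measL (n := n) m ℏ)) (q, p))
      ((‖(φ : G → ℂ) q‖ ^ 2 : ℝ) : ℂ) := by
  have := sigmaFinite_measX (G := G) hO
  have := sigmaFinite_haar n m
  have := topologicalGroup_of_lieGroup (𝓡 n) ∞ (G := G)
  have := locallyCompactSpace_of_charted n G
  have hl : ((|2 * Real.pi * ℏ| ^ n : ℝ) : ℂ) ≠ 0 := by
    have := Real.pi_ne_zero
    have : |2 * Real.pi * ℏ| ^ n ≠ 0 := by positivity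
    exact_mod_cast this
  have hi2 : Integrable (fun x => ‖(φ : G → ℂ) x‖ ^ 2) m :=
    (memLp_two_iff_integrable_sq_norm (Lp.memLp φ).1).1 (Lp.memLp φ)
  have hsm := stronglyMeasurable_symbolTilde_rankOneKernel hO φ φ
  filter_upwards [ae_integral_wigner_mul_gaussian hO hℏ φ φ,
    ae_memLp_fiber hO (memLp_symbolTilde hO (memLp_rankOneKernel φ φ)),
    ae_isLebesguePoint hO (Lp.stronglyMeasurable φ) ((Lp.memLp φ).locallyIntegrable one_le_two),
    ae_isLebesguePoint hO ((Lp.stronglyMeasurable φ).norm.pow 2) hi2.locallyIntegrable]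
    with q hq hu h1 h2 A
  obtain ⟨k, κ, b, hk⟩ := exists_gaussian_kernel (m := m) hO hℏ A
  set u : LieAlg n → ℂ := fun X => symbolTilde O (rankOneKernel φ φ) (q, X) with hudef
  have hum : StronglyMeasurable u := hsm.comp_measurable measurable_prodMk_left
  set c : ℂ := ((‖(φ : G → ℂ) q‖ ^ 2 : ℝ) : ℂ) with hc
  have hval : ∀ δ : ℝ, 0 < δ → ∫ p, ((|2 * Real.pi * ℏ| ^ n : ℝ) : ℂ)⁻¹ *
      (wigner ℏ O φ φ : Lp ℂ 2 (measL (n := n) m ℏ)) (q, p) *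
        (Real.exp (-δ ^ 2 * ‖A p‖ ^ 2) : ℂ) ∂(measP m) =
      ∫ X, u X * (((δ ^ n)⁻¹ * k (δ⁻¹ • X) : ℝ) : ℂ) ∂(measX m) := by
    intro δ hδ
    simp_rw [mul_assoc (((|2 * Real.pi * ℏ| ^ n : ℝ) : ℂ)⁻¹)]
    rw [integral_const_mul, (hq A k κ b hk δ hδ).2, inv_mul_cancel_left₀ hl]
  refine ⟨fun ε hε => ?_, ?_⟩
  · have h3 := ((hq A k κ b hk _ (Real.sqrt_pos.2 hε)).1).const_mul
      ((|2 * Real.pi * ℏ| ^ n : ℝ) : ℂ)⁻¹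
    rw [Real.sq_sqrt hε.le] at h3
    simpa only [mul_assoc] using h3
  -- The fibre `u` is in `L²` and Gaussians are in `L¹ ∩ L²`, so `u` and the constant `c` are both
  -- integrable against every Gaussian.
  have hfin : ∀ b : ℝ, 0 < b → ∫⁻ X, ‖u X - c‖ₑ *
      ENNReal.ofReal (Real.exp (-b * ‖X‖ ^ 2)) ∂(measX m) ≠ ⊤ := by
    intro b hb
    have g1 : ∀ b : ℝ, 0 < b → Integrable (fun X : LieAlg n => Real.exp (-b * ‖X‖ ^ 2))
        (measX m) := by
      intro b hb
      have := integrable_exp_mul_exp_neg (V := LieAlg n) 0 hb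
      simp only [zero_mul, Real.exp_zero, one_mul] at this
      exact this.smul_measure (densityAtOne_ne_top hO)
    have g2 : MemLp (fun X : LieAlg n => (Real.exp (-b * ‖X‖ ^ 2) : ℂ)) 2 (measX m) := by
      refine (memLp_two_iff_integrable_sq_norm
        (Continuous.aestronglyMeasurable (by fun_prop))).2 ((g1 (2 * b) (by positivity)).congr
        (Eventually.of_forall fun X => ?_))
      simp only
      rw [Complex.norm_of_nonneg (Real.exp_pos _).le, ← Real.exp_nat_mul]
      congr 1
      push_cast
      ring
    have i1 : Integrable (fun X => u X * (Real.exp (-b * ‖X‖ ^ 2) : ℂ)) (measX m) :=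
      hu.integrable_mul g2
    have i2 : Integrable (fun X : LieAlg n => c * (Real.exp (-b * ‖X‖ ^ 2) : ℂ)) (measX m) :=
      (g1 b hb).ofReal.const_mul c
    have i3 := (i1.sub i2).2.ne
    refine ne_of_eq_of_ne ?_ i3
    refine lintegral_congr fun X => ?_
    simp only [Pi.sub_apply]
    rw [← sub_mul, enorm_mul, ← ofReal_norm (Real.exp (-b * ‖X‖ ^ 2) : ℂ),
      Complex.norm_of_nonneg (Real.exp_pos _).le]
  have hlim := hk.tendsto_lintegral (v := fun X => ‖u X - c‖ₑ)
    (hum.sub stronglyMeasurable_const).enorm (tendsto_mean_symbolTilde_sub hO φ h1 h2) hfin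
  have hmain : Tendsto (fun δ : ℝ => ∫ X, u X * (((δ ^ n)⁻¹ * k (δ⁻¹ • X) : ℝ) : ℂ) ∂(measX m))
      (𝓝[>] 0) (𝓝 c) := by
    rw [tendsto_iff_edist_tendsto_0]
    refine tendsto_of_tendsto_of_tendsto_of_le_of_le' tendsto_const_nhds hlim
      (Eventually.of_forall fun _ => zero_le) ?_
    filter_upwards [self_mem_nhdsWithin] with δ hδ
    have hδ : 0 < δ := hδ
    have hone : ∫ X, c * (((δ ^ n)⁻¹ * k (δ⁻¹ • X) : ℝ) : ℂ) ∂(measX m) = c := by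
      rw [IsGaussianKernel.integral_mul_scaled hδ (fun _ => c), integral_const_mul,
        integral_complex_ofReal, hk.integral_eq_one]
      simp
    have i1 : Integrable (fun X => u X * (((δ ^ n)⁻¹ * k (δ⁻¹ • X) : ℝ) : ℂ)) (measX m) :=
      hu.integrable_mul (hk.memLp_scaled hO hδ)
    have i2 : Integrable (fun X => c * (((δ ^ n)⁻¹ * k (δ⁻¹ • X) : ℝ) : ℂ)) (measX m) :=
      (hk.integrable_scaled hO hδ).ofReal.const_mul c
    conv_lhs => rw [← hone]
    rw [edist_eq_enorm_sub, ← integral_sub i1 i2]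
    refine (enorm_integral_le_lintegral_enorm _).trans_eq (lintegral_congr fun X => ?_)
    rw [← sub_mul, enorm_mul, ← ofReal_norm (((δ ^ n)⁻¹ * k (δ⁻¹ • X) : ℝ) : ℂ),
      Complex.norm_of_nonneg (hk.scaled_nonneg hδ X)]
  have hsqrt : Tendsto (fun ε : ℝ => √ε) (𝓝[>] 0) (𝓝[>] 0) := by
    refine tendsto_nhdsWithin_iff.2 ⟨?_, ?_⟩
    · have := Real.continuous_sqrt.tendsto 0
      rw [Real.sqrt_zero] at this
      exact this.mono_left nhdsWithin_le_nhds
    · filter_upwards [self_mem_nhdsWithin] with ε hε using Real.sqrt_pos.2 hε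
  refine (hmain.comp hsqrt).congr' ?_
  filter_upwards [self_mem_nhdsWithin] with ε hε
  rw [Function.comp_apply, ← hval _ (Real.sqrt_pos.2 hε), Real.sq_sqrt (le_of_lt hε)]

end MomentumIntegral
end LieWigner
end

theorem theorem4 {n : ℕ} {G : Type*} [TopologicalSpace G]
    [ChartedSpace (EuclideanSpace ℝ (Fin n)) G] [Group G] [LieGroup (𝓡 n) ∞ G]
    [T2Space G] [SecondCountableTopology G] [MeasurableSpace G] [BorelSpace G]
    (m : Measure G) [m.IsHaarMeasure] (O : Set (LieAlg n))
    (hO : LieWigner.IsWeaklyExponential m O) (ℏ : ℝ) (hℏ : ℏ ≠ 0) :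
    -- the objects are well defined
    (∃! T, LieWigner.IsInvMomentumFourier (n := n) m ℏ T) ∧
    (∃! B, LieWigner.IsStarProduct (n := n) m ℏ O B) ∧
    (∀ k : G × G → ℂ, LieWigner.IsTestKernel (n := n) k →
      MemLp (LieWigner.symbolTilde O k) 2 (LieWigner.measN (n := n) m) ∧
      ∃! A, LieWigner.IsIntegralOperator (m := m) k A) ∧
    (∀ φ ψ : Lp ℂ 2 m, MemLp (LieWigner.symbolTilde O (LieWigner.rankOneKernel φ ψ)) 2
      (LieWigner.measN (n := n) m)) ∧
    -- (i)
    (∀ φ ψ : Lp ℂ 2 m, ∀ᵐ x ∂(LieWigner.measL (n := n) m ℏ),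
      (starRingEnd ℂ) ((LieWigner.wigner ℏ O φ ψ : Lp ℂ 2 (LieWigner.measL (n := n) m ℏ)) x) =
        (LieWigner.wigner ℏ O ψ φ : Lp ℂ 2 (LieWigner.measL (n := n) m ℏ)) x) ∧
    -- (ii)
    (∀ φ ψ : Lp ℂ 2 m, LieWigner.HasPhaseSpaceIntegral m ℏ
      (LieWigner.wigner ℏ O φ ψ : Lp ℂ 2 (LieWigner.measL (n := n) m ℏ)) (inner ℂ φ ψ)) ∧
    -- (iii)
    (∀ φ ψ η χ : Lp ℂ 2 m,
      inner ℂ (LieWigner.wigner ℏ O φ ψ) (LieWigner.wigner ℏ O η χ) =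
        (starRingEnd ℂ) (inner ℂ φ η) * inner ℂ ψ χ) ∧
    -- (iv)
    (∀ φ ψ η χ : Lp ℂ 2 m,
      LieWigner.starProd m ℏ O (LieWigner.wigner ℏ O φ ψ) (LieWigner.wigner ℏ O η χ) =
        (inner ℂ φ χ : ℂ) • LieWigner.wigner ℏ O η ψ) ∧
    -- (v)
    (∀ k : G × G → ℂ, LieWigner.IsTestKernel (n := n) k → ∀ φ ψ : Lp ℂ 2 m,
      LieWigner.starProd m ℏ O (LieWigner.symbol m ℏ O k) (LieWigner.wigner ℏ O φ ψ) =
        LieWigner.wigner ℏ O φ (LieWigner.integralOperator m k ψ) ∧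
      LieWigner.starProd m ℏ O (LieWigner.wigner ℏ O φ ψ) (LieWigner.symbol m ℏ O k) =
        LieWigner.wigner ℏ O
          (ContinuousLinearMap.adjoint (LieWigner.integralOperator m k) φ) ψ) ∧
    -- (vi)
    (∀ φ : Lp ℂ 2 m, ∀ᵐ q ∂m, LieWigner.HasMomentumIntegral m
      (fun p => ((|2 * Real.pi * ℏ| ^ n : ℝ) : ℂ)⁻¹ *
        (LieWigner.wigner ℏ O φ φ : Lp ℂ 2 (LieWigner.measL (n := n) m ℏ)) (q, p))
      ((‖(φ : G → ℂ) q‖ ^ 2 : ℝ) : ℂ)) := by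
  have := LieWigner.sigmaFinite_haar n m
  exact ⟨LieWigner.existsUnique_isInvMomentumFourier hO hℏ,
    LieWigner.existsUnique_isStarProduct hO hℏ,
    fun k hk => ⟨LieWigner.memLp_symbolTilde hO hk.memLp,
      LieWigner.existsUnique_isIntegralOperator hk.memLp⟩,
    fun φ ψ => LieWigner.memLp_symbolTilde hO (LieWigner.memLp_rankOneKernel φ ψ),
    LieWigner.conj_wigner hO hℏ,
    LieWigner.hasPhaseSpaceIntegral_wigner hO hℏ,
    LieWigner.inner_wigner hO hℏ,
    LieWigner.starProd_wigner_wigner hO hℏ,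
    fun k hk φ ψ => ⟨LieWigner.starProd_symbol_wigner hO hℏ hk.memLp φ ψ,
      LieWigner.starProd_wigner_symbol hO hℏ hk.memLp φ ψ⟩,
    LieWigner.ae_hasMomentumIntegral_wigner hO hℏ⟩
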